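/- **Setting.** A hybrid dynamical system $H=(D,F,G,R)$ consists of a finite disjoint union $D=\coprod_{j\in J}D_j$ of connected smooth manifolds with boundary, of positive and possibly different dimensions; a smooth vector field $F$ on $D$; a relatively open subset $G\subset\partial D$ (the guard) on which $F$ is outward-pointing; and a smooth map $R:G\to D$ (the reset). An execution is a right-continuous function $x:T\to D$ on an interval $T\subset\mathbb R$ such that $\dot x(t)=F(x(t))$ wherever $x$ is continuous, and such that at every discontinuity $t$ the limit $x(t^-)$ exists, lies in $G$, and $R(x(t^-))=x(t)$. The trajectory from a point $x_0$ is the execution on an interval $[0,b]$ with initial value $x_0$ if $x_0\notin G$, and with initial value $R(x_0)$ if $x_0\in G$. A periodic orbit $\gamma:\mathbb R\to D$ is an execution with a least period $\tau>0$. It has isolated transitions if it has finitely many discontinuities per period. We also write $\gamma$ for the set of its values together with the exit points $\gamma(t^-)\in G$. A Poincaré section is an embedded submanifold $\Sigma$ (without boundary) of codimension one in some $D_j$ that meets $\gamma$ in a single point $\xi$, transversally to $F(\xi)$. A Poincaré map is a smooth map $P:U\to\Sigma$ on an open neighborhood $U$ of $\xi$ in $\Sigma$ which sends $x$ to the first point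 in which the trajectory from $x$ meets $\Sigma$ after the initial time (as a value or as a left limit), the return time being continuous at $\xi$. **Theorem 1 (Exact Reduction).** Let $\gamma$ be a periodic orbit with isolated transitions in a hybrid dynamical system $H=(D,F,G,R)$. Assume that for every $t$, all points of $D$ in some neighborhood of $\gamma(t)$ are starting points of an integral curve of $F$ in $D$ defined on some interval $[0,\delta)$, $\delta>0$ (this is automatic if $\gamma(t)\notin\partial D$ or if $F$ is inward-pointing at $\gamma(t)$). Let $P:U\to\Sigma$ be a Poincaré map for $\gamma$ with fixed point $\xi$, and let $m$ be the minimum of $\dim D_j$ over the domains $D_j$ that $\gamma$ visits. Suppose that there are $r\in\mathbb N$ and an open neighborhood $V\subset U$ of $\xi$ on which the $m$-th iterate $P^m$ is defined and $\operatorname{rank}DP^m(x)=r$ for all $x\in V$. Then there exist an $(r+1)$-dimensional hybrid embedded submanifold $M\subset D$ (for each $j$, $M\cap D_j$ is a possibly empty embedded submanifold with boundary of $D_j$, of dimension $r+1$ and with finitely many components) and an open set $W\subset D$ such that 1. $\gamma\subset M\cap W$; 2. $M$ is invariant under flow and reset: $F$ is tangent to $M$, $G\cap M$ is a relatively open subset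 of $\partial M$, and $R(G\cap M)\subset M$; 3. trajectories starting in $W$ reach $M$ in finite time: there is $b_0<\infty$ such that for every $x\in W$ the trajectory from $x$ exists up to some time $b\in[0,b_0]$ at which it lies in $M$. -/

import Mathlib

open Set Filter Topology
open scoped Manifold ContDiff

namespace HybridDS

/-- A smooth embedding of manifolds (with or without boundary): a smooth map with injective
pushforward at every point that is a homeomorphism onto its image. -/
structure SmoothEmb {E H E' H' : Type*} [NormedAddCommGroup E] [NormedSpace ℝ E]
    [TopologicalSpace H] [NormedAddCommGroup E'] [NormedSpace ℝ E'] [TopologicalSpace H']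
    (I : ModelWithCorners ℝ E H) (I' : ModelWithCorners ℝ E' H')
    {X Y : Type*} [TopologicalSpace X] [ChartedSpace H X] [TopologicalSpace Y] [ChartedSpace H' Y]
    (f : X → Y) : Prop where
  smooth : ContMDiff I I' ∞ f
  injective_mfderiv : ∀ x, Function.Injective (mfderiv I I' f x)
  isEmbedding : IsEmbedding f

section

variable {J : Type*} {n : J → ℕ} [∀ j, NeZero (n j)] {D : J → Type*}
  [∀ j, TopologicalSpace (D j)] [∀ j, ChartedSpace (EuclideanHalfSpace (n j)) (D j)]
  [∀ j, IsManifold (𝓡∂ (n j)) ∞ (D j)]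

/-- A hybrid dynamical system on the hybrid manifold `∐ j, D j`, where `D j` is a smooth manifold
with boundary of dimension `n j`. The topological space `∐ j, D j` is the sigma type `Σ j, D j`. -/
structure HybridSystem (n : J → ℕ) [∀ j, NeZero (n j)] (D : J → Type*)
    [∀ j, TopologicalSpace (D j)] [∀ j, ChartedSpace (EuclideanHalfSpace (n j)) (D j)]
    [∀ j, IsManifold (𝓡∂ (n j)) ∞ (D j)] where
  /-- the vector field -/
  field : ∀ (j : J) (x : D j), TangentSpace (𝓡∂ (n j)) x
  smooth_field : ∀ j, ContMDiff (𝓡∂ (n j)) (𝓡∂ (n j)).tangent ∞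
    (fun x => (⟨x, field j x⟩ : TangentBundle (𝓡∂ (n j)) (D j)))
  /-- the guard, an open subset of the boundary -/
  guard : ∀ j, Set (D j)
  guard_open : ∀ j, ∃ O : Set (D j), IsOpen O ∧ guard j = O ∩ (𝓡∂ (n j)).boundary (D j)
  /-- the reset map; its values off the guard play no role -/
  reset : ∀ j, D j → Σ k, D k
  /-- the reset map is smooth on the guard: near each point of the guard it takes values in a
  single domain, and is smooth as a map into that domain -/
  smooth_reset : ∀ j, ∀ x ∈ guard j, ∃ (k : J) (f : D j → D k),
    (∀ᶠ y in 𝓝[guard j] x, reset j y = ⟨k, f y⟩) ∧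
    ContMDiffWithinAt (𝓡∂ (n j)) (𝓡∂ (n k)) ∞ f (guard j) x
  /-- the vector field is outward-pointing on the guard. The elements of `TangentSpace _ x` are the
  coordinate vectors in the preferred chart at `x`, and the half-space is `{y | 0 ≤ y 0}`. -/
  outward : ∀ j, ∀ x ∈ guard j, (show EuclideanSpace ℝ (Fin (n j)) from field j x) 0 < 0

namespace HybridSystem

variable (H : HybridSystem n D)

/-- At the time `t`, the function `u` on `T` is differentiable with velocity given by the vector
field: near `t` it takes values in a single domain, and its derivative (relative to `T`) at `t`
is the value of the field at `u t`. -/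
def HasFieldVelocity (T : Set ℝ) (u : ℝ → Σ j, D j) (t : ℝ) : Prop :=
  ∃ (j : J) (c : ℝ → D j), (∀ᶠ s in 𝓝[T] t, u s = ⟨j, c s⟩) ∧
    HasMFDerivWithinAt 𝓘(ℝ, ℝ) (𝓡∂ (n j)) c T t
      ((1 : ℝ →L[ℝ] ℝ).smulRight (H.field j (c t)))

/-- `u` is an execution over the interval `T` (values of `u` off `T` play no role). -/
structure IsExecution (T : Set ℝ) (u : ℝ → Σ j, D j) : Prop where
  interval : T.OrdConnected
  right_cont : ∀ t ∈ T, ContinuousWithinAt u (T ∩ Ici t) t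
  flow : ∀ t ∈ T, ContinuousWithinAt u T t → H.HasFieldVelocity T u t
  jump : ∀ t ∈ T, ¬ ContinuousWithinAt u T t → ∃ (j : J), ∃ y ∈ H.guard j,
    Tendsto u (𝓝[T ∩ Iio t] t) (𝓝 ⟨j, y⟩) ∧ H.reset j y = u t

/-- `u` is a trajectory over `[0, b]` started at `x`: an execution with initial value `x`, or with
initial value the reset of `x` in case `x` lies in the guard. -/
structure IsTrajectory (x : Σ j, D j) (b : ℝ) (u : ℝ → Σ j, D j) : Prop where
  isExecution : H.IsExecution (Icc 0 b) u
  start_flow : x.2 ∉ H.guard x.1 → u 0 = x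
  start_reset : x.2 ∈ H.guard x.1 → u 0 = H.reset x.1 x.2

/-- A periodic orbit with (least) period `τ`, defined on the whole real line. -/
structure IsPeriodicOrbit (γ : ℝ → Σ j, D j) (τ : ℝ) : Prop where
  isExecution : H.IsExecution univ γ
  pos : 0 < τ
  periodic : Function.Periodic γ τ
  least : ∀ τ', 0 < τ' → τ' < τ → ¬ Function.Periodic γ τ'

/-- There is an integral curve of the vector field, in the domain containing `x`, that starts at
`x` and is defined on some interval `[0, δ)` with `δ > 0`. -/
def FlowsForward (x : Σ j, D j) : Prop :=
  ∃ δ > (0 : ℝ), ∃ c : ℝ → D x.1, c 0 = x.2 ∧ IsMIntegralCurveOn c (H.field x.1) (Ico 0 δ)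

end HybridSystem

/-- The image of the orbit `γ` together with its limit points. For an orbit with finitely many
transitions per period, these are the exit points, in which `γ` reaches the guard. -/
def orbit (γ : ℝ → Σ j, D j) : Set (Σ j, D j) := closure (range γ)

/-- A curve `u` meets the point `y` at the time `t > 0`: as its value or as its left limit
(which differs from the value if `t` is a transition time and `y` is in the guard). -/
def MeetsAt (u : ℝ → Σ j, D j) (t : ℝ) (y : Σ j, D j) : Prop :=
  u t = y ∨ Tendsto u (𝓝[<] t) (𝓝 y)

namespace HybridSystem

variable (H : HybridSystem n D)

/-- `P : U → S` is a Poincaré map for `γ` with fixed point `ξ`, where the section is the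
submanifold `ι S` of codimension one in `D j`. It is given as a map `S → S` whose values off the
open set `U` play no role. -/
structure IsPoincareMap (γ : ℝ → Σ j, D j) (d : ℕ) {S : Type*} [TopologicalSpace S]
    [ChartedSpace (EuclideanSpace ℝ (Fin d)) S] [IsManifold (𝓡 d) ∞ S]
    {j : J} (ι : S → D j) (U : Set S) (P : S → S) (ξ : S) : Prop where
  codim : d + 1 = n j
  embedding : SmoothEmb (𝓡 d) (𝓡∂ (n j)) ι
  /-- the section intersects the orbit in exactly one point -/
  inter : orbit γ ∩ range (fun s => (⟨j, ι s⟩ : Σ j, D j)) = {⟨j, ι ξ⟩}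
  /-- transversally -/
  transverse : H.field j (ι ξ) ∉ range (mfderiv (𝓡 d) (𝓡∂ (n j)) ι ξ)
  isOpen : IsOpen U
  mem : ξ ∈ U
  smooth : ContMDiffOn (𝓡 d) (𝓡 d) ∞ P U
  /-- `P x` is the point in which the trajectory from `x` first meets the section again. The
  return time `θ` is continuous at the fixed point. -/
  first_return : ∃ θ : S → ℝ, ContinuousAt θ ξ ∧ ∀ x ∈ U, 0 < θ x ∧
    ∃ u : ℝ → Σ j, D j, H.IsTrajectory ⟨j, ι x⟩ (θ x) u ∧
      MeetsAt u (θ x) ⟨j, ι (P x)⟩ ∧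
      ∀ t ∈ Ioo 0 (θ x), ∀ y : S, ¬ MeetsAt u t ⟨j, ι y⟩

/-- `M` is a `d`-dimensional hybrid embedded submanifold (with boundary) of `∐ j, D j` that is
invariant under flow and reset: in each domain it is a (possibly empty) embedded submanifold of
dimension `d` with finitely many components, to which the vector field is tangent; the part of the
guard in `M` is an open subset of the boundary of `M`, and the reset map sends it to `M`. -/
structure IsInvariantSubmanifold (d : ℕ) [NeZero d] (M : Set (Σ j, D j)) : Prop where
  submanifold : ∀ j, ∃ (_ : ChartedSpace (EuclideanHalfSpace d) ↥(Sigma.mk j ⁻¹' M)),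
    IsManifold (𝓡∂ d) ∞ ↥(Sigma.mk j ⁻¹' M) ∧
    SmoothEmb (𝓡∂ d) (𝓡∂ (n j)) (Subtype.val : ↥(Sigma.mk j ⁻¹' M) → D j) ∧
    (∀ p : ↥(Sigma.mk j ⁻¹' M), H.field j p.1 ∈
      range (mfderiv (𝓡∂ d) (𝓡∂ (n j)) (Subtype.val : ↥(Sigma.mk j ⁻¹' M) → D j) p)) ∧
    (∃ O : Set ↥(Sigma.mk j ⁻¹' M), IsOpen O ∧
      Subtype.val ⁻¹' H.guard j = O ∩ (𝓡∂ d).boundary ↥(Sigma.mk j ⁻¹' M))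
  components : ∀ j, Finite (ConnectedComponents ↥(Sigma.mk j ⁻¹' M))
  reset_mem : ∀ j, ∀ x ∈ H.guard j, (⟨j, x⟩ : Σ j, D j) ∈ M → H.reset j x ∈ M

end HybridSystem

end

end HybridDS

/-! Suppose that the orbit has transitions. Sliding a section along the field into the guard
identifies it with a neighbourhood of an exit point `Q` in the guard (`exists_guard_coord`). Under
this identification the Poincaré map becomes the return map `g` of the guard, which runs through the
`K` transitions of one period (`IsPoincareMap.eventually_hit_eq`). Hence `g^[m]` has constant rank
`r` near its fixed point.

The return map factors through every visited domain, and there it forgets the position along the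
field. So the rank of `Dg` is smaller than the dimension of each visited domain, in particular
smaller than `m` (`finrank_range_fderiv_returnMap_lt`). Then `Dg` is injective on the range of
`(Dg)^m` (`ker_disjoint_range_pow`). By the constant rank theorem the local image of `g^[m]` is an
`r`-dimensional submanifold `Z`. As `g` commutes with `g^[m]`, it maps `Z` into itself near the
fixed point, and its restriction `f` to `Z` is a local diffeomorphism (`exists_reduction`).

The manifold `M` is swept out by the curves into the guard that start where the successive resets
send `Z`: there are `K` sheets of dimension `r + 1` (`exists_sheetSystem`). A small ball in `Z` need
not be mapped into itself by `f`, so the sheet behind `Q` is extended over the `f`-image of the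
ball, but only for half of its length, where no reset has to be considered. The parameter of a point
of a sheet is recovered smoothly by following the system on to the guard at `Q` and applying the
inverse of `f`; this yields slice charts. A trajectory that starts near the orbit reaches the guard
near `Q`, lies in `Z` after `m` more turns, and hence in `M` shortly afterwards. Compactness of the
orbit makes neighbourhood and time uniform (`exists_reduction_of_isCycle`).

Without transitions, uniqueness of integral curves makes the Poincaré map injective near its fixed
point, and so its iterates. An injective map of constant rank is an immersion, so `r + 1` is the
dimension of the domain and an open set serves as `M` (`exists_reduction_of_continuous`).

The analytic input is a smooth flow on manifolds with boundary. In a chart the field is extended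
across the boundary by reflections (`exists_contDiff_extension`); the flow of the extension is `C^k`
by the implicit function theorem in a space of continuous curves (`exists_contDiffAt_flow`);
uniqueness shows that it stays in the manifold near points from which the field can be followed
(`exists_box_flow`). The guard is met transversally, so hitting time and hitting point are smooth
(`hit_regular`). -/

namespace HybridDS

/-! ### Extension of smooth functions across the boundary of a half-space -/

section Reflection

universe u
variable {E : Type u} [NormedAddCommGroup E] [NormedSpace ℝ E]

/-- The reflection in the hyperplane `ℓ = 0` in the direction `e`, scaled by `b`. -/
noncomputable def reflection (ℓ : E →L[ℝ] ℝ) (e : E) (b : ℝ) : E →L[ℝ] E :=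
  ContinuousLinearMap.id ℝ E - (1 + b) • ℓ.smulRight e

theorem reflection_apply (ℓ : E →L[ℝ] ℝ) (e : E) (b : ℝ) (y : E) :
    reflection ℓ e b y = y - ((1 + b) * ℓ y) • e := by
  simp [reflection, mul_smul]

theorem apply_reflection {ℓ : E →L[ℝ] ℝ} {e : E} (he : ℓ e = 1) (b : ℝ) (y : E) :
    ℓ (reflection ℓ e b y) = -b * ℓ y := by
  simp [reflection_apply, he]; ring

/-- The extension of a function on a half-space by a combination of its reflections. -/
noncomputable def reflectExt {F : Type u} [NormedAddCommGroup F] [NormedSpace ℝ F]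
    (ℓ : E →L[ℝ] ℝ) (e : E) (N : ℕ) (c : ℕ → ℝ) (f : E → F) (y : E) : F :=
  open Classical in
  if 0 ≤ ℓ y then f y
  else ∑ i ∈ Finset.range N, c i • f (reflection ℓ e (i + 1) y)

/-- The first moments of the coefficients `c`, with respect to the nodes `-(i + 1)`, are `1`. -/
def MomentsEqOne (N : ℕ) (c : ℕ → ℝ) (k : ℕ) : Prop :=
  ∀ j ≤ k, ∑ i ∈ Finset.range N, c i * (-((i : ℝ) + 1)) ^ j = 1

/-- Lagrange interpolation at the `k + 1` nodes `-(i + 1)` reproduces the monomials of degree at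
most `k`. Evaluated at `1`, this is the system of moment equations, solved by the values of the
basis polynomials at `1`. -/
theorem exists_momentsEqOne (k : ℕ) : ∃ N c, MomentsEqOne N c k := by
  classical
  let v : ℕ → ℝ := fun i => -((i : ℝ) + 1)
  have hv : Set.InjOn v (Finset.range (k + 1)) := fun a _ b _ h => by simpa [v] using h
  refine ⟨k + 1, fun i => (Lagrange.basis (Finset.range (k + 1)) v i).eval 1, fun j hj => ?_⟩
  have h := Lagrange.eq_interpolate (s := Finset.range (k + 1)) (v := v)
    (f := (Polynomial.X : Polynomial ℝ) ^ j) hv (by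
      rw [Polynomial.degree_X_pow, Finset.card_range]; exact_mod_cast Nat.lt_succ_of_le hj)
  have h2 := congrArg (Polynomial.eval 1) h
  simp only [Polynomial.eval_pow, Polynomial.eval_X, one_pow, Lagrange.interpolate_apply,
    Polynomial.eval_finsetSum, Polynomial.eval_mul, Polynomial.eval_C] at h2
  exact (h2.trans (Finset.sum_congr rfl fun i _ => mul_comm _ _)).symm

/-- A normal derivative of the `i`-th reflected function produces the factor `-(i + 1)`. The new
coefficients satisfy one moment equation less, which matches the loss of one order of smoothness. -/
theorem MomentsEqOne.shift {N : ℕ} {c : ℕ → ℝ} {k : ℕ} (h : MomentsEqOne N c (k + 1)) :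
    MomentsEqOne N (fun i => c i * (-((i : ℝ) + 1))) k := fun j hj => by
  exact (Finset.sum_congr rfl fun i _ => by ring).trans (h (j + 1) (by omega))

theorem reflection_eq_self (ℓ : E →L[ℝ] ℝ) (e : E) (b : ℝ) {y : E} (hy : ℓ y = 0) :
    reflection ℓ e b y = y := by simp [reflection_apply, hy]

variable {F : Type u} [NormedAddCommGroup F] [NormedSpace ℝ F]

theorem reflectExt_of_nonpos {ℓ : E →L[ℝ] ℝ} {e : E} {N : ℕ} {c : ℕ → ℝ} {k : ℕ}
    (hc : MomentsEqOne N c k) (f : E → F) {y : E} (hy : ℓ y ≤ 0) :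
    reflectExt ℓ e N c f y = ∑ i ∈ Finset.range N, c i • f (reflection ℓ e (i + 1) y) := by
  rcases hy.lt_or_eq with h | h
  · simp [reflectExt, not_le.2 h]
  -- On the hyperplane every reflection fixes `y`, and by the moment of order zero the coefficients
  -- add up to `1`, so the two formulas agree there.
  · have h0 := hc 0 (Nat.zero_le _)
    simp only [pow_zero, mul_one] at h0
    simp [reflectExt, h, reflection_eq_self, ← Finset.sum_smul, h0]

theorem reflectExt_of_nonneg {ℓ : E →L[ℝ] ℝ} {e : E} {N : ℕ} {c : ℕ → ℝ} (f : E → F)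
    {y : E} (hy : 0 ≤ ℓ y) : reflectExt ℓ e N c f y = f y := by simp [reflectExt, hy]

theorem uniqueDiffOn_halfSpace {ℓ : E →L[ℝ] ℝ} {e : E} (he : ℓ e = 1) :
    UniqueDiffOn ℝ {y | 0 ≤ ℓ y} := by
  refine uniqueDiffOn_convex ?_ ⟨e, ?_⟩
  · intro x hx y hy a b ha hb _
    simp only [mem_ofPred_eq, map_add, map_smul, smul_eq_mul] at *
    positivity
  · refine mem_interior_iff_mem_nhds.2 ?_
    have : {y | 0 < ℓ y} ∈ 𝓝 e := (isOpen_lt continuous_const ℓ.continuous).mem_nhds (by simp [he])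
    exact mem_of_superset this fun y (hy : 0 < ℓ y) => hy.le

theorem continuous_reflectExt {ℓ : E →L[ℝ] ℝ} {e : E} (he : ℓ e = 1) {N : ℕ} {c : ℕ → ℝ} {k : ℕ}
    (hc : MomentsEqOne N c k) {f : E → F} (hf : ContinuousOn f {y | 0 ≤ ℓ y}) :
    Continuous (reflectExt ℓ e N c f) := by
  have h1 : ContinuousOn (reflectExt ℓ e N c f) {y | 0 ≤ ℓ y} :=
    hf.congr fun y hy => reflectExt_of_nonneg f hy
  have h2 : ContinuousOn (reflectExt ℓ e N c f) {y | ℓ y ≤ 0} := by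
    refine ContinuousOn.congr (f := fun y => ∑ i ∈ Finset.range N, c i • f (reflection ℓ e (i + 1) y))
      ?_ fun y hy => reflectExt_of_nonpos hc f hy
    refine continuousOn_finsetSum _ fun i _ => ContinuousOn.const_smul ?_ _
    refine hf.comp (reflection ℓ e (i + 1)).continuous.continuousOn fun y hy => ?_
    rw [mem_ofPred_eq, apply_reflection he]
    have : ℓ y ≤ 0 := hy
    nlinarith [(Nat.cast_nonneg i : (0 : ℝ) ≤ i)]
  have := h1.union_of_isClosed h2 (isClosed_le continuous_const ℓ.continuous)
    (isClosed_le ℓ.continuous continuous_const)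
  rw [← continuousOn_univ]
  exact this.mono fun y _ => le_total 0 (ℓ y)

/-- A reflection is the identity on the kernel of `ℓ` and multiplies `e` by `-(i + 1)`. The
derivative of the extension is therefore built from two extensions of `f'`: one with the old
coefficients for tangential directions, one with the shifted coefficients for the normal direction.
Both agree with `f'` on the hyperplane. -/
theorem hasFDerivAt_reflectExt {ℓ : E →L[ℝ] ℝ} {e : E} (he : ℓ e = 1) {N : ℕ} {c : ℕ → ℝ} {k : ℕ}
    (hc : MomentsEqOne N c (k + 1)) {f : E → F} {f' : E → E →L[ℝ] F}
    (hf : ∀ y ∈ {y | 0 ≤ ℓ y}, HasFDerivWithinAt f (f' y) {y | 0 ≤ ℓ y} y) (y : E) :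
    HasFDerivAt (reflectExt ℓ e N c f)
      ((reflectExt ℓ e N c f' y).comp (ContinuousLinearMap.id ℝ E - ℓ.smulRight e) +
        (reflectExt ℓ e N (fun i => c i * (-((i : ℝ) + 1))) f' y).comp (ℓ.smulRight e)) y := by
  set g := fun y => (reflectExt ℓ e N c f' y).comp (ContinuousLinearMap.id ℝ E - ℓ.smulRight e) +
        (reflectExt ℓ e N (fun i => c i * (-((i : ℝ) + 1))) f' y).comp (ℓ.smulRight e) with hg
  have gpos : ∀ y, 0 ≤ ℓ y → g y = f' y := by
    intro y hy
    simp only [hg, reflectExt_of_nonneg f' hy]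
    ext w; simp
  have gneg : ∀ y, ℓ y ≤ 0 →
      g y = ∑ i ∈ Finset.range N, c i • (f' (reflection ℓ e (i + 1) y)).comp
        (reflection ℓ e (i + 1)) := by
    intro y hy
    simp only [hg, reflectExt_of_nonpos hc f' hy, reflectExt_of_nonpos hc.shift f' hy]
    ext w
    simp only [_root_.add_apply, ContinuousLinearMap.comp_apply,
      _root_.sum_apply, _root_.smul_apply, ← Finset.sum_add_distrib]
    refine Finset.sum_congr rfl fun i _ => ?_
    rw [reflection_apply ℓ e _ w, mul_smul, ← smul_add, ← map_smul, ← map_add]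
    congr 2
    simp only [_root_.sub_apply, ContinuousLinearMap.id_apply,
      ContinuousLinearMap.smulRight_apply, smul_smul, sub_add, ← sub_smul]
    congr 2; ring
  have dpos : ∀ y, 0 ≤ ℓ y → HasFDerivWithinAt (reflectExt ℓ e N c f) (g y) {y | 0 ≤ ℓ y} y := by
    intro y hy
    rw [gpos y hy]
    exact (hf y hy).congr (fun z hz => reflectExt_of_nonneg f hz) (reflectExt_of_nonneg f hy)
  have dneg : ∀ y, ℓ y ≤ 0 → HasFDerivWithinAt (reflectExt ℓ e N c f) (g y) {y | ℓ y ≤ 0} y := by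
    intro y hy
    rw [gneg y hy]
    refine HasFDerivWithinAt.congr ?_ (fun z hz => reflectExt_of_nonpos hc f hz)
      (reflectExt_of_nonpos hc f hy)
    refine HasFDerivWithinAt.fun_sum fun i _ => HasFDerivWithinAt.const_smul ?_ _
    have hmaps : ∀ z, ℓ z ≤ 0 → 0 ≤ ℓ (reflection ℓ e (i + 1) z) := fun z hz => by
      rw [apply_reflection he]; nlinarith [(Nat.cast_nonneg i : (0 : ℝ) ≤ i)]
    exact (hf _ (hmaps y hy)).comp y (reflection ℓ e (i + 1)).hasFDerivWithinAt
      fun z hz => hmaps z hz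
  rcases lt_trichotomy (ℓ y) 0 with h | h | h
  · exact (dneg y h.le).hasFDerivAt (mem_of_superset
      ((isOpen_lt ℓ.continuous continuous_const).mem_nhds h) fun z (hz : ℓ z < 0) => hz.le)
  · have := (dpos y h.ge).union (dneg y h.le)
    rwa [show {y | 0 ≤ ℓ y} ∪ {y | ℓ y ≤ 0} = univ from eq_univ_of_forall fun z => le_total 0 (ℓ z),
      hasFDerivWithinAt_univ] at this
  · exact (dpos y h.le).hasFDerivAt (mem_of_superset
      ((isOpen_lt continuous_const ℓ.continuous).mem_nhds h) fun z (hz : 0 < ℓ z) => hz.le)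

/-- Induction on the order, as the derivative of an extension is again made of extensions. The
target space varies in the induction because derivatives take values in spaces of linear maps. -/
theorem contDiff_reflectExt {ℓ : E →L[ℝ] ℝ} {e : E} (he : ℓ e = 1) {N : ℕ} (k : ℕ) :
    ∀ {F : Type u} [NormedAddCommGroup F] [NormedSpace ℝ F] {c : ℕ → ℝ} {f : E → F},
    MomentsEqOne N c k → ContDiffOn ℝ k f {y | 0 ≤ ℓ y} →
    ContDiff ℝ k (reflectExt ℓ e N c f) := by
  induction k with
  | zero =>
    intro F _ _ c f hc hf
    exact contDiff_zero.2 (continuous_reflectExt he hc hf.continuousOn)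
  | succ k ih =>
    intro F _ _ c f hc hf
    have hu := uniqueDiffOn_halfSpace he
    have hd : ∀ y ∈ {y | 0 ≤ ℓ y},
        HasFDerivWithinAt f (fderivWithin ℝ f {y | 0 ≤ ℓ y} y) {y | 0 ≤ ℓ y} y := fun y hy =>
      (hf.differentiableOn (by simp) y hy).hasFDerivWithinAt
    have hf' : ContDiffOn ℝ k (fderivWithin ℝ f {y | 0 ≤ ℓ y}) {y | 0 ≤ ℓ y} :=
      hf.fderivWithin hu (by norm_cast)
    have hg := hasFDerivAt_reflectExt he hc hd
    rw [show ((k + 1 : ℕ) : WithTop ℕ∞) = (k : WithTop ℕ∞) + 1 by norm_cast,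
      contDiff_succ_iff_fderiv]
    refine ⟨fun y => (hg y).differentiableAt, by simp, ?_⟩
    rw [show fderiv ℝ (reflectExt ℓ e N c f) = _ from funext fun y => (hg y).fderiv]
    have hc' : MomentsEqOne N c k := fun j hj => hc j (by omega)
    exact ((ih hc' hf').clm_comp contDiff_const).add ((ih hc.shift hf').clm_comp contDiff_const)

/-- A function that is `C^k` at a point of a half-space agrees near this point on the half-space
with a compactly supported `C^k` function. -/
theorem exists_contDiff_extension [FiniteDimensional ℝ E] {ℓ : E →L[ℝ] ℝ} {e : E} (he : ℓ e = 1)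
    (k : ℕ) {f : E → F} {y₀ : E} (hf : ContDiffWithinAt ℝ k f {y | 0 ≤ ℓ y} y₀)
    (hy₀ : 0 ≤ ℓ y₀) :
    ∃ g : E → F, ContDiff ℝ k g ∧ HasCompactSupport g ∧ ∀ᶠ y in 𝓝[{y | 0 ≤ ℓ y}] y₀, g y = f y := by
  obtain ⟨u, hu, hyu₀, hfu⟩ := hf.contDiffOn' le_rfl (by simp)
  rw [insert_eq_of_mem (by exact hy₀)] at hfu
  obtain ⟨ε, hε, hεu⟩ := Metric.isOpen_iff.1 hu y₀ hyu₀
  -- Two cutoffs are needed. The first, supported where `f` is `C^k`, makes the function `C^k` on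
  -- the whole half-space before it is extended. The second, supported where the first is `1`, makes
  -- the extension compactly supported.
  let b : ContDiffBump y₀ := ⟨ε / 3, ε / 2, by positivity, by linarith⟩
  have h1 : ContDiffOn ℝ k (fun y => b y • f y) {y | 0 ≤ ℓ y} := by
    intro y hy
    by_cases hyu : y ∈ Metric.ball y₀ ε
    · have := hfu y ⟨hy, hεu hyu⟩
      have h2 : ContDiffWithinAt ℝ k f {y | 0 ≤ ℓ y} y :=
        (contDiffWithinAt_inter (hu.mem_nhds (hεu hyu))).1 this
      exact b.contDiff.contDiffWithinAt.smul h2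
    · have hz : (fun y => b y • f y) =ᶠ[𝓝 y] fun _ => 0 := by
        have : (Metric.closedBall y₀ (ε / 2))ᶜ ∈ 𝓝 y :=
          Metric.isClosed_closedBall.isOpen_compl.mem_nhds (by
            simp only [mem_compl_iff, Metric.mem_closedBall, not_le]
            simp only [Metric.mem_ball, not_lt] at hyu
            linarith)
        filter_upwards [this] with z hz
        simp only [mem_compl_iff, Metric.mem_closedBall, not_le] at hz
        rw [b.zero_of_le_dist hz.le, zero_smul]
      exact (contDiffAt_const.congr_of_eventuallyEq hz).contDiffWithinAt
  obtain ⟨N, c, hc⟩ := exists_momentsEqOne k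
  have h2 := contDiff_reflectExt he k hc h1
  let b' : ContDiffBump y₀ := ⟨ε / 4, ε / 3, by positivity, by linarith⟩
  refine ⟨fun y => b' y • reflectExt ℓ e N c (fun y => b y • f y) y, b'.contDiff.smul h2,
    b'.hasCompactSupport.smul_right, ?_⟩
  filter_upwards [mem_nhdsWithin_of_mem_nhds (Metric.closedBall_mem_nhds y₀
    (show 0 < ε / 4 by positivity)), self_mem_nhdsWithin] with y hy1 hy2
  rw [reflectExt_of_nonneg _ hy2, b'.one_of_mem_closedBall hy1, b.one_of_mem_closedBall, one_smul,
    one_smul]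
  exact Metric.closedBall_subset_closedBall (by show ε / 4 ≤ ε / 3; linarith) hy1

end Reflection

end HybridDS

namespace HybridDS

/-! ### Smooth dependence of the local flow on time and initial value -/

section Superposition

universe u
variable {K : Type} [TopologicalSpace K] [CompactSpace K]
variable {E : Type u} [NormedAddCommGroup E] [NormedSpace ℝ E]

/-- The superposition operator `α ↦ F ∘ α`. -/
def superpose {F : Type u} [NormedAddCommGroup F] (f : E → F) (hf : Continuous f) (α : C(K, E)) :
    C(K, F) := (⟨f, hf⟩ : C(E, F)).comp α

variable {F : Type u} [NormedAddCommGroup F] [NormedSpace ℝ F]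

/-- Pointwise application of a family of continuous linear maps, as a continuous bilinear map. -/
noncomputable def pointwiseApply : C(K, E →L[ℝ] F) →L[ℝ] C(K, E) →L[ℝ] C(K, F) :=
  LinearMap.mkContinuous₂
    (LinearMap.mk₂ ℝ (fun (A : C(K, E →L[ℝ] F)) (β : C(K, E)) =>
      (⟨fun t => A t (β t), A.continuous.clm_apply β.continuous⟩ : C(K, F)))
      (fun _ _ _ => by ext; simp) (fun _ _ _ => by ext; simp) (fun _ _ _ => by ext; simp)
      (fun _ _ _ => by ext; simp)) 1 (fun A β => by
        rw [one_mul]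
        refine (ContinuousMap.norm_le _ (by positivity)).2 fun t => ?_
        exact (A t).le_of_opNorm_le_of_le (A.norm_coe_le_norm t) (β.norm_coe_le_norm t))

@[simp] theorem pointwiseApply_apply (A : C(K, E →L[ℝ] F)) (β : C(K, E)) (t : K) :
    pointwiseApply A β t = A t (β t) := rfl

/-- The image of `α` is compact, so `fderiv ℝ f` is uniformly continuous around it. The mean value
inequality then gives an error bound that is uniform in `t`. -/
theorem hasFDerivAt_superpose {f : E → F} (hf : ContDiff ℝ 1 f) (α : C(K, E)) :
    HasFDerivAt (superpose f hf.continuous)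
      (pointwiseApply (superpose (fderiv ℝ f) (hf.continuous_fderiv one_ne_zero) α)) α := by
  rw [hasFDerivAt_iff_isLittleO_nhds_zero, Asymptotics.isLittleO_iff]
  intro ε hε
  have hc : IsCompact (range α) := isCompact_range α.continuous
  have hu := hc.uniformContinuousAt_of_continuousAt (fderiv ℝ f)
    (fun a _ => (hf.continuous_fderiv one_ne_zero).continuousAt) (Metric.dist_mem_uniformity hε)
  obtain ⟨δ, hδ, hu⟩ := Metric.mem_uniformity_dist.1 hu
  filter_upwards [Metric.ball_mem_nhds (0 : C(K, E)) hδ] with β hβ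
  rw [mem_ball_zero_iff] at hβ
  refine (ContinuousMap.norm_le _ (by positivity)).2 fun t => ?_
  have hd : ∀ x ∈ Metric.ball (α t) δ, ‖fderiv ℝ f x - fderiv ℝ f (α t)‖ ≤ ε := fun x hx => by
    have := hu (a := α t) (b := x) (by rwa [dist_comm]) (mem_range_self t)
    rw [← dist_eq_norm, dist_comm]
    exact le_of_lt this
  have h1 := Convex.norm_image_sub_le_of_norm_fderiv_le'
    (fun x _ => (hf.differentiable one_ne_zero).differentiableAt) hd (convex_ball _ _)
    (Metric.mem_ball_self hδ) (y := α t + β t) (by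
      simpa [Metric.mem_ball, dist_eq_norm] using (β.norm_coe_le_norm t).trans_lt hβ)
  rw [add_sub_cancel_left] at h1
  refine le_trans h1 (mul_le_mul_of_nonneg_left (β.norm_coe_le_norm t) hε.le)

/-- The derivative is the superposition operator of `fderiv ℝ f` followed by a bounded linear map,
which allows induction on `k`. -/
theorem contDiff_superpose (k : ℕ) : ∀ {F : Type u} [NormedAddCommGroup F] [NormedSpace ℝ F]
    {f : E → F} (hf : ContDiff ℝ k f),
    ContDiff ℝ k (superpose (K := K) f hf.continuous) := by
  induction k with
  | zero =>
    intro F _ _ f hf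
    refine contDiff_zero.2 ?_
    exact ContinuousMap.continuous_postcomp _
  | succ k ih =>
    intro F _ _ f hf
    have h1 : ContDiff ℝ 1 f := hf.of_le (by norm_cast; omega)
    have h2 : ContDiff ℝ k (fderiv ℝ f) := hf.fderiv_right (by norm_cast)
    have hc := hf.continuous
    suffices h : ContDiff ℝ ((k : WithTop ℕ∞) + 1) (superpose (K := K) f hc) by exact_mod_cast h
    rw [contDiff_succ_iff_hasFDerivAt]
    have h3 : ContDiff ℝ k fun α : C(K, E) => pointwiseApply (K := K) (E := E) (F := F)
        (superpose (fderiv ℝ f) (h1.continuous_fderiv one_ne_zero) α) := by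
      have := ContinuousLinearMap.contDiff (𝕜 := ℝ) (n := (k : WithTop ℕ∞))
        (E := C(K, E →L[ℝ] F)) (F := C(K, E) →L[ℝ] C(K, F))
        (pointwiseApply (K := K) (E := E) (F := F))
      exact this.comp (ih h2)
    exact ⟨fun α => pointwiseApply (superpose (fderiv ℝ f) (h1.continuous_fderiv one_ne_zero) α),
      h3, fun α => hasFDerivAt_superpose h1 α⟩

end Superposition

/-! ### The local flow as an implicit function -/

section Flow

variable {E : Type*} [NormedAddCommGroup E] [NormedSpace ℝ E]

open unitInterval

/-- Integration of a continuous function on `[0, 1]` from `0`, as an operator. -/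
noncomputable def primitive : C(I, E) →L[ℝ] C(I, E) :=
  LinearMap.mkContinuous
    { toFun := fun β => ⟨fun s => ∫ ρ in (0 : ℝ)..s, IccExtend zero_le_one β ρ, by
        have := intervalIntegral.continuous_primitive (μ := MeasureTheory.volume)
          (f := IccExtend zero_le_one β)
          (fun a b => β.continuous.Icc_extend'.intervalIntegrable a b) 0
        exact this.comp continuous_subtype_val⟩
      map_add' := fun β β' => by
        ext s
        exact intervalIntegral.integral_add (β.continuous.Icc_extend'.intervalIntegrable _ _)
          (β'.continuous.Icc_extend'.intervalIntegrable _ _)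
      map_smul' := fun c β => by
        ext s
        exact intervalIntegral.integral_smul c _ } 1 (fun β => by
      rw [one_mul]
      refine (ContinuousMap.norm_le _ (norm_nonneg _)).2 fun s => ?_
      refine (intervalIntegral.norm_integral_le_of_norm_le_const (C := ‖β‖) fun x _ =>
        β.norm_coe_le_norm _).trans ?_
      rw [sub_zero, abs_of_nonneg s.2.1]
      exact mul_le_of_le_one_right (norm_nonneg _) s.2.2)

theorem primitive_apply (β : C(I, E)) (s : I) :
    primitive β s = ∫ ρ in (0 : ℝ)..s, IccExtend zero_le_one β ρ := rfl

/-- A compactly supported `C^k` vector field has a local flow of class `C^k`. -/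
theorem exists_contDiffAt_flow {E : Type} [NormedAddCommGroup E] [NormedSpace ℝ E]
    [CompleteSpace E] {F : E → E} {k : ℕ} (hk : k ≠ 0) (hF : ContDiff ℝ k F)
    {K : NNReal} (hL : LipschitzWith K F) (x₀ : E) :
    ∃ φ : ℝ × E → E, ∃ δ > 0, ∀ t x, |t| < δ → dist x x₀ < δ →
      φ (0, x) = x ∧ HasDerivAt (fun s => φ (s, x)) (F (φ (t, x))) t ∧ ContDiffAt ℝ k φ (t, x) := by
  obtain ⟨r, hr, ε, hε, hsol⟩ :=
    ContDiffAt.exists_forall_mem_closedBall_exists_eq_forall_mem_Ioo_hasDerivAt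
      (hF.contDiffAt (x := x₀) |>.of_le (m := 1) (by norm_cast; omega)) 0
  choose! y hy0 hy using hsol
  have hk' : (k : WithTop ℕ∞) ≠ 0 := by exact_mod_cast hk
  -- With time rescaled to `[0, 1]`, the solution from `x` up to time `τ` is the zero `α` of `α - x
  -- - τ ∫ F ∘ α`. Time thus becomes a parameter on a par with the initial value.
  let Ξ : (ℝ × E) × C(I, E) → C(I, E) := fun p =>
    p.2 - ContinuousMap.const I p.1.2 - p.1.1 • primitive (superpose F hF.continuous p.2)
  have hconst : ContDiff ℝ k (fun x : E => ContinuousMap.const I x) := by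
    let c : E →L[ℝ] C(I, E) := LinearMap.mkContinuous
      ⟨⟨fun x => ContinuousMap.const I x, fun _ _ => rfl⟩, fun _ _ => rfl⟩ 1 (fun x => by
        rw [one_mul]
        exact (ContinuousMap.norm_le _ (norm_nonneg _)).2 fun _ => le_rfl)
    exact c.contDiff
  have hP : ContDiff ℝ k (fun α : C(I, E) => primitive (superpose F hF.continuous α)) :=
    primitive.contDiff.comp (contDiff_superpose k hF)
  have hΞ : ContDiff ℝ k Ξ :=
    (contDiff_snd.sub (hconst.comp (contDiff_snd.comp contDiff_fst))).sub
      ((contDiff_fst.comp contDiff_fst).smul (hP.comp contDiff_snd))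
  let u : (ℝ × E) × C(I, E) := ((0, x₀), ContinuousMap.const I x₀)
  -- At `τ = 0` the integral term disappears and `Ξ` is a translation in `α`, so the partial
  -- derivative is the identity.
  have hpart : fderiv ℝ Ξ u ∘L .inr ℝ (ℝ × E) C(I, E) = ContinuousLinearMap.id ℝ _ := by
    have h1 : HasFDerivAt (fun α : C(I, E) => Ξ ((0, x₀), α))
        (fderiv ℝ Ξ u ∘L .inr ℝ (ℝ × E) C(I, E)) (ContinuousMap.const I x₀) :=
      ((hΞ.differentiable hk').differentiableAt (x := u)).hasFDerivAt.comp
        (ContinuousMap.const I x₀) (hasFDerivAt_prodMk_right (0, x₀) _)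
    have h2 : (fun α : C(I, E) => Ξ ((0, x₀), α)) = fun α => α - ContinuousMap.const I x₀ := by
      funext α; simp [Ξ]
    rw [h2] at h1
    exact h1.unique ((hasFDerivAt_id _).sub_const _)
  have hinv : (fderiv ℝ Ξ u ∘L .inr ℝ (ℝ × E) C(I, E)).IsInvertible := by
    rw [hpart]; exact ⟨ContinuousLinearEquiv.refl ℝ _, rfl⟩
  have hΞu : ContDiffAt ℝ k Ξ u := hΞ.contDiffAt
  set A := hΞu.implicitFunction hk' hinv with hA
  have hAk : ContDiffAt ℝ k A (0, x₀) := hΞu.contDiffAt_implicitFunction hk' hinv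
  have hAeq : ∀ᶠ p in 𝓝 ((0 : ℝ), x₀), Ξ (p, A p) = 0 := by
    have := hΞu.eventually_apply_implicitFunction hk' hinv
    have h0 : Ξ u = 0 := by simp [Ξ, u]
    rwa [h0] at this
  -- For finite `k`, being `C^k` at a point implies being `C^k` near it; this is one reason to keep
  -- `k` finite throughout the analysis.
  have hAev : ∀ᶠ p in 𝓝 ((0 : ℝ), x₀), ContDiffAt ℝ k A p :=
    hAk.eventually (by simp)
  let ev1 : C(I, E) →L[ℝ] E := ContinuousMap.evalCLM ℝ (1 : I)
  have hnear : ∀ᶠ p : ℝ × E in 𝓝 ((0 : ℝ), x₀), |p.1| < ε ∧ dist p.2 x₀ < r :=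
    ((continuous_abs.comp continuous_fst).continuousAt.eventually_lt_const (by simpa using hε)).and
      ((continuous_snd.dist continuous_const).continuousAt.eventually_lt_const (by simpa using hr))
  -- By uniqueness for the rescaled equation, the Picard–Lindelöf solution at time `τ` is the value
  -- at `1` of the implicit function.
  have hflow : ∀ᶠ p in 𝓝 ((0 : ℝ), x₀), y p.2 p.1 = ev1 (A p) := by
    filter_upwards [hAeq, hnear] with p hp hp2
    obtain ⟨τ, x⟩ := p
    simp only at hp2
    let g : ℝ → E := fun s => x + τ • ∫ ρ in (0 : ℝ)..s, F (IccExtend zero_le_one (A (τ, x)) ρ)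
    have hcont : Continuous fun ρ => F (IccExtend zero_le_one (A (τ, x)) ρ) :=
      hF.continuous.comp (A (τ, x)).continuous.Icc_extend'
    have hg : ∀ s, HasDerivAt g (τ • F (IccExtend zero_le_one (A (τ, x)) s)) s := fun s =>
      ((intervalIntegral.integral_hasDerivAt_right (hcont.intervalIntegrable _ _)
        (hcont.stronglyMeasurableAtFilter _ _) hcont.continuousAt).const_smul τ).const_add x
    have hgA : ∀ s : I, g s = A (τ, x) s := by
      intro s
      have h1 := congrArg (fun β : C(I, E) => β s) hp
      simp only [Ξ, ContinuousMap.sub_apply, ContinuousMap.const_apply, ContinuousMap.smul_apply,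
        primitive_apply, ContinuousMap.zero_apply] at h1
      rw [sub_eq_zero, sub_eq_iff_eq_add] at h1
      rw [h1, add_comm]
      rfl
    have hxr : x ∈ Metric.closedBall x₀ r := le_of_lt hp2.2
    have hz : ∀ s ∈ Icc (0 : ℝ) 1,
        HasDerivAt (fun s => y x (τ * s)) (τ • F (y x (τ * s))) s := by
      intro s hs
      have hmem : τ * s ∈ Ioo (0 - ε) (0 + ε) := by
        have : |τ * s| < ε := by
          rw [abs_mul, abs_of_nonneg hs.1]
          exact lt_of_le_of_lt (mul_le_of_le_one_right (abs_nonneg _) hs.2) hp2.1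
        rw [abs_lt] at this
        constructor <;> linarith
      have h1 := (hy x hxr (τ * s) hmem).scomp s ((hasDerivAt_id s).const_mul τ)
      rw [mul_one] at h1
      exact h1
    have huniq := ODE_solution_unique (v := fun _ z => τ • F z) (K := ‖τ‖₊ * K) (f := g)
      (g := fun s => y x (τ * s)) (a := 0) (b := 1)
      (fun t => (lipschitzWith_smul τ).comp hL)
      (fun s _ => (hg s).continuousAt.continuousWithinAt)
      (fun s hs => by
        have := (hg s).hasDerivWithinAt (s := Ici s)
        rwa [IccExtend_of_mem _ _ (Ico_subset_Icc_self hs), ← hgA] at this)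
      (fun s hs => (hz s hs).continuousAt.continuousWithinAt)
      (fun s hs => (hz s (Ico_subset_Icc_self hs)).hasDerivWithinAt)
      (by simp [g, hy0 x hxr])
    have := huniq (right_mem_Icc.2 zero_le_one)
    simp only [mul_one] at this
    rw [← this]
    exact hgA 1
  have hflow' := hflow.eventually_nhds
  obtain ⟨δ, hδ, H⟩ := Metric.eventually_nhds_iff.1 (hflow'.and (hAev.and hnear))
  have hmem : ∀ t x, |t| < δ → dist x x₀ < δ → dist (t, x) ((0 : ℝ), x₀) < δ := fun t x ht hx => by
    rw [Prod.dist_eq]; exact max_lt (by simpa [Real.dist_eq] using ht) hx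
  refine ⟨fun p => y p.2 p.1, δ, hδ, fun t x ht hx => ?_⟩
  obtain ⟨h1, h2, h3, h4⟩ := H (hmem t x ht hx)
  have hxr : x ∈ Metric.closedBall x₀ r := le_of_lt h4
  refine ⟨hy0 x hxr, hy x hxr t ?_, ?_⟩
  · rw [abs_lt] at h3
    constructor <;> simp only at h3 ⊢ <;> linarith
  · exact (ev1.contDiff.contDiffAt.comp (t, x) h2).congr_of_eventuallyEq h1

end Flow

end HybridDS

namespace HybridDS

/-! ### Integral curves on a manifold with boundary -/

section IntegralCurves

variable {n : ℕ} [NeZero n] {X : Type*} [TopologicalSpace X]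
  [ChartedSpace (EuclideanHalfSpace n) X] [IsManifold (𝓡∂ n) ∞ X]

/-- The derivative of a curve in a manifold that corresponds to a velocity vector. -/
noncomputable abbrev velocity {x : X} (w : TangentSpace (𝓡∂ n) x) :
    ℝ →L[ℝ] TangentSpace (𝓡∂ n) x :=
  (1 : ℝ →L[ℝ] ℝ).smulRight w

/-- The coordinates of a tangent vector at `x` in the chart at `p`. -/
noncomputable def coords (p x : X) (w : TangentSpace (𝓡∂ n) x) : EuclideanSpace ℝ (Fin n) :=
  tangentCoordChange (𝓡∂ n) x p x w

omit [IsManifold (𝓡∂ n) ∞ X] in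
theorem hasMFDerivWithinAt_iff_self {c : ℝ → X} {s : Set ℝ} {t : ℝ}
    (w : EuclideanSpace ℝ (Fin n)) :
    HasMFDerivWithinAt 𝓘(ℝ, ℝ) (𝓡∂ n) c s t (velocity (x := c t) w) ↔
      ContinuousWithinAt c s t ∧ HasDerivWithinAt (extChartAt (𝓡∂ n) (c t) ∘ c) w s t := by
  unfold HasMFDerivWithinAt
  refine and_congr_right fun _ => ?_
  rw [hasDerivWithinAt_iff_hasFDerivWithinAt]
  have h1 : (extChartAt 𝓘(ℝ, ℝ) t).symm ⁻¹' s ∩ range 𝓘(ℝ, ℝ) = s := by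
    rw [extChartAt_model_space_eq_id]; simp
  have h2 : writtenInExtChartAt 𝓘(ℝ, ℝ) (𝓡∂ n) t c = extChartAt (𝓡∂ n) (c t) ∘ c := by
    rw [writtenInExtChartAt, extChartAt_model_space_eq_id]; rfl
  have h3 : (1 : ℝ →L[ℝ] ℝ).smulRight w = ContinuousLinearMap.toSpanSingleton ℝ w := by
    ext1
    simp
  rw [h1, h2, ← h3]
  rfl

theorem hasDerivWithinAt_chart_change {p q : X} {c : ℝ → X} {s : Set ℝ} {t : ℝ}
    {w : EuclideanSpace ℝ (Fin n)} (hp : c t ∈ (extChartAt (𝓡∂ n) p).source)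
    (hq : c t ∈ (extChartAt (𝓡∂ n) q).source) (hc : ContinuousWithinAt c s t)
    (hd : HasDerivWithinAt (extChartAt (𝓡∂ n) p ∘ c) w s t) :
    HasDerivWithinAt (extChartAt (𝓡∂ n) q ∘ c) (tangentCoordChange (𝓡∂ n) p q (c t) w) s t := by
  have h1 := hasFDerivWithinAt_tangentCoordChange (I := 𝓡∂ n) (x := p) (y := q) (z := c t) ⟨hp, hq⟩
  have h2 := HasFDerivWithinAt.comp_hasDerivWithinAt (s := s) t h1 hd
    (fun s _ => (mem_range_self (chartAt (EuclideanHalfSpace n) p (c s)) :))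
  refine h2.congr_of_eventuallyEq ?_ ?_
  · filter_upwards [hc.eventually ((isOpen_extChartAt_source p).mem_nhds hp)] with s' hs'
    simp only [Function.comp_apply]
    rw [(extChartAt (𝓡∂ n) p).left_inv hs']
  · simp only [Function.comp_apply]
    rw [(extChartAt (𝓡∂ n) p).left_inv hp]

/-- The definition of the derivative uses the chart at the moving point `c t`. A fixed chart is
needed to regard integral curves as solutions of one ordinary differential equation. -/
theorem hasMFDerivWithinAt_iff_chart {p : X} {c : ℝ → X} {s : Set ℝ} {t : ℝ}
    (w : TangentSpace (𝓡∂ n) (c t)) (h : c t ∈ (extChartAt (𝓡∂ n) p).source) :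
    HasMFDerivWithinAt 𝓘(ℝ, ℝ) (𝓡∂ n) c s t (velocity w) ↔
      ContinuousWithinAt c s t ∧ HasDerivWithinAt (extChartAt (𝓡∂ n) p ∘ c)
        (coords p (c t) w) s t := by
  refine (hasMFDerivWithinAt_iff_self (c := c) w).trans (and_congr_right fun hc => ?_)
  have h0 : c t ∈ (extChartAt (𝓡∂ n) (c t)).source := mem_extChartAt_source _
  refine ⟨fun hd => hasDerivWithinAt_chart_change h0 h hc hd, fun hd => ?_⟩
  have hid : ∀ u : EuclideanSpace ℝ (Fin n), tangentCoordChange (𝓡∂ n) p (c t) (c t)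
      (tangentCoordChange (𝓡∂ n) (c t) p (c t) u) = u := fun u => by
    rw [tangentCoordChange_comp ⟨⟨h0, h⟩, h0⟩, tangentCoordChange_self h0]
  have := hasDerivWithinAt_chart_change h h0 hc hd
  exact (hid w) ▸ this

omit [IsManifold (𝓡∂ n) ∞ X] in
theorem range_eq_halfSpace :
    range (𝓡∂ n) = {y : EuclideanSpace ℝ (Fin n) | 0 ≤ EuclideanSpace.proj (𝕜 := ℝ) (0 : Fin n) y} := by
  rw [range_modelWithCornersEuclideanHalfSpace]
  rfl

omit [IsManifold (𝓡∂ n) ∞ X] in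
theorem extChartAt_apply_zero_nonneg (p x : X) : 0 ≤ (extChartAt (𝓡∂ n) p x) 0 := by
  have : extChartAt (𝓡∂ n) p x ∈ range (𝓡∂ n) := ⟨chartAt _ p x, rfl⟩
  rwa [range_eq_halfSpace] at this

omit [IsManifold (𝓡∂ n) ∞ X] in
theorem tendsto_extChartAt_range (p : X) {x : X} (hx : x ∈ (extChartAt (𝓡∂ n) p).source) :
    Tendsto (extChartAt (𝓡∂ n) p) (𝓝 x) (𝓝[range (𝓡∂ n)] (extChartAt (𝓡∂ n) p x)) :=
  tendsto_nhdsWithin_iff.2 ⟨continuousAt_extChartAt' hx, Eventually.of_forall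
      fun x => ⟨chartAt _ p x, rfl⟩⟩

variable {v : ∀ x : X, TangentSpace (𝓡∂ n) x}

/-- The local representation of a smooth vector field in a chart, extended to a compactly supported
`C^k` vector field. -/
theorem exists_chart_field (hv : ContMDiff (𝓡∂ n) (𝓡∂ n).tangent ∞
    (fun x => (⟨x, v x⟩ : TangentBundle (𝓡∂ n) X))) (p : X) (k : ℕ) :
    ∃ F : EuclideanSpace ℝ (Fin n) → EuclideanSpace ℝ (Fin n), ContDiff ℝ k F ∧
      HasCompactSupport F ∧ ∀ᶠ x in 𝓝 p, x ∈ (extChartAt (𝓡∂ n) p).source ∧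
        F (extChartAt (𝓡∂ n) p x) = coords p x (v x) := by
  have h1 := (Bundle.contMDiffAt_section p).1 hv.contMDiffAt
  rw [contMDiffAt_iff] at h1
  have h2 := h1.2.of_le (m := (k : WithTop ℕ∞)) (by exact_mod_cast le_top)
  rw [range_eq_halfSpace] at h2
  -- In the chart the field is given only on a half-space. Its extension is defined and Lipschitz on
  -- the whole space, so the usual theory of differential equations applies also at boundary points.
  obtain ⟨F, hF1, hF2, hF3⟩ := exists_contDiff_extension
    (ℓ := EuclideanSpace.proj (𝕜 := ℝ) (0 : Fin n)) (e := EuclideanSpace.single 0 1) (by simp) k h2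
    (extChartAt_apply_zero_nonneg p p)
  refine ⟨F, hF1, hF2, ?_⟩
  rw [← range_eq_halfSpace] at hF3
  have h3 := tendsto_extChartAt_range (n := n) p (mem_extChartAt_source p)
  filter_upwards [h3.eventually hF3, extChartAt_source_mem_nhds (I := 𝓡∂ n) p] with x hx hxs
  refine ⟨hxs, ?_⟩
  rw [hx]
  simp only [Function.comp_apply, extChartAt_model_space_eq_id, PartialEquiv.refl_coe, id_eq]
  rw [(extChartAt (𝓡∂ n) p).left_inv hxs]
  rfl

theorem isMIntegralCurveOn_iff_chart {F : EuclideanSpace ℝ (Fin n) → EuclideanSpace ℝ (Fin n)}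
    {p : X} {c : ℝ → X} {s : Set ℝ}
    (h : ∀ t ∈ s, c t ∈ (extChartAt (𝓡∂ n) p).source ∧
        F (extChartAt (𝓡∂ n) p (c t)) = coords p (c t) (v (c t))) :
    IsMIntegralCurveOn c v s ↔ ContinuousOn c s ∧
      ∀ t ∈ s, HasDerivWithinAt (extChartAt (𝓡∂ n) p ∘ c) (F (extChartAt (𝓡∂ n) p (c t))) s t := by
  constructor
  · intro hc
    refine ⟨hc.continuousOn, fun t ht => ?_⟩
    rw [(h t ht).2]
    exact ((hasMFDerivWithinAt_iff_chart _ (h t ht).1).1 (hc t ht)).2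
  · rintro ⟨h1, h2⟩ t ht
    refine (hasMFDerivWithinAt_iff_chart _ (h t ht).1).2 ⟨h1 t ht, ?_⟩
    rw [← (h t ht).2]
    exact h2 t ht

/-! ### Uniqueness of integral curves -/

section Unique

variable [T2Space X] (hv : ContMDiff (𝓡∂ n) (𝓡∂ n).tangent ∞
    (fun x => (⟨x, v x⟩ : TangentBundle (𝓡∂ n) X)))
include hv

-- In a chart at the common point both curves solve the equation of the same Lipschitz field, and
-- uniqueness applies to both sides of `t₀`.
omit [T2Space X] in
theorem eventually_eq_of_isMIntegralCurveOn {c c' : ℝ → X} {a b t₀ : ℝ} (ht₀ : t₀ ∈ Icc a b)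
    (hc : IsMIntegralCurveOn c v (Icc a b)) (hc' : IsMIntegralCurveOn c' v (Icc a b))
    (h : c t₀ = c' t₀) : ∀ᶠ t in 𝓝[Icc a b] t₀, c t = c' t := by
  obtain ⟨F, hF, hFc, hchart⟩ := exists_chart_field hv (c t₀) 1
  obtain ⟨K, hK⟩ := hF.lipschitzWith_of_hasCompactSupport hFc (by simp)
  have h1 := (hc.continuousOn t₀ ht₀).eventually hchart
  have h2 := (hc'.continuousOn t₀ ht₀).eventually (h ▸ hchart)
  obtain ⟨ε, hε, H⟩ := Metric.mem_nhdsWithin_iff.1 (h1.and h2)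
  rw [← h] at H
  set e := extChartAt (𝓡∂ n) (c t₀) with he
  have key : ∀ s ⊆ Metric.ball t₀ ε ∩ Icc a b, (IsMIntegralCurveOn c v s ∧
      IsMIntegralCurveOn c' v s) ∧ (ContinuousOn (e ∘ c) s ∧ ContinuousOn (e ∘ c') s) ∧
      (∀ t ∈ s, HasDerivWithinAt (e ∘ c) (F (e (c t))) s t) ∧
      (∀ t ∈ s, HasDerivWithinAt (e ∘ c') (F (e (c' t))) s t) := by
    intro s hs
    have i1 := hc.mono fun t ht => (hs ht).2
    have i2 := hc'.mono fun t ht => (hs ht).2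
    have d1 := ((isMIntegralCurveOn_iff_chart fun t ht => (H (hs ht)).1).1 i1).2
    have d2 := ((isMIntegralCurveOn_iff_chart fun t ht => (H (hs ht)).2).1 i2).2
    exact ⟨⟨i1, i2⟩, ⟨fun t ht => (d1 t ht).continuousWithinAt,
      fun t ht => (d2 t ht).continuousWithinAt⟩, d1, d2⟩
  rw [eventually_nhdsWithin_iff]
  filter_upwards [Metric.ball_mem_nhds t₀ hε] with t htb ht
  have hinj : e (c t) = e (c' t) → c t = c' t := fun h' =>
    e.injOn (H ⟨htb, ht⟩).1.1 (H ⟨htb, ht⟩).2.1 h'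
  apply hinj
  rw [Real.ball_eq_Ioo] at *
  rcases le_total t₀ t with hle | hle
  · obtain ⟨-, ⟨e1, e2⟩, e3, e4⟩ := key (Icc t₀ t) fun s hs =>
      ⟨⟨by linarith [hs.1], hs.2.trans_lt htb.2⟩, ht₀.1.trans hs.1, hs.2.trans ht.2⟩
    refine ODE_solution_unique (v := fun _ => F) (fun _ => hK) e1 (fun s hs => ?_) e2
      (fun s hs => ?_) (by simp [h]) (right_mem_Icc.2 hle)
    · exact (e3 s (Ico_subset_Icc_self hs)).mono_of_mem_nhdsWithin
        (mem_of_superset (Ico_mem_nhdsGE hs.2) fun x hx => ⟨hs.1.trans hx.1, hx.2.le⟩)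
    · exact (e4 s (Ico_subset_Icc_self hs)).mono_of_mem_nhdsWithin
        (mem_of_superset (Ico_mem_nhdsGE hs.2) fun x hx => ⟨hs.1.trans hx.1, hx.2.le⟩)
  · obtain ⟨-, ⟨e1, e2⟩, e3, e4⟩ := key (Icc t t₀) fun s hs =>
      ⟨⟨htb.1.trans_le hs.1, by linarith [hs.2]⟩, ht.1.trans hs.1, hs.2.trans ht₀.2⟩
    refine ODE_solution_unique_of_mem_Icc_left (v := fun _ => F) (s := fun _ => univ)
      (fun _ _ => hK.lipschitzOnWith) e1 (fun s hs => ?_) (fun _ _ => mem_univ _) e2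
      (fun s hs => ?_) (fun _ _ => mem_univ _) (by simp [h]) (left_mem_Icc.2 hle)
    · exact (e3 s (Ioc_subset_Icc_self hs)).mono_of_mem_nhdsWithin
        (mem_of_superset (Ioc_mem_nhdsLE hs.1) fun x hx => ⟨hx.1.le, hx.2.trans hs.2⟩)
    · exact (e4 s (Ioc_subset_Icc_self hs)).mono_of_mem_nhdsWithin
        (mem_of_superset (Ioc_mem_nhdsLE hs.1) fun x hx => ⟨hx.1.le, hx.2.trans hs.2⟩)

/-- Integral curves on an interval that agree at some time agree. -/
theorem eqOn_of_isMIntegralCurveOn {c c' : ℝ → X} {a b t₀ : ℝ} (ht₀ : t₀ ∈ Icc a b)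
    (hc : IsMIntegralCurveOn c v (Icc a b)) (hc' : IsMIntegralCurveOn c' v (Icc a b))
    (h : c t₀ = c' t₀) : EqOn c c' (Icc a b) := by
  have hconn : IsPreconnected (univ : Set (Icc a b)) :=
    (isPreconnected_iff_preconnectedSpace.1 isPreconnected_Icc).isPreconnected_univ
  -- The set of agreement is closed as the manifold is Hausdorff, open by local uniqueness, and the
  -- interval is connected.
  let A : Set (Icc a b) := {t | c t = c' t}
  have hA : IsClopen A := by
    constructor
    · exact isClosed_eq (continuousOn_iff_continuous_domRestrict.1 hc.continuousOn)
        (continuousOn_iff_continuous_domRestrict.1 hc'.continuousOn)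
    · rw [isOpen_iff_mem_nhds]
      intro t ht
      have := eventually_eq_of_isMIntegralCurveOn hv t.2 hc hc' ht
      rw [nhds_subtype_eq_comap_nhdsWithin]
      exact ⟨_, this, fun x hx => hx⟩
  have : PreconnectedSpace (Icc a b) := isPreconnected_iff_preconnectedSpace.1 isPreconnected_Icc
  have hu : A = univ := hA.eq_univ ⟨⟨t₀, ht₀⟩, h⟩
  intro t ht
  have : (⟨t, ht⟩ : Icc a b) ∈ A := hu ▸ mem_univ _
  exact this

end Unique

omit [IsManifold (𝓡∂ n) ∞ X] in
theorem isMIntegralCurveOn_congr {c c' : ℝ → X} {s : Set ℝ} (hc : IsMIntegralCurveOn c v s)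
    (h : EqOn c' c s) : IsMIntegralCurveOn c' v s := fun t ht => by
  have h1 := (hc t ht).congr_mono h (h ht) subset_rfl
  -- The derivatives live in tangent spaces at `c' t` and at `c t`, which are equal only
  -- propositionally; generalizing the point makes the rewriting possible.
  have key : ∀ x, x = c t → HasMFDerivWithinAt 𝓘(ℝ, ℝ) (𝓡∂ n) c' s t
      (velocity (x := c' t) (v x : EuclideanSpace ℝ (Fin n))) := by
    rintro _ rfl; exact h1
  exact key (c' t) (h ht)

omit [IsManifold (𝓡∂ n) ∞ X] in
/-- Concatenation of integral curves. -/
theorem isMIntegralCurveOn_concat {c c' : ℝ → X} {a b d : ℝ} (hab : a ≤ b) (hbd : b ≤ d)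
    (hc : IsMIntegralCurveOn c v (Icc a b)) (hc' : IsMIntegralCurveOn c' v (Icc b d))
    (h : c b = c' b) : IsMIntegralCurveOn (fun t => if t ≤ b then c t else c' t) v (Icc a d) := by
  have e1 : ∀ t ∈ Icc a b, (if t ≤ b then c t else c' t) = c t := fun t ht => if_pos ht.2
  have e2 : ∀ t ∈ Icc b d, (if t ≤ b then c t else c' t) = c' t := fun t ht => by
    rcases ht.1.eq_or_lt with rfl | h'
    · simp [h]
    · simp [not_le.2 h']
  have k1 : IsMIntegralCurveOn (fun t => if t ≤ b then c t else c' t) v (Icc a b) :=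
    isMIntegralCurveOn_congr hc e1
  have k2 : IsMIntegralCurveOn (fun t => if t ≤ b then c t else c' t) v (Icc b d) :=
    isMIntegralCurveOn_congr hc' e2
  intro t ht
  rw [← Icc_union_Icc_eq_Icc hab hbd]
  rcases lt_trichotomy t b with h' | rfl | h'
  · refine (k1 t ⟨ht.1, h'.le⟩).mono_of_mem_nhdsWithin ?_
    refine mem_nhdsWithin.2 ⟨Iio b, isOpen_Iio, h', ?_⟩
    rintro x ⟨hx1, hx2 | hx2⟩
    · exact hx2
    · exact absurd hx2.1 (not_le.2 hx1)
  · exact (k1 t ⟨ht.1, le_rfl⟩).union (k2 t ⟨le_rfl, ht.2⟩)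
  · refine (k2 t ⟨h'.le, ht.2⟩).mono_of_mem_nhdsWithin ?_
    refine mem_nhdsWithin.2 ⟨Ioi b, isOpen_Ioi, h', ?_⟩
    rintro x ⟨hx1, hx2 | hx2⟩
    · exact absurd hx2.2 (not_le.2 hx1)
    · exact hx2

end IntegralCurves

end HybridDS

namespace HybridDS

/-! ### The forward flow near points from which the field can be followed -/

/-- A supremum argument: if every time has a neighbourhood within which `P` propagates forward, then
`P` spreads from `a` over the interval. It carries the regularity of the flow along a curve from one
flow box to the next. -/
theorem Icc_chain_induction {P : ℝ → Prop} {a b : ℝ} (hab : a ≤ b) (ha : P a)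
    (h : ∀ t ∈ Icc a b, ∃ ε > 0, ∀ s₁ ∈ Icc a b, ∀ s₂ ∈ Icc a b, t - ε < s₁ → s₁ ≤ s₂ → s₂ < t + ε →
      P s₁ → P s₂) : ∀ t ∈ Icc a b, P t := by
  let S : Set ℝ := {t | t ∈ Icc a b ∧ ∀ s ∈ Icc a t, P s}
  have haS : a ∈ S := ⟨left_mem_Icc.2 hab, fun s hs => by
    rwa [show s = a from le_antisymm hs.2 hs.1]⟩
  have hbd : BddAbove S := ⟨b, fun t ht => ht.1.2⟩
  set u := sSup S with hu
  have hau : a ≤ u := le_csSup hbd haS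
  have hub : u ≤ b := csSup_le ⟨a, haS⟩ fun t ht => ht.1.2
  obtain ⟨ε, hε, H⟩ := h u ⟨hau, hub⟩
  obtain ⟨t₁, ht₁, hlt⟩ := exists_lt_of_lt_csSup ⟨a, haS⟩ (show u - ε < sSup S by linarith)
  have ht₁u : t₁ ≤ u := le_csSup hbd ht₁
  have hall : ∀ s ∈ Icc a b, s < u + ε → P s := fun s hs hsu => by
    rcases le_total s t₁ with h1 | h1
    · exact ht₁.2 s ⟨hs.1, h1⟩
    · exact H t₁ ht₁.1 s hs hlt h1 hsu (ht₁.2 t₁ ⟨ht₁.1.1, le_rfl⟩)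
  have hbu : b ≤ u := by
    by_contra hcon
    push Not at hcon
    have hm : min b (u + ε / 2) ∈ S := by
      refine ⟨⟨le_min hab (by linarith), min_le_left _ _⟩, fun s hs => hall s ⟨hs.1,
        hs.2.trans (min_le_left _ _)⟩ ?_⟩
      have := hs.2.trans (min_le_right _ _)
      linarith
    have := le_csSup hbd hm
    rw [← hu] at this
    rcases min_le_iff.1 this with h1 | h1 <;> linarith
  exact fun t ht => hall t ht (by linarith [ht.2])

theorem contMDiffWithinAt_comp_of_mem {E H M E' H' M' E'' H'' M'' : Type*}
    [NormedAddCommGroup E] [NormedSpace ℝ E] [TopologicalSpace H] {I : ModelWithCorners ℝ E H}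
    [TopologicalSpace M] [ChartedSpace H M]
    [NormedAddCommGroup E'] [NormedSpace ℝ E'] [TopologicalSpace H'] {I' : ModelWithCorners ℝ E' H'}
    [TopologicalSpace M'] [ChartedSpace H' M']
    [NormedAddCommGroup E''] [NormedSpace ℝ E''] [TopologicalSpace H'']
    {I'' : ModelWithCorners ℝ E'' H''} [TopologicalSpace M''] [ChartedSpace H'' M'']
    {k : WithTop ℕ∞} {f : M → M'} {g : M' → M''} {s : Set M} {t : Set M'} (x : M)
    (hg : ContMDiffWithinAt I' I'' k g t (f x)) (hf : ContMDiffWithinAt I I' k f s x)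
    (h : f ⁻¹' t ∈ 𝓝[s] x) : ContMDiffWithinAt I I'' k (g ∘ f) s x :=
  (hg.comp' x hf).mono_of_mem_nhdsWithin (inter_mem self_mem_nhdsWithin h)

section Flow

variable {n : ℕ} [NeZero n] {X : Type*} [TopologicalSpace X]
  [ChartedSpace (EuclideanHalfSpace n) X]

/-- The field `v` can be followed forward from `x` for some time. -/
def CanFlow (v : ∀ x : X, TangentSpace (𝓡∂ n) x) (x : X) : Prop :=
  ∃ δ > (0 : ℝ), ∃ c : ℝ → X, c 0 = x ∧ IsMIntegralCurveOn c v (Ico 0 δ)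

/-- The points near which the field `v` can be followed forward. -/
def fwdSet (v : ∀ x : X, TangentSpace (𝓡∂ n) x) : Set X := {x | ∀ᶠ y in 𝓝 x, CanFlow v y}

theorem isOpen_fwdSet (v : ∀ x : X, TangentSpace (𝓡∂ n) x) : IsOpen (fwdSet v) :=
  isOpen_iff_mem_nhds.2 fun _ hx => eventually_eventually_nhds.2 hx

/-- There is an integral curve from `x` to `y` in time `t` that stays in the set `fwdSet v`. -/
def FlowsTo (v : ∀ x : X, TangentSpace (𝓡∂ n) x) (x : X) (t : ℝ) (y : X) : Prop :=
  0 ≤ t ∧ ∃ c : ℝ → X, c 0 = x ∧ c t = y ∧ IsMIntegralCurveOn c v (Icc 0 t) ∧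
    ∀ s ∈ Icc 0 t, c s ∈ fwdSet v

open Classical in
/-- The forward flow, where it is defined. -/
noncomputable def fwdFlow (v : ∀ x : X, TangentSpace (𝓡∂ n) x) (t : ℝ) (x : X) : X :=
  if h : ∃ y, FlowsTo v x t y then h.choose else x

/-- The domain of the forward flow. -/
def flowDomain (v : ∀ x : X, TangentSpace (𝓡∂ n) x) : Set (ℝ × X) :=
  {p | ∃ y, FlowsTo v p.2 p.1 y}

variable {v : ∀ x : X, TangentSpace (𝓡∂ n) x}

theorem flowsTo_fwdFlow {t : ℝ} {x : X} (h : (t, x) ∈ flowDomain v) :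
    FlowsTo v x t (fwdFlow v t x) := by
  have h' : ∃ y, FlowsTo v x t y := h
  rw [fwdFlow, dif_pos h']
  exact h'.choose_spec

theorem FlowsTo.trans {x y z : X} {s t : ℝ} (h1 : FlowsTo v x s y) (h2 : FlowsTo v y t z) :
    FlowsTo v x (s + t) z := by
  obtain ⟨hs, c, hc0, hcs, hc, hcF⟩ := h1
  obtain ⟨ht, c', hc0', hct', hc', hcF'⟩ := h2
  have hc'' : IsMIntegralCurveOn (fun r => c' (r - s)) v (Icc s (s + t)) := by
    have := IsMIntegralCurveOn.comp_add hc' (-s)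
    refine IsMIntegralCurveOn.mono this fun r hr => ?_
    show r + -s ∈ Icc 0 t
    constructor <;> linarith [hr.1, hr.2]
  refine ⟨by linarith, fun r => if r ≤ s then c r else c' (r - s), by simp [hs, hc0], ?_,
    isMIntegralCurveOn_concat hs (by linarith) hc hc'' (by simp [hcs, hc0']), fun r hr => ?_⟩
  · rcases ht.eq_or_lt with rfl | ht'
    · simp [hcs, ← hct', hc0']
    · simp [not_le.2 (show s < s + t by linarith), hct']
  · dsimp only
    split_ifs with h
    · exact hcF r ⟨hr.1, h⟩
    · exact hcF' _ ⟨by linarith, by linarith [hr.2]⟩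

variable [IsManifold (𝓡∂ n) ∞ X] [T2Space X]
  (hv : ContMDiff (𝓡∂ n) (𝓡∂ n).tangent ∞ (fun x => (⟨x, v x⟩ : TangentBundle (𝓡∂ n) X)))

include hv

theorem FlowsTo.unique {x y z : X} {t : ℝ} (h1 : FlowsTo v x t y) (h2 : FlowsTo v x t z) :
    y = z := by
  obtain ⟨hs, c, hc0, hcs, hc, -⟩ := h1
  obtain ⟨-, c', hc0', hct', hc', -⟩ := h2
  rw [← hcs, ← hct']
  exact eqOn_of_isMIntegralCurveOn hv (left_mem_Icc.2 hs) hc hc' (hc0.trans hc0'.symm)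
    (right_mem_Icc.2 hs)

theorem FlowsTo.fwdFlow_eq {x y : X} {t : ℝ} (h : FlowsTo v x t y) : fwdFlow v t x = y :=
  (flowsTo_fwdFlow (show (t, x) ∈ flowDomain v from ⟨y, h⟩)).unique hv h

omit [T2Space X] in
/-- The flow of a local representation of the field in a chart. -/
theorem exists_chart_flow (p : X) {k : ℕ} (hk : k ≠ 0) :
    ∃ (F : EuclideanSpace ℝ (Fin n) → EuclideanSpace ℝ (Fin n)) (K : NNReal)
      (φ : ℝ × EuclideanSpace ℝ (Fin n) → EuclideanSpace ℝ (Fin n)) (δ : ℝ),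
      LipschitzWith K F ∧ ContDiff ℝ k F ∧ 0 < δ ∧
      (∀ᶠ x in 𝓝 p, x ∈ (extChartAt (𝓡∂ n) p).source ∧
        F (extChartAt (𝓡∂ n) p x) = coords p x (v x)) ∧
      (∀ t y, |t| < δ → dist y (extChartAt (𝓡∂ n) p p) < δ →
        φ (0, y) = y ∧ HasDerivAt (fun s => φ (s, y)) (F (φ (t, y))) t ∧
        ContDiffAt ℝ k φ (t, y)) ∧
      ∀ t y, |t| < δ → dist y (extChartAt (𝓡∂ n) p p) < δ →
        dist (φ (t, y)) (extChartAt (𝓡∂ n) p p) < δ → φ (-t, φ (t, y)) = y := by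
  obtain ⟨F, hF, hFc, hchart⟩ := exists_chart_field hv p k
  obtain ⟨K, hK⟩ := hF.lipschitzWith_of_hasCompactSupport hFc (by exact_mod_cast hk)
  obtain ⟨φ, δ, hδ, H⟩ := exists_contDiffAt_flow hk hF hK (extChartAt (𝓡∂ n) p p)
  refine ⟨F, K, φ, δ, hK, hF, hδ, hchart, H, fun t y ht hy hty => ?_⟩
  -- The curves `φ (t - t * s, y)` and `φ (-(t * s), φ (t, y))` start at the same point and both
  -- solve `z' = -t F(z)`. At `s = 1` uniqueness says that flowing back by `t` undoes the flow.
  have d1 : ∀ s ∈ Icc (0 : ℝ) 1, HasDerivAt (fun s => φ (t - t * s, y))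
      (-t • F (φ (t - t * s, y))) s := fun s hs => by
    have hlt : |t - t * s| < δ := by
      rw [show t - t * s = t * (1 - s) by ring, abs_mul, abs_of_nonneg (sub_nonneg.2 hs.2)]
      exact lt_of_le_of_lt (mul_le_of_le_one_right (abs_nonneg _) (by linarith [hs.1])) ht
    have := (H _ y hlt hy).2.1.scomp s (((hasDerivAt_id s).const_mul t).const_sub t)
    rwa [mul_one] at this
  have d2 : ∀ s ∈ Icc (0 : ℝ) 1, HasDerivAt (fun s => φ (-(t * s), φ (t, y)))
      (-t • F (φ (-(t * s), φ (t, y)))) s := fun s hs => by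
    have hlt : |-(t * s)| < δ := by
      rw [abs_neg, abs_mul, abs_of_nonneg hs.1]
      exact lt_of_le_of_lt (mul_le_of_le_one_right (abs_nonneg _) hs.2) ht
    have := (H _ _ hlt hty).2.1.scomp s (((hasDerivAt_id s).const_mul t).neg)
    rwa [mul_one] at this
  have := ODE_solution_unique (v := fun _ z => -t • F z) (K := ‖-t‖₊ * K) (a := 0) (b := 1)
    (fun _ => (lipschitzWith_smul (-t)).comp hK)
    (fun s hs => (d1 s hs).continuousAt.continuousWithinAt)
    (fun s hs => (d1 s (Ico_subset_Icc_self hs)).hasDerivWithinAt)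
    (fun s hs => (d2 s hs).continuousAt.continuousWithinAt)
    (fun s hs => (d2 s (Ico_subset_Icc_self hs)).hasDerivWithinAt)
    (by simp [(H 0 (φ (t, y)) (by simpa using hδ) hty).1]) (right_mem_Icc.2 zero_le_one)
  simp only [mul_one, sub_self] at this
  rw [← this]
  exact (H t y ht hy).1

-- As long as a curve in the manifold stays where `F` represents the field, the flow of `F` follows
-- it, whatever values the extension has outside the half-space.
omit hv [T2Space X] in
theorem chart_flow_eq_curve {p : X} {F : EuclideanSpace ℝ (Fin n) → EuclideanSpace ℝ (Fin n)}
    {K : NNReal} (hK : LipschitzWith K F) {c : ℝ → X} {T : ℝ}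
    {z : ℝ → EuclideanSpace ℝ (Fin n)} (hc : IsMIntegralCurveOn c v (Icc 0 T))
    (hcF : ∀ s ∈ Icc 0 T, c s ∈ (extChartAt (𝓡∂ n) p).source ∧
        F (extChartAt (𝓡∂ n) p (c s)) = coords p (c s) (v (c s)))
    (hz : ∀ s ∈ Icc 0 T, HasDerivAt z (F (z s)) s) (h0 : z 0 = extChartAt (𝓡∂ n) p (c 0)) :
    ∀ s ∈ Icc 0 T, z s = extChartAt (𝓡∂ n) p (c s) := by
  have d := ((isMIntegralCurveOn_iff_chart hcF).1 hc).2
  intro s hs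
  refine ODE_solution_unique (v := fun _ => F) (fun _ => hK)
    (fun s hs => (hz s hs).continuousAt.continuousWithinAt)
    (fun s hs => (hz s (Ico_subset_Icc_self hs)).hasDerivWithinAt)
    (fun s hs => (d s hs).continuousWithinAt)
    (fun s hs => ?_) h0 hs
  exact (d s (Ico_subset_Icc_self hs)).mono_of_mem_nhdsWithin
    (mem_of_superset (Ico_mem_nhdsGE hs.2) fun x hx => ⟨hs.1.trans hx.1, hx.2.le⟩)

omit hv [T2Space X] [IsManifold (𝓡∂ n) ∞ X] in
theorem exists_ball_subset_symm (p : X) {O : Set X} (hO : O ∈ 𝓝 p) :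
    ∃ ρ > 0, ∀ y ∈ Metric.ball (extChartAt (𝓡∂ n) p p) ρ, y ∈ range (𝓡∂ n) →
      y ∈ (extChartAt (𝓡∂ n) p).target ∧ (extChartAt (𝓡∂ n) p).symm y ∈ O := by
  have h1 : (extChartAt (𝓡∂ n) p).target ∩ (extChartAt (𝓡∂ n) p).symm ⁻¹' O ∈
      𝓝[range (𝓡∂ n)] (extChartAt (𝓡∂ n) p p) := by
    refine inter_mem (extChartAt_target_mem_nhdsWithin p) ?_
    have := (continuousAt_extChartAt_symm (I := 𝓡∂ n) p).preimage_mem_nhds (t := O)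
      (by rwa [extChartAt_to_inv])
    exact mem_nhdsWithin_of_mem_nhds this
  obtain ⟨ρ, hρ, H⟩ := Metric.mem_nhdsWithin_iff.1 h1
  exact ⟨ρ, hρ, fun y hy hyr => H ⟨hy, hyr⟩⟩

omit [T2Space X] in
/-- Near a point of `fwdSet v`, the field has a forward flow of class `C^k`, for a uniform time. -/
theorem exists_box_flow {p : X} (hp : p ∈ fwdSet v) {k : ℕ} (hk : k ≠ 0) :
    ∃ O, p ∈ O ∧ IsOpen O ∧ ∃ δ > 0, ∃ Φ : ℝ → X → X, ∀ x ∈ O, Φ 0 x = x ∧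
      ∀ t ∈ Icc 0 δ, FlowsTo v x t (Φ t x) ∧
        ContMDiffWithinAt (𝓘(ℝ, ℝ).prod (𝓡∂ n)) (𝓡∂ n) k (Function.uncurry Φ)
          (Icc 0 δ ×ˢ univ) (t, x) ∧
        ∃ Λ : X → EuclideanSpace ℝ (Fin n), ContMDiffAt (𝓡∂ n) 𝓘(ℝ, EuclideanSpace ℝ (Fin n)) k Λ
          (Φ t x) ∧ ∀ᶠ x' in 𝓝 x, Λ (Φ t x') = extChartAt (𝓡∂ n) p x' ∧
          x' ∈ (extChartAt (𝓡∂ n) p).source := by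
  obtain ⟨F, K, φ, δ₀, hK, hF, hδ₀, hchart, hφ, hinv⟩ := exists_chart_flow hv p hk
  set e := extChartAt (𝓡∂ n) p with he
  have hk1 : IsManifold (𝓡∂ n) k X := IsManifold.of_le (I := 𝓡∂ n) (M := X) (n := ∞)
    (by exact_mod_cast le_top)
  obtain ⟨O₁, hO₁, hO₁o, hpO₁⟩ := eventually_nhds_iff.1 hchart
  obtain ⟨ρ, hρ, hball⟩ := exists_ball_subset_symm (n := n) p
    ((hO₁o.inter (isOpen_fwdSet v)).mem_nhds ⟨hpO₁, hp⟩)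
  have hcont : ContinuousAt φ (0, e p) :=
    (hφ 0 (e p) (by simpa using hδ₀) (by simpa using hδ₀)).2.2.continuousAt
  have h0 : φ (0, e p) = e p := (hφ 0 (e p) (by simpa using hδ₀) (by simpa using hδ₀)).1
  have hnear : ∀ᶠ q in 𝓝 ((0 : ℝ), e p), φ q ∈ Metric.ball (e p) (min ρ δ₀) :=
    hcont.eventually (by rw [h0]; exact Metric.ball_mem_nhds _ (lt_min hρ hδ₀))
  obtain ⟨η, hη, hnear⟩ := Metric.eventually_nhds_iff.1 hnear
  set δ := min (η / 2) (δ₀ / 2) with hδ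
  have hδpos : 0 < δ := lt_min (by linarith) (by linarith)
  have hφt : ∀ t ∈ Icc 0 δ, ∀ y, dist y (e p) < min η δ₀ → φ (t, y) ∈ Metric.ball (e p) ρ ∧
      dist (φ (t, y)) (e p) < δ₀ ∧ |t| < δ₀ ∧ dist y (e p) < δ₀ := by
    intro t ht y hy
    have hta : |t| = t := abs_of_nonneg ht.1
    have h1 : t < η := by have := ht.2.trans (min_le_left _ _); linarith
    have h2 : t < δ₀ := by have := ht.2.trans (min_le_right _ _); linarith
    have := hnear (y := (t, y)) (by
      rw [Prod.dist_eq]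
      exact max_lt (by simpa [Real.dist_eq, hta] using h1) (hy.trans_le (min_le_left _ _)))
    exact ⟨Metric.ball_subset_ball (min_le_left _ _) this, lt_of_lt_of_le this (min_le_right _ _),
      by rwa [hta], hy.trans_le (min_le_right _ _)⟩
  have hO1 : ∀ᶠ x in 𝓝 p, x ∈ e.source ∧ dist (e x) (e p) < min η δ₀ :=
    Filter.Eventually.and (extChartAt_source_mem_nhds (I := 𝓡∂ n) p)
      ((continuousAt_extChartAt (I := 𝓡∂ n) p).eventually
      (Metric.ball_mem_nhds _ (lt_min hη hδ₀)))
  obtain ⟨O, hO, hOo, hpO⟩ := eventually_nhds_iff.1 hO1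
  -- the flow in the chart stays in the half-space
  have hd : ∀ x ∈ O, ∀ t ∈ Icc 0 δ, HasDerivAt (fun s => φ (s, e x)) (F (φ (t, e x))) t :=
    fun x hx t ht =>
      (hφ t (e x) (hφt t ht _ (hO x hx).2).2.2.1 (hφt t ht _ (hO x hx).2).2.2.2).2.1
  have hrange : ∀ x ∈ O, ∀ t ∈ Icc 0 δ, φ (t, e x) ∈ range (𝓡∂ n) := by
    intro x hx
    refine IsClosed.Icc_subset_of_forall_exists_gt (s := {t | φ (t, e x) ∈ range (𝓡∂ n)})
      ?_ ?_ ?_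
    · have hc : ContinuousOn (fun t => φ (t, e x)) (Icc 0 δ) := fun t ht =>
        (hd x hx t ht).continuousAt.continuousWithinAt
      rw [inter_comm]
      exact hc.preimage_isClosed_of_isClosed isClosed_Icc (𝓡∂ n).isClosed_range
    · show φ (0, e x) ∈ range (𝓡∂ n)
      rw [(hφ 0 (e x) (by simpa using hδ₀) ((hO x hx).2.trans_le (min_le_right _ _))).1]
      exact ⟨chartAt _ p x, rfl⟩
    -- At a time with position in the half-space, the corresponding point of the manifold lies in
    -- `fwdSet v`, so some integral curve leaves it inside the manifold. The flow of the extended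
    -- field must agree with this curve for a short time, and hence cannot cross the boundary there.
    · rintro t ⟨htr, ht⟩ y hy
      have hb := hφt t (Ico_subset_Icc_self ht) (e x) (hO x hx).2
      obtain ⟨htgt, hz, hzF⟩ := hball _ hb.1 htr
      obtain ⟨η', hη', c, hc0, hc⟩ := hzF.self_of_nhds
      have hcc : ContinuousWithinAt c (Ico 0 η') 0 := hc.continuousWithinAt ⟨le_rfl, hη'⟩
      have hev : ∀ᶠ s in 𝓝[Ico 0 η'] 0, c s ∈ O₁ :=
        hcc.eventually (by rw [hc0]; exact hO₁o.mem_nhds hz)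
      rw [nhdsWithin_Ico_eq_nhdsGE hη'] at hev
      obtain ⟨b, hb0, hb⟩ := (mem_nhdsGE_iff_exists_Icc_subset).1 hev
      set T := min b (min (η' / 2) (min (δ - t) (y - t))) with hT
      have hTpos : 0 < T := lt_min hb0 (lt_min (by linarith) (lt_min (by linarith [ht.2])
        (by linarith [show t < y from hy])))
      have hT1 : T ≤ b := min_le_left _ _
      have hT2 : T ≤ η' / 2 := (min_le_right _ _).trans (min_le_left _ _)
      have hT3 : T ≤ δ - t := (min_le_right _ _).trans ((min_le_right _ _).trans (min_le_left _ _))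
      have hT4 : T ≤ y - t := (min_le_right _ _).trans ((min_le_right _ _).trans (min_le_right _ _))
      have := chart_flow_eq_curve hK (p := p) (c := c) (T := T) (z := fun s => φ (t + s, e x))
        (IsMIntegralCurveOn.mono hc fun s hs => ⟨hs.1, by linarith [hs.2]⟩)
        (fun s hs => hO₁ _ (hb ⟨hs.1, hs.2.trans hT1⟩))
        (fun s hs => (hd x hx (t + s) ⟨by linarith [hs.1, ht.1], by linarith [hs.2]⟩).comp_const_add
          t s)
        (by simp only [add_zero]; rw [hc0]; exact (e.right_inv htgt).symm) T
        (right_mem_Icc.2 hTpos.le)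
      refine ⟨t + T, ?_, by linarith, by linarith⟩
      show φ (t + T, e x) ∈ range (𝓡∂ n)
      rw [this]
      exact ⟨chartAt _ p (c T), rfl⟩
  have htgt : ∀ x ∈ O, ∀ t ∈ Icc 0 δ, φ (t, e x) ∈ e.target ∧
      e.symm (φ (t, e x)) ∈ O₁ ∩ fwdSet v := fun x hx t ht =>
    hball _ (hφt t ht (e x) (hO x hx).2).1 (hrange x hx t ht)
  refine ⟨O, hpO, hOo, δ, hδpos, fun t x => e.symm (φ (t, e x)), fun x hx => ⟨?_, fun t ht =>
    ⟨⟨ht.1, fun s => e.symm (φ (s, e x)), ?_, rfl, ?_, fun s hs =>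
      (htgt x hx s ⟨hs.1, hs.2.trans ht.2⟩).2.2⟩, ?_, ?_⟩⟩⟩
  · dsimp only
    rw [(hφ 0 (e x) (by simpa using hδ₀) ((hO x hx).2.trans_le (min_le_right _ _))).1]
    exact e.left_inv (hO x hx).1
  · dsimp only
    rw [(hφ 0 (e x) (by simpa using hδ₀) ((hO x hx).2.trans_le (min_le_right _ _))).1]
    exact e.left_inv (hO x hx).1
  · have hI : ∀ s ∈ Icc 0 t, s ∈ Icc 0 δ := fun s hs => ⟨hs.1, hs.2.trans ht.2⟩
    refine (isMIntegralCurveOn_iff_chart (p := p) (F := F) fun s hs =>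
      hO₁ _ (htgt x hx s (hI s hs)).2.1).2 ⟨?_, fun s hs => ?_⟩
    · refine (continuousOn_extChartAt_symm (I := 𝓡∂ n) p).comp (fun s hs =>
        (hd x hx s (hI s hs)).continuousAt.continuousWithinAt) fun s hs => (htgt x hx s (hI s hs)).1
    · rw [e.right_inv (htgt x hx s (hI s hs)).1]
      refine (hd x hx s (hI s hs)).hasDerivWithinAt.congr (fun s' hs' => ?_) ?_
      · exact e.right_inv (htgt x hx s' (hI s' hs')).1
      · exact e.right_inv (htgt x hx s (hI s hs)).1
  · have hin : ContMDiffAt (𝓘(ℝ, ℝ).prod (𝓡∂ n)) 𝓘(ℝ, EuclideanSpace ℝ (Fin n)) k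
        (fun q : ℝ × X => φ (q.1, e q.2)) (t, x) := by
      have h1 : ContMDiffAt 𝓘(ℝ, ℝ × EuclideanSpace ℝ (Fin n))
          𝓘(ℝ, EuclideanSpace ℝ (Fin n)) k φ (t, e x) :=
        (hφ t (e x) (hφt t ht _ (hO x hx).2).2.2.1
          (hφt t ht _ (hO x hx).2).2.2.2).2.2.contMDiffAt
      have h2 : ContMDiffAt (𝓘(ℝ, ℝ).prod (𝓡∂ n)) 𝓘(ℝ, ℝ × EuclideanSpace ℝ (Fin n)) k
          (fun q : ℝ × X => (q.1, e q.2)) (t, x) :=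
        contMDiffAt_fst.prodMk_space ((contMDiffAt_extChartAt' (by
          rw [← extChartAt_source (𝓡∂ n)]; exact (hO x hx).1)).comp (t, x) contMDiffAt_snd)
      exact h1.comp (t, x) h2
    refine contMDiffWithinAt_comp_of_mem (t, x) ((contMDiffOn_extChartAt_symm (I := 𝓡∂ n) (n := k)
      p) (φ (t, e x)) (htgt x hx t ht).1) hin.contMDiffWithinAt ?_
    filter_upwards [self_mem_nhdsWithin, mem_nhdsWithin_of_mem_nhds
      (continuousAt_snd.preimage_mem_nhds (hOo.mem_nhds hx))] with q hq hqO
    exact (htgt q.2 hqO q.1 hq.1).1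
  · have hy := hφt t ht (e x) (hO x hx).2
    have he' : e (e.symm (φ (t, e x))) = φ (t, e x) := e.right_inv (htgt x hx t ht).1
    -- Flowing back in the chart for the time `t` is a smooth left inverse, even if the backward
    -- curve leaves the half-space. It shows later that the flow maps are immersions.
    refine ⟨fun z => φ (-t, e z), ?_, ?_⟩
    · have h1 : ContMDiffAt 𝓘(ℝ, ℝ × EuclideanSpace ℝ (Fin n))
          𝓘(ℝ, EuclideanSpace ℝ (Fin n)) k φ (-t, e (e.symm (φ (t, e x)))) := by
        rw [he']
        exact (hφ (-t) _ (by rw [abs_neg]; exact hy.2.2.1) hy.2.1).2.2.contMDiffAt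
      have h2 : ContMDiffAt (𝓡∂ n) 𝓘(ℝ, ℝ × EuclideanSpace ℝ (Fin n)) k
          (fun z : X => (-t, e z)) (e.symm (φ (t, e x))) :=
        contMDiffAt_const.prodMk_space (contMDiffAt_extChartAt' (by
          rw [← extChartAt_source (𝓡∂ n)]; exact e.map_target (htgt x hx t ht).1))
      exact h1.comp (e.symm (φ (t, e x))) h2
    · filter_upwards [hOo.mem_nhds hx] with x' hx'
      have hy' := hφt t ht (e x') (hO x' hx').2
      refine ⟨?_, (hO x' hx').1⟩
      rw [e.right_inv (htgt x' hx' t ht).1]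
      exact hinv t _ hy'.2.2.1 hy'.2.2.2 hy'.2.1

/-- The flow is defined and smooth near every point of its domain, and its maps are immersions. -/
theorem fwdFlow_regular {t₀ : ℝ} {x₀ : X} (h : (t₀, x₀) ∈ flowDomain v) :
    flowDomain v ∈ 𝓝[Ici 0 ×ˢ univ] (t₀, x₀) ∧
    ContMDiffWithinAt (𝓘(ℝ, ℝ).prod (𝓡∂ n)) (𝓡∂ n) ∞ (Function.uncurry (fwdFlow v))
      (Ici 0 ×ˢ univ) (t₀, x₀) ∧
    Function.Injective (mfderiv (𝓡∂ n) (𝓡∂ n) (fwdFlow v t₀) x₀) := by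
  obtain ⟨y, ht₀, c, hc0, hcy, hc, hcF⟩ := h
  change 0 ≤ t₀ at ht₀
  -- The extended field and the flow boxes depend on `k`, but `fwdFlow v` does not, so smoothness
  -- follows from class `C^k` for every `k`.
  suffices key : ∀ k : ℕ, k ≠ 0 → ∀ t ∈ Icc 0 t₀, flowDomain v ∈ 𝓝[Ici 0 ×ˢ univ] (t, x₀) ∧
      ContMDiffWithinAt (𝓘(ℝ, ℝ).prod (𝓡∂ n)) (𝓡∂ n) k (Function.uncurry (fwdFlow v))
      (Ici 0 ×ˢ univ) (t, x₀) ∧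
      Function.Injective (mfderiv (𝓡∂ n) (𝓡∂ n) (fwdFlow v t) x₀) by
    refine ⟨(key 1 one_ne_zero t₀ ⟨ht₀, le_rfl⟩).1, contMDiffWithinAt_infty.2 fun k => ?_,
      (key 1 one_ne_zero t₀ ⟨ht₀, le_rfl⟩).2.2⟩
    exact (key (k + 1) (by simp) t₀ ⟨ht₀, le_rfl⟩).2.1.of_le (by exact_mod_cast Nat.le_succ k)
  intro k hk
  have hk1 : (1 : WithTop ℕ∞) ≤ k := by exact_mod_cast Nat.one_le_iff_ne_zero.2 hk
  have hm1 : IsManifold (𝓡∂ n) 1 X := IsManifold.of_le (I := 𝓡∂ n) (M := X) (n := ∞)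
    (by exact_mod_cast le_top)
  have hcx : ∀ t ∈ Icc 0 t₀, fwdFlow v t x₀ = c t := fun t ht =>
    FlowsTo.fwdFlow_eq hv ⟨ht.1, c, hc0, rfl, IsMIntegralCurveOn.mono hc
      (Icc_subset_Icc_right ht.2), fun s hs => hcF s ⟨hs.1, hs.2.trans ht.2⟩⟩
  have slice : ∀ {Φ : ℝ → X → X} {s : Set ℝ} {t : ℝ} {x : X}, t ∈ s →
      ContMDiffWithinAt (𝓘(ℝ, ℝ).prod (𝓡∂ n)) (𝓡∂ n) k (Function.uncurry Φ) (s ×ˢ univ) (t, x) →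
      ContMDiffAt (𝓡∂ n) (𝓡∂ n) k (Φ t) x := by
    intro Φ s t x hts hΦ
    have h1 : ContMDiffWithinAt (𝓡∂ n) (𝓘(ℝ, ℝ).prod (𝓡∂ n)) k (fun x' => (t, x')) univ x :=
      (contMDiffAt_const.prodMk contMDiffAt_id).contMDiffWithinAt
    have := hΦ.comp x h1 (fun x' _ => ⟨hts, mem_univ _⟩)
    exact contMDiffWithinAt_univ.1 this
  -- injectivity of the derivative of the flow in a box
  have boxinj : ∀ {p x : X} {Φ : X → X} {Λ : X → EuclideanSpace ℝ (Fin n)},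
      ContMDiffAt (𝓡∂ n) (𝓡∂ n) k Φ x →
      ContMDiffAt (𝓡∂ n) 𝓘(ℝ, EuclideanSpace ℝ (Fin n)) k Λ (Φ x) →
      (∀ᶠ x' in 𝓝 x, Λ (Φ x') = extChartAt (𝓡∂ n) p x' ∧
          x' ∈ (extChartAt (𝓡∂ n) p).source) →
      Function.Injective (mfderiv (𝓡∂ n) (𝓡∂ n) Φ x) := by
    intro p x Φ Λ hΦ hΛ hev
    -- Composed with `Λ`, the flow map becomes a chart, whose derivative is invertible.
    have e1 : Λ ∘ Φ =ᶠ[𝓝 x] extChartAt (𝓡∂ n) p := hev.mono fun _ h => h.1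
    have e2 := mfderiv_comp x (hΛ.mdifferentiableAt (by positivity))
      (hΦ.mdifferentiableAt (by positivity))
    rw [e1.mfderiv_eq] at e2
    have e3 := isInvertible_mfderiv_extChartAt (I := 𝓡∂ n) (x := p) hev.self_of_nhds.2
    intro a b hab
    refine e3.injective ?_
    rw [e2]
    exact congrArg (mfderiv (𝓡∂ n) 𝓘(ℝ, EuclideanSpace ℝ (Fin n)) Λ (Φ x)) hab
  refine Icc_chain_induction ht₀ ?_ fun u hu => ?_
  · obtain ⟨O, hpO, hOo, δ, hδ, Φ, H⟩ := exists_box_flow hv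
      (show x₀ ∈ fwdSet v from (show c 0 = x₀ from hc0) ▸ hcF 0 ⟨le_rfl, ht₀⟩) hk
    have hnh : 𝓝[Ici 0 ×ˢ univ] ((0 : ℝ), x₀) = 𝓝[Icc 0 δ ×ˢ univ] ((0 : ℝ), x₀) := by
      rw [nhdsWithin_prod_eq, nhdsWithin_prod_eq, nhdsWithin_Icc_eq_nhdsGE hδ]
    have hm : Icc 0 δ ×ˢ O ∈ 𝓝[Ici 0 ×ˢ univ] ((0 : ℝ), x₀) := by
      rw [hnh, nhdsWithin_prod_eq, nhdsWithin_univ]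
      exact prod_mem_prod self_mem_nhdsWithin (hOo.mem_nhds hpO)
    have heq : ∀ q ∈ Icc 0 δ ×ˢ O, fwdFlow v q.1 q.2 = Φ q.1 q.2 := fun q hq =>
      ((H q.2 hq.2).2 q.1 hq.1).1.fwdFlow_eq hv
    have h0 : (0 : ℝ) ∈ Icc 0 δ := ⟨le_rfl, hδ.le⟩
    refine ⟨mem_of_superset hm fun q hq => ⟨_, ((H q.2 hq.2).2 q.1 hq.1).1⟩, ?_, ?_⟩
    · have := ((H x₀ hpO).2 0 h0).2.1
      have h2 : ContMDiffWithinAt (𝓘(ℝ, ℝ).prod (𝓡∂ n)) (𝓡∂ n) k (Function.uncurry Φ)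
          (Ici 0 ×ˢ univ) (0, x₀) := this.mono_of_mem_nhdsWithin (by
            rw [hnh]; exact self_mem_nhdsWithin)
      exact h2.congr_of_eventuallyEq (mem_of_superset hm fun q hq => heq q hq) (heq _ ⟨h0, hpO⟩)
    · have e1 : fwdFlow v 0 =ᶠ[𝓝 x₀] id := by
        filter_upwards [hOo.mem_nhds hpO] with x hx
        rw [heq (0, x) ⟨h0, hx⟩, (H x hx).1]; rfl
      rw [e1.mfderiv_eq, mfderiv_id]
      exact fun a b h => h
  · obtain ⟨O, hpO, hOo, δ, hδ, Φ, H⟩ := exists_box_flow hv (hcF u hu) hk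
    obtain ⟨ε, hε, hεO⟩ := Metric.mem_nhdsWithin_iff.1
      (hc.continuousOn u hu (hOo.mem_nhds hpO))
    -- Times at distance less than `ε` from `u` have positions in the box `O`, and two times at
    -- distance less than `δ / 2` from `u` differ by less than the box time `δ`. For `t₁ < t₂` the
    -- flow to a time near `t₂` is the flow up to `t₁` followed by the flow in the box.
    refine ⟨min ε (δ / 2), lt_min hε (by linarith), fun t₁ h₁ t₂ h₂ hl₁ hle hl₂ hP => ?_⟩
    rcases hle.eq_or_lt with rfl | hlt
    · exact hP
    obtain ⟨hPd, hPs, hPi⟩ := hP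
    have b1 := min_le_left ε (δ / 2)
    have b2 := min_le_right ε (δ / 2)
    have ht₁O : fwdFlow v t₁ x₀ ∈ O := by
      rw [hcx _ h₁]
      refine hεO ⟨?_, h₁⟩
      rw [Real.ball_eq_Ioo]
      constructor <;> linarith
    have hs₁ : ContMDiffAt (𝓡∂ n) (𝓡∂ n) k (fwdFlow v t₁) x₀ := slice (s := Ici 0) h₁.1 hPs
    have hd : ∀ᶠ x in 𝓝 x₀, (t₁, x) ∈ flowDomain v := by
      have : Tendsto (fun x : X => (t₁, x)) (𝓝 x₀) (𝓝[Ici 0 ×ˢ univ] (t₁, x₀)) :=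
        tendsto_nhdsWithin_iff.2 ⟨by
          exact (Continuous.prodMk_right t₁).continuousAt, Eventually.of_forall fun x =>
          ⟨h₁.1, mem_univ _⟩⟩
      exact this.eventually hPd
    have hev : ∀ᶠ q : ℝ × X in 𝓝 (t₂, x₀), q.1 - t₁ ∈ Icc 0 δ ∧ fwdFlow v t₁ q.2 ∈ O ∧
        FlowsTo v q.2 q.1 (Φ (q.1 - t₁) (fwdFlow v t₁ q.2)) := by
      have i1 : ∀ᶠ q : ℝ × X in 𝓝 (t₂, x₀), q.1 ∈ Ioo t₁ (t₁ + δ) :=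
        continuousAt_fst.preimage_mem_nhds (Ioo_mem_nhds hlt (by linarith))
      have i2 : ∀ᶠ q : ℝ × X in 𝓝 (t₂, x₀), fwdFlow v t₁ q.2 ∈ O ∧ (t₁, q.2) ∈ flowDomain v :=
        (continuous_snd.tendsto (t₂, x₀)).eventually (p := fun x => fwdFlow v t₁ x ∈ O ∧
          (t₁, x) ∈ flowDomain v) ((hs₁.continuousAt.eventually (p := fun y => y ∈ O)
            (hOo.mem_nhds ht₁O)).and hd)
      filter_upwards [i1, i2] with q hq1 hq2
      have hI : q.1 - t₁ ∈ Icc 0 δ := ⟨by linarith [hq1.1], by linarith [hq1.2]⟩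
      refine ⟨hI, hq2.1, ?_⟩
      have := (flowsTo_fwdFlow hq2.2).trans ((H _ hq2.1).2 _ hI).1
      simpa using this
    have hΦ := (H _ ht₁O).2 (t₂ - t₁) ⟨by linarith, by linarith⟩
    refine ⟨mem_nhdsWithin_of_mem_nhds (hev.mono fun q hq => ⟨_, hq.2.2⟩), ?_, ?_⟩
    · have e1 : Function.uncurry (fwdFlow v) =ᶠ[𝓝 (t₂, x₀)]
          fun q => Function.uncurry Φ (q.1 - t₁, fwdFlow v t₁ q.2) :=
        hev.mono fun q hq => hq.2.2.fwdFlow_eq hv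
      refine ContMDiffAt.contMDiffWithinAt ?_
      refine ContMDiffAt.congr_of_eventuallyEq ?_ e1
      have i1 : ContMDiffAt (𝓘(ℝ, ℝ).prod (𝓡∂ n)) (𝓘(ℝ, ℝ).prod (𝓡∂ n)) k
          (fun q : ℝ × X => (q.1 - t₁, fwdFlow v t₁ q.2)) (t₂, x₀) := by
        refine ContMDiffAt.prodMk ?_ (ContMDiffAt.comp (t₂, x₀) (f := Prod.snd) hs₁ contMDiffAt_snd)
        have : ContMDiffAt 𝓘(ℝ, ℝ) 𝓘(ℝ, ℝ) k (fun s : ℝ => s - t₁) t₂ :=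
          (contDiff_id.sub contDiff_const).contDiffAt.contMDiffAt
        exact ContMDiffAt.comp (t₂, x₀) (f := Prod.fst) this contMDiffAt_fst
      rw [← contMDiffWithinAt_univ] at i1 ⊢
      refine contMDiffWithinAt_comp_of_mem (t₂, x₀) hΦ.2.1 i1 ?_
      rw [nhdsWithin_univ]
      exact hev.mono fun q hq => ⟨hq.1, mem_univ _⟩
    · have e1 : fwdFlow v t₂ =ᶠ[𝓝 x₀] Φ (t₂ - t₁) ∘ fwdFlow v t₁ := by
        have : Tendsto (fun x : X => (t₂, x)) (𝓝 x₀) (𝓝 (t₂, x₀)) :=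
          (Continuous.prodMk_right t₂).continuousAt
        exact (this.eventually hev).mono fun x hx => hx.2.2.fwdFlow_eq hv
      have hsl := slice (s := Icc 0 δ) (show t₂ - t₁ ∈ Icc 0 δ from
        ⟨by linarith, by linarith⟩) hΦ.2.1
      obtain ⟨Λ, hΛ, hΛe⟩ := hΦ.2.2
      rw [e1.mfderiv_eq, mfderiv_comp x₀ (hsl.mdifferentiableAt (by positivity))
        (hs₁.mdifferentiableAt (by positivity))]
      exact (boxinj hsl hΛ hΛe).comp hPi

end Flow

end HybridDS

namespace HybridDS

/-! ### Flowing into the guard -/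

section Guard

variable {n : ℕ} [NeZero n] {X : Type*} [TopologicalSpace X]
  [ChartedSpace (EuclideanHalfSpace n) X]

/-! ### Interior and boundary points in an arbitrary chart -/

section Boundary

variable [IsManifold (𝓡∂ n) ∞ X]

theorem isInteriorPoint_iff_chart {q x : X} (hx : x ∈ (extChartAt (𝓡∂ n) q).source) :
    (𝓡∂ n).IsInteriorPoint x ↔ 0 < extChartAt (𝓡∂ n) q x 0 := by
  have hx' : x ∈ (chartAt (EuclideanHalfSpace n) q).source := by rwa [← extChartAt_source (𝓡∂ n)]
  rw [ModelWithCorners.isInteriorPoint_iff_of_mem_atlas (n := ∞) (by simp)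
    (chart_mem_atlas (EuclideanHalfSpace n) q) hx']
  have key : ∀ y : EuclideanSpace ℝ (Fin n), y ∈ interior (range (𝓡∂ n)) ↔ 0 < y 0 := fun y => by
    rw [interior_range_modelWithCornersEuclideanHalfSpace]; rfl
  rw [← key]
  refine ⟨fun h => OpenPartialHomeomorph.interior_extend_target_subset_interior_range _ h,
    fun h => ?_⟩
  exact OpenPartialHomeomorph.mem_interior_extend_target _
    ((chartAt (EuclideanHalfSpace n) q).map_source hx') h

theorem isBoundaryPoint_iff_chart {q x : X} (hx : x ∈ (extChartAt (𝓡∂ n) q).source) :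
    (𝓡∂ n).IsBoundaryPoint x ↔ extChartAt (𝓡∂ n) q x 0 = 0 := by
  rw [ModelWithCorners.isBoundaryPoint_iff_not_isInteriorPoint, isInteriorPoint_iff_chart hx]
  have := extChartAt_apply_zero_nonneg (n := n) q x
  constructor
  · intro h; linarith
  · intro h; linarith

end Boundary

/-- The curve `c` leads from `x` into the guard `G` in time `t`. -/
def HitBy (v : ∀ x : X, TangentSpace (𝓡∂ n) x) (G : Set X) (x : X) (t : ℝ) (c : ℝ → X) : Prop :=
  0 ≤ t ∧ c 0 = x ∧ IsMIntegralCurveOn c v (Icc 0 t) ∧ c t ∈ G ∧ ∀ s ∈ Ico 0 t, c s ∈ fwdSet v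

/-- The points from which the field leads into the guard. -/
def basin (v : ∀ x : X, TangentSpace (𝓡∂ n) x) (G : Set X) : Set X := {x | ∃ t c, HitBy v G x t c}

open Classical in
/-- The time that the field takes to lead into the guard. -/
noncomputable def hitTime (v : ∀ x : X, TangentSpace (𝓡∂ n) x) (G : Set X) (x : X) : ℝ :=
  if h : x ∈ basin v G then h.choose else 0

open Classical in
/-- The curve that leads into the guard. -/
noncomputable def hitCurve (v : ∀ x : X, TangentSpace (𝓡∂ n) x) (G : Set X) (x : X) : ℝ → X :=
  if h : x ∈ basin v G then h.choose_spec.choose else fun _ => x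

/-- The point in which the field leads into the guard. -/
noncomputable def hitPt (v : ∀ x : X, TangentSpace (𝓡∂ n) x) (G : Set X) (x : X) : X :=
  hitCurve v G x (hitTime v G x)

variable {v : ∀ x : X, TangentSpace (𝓡∂ n) x} {G : Set X}

theorem hitBy_hitCurve {x : X} (hx : x ∈ basin v G) :
    HitBy v G x (hitTime v G x) (hitCurve v G x) := by
  rw [hitTime, hitCurve, dif_pos hx, dif_pos hx]
  exact hx.choose_spec.choose_spec

theorem HitBy.mem_basin {x : X} {t : ℝ} {c : ℝ → X} (h : HitBy v G x t c) : x ∈ basin v G :=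
  ⟨t, c, h⟩

/-- On an interval with one point the condition on the derivative is void. This covers points of the
guard, which are hit after time zero. -/
theorem isMIntegralCurveOn_const_Icc_self (c : ℝ → X) (t : ℝ) :
    IsMIntegralCurveOn c v (Icc t t) := by
  intro s hs
  rw [Icc_self] at hs ⊢
  obtain rfl : s = t := hs
  exact (hasMFDerivWithinAt_iff_self (v (c s) : EuclideanSpace ℝ (Fin n))).2
    ⟨continuousWithinAt_singleton, HasFDerivWithinAt.of_subsingleton subsingleton_singleton⟩

theorem hitBy_zero {x : X} (hx : x ∈ G) : HitBy v G x 0 fun _ => x :=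
  ⟨le_rfl, rfl, isMIntegralCurveOn_const_Icc_self _ 0, hx, fun _ hs => absurd hs.2 (not_lt.2 hs.1)⟩

theorem HitBy.shift {x : X} {t s : ℝ} {c : ℝ → X} (h : HitBy v G x t c) (hs : s ∈ Icc 0 t) :
    HitBy v G (c s) (t - s) fun r => c (r + s) := by
  obtain ⟨ht, h0, hc, hG, hF⟩ := h
  refine ⟨by linarith [hs.2], by simp, ?_, by simpa using hG, fun r hr =>
    hF _ ⟨by linarith [hs.1, hr.1], by linarith [hr.2]⟩⟩
  refine IsMIntegralCurveOn.mono (IsMIntegralCurveOn.comp_add hc s) fun r hr => ?_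
  exact ⟨by linarith [hs.1, hr.1], by linarith [hr.2]⟩

theorem HitBy.of_flow {x y : X} {s t : ℝ} {c c' : ℝ → X} (hs : 0 ≤ s) (hc0 : c 0 = x)
    (hcs : c s = y) (hc : IsMIntegralCurveOn c v (Icc 0 s)) (hcF : ∀ r ∈ Ico 0 s, c r ∈ fwdSet v)
    (h : HitBy v G y t c') :
    HitBy v G x (s + t) fun r => if r ≤ s then c r else c' (r - s) := by
  obtain ⟨ht, h0, hc', hG, hF⟩ := h
  have hc'' : IsMIntegralCurveOn (fun r => c' (r - s)) v (Icc s (s + t)) := by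
    have := IsMIntegralCurveOn.comp_add hc' (-s)
    refine IsMIntegralCurveOn.mono this fun r hr => ?_
    show r + -s ∈ Icc 0 t
    constructor <;> linarith [hr.1, hr.2]
  refine ⟨by linarith, by simp [hs, hc0], isMIntegralCurveOn_concat hs (by linarith) hc hc''
    (by simp [hcs, h0]), ?_, fun r hr => ?_⟩
  · rcases ht.eq_or_lt with rfl | ht'
    · simpa [hcs, ← h0] using hG
    · simpa [not_le.2 (show s < s + t by linarith)] using hG
  · dsimp only
    split_ifs with h
    · rcases h.eq_or_lt with rfl | h'
      · rw [hcs, ← h0]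
        exact hF 0 ⟨le_rfl, by linarith [hr.2]⟩
      · exact hcF r ⟨hr.1, h'⟩
    · exact hF _ ⟨by linarith, by linarith [hr.2]⟩

variable [IsManifold (𝓡∂ n) ∞ X]
  (hv : ContMDiff (𝓡∂ n) (𝓡∂ n).tangent ∞ (fun x => (⟨x, v x⟩ : TangentBundle (𝓡∂ n) X)))
  (hG : ∃ O : Set X, IsOpen O ∧ G = O ∩ (𝓡∂ n).boundary X)
  (hout : ∀ x ∈ G, (show EuclideanSpace ℝ (Fin n) from v x) 0 < 0)

-- The interior is open, and the existence theorem for integral curves applies at each of its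
-- points.
include hv in
theorem interior_subset_fwdSet [T2Space X] {x : X} (hx : (𝓡∂ n).IsInteriorPoint x) : x ∈ fwdSet v := by
  have hm1 : IsManifold (𝓡∂ n) 1 X := IsManifold.of_le (I := 𝓡∂ n) (M := X) (n := ∞)
    (by exact_mod_cast le_top)
  filter_upwards [((𝓡∂ n).isOpen_interior (M := X) (n := ∞) (by simp)).mem_nhds hx] with y hy
  obtain ⟨c, hc0, hc⟩ := exists_isMIntegralCurveAt_of_contMDiffAt (I := 𝓡∂ n) (t₀ := 0)
    ((hv.contMDiffAt (x := y)).of_le (by exact_mod_cast le_top)) hy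
  obtain ⟨ε, hε, hc⟩ := isMIntegralCurveAt_iff'.1 hc
  refine ⟨ε, hε, c, hc0, IsMIntegralCurveOn.mono hc fun s hs => ?_⟩
  rw [Real.ball_eq_Ioo]
  constructor <;> linarith [hs.1, hs.2]

-- Along a curve that starts in the guard, the first chart coordinate would start at `0` with
-- negative derivative, but it is nonnegative on the manifold.
include hG hout in
theorem disjoint_fwdSet : Disjoint (fwdSet v) G := by
  rw [Set.disjoint_left]
  intro x hx hxG
  obtain ⟨δ, hδ, c, hc0, hc⟩ := (show ∀ᶠ y in 𝓝 x, CanFlow v y from hx).self_of_nhds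
  obtain ⟨O, -, rfl⟩ := hG
  subst hc0
  have hb : extChartAt (𝓡∂ n) (c 0) (c 0) 0 = 0 :=
    (isBoundaryPoint_iff_chart (mem_extChartAt_source _)).1 hxG.2
  have hd := ((hasMFDerivWithinAt_iff_self (v (c 0) : EuclideanSpace ℝ (Fin n))).1
    (hc 0 ⟨le_rfl, hδ⟩)).2
  have hd' := (EuclideanSpace.proj (𝕜 := ℝ) (0 : Fin n)).hasFDerivAt.comp_hasDerivWithinAt
    (0 : ℝ) hd
  rw [hasDerivWithinAt_iff_tendsto_slope] at hd'
  have h1 := hd'.eventually_lt_const (hout _ hxG)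
  have hI : Ico 0 δ \ {0} = Ioo 0 δ := by
    ext s; simp only [Set.mem_sdiff, mem_Ico, mem_singleton_iff, mem_Ioo]
    constructor
    · rintro ⟨⟨h1, h2⟩, h3⟩
      exact ⟨lt_of_le_of_ne h1 (Ne.symm h3), h2⟩
    · rintro ⟨h1, h2⟩
      exact ⟨⟨h1.le, h2⟩, h1.ne'⟩
  rw [hI, nhdsWithin_Ioo_eq_nhdsGT hδ] at h1
  obtain ⟨s, hs, hs0⟩ := (h1.and self_mem_nhdsWithin).exists
  rw [slope_def_field] at hs
  have hs0 : 0 < s := hs0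
  have h2 : 0 ≤ (EuclideanSpace.proj (𝕜 := ℝ) (0 : Fin n) ∘ extChartAt (𝓡∂ n) (c 0) ∘ c) s :=
    extChartAt_apply_zero_nonneg (c 0) (c s)
  have h3 : (EuclideanSpace.proj (𝕜 := ℝ) (0 : Fin n) ∘ extChartAt (𝓡∂ n) (c 0) ∘ c) 0 = 0 := hb
  rw [h3, sub_zero, sub_zero] at hs
  exact absurd hs (not_lt.2 (div_nonneg h2 hs0.le))

-- If one curve arrived earlier, its end point would lie on the other curve before the end, and thus
-- in `fwdSet v`, which is disjoint from the guard.
include hv hG hout in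
theorem HitBy.unique [T2Space X] {x : X} {t t' : ℝ} {c c' : ℝ → X} (h : HitBy v G x t c)
    (h' : HitBy v G x t' c') : t = t' ∧ EqOn c c' (Icc 0 t) := by
  have hdis := Set.disjoint_left.1 (disjoint_fwdSet hG hout)
  have key : ∀ {t t' : ℝ} {c c' : ℝ → X}, HitBy v G x t c → HitBy v G x t' c' → t ≤ t' →
      t = t' ∧ EqOn c c' (Icc 0 t) := by
    intro t t' c c' h h' hle
    have heq : EqOn c c' (Icc 0 t) := eqOn_of_isMIntegralCurveOn hv (left_mem_Icc.2 h.1) h.2.2.1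
      (IsMIntegralCurveOn.mono h'.2.2.1 (Icc_subset_Icc_right hle)) (h.2.1.trans h'.2.1.symm)
    refine ⟨?_, heq⟩
    by_contra hne
    refine hdis (h'.2.2.2.2 t ⟨h.1, lt_of_le_of_ne hle hne⟩) ?_
    rw [← heq (right_mem_Icc.2 h.1)]
    exact h.2.2.2.1
  rcases le_total t t' with hle | hle
  · exact key h h' hle
  · obtain ⟨rfl, h2⟩ := key h' h hle
    exact ⟨rfl, h2.symm⟩

include hv hG hout in
theorem HitBy.eq [T2Space X] {x : X} {t : ℝ} {c : ℝ → X} (h : HitBy v G x t c) :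
    hitTime v G x = t ∧ hitPt v G x = c t ∧ EqOn (hitCurve v G x) c (Icc 0 t) := by
  obtain ⟨h1, h2⟩ := (hitBy_hitCurve h.mem_basin).unique hv hG hout h
  refine ⟨h1, ?_, h1 ▸ h2⟩
  rw [hitPt, h2 (right_mem_Icc.2 (hitBy_hitCurve h.mem_basin).1), h1]

include hv hG hout in
/-- Near a point of the guard, the field leads into the guard. -/
theorem exists_box_hit [T2Space X] {q : X} (hq : q ∈ G) {k : ℕ} (hk : k ≠ 0) :
    ∃ (O : Set X) (ε : ℝ) (T : X → ℝ) (Ψ : ℝ → X → X), q ∈ O ∧ IsOpen O ∧ 0 < ε ∧ T q = 0 ∧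
      ∀ x ∈ O, 0 ≤ T x ∧ Ψ 0 x = x ∧ IsMIntegralCurveOn (fun s => Ψ s x) v (Ioc (-ε) (T x)) ∧
        Ψ (T x) x ∈ G ∧ (∀ s ∈ Ioo (-ε) (T x), Ψ s x ∈ fwdSet v) ∧
        ContMDiffAt (𝓡∂ n) 𝓘(ℝ, ℝ) k T x ∧
        (∀ t ∈ Ioc (-ε) (T x), ContMDiffWithinAt (𝓘(ℝ, ℝ).prod (𝓡∂ n)) (𝓡∂ n) k
          (Function.uncurry Ψ) {p | p.2 ∈ O ∧ p.1 ∈ Ioc (-ε) (T p.2)} (t, x)) ∧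
        ∃ Λ : ℝ × X → EuclideanSpace ℝ (Fin n), ContMDiffAt (𝓘(ℝ, ℝ).prod (𝓡∂ n))
          𝓘(ℝ, EuclideanSpace ℝ (Fin n)) k Λ (T x, Ψ (T x) x) ∧
          ∀ᶠ x' in 𝓝 x, Λ (T x', Ψ (T x') x') = extChartAt (𝓡∂ n) q x' ∧
            x' ∈ (extChartAt (𝓡∂ n) q).source := by
  obtain ⟨F, K, φ, δ₀, hK, hF, hδ₀, hchart, hφ, hinv⟩ := exists_chart_flow hv q hk
  set e := extChartAt (𝓡∂ n) q with he
  have hk1 : IsManifold (𝓡∂ n) k X := IsManifold.of_le (I := 𝓡∂ n) (M := X) (n := ∞)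
    (by exact_mod_cast le_top)
  have hk0 : (k : WithTop ℕ∞) ≠ 0 := by exact_mod_cast hk
  let ℓ : EuclideanSpace ℝ (Fin n) →L[ℝ] ℝ := EuclideanSpace.proj (𝕜 := ℝ) (0 : Fin n)
  obtain ⟨O₁, hO₁, hO₁o, hqO₁⟩ := eventually_nhds_iff.1 hchart
  have hG' := hG
  obtain ⟨OG, hOGo, rfl⟩ := hG'
  have hℓq : ℓ (e q) = 0 := (isBoundaryPoint_iff_chart (mem_extChartAt_source _)).1 hq.2
  have hFq : ℓ (F (e q)) < 0 := by
    rw [hchart.self_of_nhds.2]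
    have : coords q q (v q) = v q := tangentCoordChange_self (mem_extChartAt_source q)
    rw [this]
    exact hout q hq
  obtain ⟨ρ, hρ, hball⟩ := exists_ball_subset_symm (n := n) q
    ((hO₁o.inter hOGo).mem_nhds ⟨hqO₁, hq.1⟩)
  obtain ⟨ρ₁, hρ₁, hneg⟩ := Metric.eventually_nhds_iff.1
    ((ℓ.continuous.comp hF.continuous).continuousAt.eventually_lt_const hFq)
  have hφq := hφ 0 (e q) (by simpa using hδ₀) (by simpa using hδ₀)
  have hnear : ∀ᶠ p in 𝓝 ((0 : ℝ), e q),
      φ p ∈ Metric.ball (e q) (min ρ (min ρ₁ δ₀)) ∧ |p.1| < δ₀ ∧ dist p.2 (e q) < δ₀ := by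
    refine (hφq.2.2.continuousAt.eventually (by
      rw [hφq.1]; exact Metric.ball_mem_nhds _ (lt_min hρ (lt_min hρ₁ hδ₀)))).and (.and ?_ ?_)
    · exact (continuous_abs.comp continuous_fst).continuousAt.eventually_lt_const (by simpa)
    · exact (continuous_snd.dist continuous_const).continuousAt.eventually_lt_const (by simpa)
  obtain ⟨η, hη, hnear⟩ := Metric.eventually_nhds_iff.1 hnear
  have hφt : ∀ t y, |t| < η → dist y (e q) < η → φ (t, y) ∈ Metric.ball (e q) ρ ∧
      dist (φ (t, y)) (e q) < δ₀ ∧ ℓ (F (φ (t, y))) < 0 ∧ |t| < δ₀ ∧ dist y (e q) < δ₀ := by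
    intro t y ht hy
    have := hnear (y := (t, y)) (by
      rw [Prod.dist_eq]
      exact max_lt (by simpa [Real.dist_eq] using ht) hy)
    have h1 : dist (φ (t, y)) (e q) < min ρ (min ρ₁ δ₀) := this.1
    exact ⟨h1.trans_le (min_le_left _ _),
      h1.trans_le ((min_le_right _ _).trans (min_le_right _ _)),
      hneg (h1.trans_le ((min_le_right _ _).trans (min_le_left _ _))), this.2⟩
  -- the time of reaching the boundary, as an implicit function
  let f : EuclideanSpace ℝ (Fin n) × ℝ → ℝ := fun p => ℓ (φ (p.2, p.1))
  have hf : ContDiffAt ℝ k f (e q, 0) := ℓ.contDiff.contDiffAt.comp (e q, (0 : ℝ))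
    (hφq.2.2.comp (e q, (0 : ℝ)) (contDiff_snd.prodMk contDiff_fst).contDiffAt)
  -- The derivative of the first coordinate in time is the first component of the field at `q`,
  -- which is negative as the field points outward.
  have hpart : fderiv ℝ f (e q, 0) ∘L .inr ℝ (EuclideanSpace ℝ (Fin n)) ℝ =
      ContinuousLinearMap.toSpanSingleton ℝ (ℓ (F (e q))) := by
    have h1 : HasFDerivAt (fun t : ℝ => f (e q, t))
        (fderiv ℝ f (e q, 0) ∘L .inr ℝ (EuclideanSpace ℝ (Fin n)) ℝ) 0 :=
      (hf.differentiableAt hk0).hasFDerivAt.comp (0 : ℝ) (hasFDerivAt_prodMk_right (e q) (0 : ℝ))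
    have h2 : HasDerivAt (fun t : ℝ => f (e q, t)) (ℓ (F (e q))) 0 := by
      have := ℓ.hasFDerivAt.comp_hasDerivAt (0 : ℝ) hφq.2.1
      rwa [hφq.1] at this
    exact h1.unique h2.hasFDerivAt
  have hinvert : (fderiv ℝ f (e q, 0) ∘L .inr ℝ (EuclideanSpace ℝ (Fin n)) ℝ).IsInvertible := by
    rw [hpart]
    refine ⟨ContinuousLinearEquiv.unitsEquivAut ℝ (Units.mk0 _ hFq.ne), ?_⟩
    ext
    simp
  set τ := hf.implicitFunction hk0 hinvert with hτ
  have hτq : τ (e q) = 0 := hf.implicitFunction_apply_self hk0 hinvert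
  have hτk : ContDiffAt ℝ k τ (e q) := hf.contDiffAt_implicitFunction hk0 hinvert
  have hτev : ∀ᶠ y in 𝓝 (e q), ContDiffAt ℝ k τ y ∧ |τ y| < η ∧ dist y (e q) < η ∧
      ℓ (φ (τ y, y)) = 0 := by
    refine (hτk.eventually (by simp)).and (.and ?_ (.and (Metric.ball_mem_nhds _ hη) ?_))
    · exact (hτk.continuousAt.abs).eventually_lt_const (by simpa [hτq])
    · have := hf.eventually_apply_implicitFunction hk0 hinvert
      have h0 : f (e q, 0) = 0 := by simp only [f]; rw [hφq.1, hℓq]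
      rwa [h0] at this
  have hO : ∀ᶠ x in 𝓝 q, x ∈ e.source ∧ ContDiffAt ℝ k τ (e x) ∧ |τ (e x)| < η ∧
      dist (e x) (e q) < η ∧ ℓ (φ (τ (e x), e x)) = 0 :=
    Filter.Eventually.and (extChartAt_source_mem_nhds (I := 𝓡∂ n) q)
      ((continuousAt_extChartAt (I := 𝓡∂ n) q).eventually hτev)
  obtain ⟨O, hO, hOo, hqO⟩ := eventually_nhds_iff.1 hO
  have hφ0 : ∀ x ∈ O, φ (0, e x) = e x := fun x hx =>
    (hφ 0 (e x) (by simpa using hδ₀) (hφt 0 (e x) (by simpa using hη) (hO x hx).2.2.2.1).2.2.2.2).1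
  have hd : ∀ x ∈ O, ∀ t, |t| < η → HasDerivAt (fun s => φ (s, e x)) (F (φ (t, e x))) t :=
    fun x hx t ht => (hφ t (e x) (hφt t _ ht (hO x hx).2.2.2.1).2.2.2.1
      (hφt t _ ht (hO x hx).2.2.2.1).2.2.2.2).2.1
  -- The first coordinate strictly decreases along the flow. So it is positive before the time `τ (e
  -- x)`, which places the curve in the interior, and `τ (e x)` cannot be negative since the
  -- coordinate is nonnegative at time `0`.
  have hanti : ∀ x ∈ O, StrictAntiOn (fun s => ℓ (φ (s, e x))) (Ioo (-η) η) := by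
    intro x hx
    have hdl : ∀ t ∈ Ioo (-η) η, HasDerivAt (fun s => ℓ (φ (s, e x))) (ℓ (F (φ (t, e x)))) t :=
      fun t ht => ℓ.hasFDerivAt.comp_hasDerivAt t (hd x hx t (abs_lt.2 ht))
    refine strictAntiOn_of_deriv_neg (convex_Ioo _ _) (fun t ht =>
      (hdl t ht).continuousAt.continuousWithinAt) fun t ht => ?_
    rw [interior_Ioo] at ht
    rw [(hdl t ht).deriv]
    exact (hφt t (e x) (abs_lt.2 ht) (hO x hx).2.2.2.1).2.2.1
  have h0η : (0 : ℝ) ∈ Ioo (-η) η := ⟨by linarith, hη⟩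
  have hTpos : ∀ x ∈ O, 0 ≤ τ (e x) := by
    intro x hx
    by_contra hcon
    push Not at hcon
    have h1 := hanti x hx (abs_lt.1 (hO x hx).2.2.1) h0η hcon
    have h2 := extChartAt_apply_zero_nonneg (n := n) q x
    simp only [hφ0 x hx, (hO x hx).2.2.2.2] at h1
    exact absurd h1 (not_lt.2 h2)
  have hpos : ∀ x ∈ O, ∀ s ∈ Ioo (-η) (τ (e x)), 0 < ℓ (φ (s, e x)) := by
    intro x hx s hs
    have hτ' := abs_lt.1 (hO x hx).2.2.1
    have h1 := hanti x hx ⟨hs.1, hs.2.trans hτ'.2⟩ hτ' hs.2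
    simp only [(hO x hx).2.2.2.2] at h1
    exact h1
  have hI : ∀ x ∈ O, ∀ s ∈ Ioc (-η) (τ (e x)), |s| < η := fun x hx s hs =>
    abs_lt.2 ⟨hs.1, hs.2.trans_lt (abs_lt.1 (hO x hx).2.2.1).2⟩
  have htgt : ∀ x ∈ O, ∀ s ∈ Ioc (-η) (τ (e x)), φ (s, e x) ∈ e.target ∧
      e.symm (φ (s, e x)) ∈ O₁ ∩ OG := by
    intro x hx s hs
    refine hball _ (hφt s (e x) (hI x hx s hs) (hO x hx).2.2.2.1).1 ?_
    rw [range_eq_halfSpace]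
    rcases hs.2.eq_or_lt with rfl | hlt
    · exact (hO x hx).2.2.2.2.ge
    · exact (hpos x hx s ⟨hs.1, hlt⟩).le
  have hself : ∀ x ∈ O, τ (e x) ∈ Ioc (-η) (τ (e x)) := fun x hx =>
    ⟨(abs_lt.1 (hO x hx).2.2.1).1, le_rfl⟩
  -- The curves are kept for negative times as well, because at a point of the guard only backward
  -- curves run along the field. The map `Λ` flows back from the end point by the hitting time and
  -- so recovers the starting point.
  refine ⟨O, η, fun x => τ (e x), fun t x => e.symm (φ (t, e x)), hqO, hOo, hη, hτq,
    fun x hx => ⟨hTpos x hx, ?_, ?_, ⟨(htgt x hx _ (hself x hx)).2.2, ?_⟩, fun s hs => ?_, ?_,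
    fun t ht => ?_, fun p => φ (-p.1, e p.2), ?_, ?_⟩⟩
  · dsimp only
    rw [hφ0 x hx]
    exact e.left_inv (hO x hx).1
  · refine (isMIntegralCurveOn_iff_chart (p := q) (F := F) fun s hs =>
      hO₁ _ (htgt x hx s hs).2.1).2 ⟨?_, fun s hs => ?_⟩
    · exact (continuousOn_extChartAt_symm (I := 𝓡∂ n) q).comp (fun s hs =>
        (hd x hx s (hI x hx s hs)).continuousAt.continuousWithinAt) fun s hs => (htgt x hx s hs).1
    · rw [e.right_inv (htgt x hx s hs).1]
      refine (hd x hx s (hI x hx s hs)).hasDerivWithinAt.congr (fun s' hs' => ?_) ?_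
      · exact e.right_inv (htgt x hx s' hs').1
      · exact e.right_inv (htgt x hx s hs).1
  · have h1 := htgt x hx _ (hself x hx)
    refine (isBoundaryPoint_iff_chart (q := q) (e.map_target h1.1)).2 ?_
    have : e (e.symm (φ (τ (e x), e x))) = φ (τ (e x), e x) := e.right_inv h1.1
    rw [this]
    exact (hO x hx).2.2.2.2
  · have h1 := htgt x hx _ (Ioo_subset_Ioc_self hs)
    refine interior_subset_fwdSet hv ((isInteriorPoint_iff_chart (q := q) (e.map_target h1.1)).2 ?_)
    have : e (e.symm (φ (s, e x))) = φ (s, e x) := e.right_inv h1.1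
    rw [this]
    exact hpos x hx s hs
  · exact (hO x hx).2.1.contMDiffAt.comp x (contMDiffAt_extChartAt' (by
      rw [← extChartAt_source (𝓡∂ n)]; exact (hO x hx).1))
  · have hy := hφt t (e x) (hI x hx t ht) (hO x hx).2.2.2.1
    have hin : ContMDiffAt (𝓘(ℝ, ℝ).prod (𝓡∂ n)) 𝓘(ℝ, EuclideanSpace ℝ (Fin n)) k
        (fun q : ℝ × X => φ (q.1, e q.2)) (t, x) := by
      have h1 : ContMDiffAt 𝓘(ℝ, ℝ × EuclideanSpace ℝ (Fin n))
          𝓘(ℝ, EuclideanSpace ℝ (Fin n)) k φ (t, e x) :=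
        (hφ t (e x) hy.2.2.2.1 hy.2.2.2.2).2.2.contMDiffAt
      have h2 : ContMDiffAt (𝓘(ℝ, ℝ).prod (𝓡∂ n)) 𝓘(ℝ, ℝ × EuclideanSpace ℝ (Fin n)) k
          (fun q : ℝ × X => (q.1, e q.2)) (t, x) :=
        contMDiffAt_fst.prodMk_space ((contMDiffAt_extChartAt' (by
          rw [← extChartAt_source (𝓡∂ n)]; exact (hO x hx).1)).comp (t, x) contMDiffAt_snd)
      exact h1.comp (t, x) h2
    refine contMDiffWithinAt_comp_of_mem (t, x) ((contMDiffOn_extChartAt_symm (I := 𝓡∂ n) (n := k)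
      q) (φ (t, e x)) (htgt x hx t ht).1) hin.contMDiffWithinAt ?_
    filter_upwards [self_mem_nhdsWithin] with p hp
    exact (htgt p.2 hp.1 p.1 hp.2).1
  · have h1 := htgt x hx _ (hself x hx)
    have hy := hφt (τ (e x)) (e x) (hO x hx).2.2.1 (hO x hx).2.2.2.1
    have he' : e (e.symm (φ (τ (e x), e x))) = φ (τ (e x), e x) := e.right_inv h1.1
    have i1 : ContMDiffAt 𝓘(ℝ, ℝ × EuclideanSpace ℝ (Fin n))
        𝓘(ℝ, EuclideanSpace ℝ (Fin n)) k φ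
        (-(τ (e x)), e (e.symm (φ (τ (e x), e x)))) := by
      rw [he']
      exact (hφ (-(τ (e x))) _ (by rw [abs_neg]; exact hy.2.2.2.1) hy.2.1).2.2.contMDiffAt
    have i2 : ContMDiffAt (𝓘(ℝ, ℝ).prod (𝓡∂ n)) 𝓘(ℝ, ℝ × EuclideanSpace ℝ (Fin n)) k
        (fun p : ℝ × X => (-p.1, e p.2)) (τ (e x), e.symm (φ (τ (e x), e x))) := by
      refine ContMDiffAt.prodMk_space ?_ ((contMDiffAt_extChartAt' (by
          rw [← extChartAt_source (𝓡∂ n)]; exact e.map_target h1.1)).comp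
          (τ (e x), e.symm (φ (τ (e x), e x))) contMDiffAt_snd)
      have : ContMDiffAt 𝓘(ℝ, ℝ) 𝓘(ℝ, ℝ) k (fun s : ℝ => -s) (τ (e x)) :=
        contDiff_neg.contDiffAt.contMDiffAt
      exact ContMDiffAt.comp (τ (e x), e.symm (φ (τ (e x), e x))) (f := Prod.fst) this
        contMDiffAt_fst
    exact ContMDiffAt.comp (τ (e x), e.symm (φ (τ (e x), e x))) i1 i2
  · filter_upwards [hOo.mem_nhds hx] with x' hx'
    have hy' := hφt (τ (e x')) (e x') (hO x' hx').2.2.1 (hO x' hx').2.2.2.1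
    refine ⟨?_, (hO x' hx').1⟩
    rw [e.right_inv (htgt x' hx' _ (hself x' hx')).1]
    exact hinv _ _ hy'.2.2.2.1 hy'.2.2.2.2 hy'.2.1

-- The way to the guard is split: the forward flow leads to a point close to the guard, and a box at
-- the exit point does the rest. The last claim holds because hitting time and hitting point
-- together determine the starting point smoothly, by flowing back.
include hv hG hout in
theorem hit_regular_of_ne_zero [T2Space X] {x₀ : X} (hx₀ : x₀ ∈ basin v G) {k : ℕ} (hk : k ≠ 0) :
    basin v G ∈ 𝓝 x₀ ∧ ContMDiffAt (𝓡∂ n) 𝓘(ℝ, ℝ) k (hitTime v G) x₀ ∧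
    (∀ t₀ ∈ Icc 0 (hitTime v G x₀), ContMDiffWithinAt (𝓘(ℝ, ℝ).prod (𝓡∂ n)) (𝓡∂ n) k
      (fun p : ℝ × X => hitCurve v G p.2 p.1)
      {p | p.2 ∈ basin v G ∧ p.1 ∈ Icc 0 (hitTime v G p.2)} (t₀, x₀)) ∧
    ContMDiffAt (𝓡∂ n) (𝓡∂ n) k (hitPt v G) x₀ ∧
    ∀ w : TangentSpace (𝓡∂ n) x₀, mfderiv (𝓡∂ n) 𝓘(ℝ, ℝ) (hitTime v G) x₀ w = 0 →
      mfderiv (𝓡∂ n) (𝓡∂ n) (hitPt v G) x₀ w = 0 → w = 0 := by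
  have hk1 : (1 : WithTop ℕ∞) ≤ k := by exact_mod_cast Nat.one_le_iff_ne_zero.2 hk
  have hk0 : (k : WithTop ℕ∞) ≠ 0 := by exact_mod_cast hk
  have hm1 : IsManifold (𝓡∂ n) 1 X := IsManifold.of_le (I := 𝓡∂ n) (M := X) (n := ∞)
    (by exact_mod_cast le_top)
  have hh := hitBy_hitCurve hx₀
  set T₀ := hitTime v G x₀ with hT₀
  set c := hitCurve v G x₀ with hc
  have hq := hh.2.2.2.1
  obtain ⟨O, ε, T', Ψ, hqO, hOo, hε, hTq, H⟩ := exists_box_hit hv hG hout hq hk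
  -- a first part of the way, which ends near the guard
  obtain ⟨t₁, A, ht₁0, ht₁T, ht₁, hAk, hAi, hA0, hAev⟩ : ∃ (t₁ : ℝ) (A : X → X), 0 ≤ t₁ ∧
      t₁ ≤ T₀ ∧ (t₁ < T₀ ∨ (T₀ = 0 ∧ t₁ = 0)) ∧ ContMDiffAt (𝓡∂ n) (𝓡∂ n) k A x₀ ∧
      Function.Injective (mfderiv (𝓡∂ n) (𝓡∂ n) A x₀) ∧ A x₀ ∈ O ∧ ∀ᶠ x in 𝓝 x₀, ∃ c : ℝ → X,
        c 0 = x ∧ c t₁ = A x ∧ IsMIntegralCurveOn c v (Icc 0 t₁) ∧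
        ∀ r ∈ Ico 0 t₁, c r ∈ fwdSet v := by
    rcases hh.1.eq_or_lt with h0 | h0
    -- The point `x₀` is itself in the guard. It has no forward flow, and the first part of the way
    -- is trivial.
    · refine ⟨0, id, le_rfl, hh.1, Or.inr ⟨h0.symm, rfl⟩, contMDiffAt_id, ?_, ?_,
        Eventually.of_forall fun x => ⟨fun _ => x, rfl, rfl, isMIntegralCurveOn_const_Icc_self _ 0,
          fun r hr => absurd hr.2 (not_lt.2 hr.1)⟩⟩
      · rw [mfderiv_id]; exact fun a b h => h
      · rw [id, ← hh.2.1]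
        nth_rewrite 1 [h0]
        exact hqO
    · have hnh : ∀ᶠ s in 𝓝[Icc 0 T₀] T₀, c s ∈ O :=
        hh.2.2.1.continuousOn T₀ ⟨hh.1, le_rfl⟩ (hOo.mem_nhds hqO)
      rw [nhdsWithin_Icc_eq_nhdsLE h0] at hnh
      have hnh' : ∀ᶠ s in 𝓝[<] T₀, c s ∈ O := nhdsWithin_mono _ Iio_subset_Iic_self hnh
      obtain ⟨t₁, ht₁, ht₁'⟩ := (hnh'.and (Ioo_mem_nhdsLT h0)).exists
      have hfl : FlowsTo v x₀ t₁ (c t₁) := ⟨ht₁'.1.le, c, hh.2.1, rfl,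
        IsMIntegralCurveOn.mono hh.2.2.1 (Icc_subset_Icc_right ht₁'.2.le),
        fun s hs => hh.2.2.2.2 s ⟨hs.1, hs.2.trans_lt ht₁'.2⟩⟩
      have hfd : (t₁, x₀) ∈ flowDomain v := ⟨_, hfl⟩
      obtain ⟨r1, r2, r3⟩ := fwdFlow_regular hv hfd
      have hpt : Tendsto (fun x : X => (t₁, x)) (𝓝 x₀) (𝓝[Ici 0 ×ˢ univ] (t₁, x₀)) :=
        tendsto_nhdsWithin_iff.2 ⟨(Continuous.prodMk_right t₁).continuousAt,
          Eventually.of_forall fun x => ⟨ht₁'.1.le, mem_univ _⟩⟩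
      refine ⟨t₁, fwdFlow v t₁, ht₁'.1.le, ht₁'.2.le, Or.inl ht₁'.2, ?_, r3, ?_, ?_⟩
      · have h1 : ContMDiffWithinAt (𝓡∂ n) (𝓘(ℝ, ℝ).prod (𝓡∂ n)) k (fun x' => (t₁, x')) univ x₀ :=
          (contMDiffAt_const.prodMk contMDiffAt_id).contMDiffWithinAt
        have := (r2.of_le (m := k) (by exact_mod_cast le_top)).comp x₀ h1
          (fun x' _ => ⟨ht₁'.1.le, mem_univ _⟩)
        exact contMDiffWithinAt_univ.1 this
      · rw [hfl.fwdFlow_eq hv]; exact ht₁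
      · filter_upwards [hpt.eventually r1] with x hx
        obtain ⟨-, c', h0, h1, h2, h3⟩ := flowsTo_fwdFlow hx
        exact ⟨c', h0, h1, h2, fun r hr => h3 r (Ico_subset_Icc_self hr)⟩
  have hev : ∀ᶠ x in 𝓝 x₀, A x ∈ O ∧ ∃ c : ℝ → X,
        c 0 = x ∧ c t₁ = A x ∧ IsMIntegralCurveOn c v (Icc 0 t₁) ∧
        ∀ r ∈ Ico 0 t₁, c r ∈ fwdSet v := (hAk.continuousAt.eventually (p := fun y => y ∈ O)
    (hOo.mem_nhds hA0)).and hAev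
  have hTself : ∀ y ∈ O, T' y ∈ Ioc (-ε) (T' y) := fun y hy =>
    ⟨by linarith [(H y hy).1], le_rfl⟩
  have hhit : ∀ᶠ x in 𝓝 x₀, A x ∈ O ∧ x ∈ basin v G ∧ hitTime v G x = t₁ + T' (A x) ∧
      hitPt v G x = Ψ (T' (A x)) (A x) ∧
      ∀ t ∈ Icc t₁ (hitTime v G x), hitCurve v G x t = Ψ (t - t₁) (A x) := by
    filter_upwards [hev] with x hx
    obtain ⟨hxO, c', h0, h1, h2, h3⟩ := hx
    obtain ⟨g1, g2, g3, g4, g5, -⟩ := H _ hxO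
    have hloc : HitBy v G (A x) (T' (A x)) fun s => Ψ s (A x) :=
      ⟨g1, g2, IsMIntegralCurveOn.mono g3 fun s hs => ⟨by linarith [hs.1], hs.2⟩, g4,
        fun s hs => g5 s ⟨by linarith [hs.1], hs.2⟩⟩
    have hx' := HitBy.of_flow ht₁0 h0 h1 h2 h3 hloc
    obtain ⟨e1, e2, e3⟩ := hx'.eq hv hG hout
    have hcur : ∀ t ∈ Icc t₁ (hitTime v G x), hitCurve v G x t = Ψ (t - t₁) (A x) := by
      intro t ht
      rw [e1] at ht
      rw [e3 ⟨ht₁0.trans ht.1, ht.2⟩]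
      rcases ht.1.eq_or_lt with rfl | hlt
      · simp [h1, g2]
      · simp [not_le.2 hlt]
    refine ⟨hxO, hx'.mem_basin, e1, ?_, hcur⟩
    rw [hitPt, hcur _ ⟨by rw [e1]; linarith, le_rfl⟩, e1]
    simp
  have hbas : basin v G ∈ 𝓝 x₀ := hhit.mono fun x hx => hx.2.1
  obtain ⟨g1, g2, g3, g4, g5, g6, g7, Λ, g8, g9⟩ := H _ hA0
  have hTeq : hitTime v G =ᶠ[𝓝 x₀] fun x => t₁ + T' (A x) := hhit.mono fun x hx => hx.2.2.1
  have hT'A : ContMDiffAt (𝓡∂ n) 𝓘(ℝ, ℝ) k (fun x => T' (A x)) x₀ := g6.comp x₀ hAk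
  have hTk : ContMDiffAt (𝓡∂ n) 𝓘(ℝ, ℝ) k (hitTime v G) x₀ :=
    (contMDiffAt_const.add hT'A).congr_of_eventuallyEq hTeq
  have hcurve : ∀ t₀ ∈ Icc 0 (hitTime v G x₀), ContMDiffWithinAt (𝓘(ℝ, ℝ).prod (𝓡∂ n)) (𝓡∂ n) k
      (fun p : ℝ × X => hitCurve v G p.2 p.1)
      {p | p.2 ∈ basin v G ∧ p.1 ∈ Icc 0 (hitTime v G p.2)} (t₀, x₀) := by
    intro t₀ ht₀
    -- Before the hitting time the curve is given by the forward flow; at the hitting time the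
    -- parametrization of the box is needed.
    rcases ht₀.2.lt_or_eq with hlt | rfl
    · have hfl : FlowsTo v x₀ t₀ (c t₀) := ⟨ht₀.1, c, hh.2.1, rfl,
        IsMIntegralCurveOn.mono hh.2.2.1 (Icc_subset_Icc_right hlt.le),
        fun s hs => hh.2.2.2.2 s ⟨hs.1, hs.2.trans_lt hlt⟩⟩
      obtain ⟨-, r2, -⟩ := fwdFlow_regular hv (show (t₀, x₀) ∈ flowDomain v from ⟨_, hfl⟩)
      have r3 := (r2.of_le (m := k) (by exact_mod_cast le_top)).mono
        (t := {p | p.2 ∈ basin v G ∧ p.1 ∈ Icc 0 (hitTime v G p.2)})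
        fun p hp => ⟨hp.2.1, mem_univ _⟩
      have hev2 : ∀ᶠ p : ℝ × X in 𝓝 (t₀, x₀), p.1 < hitTime v G p.2 :=
        (continuousAt_fst (p := (t₀, x₀))).eventually_lt
          (ContinuousAt.comp (g := hitTime v G) (f := Prod.snd) (x := (t₀, x₀)) hTk.continuousAt
            continuousAt_snd) hlt
      have heq : ∀ p : ℝ × X, p.2 ∈ basin v G → p.1 ∈ Icc 0 (hitTime v G p.2) →
          p.1 < hitTime v G p.2 → hitCurve v G p.2 p.1 = fwdFlow v p.1 p.2 := by
        intro p hp1 hp2 hp3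
        have hb := hitBy_hitCurve hp1
        refine (FlowsTo.fwdFlow_eq hv ⟨hp2.1, _, hb.2.1, rfl, IsMIntegralCurveOn.mono hb.2.2.1
          (Icc_subset_Icc_right hp3.le), fun s hs => hb.2.2.2.2 s ⟨hs.1, hs.2.trans_lt hp3⟩⟩).symm
      refine r3.congr_of_eventuallyEq ?_ (heq (t₀, x₀) hx₀ ht₀ hlt)
      filter_upwards [self_mem_nhdsWithin, mem_nhdsWithin_of_mem_nhds hev2] with p hp1 hp2
      exact heq p hp1.1 hp1.2 hp2
    · have hTx := hTeq.self_of_nhds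
      have hev2 : ∀ᶠ p : ℝ × X in 𝓝[{p | p.2 ∈ basin v G ∧ p.1 ∈ Icc 0 (hitTime v G p.2)}]
          (hitTime v G x₀, x₀), t₁ ≤ p.1 := by
        rcases ht₁ with h1 | h1
        · refine mem_nhdsWithin_of_mem_nhds ?_
          exact ((continuousAt_fst (p := (hitTime v G x₀, x₀))).eventually_const_lt h1).mono
            fun p hp => le_of_lt hp
        · filter_upwards [self_mem_nhdsWithin] with p hp
          rw [h1.2]; exact hp.2.1
      have hev3 : ∀ᶠ p : ℝ × X in 𝓝 (hitTime v G x₀, x₀), A p.2 ∈ O ∧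
          hitTime v G p.2 = t₁ + T' (A p.2) ∧
          ∀ t ∈ Icc t₁ (hitTime v G p.2), hitCurve v G p.2 t = Ψ (t - t₁) (A p.2) :=
        (continuous_snd.tendsto (hitTime v G x₀, x₀)).eventually
          (p := fun x => A x ∈ O ∧ hitTime v G x = t₁ + T' (A x) ∧
          ∀ t ∈ Icc t₁ (hitTime v G x), hitCurve v G x t = Ψ (t - t₁) (A x))
          (hhit.mono fun x hx => ⟨hx.1, hx.2.2.1, hx.2.2.2.2⟩)
      have i1 : ContMDiffAt (𝓘(ℝ, ℝ).prod (𝓡∂ n)) (𝓘(ℝ, ℝ).prod (𝓡∂ n)) k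
          (fun p : ℝ × X => (p.1 - t₁, A p.2)) (hitTime v G x₀, x₀) := by
        refine ContMDiffAt.prodMk ?_
          (ContMDiffAt.comp (hitTime v G x₀, x₀) (f := Prod.snd) hAk contMDiffAt_snd)
        have : ContMDiffAt 𝓘(ℝ, ℝ) 𝓘(ℝ, ℝ) k (fun s : ℝ => s - t₁) (hitTime v G x₀) :=
          (contDiff_id.sub contDiff_const).contDiffAt.contMDiffAt
        exact ContMDiffAt.comp (hitTime v G x₀, x₀) (f := Prod.fst) this contMDiffAt_fst
      have hval : hitTime v G x₀ - t₁ = T' (A x₀) := by rw [hTx]; ring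
      have i2 := g7 (hitTime v G x₀ - t₁) (by rw [hval]; exact hTself _ hA0)
      have i3 := contMDiffWithinAt_comp_of_mem
        (s := {p | p.2 ∈ basin v G ∧ p.1 ∈ Icc 0 (hitTime v G p.2)}) (hitTime v G x₀, x₀) i2
        i1.contMDiffWithinAt (by
          filter_upwards [self_mem_nhdsWithin, mem_nhdsWithin_of_mem_nhds hev3, hev2]
            with p hp1 hp2 hp3
          refine ⟨hp2.1, ?_, ?_⟩
          · show -ε < p.1 - t₁
            linarith
          · show p.1 - t₁ ≤ T' (A p.2)
            have := hp1.2.2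
            rw [hp2.2.1] at this
            linarith)
      refine i3.congr_of_eventuallyEq ?_ ?_
      · filter_upwards [self_mem_nhdsWithin, mem_nhdsWithin_of_mem_nhds hev3, hev2]
          with p hp1 hp2 hp3
        exact hp2.2.2 p.1 ⟨hp3, hp1.2.2⟩
      · exact hhit.self_of_nhds.2.2.2.2 _ ⟨ht₁T, le_rfl⟩
  have hPk : ContMDiffAt (𝓡∂ n) (𝓡∂ n) k (hitPt v G) x₀ := by
    have i1 : ContMDiffAt (𝓡∂ n) (𝓘(ℝ, ℝ).prod (𝓡∂ n)) k
        (fun x : X => (hitTime v G x, x)) x₀ := hTk.prodMk contMDiffAt_id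
    have i2 := contMDiffWithinAt_comp_of_mem (s := univ) x₀
      (f := fun x : X => (hitTime v G x, x)) (hcurve _ ⟨hh.1, le_rfl⟩)
      i1.contMDiffWithinAt (by
        rw [nhdsWithin_univ]
        filter_upwards [hbas] with x hx
        exact ⟨hx, (hitBy_hitCurve hx).1, le_rfl⟩)
    exact contMDiffWithinAt_univ.1 i2
  refine ⟨hbas, hTk, hcurve, hPk, fun w hw1 hw2 => ?_⟩
  -- A vector killed by the derivatives of hitting time and hitting point is killed by that of
  -- `chart ∘ A`, which is injective.
  have hΛ : (fun x => Λ (hitTime v G x - t₁, hitPt v G x)) =ᶠ[𝓝 x₀]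
      fun x => extChartAt (𝓡∂ n) (c T₀) (A x) := by
    filter_upwards [hhit, hAk.continuousAt.eventually g9] with x hx hx'
    rw [hx.2.2.2.1, hx.2.2.1, add_sub_cancel_left]
    exact hx'.1
  have hval : (hitTime v G x₀ - t₁, hitPt v G x₀) = (T' (A x₀), Ψ (T' (A x₀)) (A x₀)) := by
    rw [hhit.self_of_nhds.2.2.2.1, hhit.self_of_nhds.2.2.1, add_sub_cancel_left]
  have hTd : HasMFDerivAt (𝓡∂ n) 𝓘(ℝ, ℝ) (fun x => hitTime v G x - t₁) x₀
      (mfderiv (𝓡∂ n) 𝓘(ℝ, ℝ) (hitTime v G) x₀) := by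
    have h1 := (hTk.mdifferentiableAt hk0).hasMFDerivAt
    have h2 : HasMFDerivAt 𝓘(ℝ, ℝ) 𝓘(ℝ, ℝ) (fun s : ℝ => s - t₁) (hitTime v G x₀)
        (ContinuousLinearMap.id ℝ ℝ) :=
      ((hasFDerivAt_id (𝕜 := ℝ) (hitTime v G x₀)).sub_const t₁).hasMFDerivAt
    exact h2.comp x₀ h1
  have hPd := (hPk.mdifferentiableAt hk0).hasMFDerivAt
  have hΛd := ((hval ▸ g8).mdifferentiableAt hk0).hasMFDerivAt
  have hcomp := (HasMFDerivAt.comp x₀ (f := fun x => (hitTime v G x - t₁, hitPt v G x)) hΛd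
    (hTd.prodMk hPd)).congr_of_eventuallyEq hΛ.symm
  have hAd := (hAk.mdifferentiableAt hk0).hasMFDerivAt
  have hed := (mdifferentiableAt_extChartAt (I := 𝓡∂ n) (x := c T₀) (y := A x₀) (by
    rw [← extChartAt_source (𝓡∂ n)]; exact g9.self_of_nhds.2)).hasMFDerivAt
  have huniq := hasMFDerivAt_unique hcomp (hed.comp x₀ hAd)
  have hinj := (isInvertible_mfderiv_extChartAt (I := 𝓡∂ n) (x := c T₀)
    g9.self_of_nhds.2).injective
  apply hAi
  rw [map_zero]
  apply hinj
  rw [map_zero]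
  have := congrArg (fun L => L w) huniq
  refine this.symm.trans ?_
  have hz : ((mfderiv (𝓡∂ n) 𝓘(ℝ, ℝ) (hitTime v G) x₀).prod
      (mfderiv (𝓡∂ n) (𝓡∂ n) (hitPt v G) x₀)) w = 0 := Prod.ext hw1 hw2
  exact (congrArg (fun u => mfderiv (𝓘(ℝ, ℝ).prod (𝓡∂ n)) 𝓘(ℝ, EuclideanSpace ℝ (Fin n)) Λ
    (hitTime v G x₀ - t₁, hitPt v G x₀) u) hz).trans (ContinuousLinearMap.map_zero _)

include hv hG hout in
/-- The set of points from which the field leads into the guard is open, and the time, the end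
point and the curve depend smoothly on the point. -/
theorem hit_regular [T2Space X] {x₀ : X} (hx₀ : x₀ ∈ basin v G) :
    basin v G ∈ 𝓝 x₀ ∧ ContMDiffAt (𝓡∂ n) 𝓘(ℝ, ℝ) ∞ (hitTime v G) x₀ ∧
    (∀ t₀ ∈ Icc 0 (hitTime v G x₀), ContMDiffWithinAt (𝓘(ℝ, ℝ).prod (𝓡∂ n)) (𝓡∂ n) ∞
      (fun p : ℝ × X => hitCurve v G p.2 p.1)
      {p | p.2 ∈ basin v G ∧ p.1 ∈ Icc 0 (hitTime v G p.2)} (t₀, x₀)) ∧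
    ContMDiffAt (𝓡∂ n) (𝓡∂ n) ∞ (hitPt v G) x₀ ∧
    ∀ w : TangentSpace (𝓡∂ n) x₀, mfderiv (𝓡∂ n) 𝓘(ℝ, ℝ) (hitTime v G) x₀ w = 0 →
      mfderiv (𝓡∂ n) (𝓡∂ n) (hitPt v G) x₀ w = 0 → w = 0 := by
  -- The preceding result excludes order zero, hence the shift to `k + 1`.
  have key := fun k : ℕ => hit_regular_of_ne_zero hv hG hout hx₀ (k := k + 1) (by simp)
  have hle : ∀ k : ℕ, (k : WithTop ℕ∞) ≤ ((k + 1 : ℕ) : WithTop ℕ∞) := fun k => by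
    exact_mod_cast Nat.le_succ k
  refine ⟨(key 0).1, contMDiffAt_infty.2 fun k => (key k).2.1.of_le (hle k), fun t₀ ht₀ =>
    contMDiffWithinAt_infty.2 fun k => ((key k).2.2.1 t₀ ht₀).of_le (hle k),
    contMDiffAt_infty.2 fun k => (key k).2.2.2.1.of_le (hle k), (key 0).2.2.2.2⟩

include hv hG hout in
/-- The derivatives of the time and of the end point along the field. -/
theorem mfderiv_hit_field [T2Space X] {x₀ : X} (hx₀ : x₀ ∈ basin v G) :
    mfderiv (𝓡∂ n) 𝓘(ℝ, ℝ) (hitTime v G) x₀ (v x₀) = (-1 : ℝ) ∧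
      mfderiv (𝓡∂ n) (𝓡∂ n) (hitPt v G) x₀ (v x₀) = 0 := by
  have hm1 : IsManifold (𝓡∂ n) 1 X := IsManifold.of_le (I := 𝓡∂ n) (M := X) (n := ∞)
    (by exact_mod_cast le_top)
  -- On a curve through `x₀` the hitting time falls at unit speed and the hitting point is constant.
  -- If `x₀` is in the guard, the curve runs from the past up to time `0`; otherwise it runs
  -- forward. A one-sided interval still determines the derivative.
  obtain ⟨c, a, b, hab, h0, hc0, hc, hT, hP⟩ : ∃ (c : ℝ → X) (a b : ℝ), a < b ∧
      (0 : ℝ) ∈ Icc a b ∧ c 0 = x₀ ∧ IsMIntegralCurveOn c v (Icc a b) ∧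
      (∀ s ∈ Icc a b, hitTime v G (c s) = hitTime v G x₀ - s) ∧
      ∀ s ∈ Icc a b, hitPt v G (c s) = hitPt v G x₀ := by
    have hh := hitBy_hitCurve hx₀
    rcases hh.1.eq_or_lt with h0 | h0
    · have hxG : x₀ ∈ G := by
        have := hh.2.2.2.1
        rwa [← h0, hh.2.1] at this
      obtain ⟨O, ε, T', Ψ, hqO, hOo, hε, hTq, H⟩ := exists_box_hit hv hG hout hxG one_ne_zero
      obtain ⟨g1, g2, g3, g4, g5, -⟩ := H x₀ hqO
      rw [hTq] at g3 g4 g5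
      have hx := fun s (hs : s ∈ Icc (-(ε / 2)) 0) => HitBy.eq hv hG hout (v := v) (G := G)
        (x := Ψ s x₀) (t := -s)
        (c := fun r => Ψ (r + s) x₀) ⟨by linarith [hs.2], by simp, IsMIntegralCurveOn.mono
          (IsMIntegralCurveOn.comp_add g3 s) fun r hr => ⟨by linarith [hr.1, hs.1],
            by linarith [hr.2]⟩, by simpa using g4, fun r hr => g5 _
          ⟨by linarith [hs.1, hr.1], by linarith [hr.2]⟩⟩
      refine ⟨fun s => Ψ s x₀, -(ε / 2), 0, by linarith, ⟨by linarith, le_rfl⟩, g2,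
        IsMIntegralCurveOn.mono g3 fun s hs => ⟨by linarith [hs.1], hs.2⟩, fun s hs => ?_,
        fun s hs => ?_⟩
      · rw [(hx s hs).1, ← h0]; ring
      · have h2 := ((hitBy_zero hxG).eq hv hG hout (v := v) (G := G)).2.1
        rw [(hx s hs).2.1, h2]
        simp [g2]
    · have hx := fun s (hs : s ∈ Icc 0 (hitTime v G x₀)) => (hh.shift hs).eq hv hG hout
      refine ⟨hitCurve v G x₀, 0, hitTime v G x₀, h0, ⟨le_rfl, h0.le⟩, hh.2.1, hh.2.2.1,
        fun s hs => (hx s hs).1, fun s hs => ?_⟩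
      rw [(hx s hs).2.1, sub_add_cancel, hitPt]
  subst hc0
  obtain ⟨-, hTk, -, hPk, -⟩ := hit_regular hv hG hout hx₀
  have hd := hc 0 h0
  have hu : UniqueMDiffWithinAt 𝓘(ℝ, ℝ) (Icc a b) (0 : ℝ) :=
    ((uniqueDiffOn_Icc hab) 0 h0).uniqueMDiffWithinAt
  constructor
  · have h1 := (hTk.mdifferentiableAt (by simp)).hasMFDerivAt.comp_hasMFDerivWithinAt (0 : ℝ) hd
    have h2 : HasMFDerivWithinAt 𝓘(ℝ, ℝ) 𝓘(ℝ, ℝ) (hitTime v G ∘ c) (Icc a b) 0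
        (-ContinuousLinearMap.id ℝ ℝ) := by
      have : HasFDerivWithinAt (fun s : ℝ => hitTime v G (c 0) - s) (-ContinuousLinearMap.id ℝ ℝ)
        (Icc a b) 0 := (hasFDerivWithinAt_id (𝕜 := ℝ) (0 : ℝ) (Icc a b)).const_sub _
      exact (this.congr (fun s hs => hT s hs) (hT 0 h0)).hasMFDerivWithinAt
    have h3 := congrArg (fun L : ℝ →L[ℝ] ℝ => L 1) (hu.eq h1 h2)
    have h4 : ((1 : ℝ →L[ℝ] ℝ).smulRight (v (c 0))) (1 : ℝ) = v (c 0) := by simp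
    refine Eq.trans ?_ (h3.trans ?_)
    · exact congrArg (mfderiv (𝓡∂ n) 𝓘(ℝ, ℝ) (hitTime v G) (c 0)) h4.symm
    · simp
  · have h1 := (hPk.mdifferentiableAt (by simp)).hasMFDerivAt.comp_hasMFDerivWithinAt (0 : ℝ) hd
    have h2 : HasMFDerivWithinAt 𝓘(ℝ, ℝ) (𝓡∂ n) (hitPt v G ∘ c) (Icc a b) 0
        (0 : ℝ →L[ℝ] TangentSpace (𝓡∂ n) (hitPt v G (c 0))) :=
      (hasMFDerivWithinAt_const (hitPt v G (c 0)) (s := Icc a b) (x := (0 : ℝ))).congr_mono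
        (fun s hs => hP s hs) rfl subset_rfl
    have h3 := congrArg (fun L : ℝ →L[ℝ] TangentSpace (𝓡∂ n) (hitPt v G (c 0)) => L 1)
      (hu.eq h1 h2)
    have h4 : ((1 : ℝ →L[ℝ] ℝ).smulRight (v (c 0))) (1 : ℝ) = v (c 0) := by simp
    refine Eq.trans ?_ (h3.trans ?_)
    · exact congrArg (mfderiv (𝓡∂ n) (𝓡∂ n) (hitPt v G) (c 0)) h4.symm
    · simp

end Guard

end HybridDS

namespace HybridDS

/-! ### Integral curves at the end points of an interval -/

section Endpoints

variable {n : ℕ} [NeZero n] {X : Type*} [TopologicalSpace X]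
  [ChartedSpace (EuclideanHalfSpace n) X] [IsManifold (𝓡∂ n) ∞ X]
  {v : ∀ x : X, TangentSpace (𝓡∂ n) x}

/-- A curve that solves the equation in the interior of an interval and is continuous solves it at
the end points, too. -/
theorem isMIntegralCurveOn_Icc_of_Ioo
    (hv : ContMDiff (𝓡∂ n) (𝓡∂ n).tangent ∞ (fun x => (⟨x, v x⟩ : TangentBundle (𝓡∂ n) X)))
    {c : ℝ → X} {a b : ℝ} (hc : ContinuousOn c (Icc a b))
    (h : IsMIntegralCurveOn c v (Ioo a b)) : IsMIntegralCurveOn c v (Icc a b) := by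
  intro t ht
  by_cases hab : a = b
  · subst hab
    obtain rfl : t = a := le_antisymm ht.2 ht.1
    exact isMIntegralCurveOn_const_Icc_self c t t ht
  have hab' : a < b := lt_of_le_of_ne (ht.1.trans ht.2) hab
  obtain ⟨F, hF, -, hchart⟩ := exists_chart_field hv (c t) 1
  set e := extChartAt (𝓡∂ n) (c t) with he
  obtain ⟨ε, hε, H⟩ := Metric.mem_nhdsWithin_iff.1 ((hc t ht).eventually hchart)
  have hder : ∀ s ∈ Metric.ball t ε ∩ Ioo a b, HasDerivAt (e ∘ c) (F (e (c s))) s := by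
    intro s hs
    have hs' := H ⟨hs.1, Ioo_subset_Icc_self hs.2⟩
    have := ((hasMFDerivWithinAt_iff_chart (v (c s)) hs'.1).1 (h s hs.2)).2
    rw [← hs'.2] at this
    exact this.hasDerivAt (Ioo_mem_nhds hs.2.1 hs.2.2)
  have hec : ContinuousWithinAt (e ∘ c) (Icc a b) t :=
    (continuousAt_extChartAt (I := 𝓡∂ n) (c t)).comp_continuousWithinAt (hc t ht)
  have hFc : ContinuousWithinAt (fun s => F (e (c s))) (Icc a b) t :=
    hF.continuous.continuousAt.comp_continuousWithinAt hec
  have hdiff : DifferentiableOn ℝ (e ∘ c) (Metric.ball t ε ∩ Ioo a b) := fun s hs =>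
    (hder s hs).differentiableAt.differentiableWithinAt
  have hsub : Metric.ball t ε ∩ Ioo a b ⊆ Icc a b := fun s hs => Ioo_subset_Icc_self hs.2
  have h0 := (H ⟨Metric.mem_ball_self hε, ht⟩)
  refine (hasMFDerivWithinAt_iff_chart _ h0.1).2 ⟨hc t ht, ?_⟩
  rw [← h0.2]
  -- At an end point the derivatives `F (e (c s))` converge by continuity, and a continuous function
  -- whose derivative has a limit is differentiable there from one side.
  rcases ht.1.eq_or_lt with rfl | hat
  · have hm : Metric.ball a ε ∩ Ioo a b ∈ 𝓝[>] a :=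
      inter_mem (mem_nhdsWithin_of_mem_nhds (Metric.ball_mem_nhds a hε)) (Ioo_mem_nhdsGT hab')
    refine (hasDerivWithinAt_Ici_of_tendsto_deriv hdiff (hec.mono hsub) hm ?_).mono
      fun s hs => hs.1
    refine Tendsto.congr' (f₁ := fun s => F (e (c s))) ?_ ((hFc.mono hsub).mono_left
      (nhdsWithin_le_of_mem hm))
    filter_upwards [hm] with s hs using (hder s hs).deriv.symm
  rcases ht.2.eq_or_lt with rfl | htb
  · have hm : Metric.ball t ε ∩ Ioo a t ∈ 𝓝[<] t :=
      inter_mem (mem_nhdsWithin_of_mem_nhds (Metric.ball_mem_nhds t hε)) (Ioo_mem_nhdsLT hab')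
    refine (hasDerivWithinAt_Iic_of_tendsto_deriv hdiff (hec.mono hsub) hm ?_).mono
      fun s hs => hs.2
    refine Tendsto.congr' (f₁ := fun s => F (e (c s))) ?_ ((hFc.mono hsub).mono_left
      (nhdsWithin_le_of_mem hm))
    filter_upwards [hm] with s hs using (hder s hs).deriv.symm
  · exact (hder t ⟨Metric.mem_ball_self hε, hat, htb⟩).hasDerivWithinAt

/-- No curve starts in the guard with the velocity given by the field. -/
theorem not_hasMFDerivWithinAt_of_mem_guard {G : Set X}
    (hG : ∃ O : Set X, IsOpen O ∧ G = O ∩ (𝓡∂ n).boundary X)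
    (hout : ∀ x ∈ G, (show EuclideanSpace ℝ (Fin n) from v x) 0 < 0) {c : ℝ → X} {a b : ℝ}
    (hab : a < b) (ha : c a ∈ G) :
    ¬ HasMFDerivWithinAt 𝓘(ℝ, ℝ) (𝓡∂ n) c (Icc a b) a (velocity (v (c a))) := by
  intro hc
  obtain ⟨O, -, rfl⟩ := hG
  have hb : extChartAt (𝓡∂ n) (c a) (c a) 0 = 0 :=
    (isBoundaryPoint_iff_chart (mem_extChartAt_source _)).1 ha.2
  have hd := ((hasMFDerivWithinAt_iff_self (v (c a) : EuclideanSpace ℝ (Fin n))).1 hc).2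
  have hd' := (EuclideanSpace.proj (𝕜 := ℝ) (0 : Fin n)).hasFDerivAt.comp_hasDerivWithinAt
    (a : ℝ) hd
  rw [hasDerivWithinAt_iff_tendsto_slope] at hd'
  -- The first coordinate vanishes at `a` and would have negative slopes there, but it is
  -- nonnegative.
  have h1 := hd'.eventually_lt_const (hout _ ha)
  rw [Icc_sdiff_left, nhdsWithin_Ioc_eq_nhdsGT hab] at h1
  obtain ⟨s, hs, hs0⟩ := (h1.and self_mem_nhdsWithin).exists
  rw [slope_def_field] at hs
  have hs0 : a < s := hs0
  have h2 : 0 ≤ (EuclideanSpace.proj (𝕜 := ℝ) (0 : Fin n) ∘ extChartAt (𝓡∂ n) (c a) ∘ c) s :=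
    extChartAt_apply_zero_nonneg (c a) (c s)
  have h3 : (EuclideanSpace.proj (𝕜 := ℝ) (0 : Fin n) ∘ extChartAt (𝓡∂ n) (c a) ∘ c) a = 0 := hb
  rw [h3, sub_zero] at hs
  exact absurd hs (not_lt.2 (div_nonneg h2 (by linarith)))

end Endpoints

/-! ### Executions and trajectories -/

section Hybrid

variable {J : Type*} {n : J → ℕ} [∀ j, NeZero (n j)] {D : J → Type*}
  [∀ j, TopologicalSpace (D j)] [∀ j, ChartedSpace (EuclideanHalfSpace (n j)) (D j)]
  [∀ j, IsManifold (𝓡∂ (n j)) ∞ (D j)]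

namespace HybridSystem

variable (H : HybridSystem n D)

/-- The points near which the field can be followed forward. -/
def fwd : Set (Σ j, D j) := {x | x.2 ∈ fwdSet (H.field x.1)}

/-- The guard. -/
def exits : Set (Σ j, D j) := {x | x.2 ∈ H.guard x.1}

/-- The points from which the field leads into the guard. -/
def bas : Set (Σ j, D j) := {x | x.2 ∈ basin (H.field x.1) (H.guard x.1)}

/-- The time in which the field leads into the guard. -/
noncomputable def time (x : Σ j, D j) : ℝ := hitTime (H.field x.1) (H.guard x.1) x.2

/-- The point in which the field leads into the guard. -/
noncomputable def hit (x : Σ j, D j) : Σ j, D j :=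
  ⟨x.1, hitPt (H.field x.1) (H.guard x.1) x.2⟩

/-- The point to which the field and the next reset lead. -/
noncomputable def next (x : Σ j, D j) : Σ j, D j :=
  H.reset x.1 (hitPt (H.field x.1) (H.guard x.1) x.2)

/-- The curve that leads into the guard. -/
noncomputable def flow (x : Σ j, D j) (t : ℝ) : Σ j, D j :=
  ⟨x.1, hitCurve (H.field x.1) (H.guard x.1) x.2 t⟩

variable {H}

theorem HasFieldVelocity.mono {T T' : Set ℝ} {u : ℝ → Σ j, D j} {t : ℝ}
    (h : H.HasFieldVelocity T u t) (hT : T' ⊆ T) : H.HasFieldVelocity T' u t := by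
  obtain ⟨j, c, h1, h2⟩ := h
  exact ⟨j, c, h1.filter_mono (nhdsWithin_mono _ hT), h2.mono hT⟩

theorem HasFieldVelocity.congr {T : Set ℝ} {u u' : ℝ → Σ j, D j} {t : ℝ}
    (h : H.HasFieldVelocity T u t) (hu : u' =ᶠ[𝓝[T] t] u) : H.HasFieldVelocity T u' t := by
  obtain ⟨j, c, h1, h2⟩ := h
  exact ⟨j, c, by filter_upwards [h1, hu] with s hs hs' using hs'.trans hs, h2⟩

theorem HasFieldVelocity.mono_of_mem {T T' : Set ℝ} {u : ℝ → Σ j, D j} {t : ℝ}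
    (h : H.HasFieldVelocity T u t) (hT : T ∈ 𝓝[T'] t) : H.HasFieldVelocity T' u t := by
  obtain ⟨j, c, h1, h2⟩ := h
  exact ⟨j, c, h1.filter_mono (nhdsWithin_le_of_mem hT), h2.mono_of_mem_nhdsWithin hT⟩

theorem HasFieldVelocity.hasMFDerivWithinAt {T : Set ℝ} {u : ℝ → Σ j, D j} {t : ℝ}
    (h : H.HasFieldVelocity T u t) (ht : t ∈ T) {j : J} {c : ℝ → D j}
    (hc : ∀ᶠ s in 𝓝[T] t, u s = ⟨j, c s⟩) :
    HasMFDerivWithinAt 𝓘(ℝ, ℝ) (𝓡∂ (n j)) c T t (velocity (H.field j (c t))) := by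
  obtain ⟨k, c', h1, h2⟩ := h
  have h0 : (⟨j, c t⟩ : Σ j, D j) = ⟨k, c' t⟩ :=
    (hc.self_of_nhdsWithin ht).symm.trans (h1.self_of_nhdsWithin ht)
  obtain rfl : j = k := congrArg Sigma.fst h0
  have h3 : c t = c' t := sigma_mk_injective h0
  have h4 : c =ᶠ[𝓝[T] t] c' := by
    filter_upwards [hc, h1] with s hs hs'
    exact sigma_mk_injective (hs.symm.trans hs')
  have h5 := h2.congr_of_eventuallyEq h4 h3
  have key : ∀ x, x = c' t → HasMFDerivWithinAt 𝓘(ℝ, ℝ) (𝓡∂ (n j)) c T t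
      (velocity (x := c t) (H.field j x : EuclideanSpace ℝ (Fin (n j)))) := by
    rintro _ rfl; exact h5
  exact key (c t) h3

theorem hasFieldVelocity_of_isMIntegralCurveOn {T : Set ℝ} {u : ℝ → Σ j, D j} {j : J} {c : ℝ → D j}
    (hc : IsMIntegralCurveOn c (H.field j) T) (hu : ∀ s ∈ T, u s = ⟨j, c s⟩) {t : ℝ} (ht : t ∈ T) :
    H.HasFieldVelocity T u t :=
  ⟨j, c, eventually_nhdsWithin_of_forall hu, hc t ht⟩

/-- A piece of an execution without transitions is an integral curve. -/
theorem IsExecution.exists_isMIntegralCurveOn {T : Set ℝ} {u u' : ℝ → Σ j, D j}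
    (hu : H.IsExecution T u) {a b : ℝ} (hab : a < b) (hT : Ioo a b ⊆ T)
    (hc : ∀ r ∈ Ioo a b, ContinuousWithinAt u T r) (hc' : ContinuousOn u' (Icc a b))
    (heq : EqOn u' u (Ioo a b)) :
    ∃ (j : J) (c : ℝ → D j), (∀ r ∈ Icc a b, u' r = ⟨j, c r⟩) ∧
      IsMIntegralCurveOn c (H.field j) (Icc a b) := by
  -- A connected subset of a disjoint union lies in one summand. The function `u'` may differ from
  -- `u` at the end points, so that a value at a transition can be replaced by the left limit.
  have hconn : IsConnected (u' '' Icc a b) :=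
    ⟨(nonempty_Icc.2 hab.le).image _, isPreconnected_Icc.image _ hc'⟩
  obtain ⟨j, S, -, hS⟩ := Sigma.isConnected_iff.1 hconn
  have h1 : ∀ r ∈ Icc a b, ∃ y, u' r = ⟨j, y⟩ := fun r hr => by
    have : u' r ∈ Sigma.mk j '' S := hS ▸ mem_image_of_mem u' hr
    obtain ⟨y, -, hy⟩ := this
    exact ⟨y, hy.symm⟩
  obtain ⟨y₀, -⟩ := h1 a (left_mem_Icc.2 hab.le)
  classical
  let c : ℝ → D j := fun r => if h : ∃ y, u' r = ⟨j, y⟩ then h.choose else y₀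
  have hcu : ∀ r ∈ Icc a b, u' r = ⟨j, c r⟩ := fun r hr => by
    simp only [c, dif_pos (h1 r hr)]
    exact (h1 r hr).choose_spec
  have hcc : ContinuousOn c (Icc a b) := by
    rw [(Topology.IsOpenEmbedding.sigmaMk (i := j)).isInducing.continuousOn_iff]
    exact hc'.congr fun r hr => (hcu r hr).symm
  refine ⟨j, c, hcu, isMIntegralCurveOn_Icc_of_Ioo (H.smooth_field j) hcc fun r hr => ?_⟩
  exact ((hu.flow r (hT hr) (hc r hr)).mono hT).hasMFDerivWithinAt hr
    (eventually_nhdsWithin_of_forall fun s hs =>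
      (heq hs).symm.trans (hcu s (Ioo_subset_Icc_self hs)))

theorem IsExecution.shift {T : Set ℝ} {u : ℝ → Σ j, D j} (hu : H.IsExecution T u) (s : ℝ) :
    H.IsExecution {t | t + s ∈ T} fun t => u (t + s) := by
  have hmap : ∀ (A : Set ℝ) (t : ℝ), map (· + s) (𝓝[{t | t + s ∈ A}] t) = 𝓝[A] (t + s) := by
    intro A t
    exact (Homeomorph.addRight s).isOpenEmbedding.map_nhdsWithin_preimage_eq A t
  have hcont : ∀ (A : Set ℝ) (t : ℝ), ContinuousWithinAt (fun t => u (t + s)) {t | t + s ∈ A} t ↔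
      ContinuousWithinAt u A (t + s) := by
    intro A t
    rw [ContinuousWithinAt, ContinuousWithinAt, ← hmap, tendsto_map'_iff]
    rfl
  refine ⟨?_, fun t ht => ?_, fun t ht hc => ?_, fun t ht hc => ?_⟩
  · rw [ordConnected_iff]
    intro x hx y hy _ z hz
    exact hu.interval.out hx hy ⟨by linarith [hz.1], by linarith [hz.2]⟩
  · have h1 := (hcont (T ∩ Ici (t + s)) t).2 (hu.right_cont _ ht)
    refine h1.mono ?_
    rintro x ⟨hx, hx2⟩
    exact ⟨hx, by simpa using hx2⟩
  · obtain ⟨j, c, h1, h2⟩ := hu.flow _ ht ((hcont T t).1 hc)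
    refine ⟨j, fun r => c (r + s), ?_, ?_⟩
    · rw [← hmap] at h1
      exact h1
    · have h3 : HasMFDerivWithinAt 𝓘(ℝ, ℝ) 𝓘(ℝ, ℝ) (fun r : ℝ => r + s) {t | t + s ∈ T} t
          (ContinuousLinearMap.id ℝ ℝ) :=
        ((hasFDerivAt_id (𝕜 := ℝ) t).add_const s).hasFDerivWithinAt.hasMFDerivWithinAt
      exact HasMFDerivWithinAt.comp t h2 h3 fun x hx => hx
  · obtain ⟨j, y, hy, h1, h2⟩ := hu.jump _ ht (fun h => hc ((hcont T t).2 h))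
    refine ⟨j, y, hy, ?_, h2⟩
    have h3 : {r | r + s ∈ T} ∩ Iio t = {r | r + s ∈ T ∩ Iio (t + s)} := by
      ext r; simp
    rw [h3]
    exact (tendsto_map'_iff (f := u) (g := (· + s))).1 (by rw [hmap]; exact h1)

variable [∀ j, T2Space (D j)]

omit [∀ j, T2Space (D j)] in
theorem isOpen_fwd : IsOpen H.fwd :=
  isOpen_sigma_iff.2 fun j => isOpen_fwdSet (H.field j)

theorem isOpen_bas : IsOpen H.bas :=
  isOpen_sigma_iff.2 fun j => isOpen_iff_mem_nhds.2 fun _ hx =>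
    (hit_regular (H.smooth_field j) (H.guard_open j) (H.outward j) hx).1

omit [∀ j, T2Space (D j)] in
theorem disjoint_fwd_exits : Disjoint H.fwd H.exits :=
  Set.disjoint_left.2 fun x h1 h2 =>
    Set.disjoint_left.1 (disjoint_fwdSet (H.guard_open x.1) (H.outward x.1)) h1 h2

omit [∀ j, T2Space (D j)] in
theorem hitBy_flow {x : Σ j, D j} (hx : x ∈ H.bas) :
    HitBy (H.field x.1) (H.guard x.1) x.2 (H.time x) (hitCurve (H.field x.1) (H.guard x.1) x.2) :=
  hitBy_hitCurve hx

omit [∀ j, T2Space (D j)] in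
theorem time_nonneg {x : Σ j, D j} (hx : x ∈ H.bas) : 0 ≤ H.time x := (hitBy_flow hx).1

omit [∀ j, T2Space (D j)] in
theorem flow_zero {x : Σ j, D j} (hx : x ∈ H.bas) : H.flow x 0 = x :=
  Sigma.ext rfl (heq_of_eq (hitBy_flow hx).2.1)

omit [∀ j, T2Space (D j)] in
theorem flow_time (x : Σ j, D j) : H.flow x (H.time x) = H.hit x := rfl

omit [∀ j, T2Space (D j)] in
theorem hit_mem_exits {x : Σ j, D j} (hx : x ∈ H.bas) : H.hit x ∈ H.exits :=
  (hitBy_flow hx).2.2.2.1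

omit [∀ j, T2Space (D j)] in
theorem flow_mem_fwd {x : Σ j, D j} (hx : x ∈ H.bas) {s : ℝ} (hs : s ∈ Ico 0 (H.time x)) :
    H.flow x s ∈ H.fwd := (hitBy_flow hx).2.2.2.2 s hs

/-- The rest of a curve into the guard is the curve into the guard from any of its points, by
uniqueness. -/
theorem flow_regular {x : Σ j, D j} (hx : x ∈ H.bas) {s : ℝ} (hs : s ∈ Icc 0 (H.time x)) :
    H.flow x s ∈ H.bas ∧ H.time (H.flow x s) = H.time x - s ∧ H.hit (H.flow x s) = H.hit x := by
  have h := (hitBy_flow hx).shift hs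
  obtain ⟨h1, h2, -⟩ := h.eq (H.smooth_field x.1) (H.guard_open x.1) (H.outward x.1)
  refine ⟨h.mem_basin, h1, Sigma.ext rfl (heq_of_eq ?_)⟩
  refine h2.trans ?_
  simp only [sub_add_cancel]
  rfl

omit [∀ j, T2Space (D j)] in
theorem next_eq_of_hit_eq {x y : Σ j, D j} (h : H.hit x = H.hit y) : H.next x = H.next y :=
  congrArg (fun z : Σ j, D j => H.reset z.1 z.2) h

theorem next_flow {x : Σ j, D j} (hx : x ∈ H.bas) {s : ℝ} (hs : s ∈ Icc 0 (H.time x)) :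
    H.next (H.flow x s) = H.next x := next_eq_of_hit_eq (flow_regular hx hs).2.2

omit [∀ j, T2Space (D j)] in
theorem continuousOn_flow {x : Σ j, D j} (hx : x ∈ H.bas) :
    ContinuousOn (H.flow x) (Icc 0 (H.time x)) :=
  continuous_sigmaMk.comp_continuousOn (hitBy_flow hx).2.2.1.continuousOn

theorem exits_regular {x : Σ j, D j} (hx : x ∈ H.exits) :
    x ∈ H.bas ∧ H.time x = 0 ∧ H.hit x = x ∧ H.next x = H.reset x.1 x.2 := by
  have h := hitBy_zero (v := H.field x.1) (show x.2 ∈ H.guard x.1 from hx)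
  obtain ⟨h1, h2, -⟩ := h.eq (H.smooth_field x.1) (H.guard_open x.1) (H.outward x.1)
  have h3 : H.hit x = x := Sigma.ext rfl (heq_of_eq h2)
  exact ⟨h.mem_basin, h1, h3, congrArg (fun z : Σ j, D j => H.reset z.1 z.2) h3⟩

omit [∀ j, T2Space (D j)] in
theorem mem_exits_of_time_eq_zero {x : Σ j, D j} (hx : x ∈ H.bas) (h : H.time x = 0) :
    x ∈ H.exits := by
  have := hit_mem_exits hx
  rwa [← flow_time, h, flow_zero hx] at this

omit [∀ j, T2Space (D j)] in
theorem time_pos {x : Σ j, D j} (hx : x ∈ H.bas) (hx' : x ∉ H.exits) : 0 < H.time x :=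
  lt_of_le_of_ne (time_nonneg hx) fun h => hx' (mem_exits_of_time_eq_zero hx h.symm)

omit [∀ j, T2Space (D j)] in
theorem not_mem_exits {x : Σ j, D j} (hx : x ∈ H.fwd) : x ∉ H.exits :=
  fun h => Set.disjoint_left.1 disjoint_fwd_exits hx h

/-- There is no transition shortly after a point from which the field can be followed. -/
theorem IsExecution.exists_continuousWithinAt {T : Set ℝ} {u : ℝ → Σ j, D j}
    (hu : H.IsExecution T u) {t : ℝ} (ht : t ∈ T) (hf : u t ∈ H.fwd) :
    ∃ ε > 0, ∀ s ∈ T, t < s → s < t + ε → ContinuousWithinAt u T s := by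
  -- By right continuity the execution stays for a while in a closed neighbourhood inside `H.fwd`.
  -- The left limit at a transition would lie there too, but it is in the guard, which is disjoint
  -- from `H.fwd`.
  obtain ⟨N, hN, hNc, hNf⟩ : ∃ N ∈ 𝓝 (u t), IsClosed N ∧ N ⊆ H.fwd := by
    generalize u t = z at hf
    obtain ⟨j, x⟩ := z
    have : LocallyCompactSpace (D j) := Manifold.locallyCompact_of_finiteDimensional (𝓡∂ (n j))
    obtain ⟨N, h1, h2, h3⟩ := exists_mem_nhds_isClosed_subset
      ((isOpen_fwdSet (H.field j)).mem_nhds (show x ∈ fwdSet (H.field j) from hf))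
    refine ⟨Sigma.mk j '' N, ?_, Topology.IsClosedEmbedding.sigmaMk.isClosedMap _ h2, ?_⟩
    · exact Topology.IsOpenEmbedding.sigmaMk.isOpenMap.image_mem_nhds h1
    · rintro _ ⟨y, hy, rfl⟩
      exact h3 hy
  obtain ⟨ε, hε, hsub⟩ := Metric.mem_nhdsWithin_iff.1 (hu.right_cont t ht hN)
  refine ⟨ε, hε, fun s hs h1 h2 => ?_⟩
  by_contra hcon
  obtain ⟨k, y, hy, hlim, -⟩ := hu.jump s hs hcon
  have hin : ∀ r ∈ Ioo t s, r ∈ T ∩ Iio s ∧ u r ∈ N := fun r hr =>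
    have hrT : r ∈ T := hu.interval.out ht hs (Ioo_subset_Icc_self hr)
    ⟨⟨hrT, hr.2⟩, hsub ⟨by rw [Real.ball_eq_Ioo]; constructor <;> linarith [hr.1, hr.2], hrT,
      hr.1.le⟩⟩
  have hne : (𝓝[Ioo t s] s).NeBot := by
    rw [nhdsWithin_Ioo_eq_nhdsLT h1]; infer_instance
  have : (⟨k, y⟩ : Σ j, D j) ∈ N := hNc.mem_of_tendsto
    (hlim.mono_left (nhdsWithin_mono _ fun r hr => (hin r hr).1))
    (eventually_nhdsWithin_of_forall fun r hr => (hin r hr).2)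
  exact Set.disjoint_left.1 disjoint_fwd_exits (hNf this) (show (⟨k, y⟩ : Σ j, D j) ∈ H.exits from hy)

/-- The restriction of an execution to a smaller interval. -/
theorem IsExecution.restrict {T : Set ℝ} {u : ℝ → Σ j, D j} (hu : H.IsExecution T u) {a b : ℝ}
    (hab : a ≤ b) (hT : Icc a b ⊆ T) (hf : u a ∈ H.fwd) : H.IsExecution (Icc a b) u := by
  have ha := hT (left_mem_Icc.2 hab)
  have hcont : ∀ t ∈ Ioc a b, ContinuousWithinAt u (Icc a b) t → ContinuousWithinAt u T t := by
    intro t ht hc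
    have h1 : ContinuousWithinAt u (T ∩ Iic t) t := by
      refine hc.mono_of_mem_nhdsWithin ?_
      refine mem_nhdsWithin.2 ⟨Ioi a, isOpen_Ioi, ht.1, ?_⟩
      rintro x ⟨hx1, hx2, hx3⟩
      exact ⟨le_of_lt hx1, le_trans hx3 ht.2⟩
    have h2 := h1.union (hu.right_cont t (hT (Ioc_subset_Icc_self ht)))
    rwa [← inter_union_distrib_left, Iic_union_Ici, inter_univ] at h2
  have h0 : ContinuousWithinAt u (Icc a b) a := (hu.right_cont a ha).mono fun x hx => ⟨hT hx, hx.1⟩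
  refine ⟨ordConnected_Icc, fun t ht => (hu.right_cont t (hT ht)).mono fun x hx =>
    ⟨hT hx.1, hx.2⟩, fun t ht hc => ?_, fun t ht hc => ?_⟩
  · rcases ht.1.eq_or_lt with rfl | hat
    · rcases hab.eq_or_lt with rfl | hab'
      · refine hasFieldVelocity_of_isMIntegralCurveOn (j := (u a).1) (c := fun _ => (u a).2)
          (isMIntegralCurveOn_const_Icc_self _ a) (fun s hs => ?_) ht
        rw [Icc_self] at hs
        rw [show s = a from hs]
      -- The original execution may jump at `a`, whereas its restriction is continuous there and so
      -- must satisfy the equation at `a`. Since transitions do not accumulate at `a` from the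
      -- right, an integral curve on a small closed interval supplies the derivative.
      · obtain ⟨ε, hε, hε'⟩ := hu.exists_continuousWithinAt ha hf
        have hlt : a < min b (a + ε / 2) := lt_min hab' (by linarith)
        have hb1 := min_le_left b (a + ε / 2)
        have hb2 := min_le_right b (a + ε / 2)
        have hcw : ∀ r ∈ Ioc a (min b (a + ε / 2)), ContinuousWithinAt u T r := fun r hr =>
          hε' r (hT ⟨hr.1.le, hr.2.trans hb1⟩) hr.1 (by linarith [hr.2])
        have hsub : Icc a (min b (a + ε / 2)) ⊆ T := fun r hr => hT ⟨hr.1, hr.2.trans hb1⟩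
        obtain ⟨j, c, hjc, hic⟩ := hu.exists_isMIntegralCurveOn (u' := u) hlt
          (fun r hr => hsub (Ioo_subset_Icc_self hr))
          (fun r hr => hcw r (Ioo_subset_Ioc_self hr)) (fun r hr => by
            rcases hr.1.eq_or_lt with rfl | h
            · exact h0.mono (Icc_subset_Icc_right hb1)
            · exact (hcw r ⟨h, hr.2⟩).mono hsub) (fun r hr => rfl)
        refine (hasFieldVelocity_of_isMIntegralCurveOn hic hjc
          (left_mem_Icc.2 hlt.le)).mono_of_mem ?_
        refine mem_nhdsWithin.2 ⟨Iio (min b (a + ε / 2)), isOpen_Iio, hlt, ?_⟩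
        rintro x ⟨hx1, hx2⟩
        exact ⟨hx2.1, le_of_lt hx1⟩
    · exact (hu.flow t (hT ht) (hcont t ⟨hat, ht.2⟩ hc)).mono hT
  · rcases ht.1.eq_or_lt with rfl | hat
    · exact absurd h0 hc
    · obtain ⟨j, y, hy, h1, h2⟩ := hu.jump t (hT ht) fun h => hc (h.mono hT)
      exact ⟨j, y, hy, h1.mono_left (nhdsWithin_mono _ fun x hx => ⟨hT hx.1, hx.2⟩), h2⟩

/-- A supremum argument: `P` passes to the right end of an interval on which it holds, and from a
closed interval a bit further. -/
theorem real_induction {P : ℝ → Prop} {a b : ℝ}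
    (hl : ∀ t ∈ Icc a b, (∀ s ∈ Ico a t, P s) → P t)
    (hr : ∀ t ∈ Ico a b, (∀ s ∈ Icc a t, P s) → ∃ ε > 0, ∀ s ∈ Ioo t (t + ε), s ≤ b → P s) :
    ∀ t ∈ Icc a b, P t := by
  intro t ht
  have hab : a ≤ b := ht.1.trans ht.2
  let S : Set ℝ := {t | t ∈ Icc a b ∧ ∀ s ∈ Icc a t, P s}
  have haS : a ∈ S := by
    refine ⟨left_mem_Icc.2 hab, fun s hs => ?_⟩
    obtain rfl : s = a := le_antisymm hs.2 hs.1
    exact hl s ⟨le_rfl, hab⟩ fun r hr => absurd hr.2 (not_lt.2 hr.1)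
  have hbd : BddAbove S := ⟨b, fun t ht => ht.1.2⟩
  have hau : a ≤ sSup S := le_csSup hbd haS
  have hub : sSup S ≤ b := csSup_le ⟨a, haS⟩ fun t ht => ht.1.2
  have huS : ∀ s ∈ Icc a (sSup S), P s := by
    have h1 : ∀ s ∈ Ico a (sSup S), P s := fun s hs => by
      obtain ⟨t, ht, hst⟩ := exists_lt_of_lt_csSup ⟨a, haS⟩ hs.2
      exact ht.2 s ⟨hs.1, hst.le⟩
    intro s hs
    rcases hs.2.eq_or_lt with rfl | h
    · exact hl _ ⟨hau, hub⟩ h1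
    · exact h1 s ⟨hs.1, h⟩
  rcases hub.eq_or_lt with h | h
  · exact huS t ⟨ht.1, h ▸ ht.2⟩
  · obtain ⟨ε, hε, H⟩ := hr _ ⟨hau, h⟩ huS
    have hm : min b (sSup S + ε / 2) ∈ S := by
      refine ⟨⟨le_min hab (by linarith), min_le_left _ _⟩, fun s hs => ?_⟩
      rcases le_or_gt s (sSup S) with h1 | h1
      · exact huS s ⟨hs.1, h1⟩
      · exact H s ⟨h1, by linarith [hs.2.trans (min_le_right _ _)]⟩
          (hs.2.trans (min_le_left _ _))
    have := le_csSup hbd hm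
    rcases min_le_iff.1 this with h1 | h1 <;> linarith

/-- An execution follows the field up to the guard. -/
theorem IsExecution.eq_curve {u : ℝ → Σ j, D j} {b T : ℝ} (hu : H.IsExecution (Icc 0 b) u)
    {j : J} {c : ℝ → D j} (h0 : u 0 = ⟨j, c 0⟩) (hc : IsMIntegralCurveOn c (H.field j) (Icc 0 T))
    (hcF : ∀ s ∈ Ico 0 T, c s ∈ fwdSet (H.field j)) :
    ∀ t ∈ Icc 0 b, t < T → u t = ⟨j, c t⟩ := by
  have hcf : ContinuousOn (fun t => (⟨j, c t⟩ : Σ j, D j)) (Icc 0 T) :=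
    continuous_sigmaMk.comp_continuousOn hc.continuousOn
  have hlim : ∀ t ∈ Icc 0 b, t < T → 0 < t → (∀ s ∈ Ico 0 t, u s = ⟨j, c s⟩) →
      Tendsto u (𝓝[Ico 0 t] t) (𝓝 ⟨j, c t⟩) := fun t ht htT h0 heq =>
    ((hcf t ⟨h0.le, htT.le⟩).mono fun s hs => ⟨hs.1, hs.2.le.trans htT.le⟩).congr'
      (eventually_nhdsWithin_of_forall fun s hs => (heq s hs).symm)
  have hcont : ∀ t ∈ Icc 0 b, t < T → (∀ s ∈ Ico 0 t, u s = ⟨j, c s⟩) →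
      ContinuousWithinAt u (Icc 0 b) t := by
    intro t ht htT heq
    rcases ht.1.eq_or_lt with rfl | ht0
    · exact (hu.right_cont 0 ht).mono fun s hs => ⟨hs, hs.1⟩
    -- The left limit at a transition would be `c t`, a point of `H.fwd`, and not a point of the
    -- guard.
    · by_contra hcon
      obtain ⟨k, y, hy, hl, -⟩ := hu.jump t ht hcon
      have hne : (𝓝[Ico 0 t] t).NeBot := by
        rw [nhdsWithin_Ico_eq_nhdsLT ht0]; infer_instance
      have := tendsto_nhds_unique (hlim t ht htT ht0 heq) (hl.mono_left (nhdsWithin_mono _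
        fun s hs => ⟨⟨hs.1, hs.2.le.trans ht.2⟩, hs.2⟩))
      have h1 : (⟨j, c t⟩ : Σ j, D j) ∈ H.fwd := hcF t ⟨ht0.le, htT⟩
      rw [this] at h1
      exact not_mem_exits h1 hy
  intro b₁ hb₁ hb₁T
  refine real_induction (P := fun t => u t = ⟨j, c t⟩) (a := 0) (b := b₁) ?_ ?_ b₁
    (right_mem_Icc.2 hb₁.1)
  · intro t ht heq
    have ht' : t ∈ Icc 0 b := ⟨ht.1, ht.2.trans hb₁.2⟩
    have htT : t < T := ht.2.trans_lt hb₁T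
    rcases ht.1.eq_or_lt with rfl | ht0
    · exact h0
    · have hne : (𝓝[Ico 0 t] t).NeBot := by
        rw [nhdsWithin_Ico_eq_nhdsLT ht0]; infer_instance
      exact tendsto_nhds_unique ((hcont t ht' htT heq).mono fun s hs =>
        ⟨hs.1, hs.2.le.trans ht'.2⟩) (hlim t ht' htT ht0 heq)
  · intro t ht heq
    have ht' : t ∈ Icc 0 b := ⟨ht.1, ht.2.le.trans hb₁.2⟩
    have htT : t < T := ht.2.trans hb₁T
    have htx : u t = ⟨j, c t⟩ := heq t ⟨ht.1, le_rfl⟩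
    have hct := hcont t ht' htT fun s hs => heq s ⟨hs.1, hs.2.le⟩
    -- The next transition is some distance away, and up to it the execution is an integral curve,
    -- equal to `c` by uniqueness.
    obtain ⟨ε, hε, hε'⟩ := hu.exists_continuousWithinAt ht' (by
      rw [htx]; exact hcF t ⟨ht.1, htT⟩)
    have hlt : t < min b₁ (t + ε / 2) := lt_min ht.2 (by linarith)
    have hb1 := min_le_left b₁ (t + ε / 2)
    have hb2 := min_le_right b₁ (t + ε / 2)
    have hsub : Icc t (min b₁ (t + ε / 2)) ⊆ Icc 0 b := fun r hr =>
      ⟨ht.1.trans hr.1, hr.2.trans (hb1.trans hb₁.2)⟩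
    have hcw : ∀ r ∈ Icc t (min b₁ (t + ε / 2)), ContinuousWithinAt u (Icc 0 b) r := fun r hr => by
      rcases hr.1.eq_or_lt with rfl | h
      · exact hct
      · exact hε' r (hsub hr) h (by linarith [hr.2])
    obtain ⟨k, c', hjc, hic⟩ := hu.exists_isMIntegralCurveOn (u' := u) hlt
      (fun r hr => hsub (Ioo_subset_Icc_self hr))
      (fun r hr => hcw r (Ioo_subset_Icc_self hr)) (fun r hr => (hcw r hr).mono hsub)
      (fun r hr => rfl)
    have h1 : (⟨k, c' t⟩ : Σ j, D j) = ⟨j, c t⟩ := (hjc t (left_mem_Icc.2 hlt.le)).symm.trans htx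
    obtain rfl : k = j := congrArg Sigma.fst h1
    have h2 := eqOn_of_isMIntegralCurveOn (H.smooth_field k) (left_mem_Icc.2 hlt.le) hic
      (IsMIntegralCurveOn.mono hc fun r hr =>
        ⟨ht.1.trans hr.1, hr.2.trans (hb1.trans hb₁T.le)⟩) (sigma_mk_injective h1)
    refine ⟨ε / 2, by linarith, fun s hs hsb => ?_⟩
    have hs' : s ∈ Icc t (min b₁ (t + ε / 2)) := ⟨hs.1.le, le_min hsb hs.2.le⟩
    rw [hjc s hs', h2 hs']

theorem IsExecution.eq_flow {u : ℝ → Σ j, D j} {b : ℝ} (hu : H.IsExecution (Icc 0 b) u)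
    {x : Σ j, D j} (h0 : u 0 = x) (hx : x ∈ H.bas) :
    ∀ t ∈ Icc 0 b, t < H.time x → u t = H.flow x t :=
  hu.eq_curve (h0.trans (flow_zero hx).symm) (hitBy_flow hx).2.2.1 fun _ hs => flow_mem_fwd hx hs

/-- What an execution does when it reaches the guard. -/
theorem IsExecution.at_time {u : ℝ → Σ j, D j} {b : ℝ} (hu : H.IsExecution (Icc 0 b) u)
    {x : Σ j, D j} (h0 : u 0 = x) (hx : x ∈ H.bas) (hx' : x ∉ H.exits) (hb : H.time x ≤ b) :
    Tendsto u (𝓝[<] H.time x) (𝓝 (H.hit x)) ∧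
      (u (H.time x) = H.hit x ∨ u (H.time x) = H.next x) ∧
      (H.time x < b → u (H.time x) = H.next x) := by
  have hT := time_pos hx hx'
  have hmem : H.time x ∈ Icc 0 b := ⟨hT.le, hb⟩
  have hne : (𝓝[Ico 0 (H.time x)] H.time x).NeBot := by
    rw [nhdsWithin_Ico_eq_nhdsLT hT]; infer_instance
  have hlim : Tendsto u (𝓝[Ico 0 (H.time x)] H.time x) (𝓝 (H.hit x)) :=
    ((continuousOn_flow hx _ ⟨hT.le, le_rfl⟩).mono Ico_subset_Icc_self).congr'
      (eventually_nhdsWithin_of_forall fun s hs =>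
        (hu.eq_flow h0 hx s ⟨hs.1, hs.2.le.trans hb⟩ hs.2).symm)
  have hc1 : ContinuousWithinAt u (Icc 0 b) (H.time x) → u (H.time x) = H.hit x := fun hc =>
    tendsto_nhds_unique (hc.mono fun s hs => ⟨hs.1, hs.2.le.trans hb⟩) hlim
  have hc2 : ¬ ContinuousWithinAt u (Icc 0 b) (H.time x) → u (H.time x) = H.next x := by
    intro hc
    obtain ⟨j, y, hy, h1, h2⟩ := hu.jump _ hmem hc
    have h3 := tendsto_nhds_unique hlim (h1.mono_left (nhdsWithin_mono _
        fun s hs => ⟨⟨hs.1, hs.2.le.trans hb⟩, hs.2⟩))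
    rw [← h2]
    exact (congrArg (fun z : Σ j, D j => H.reset z.1 z.2) h3).symm
  refine ⟨by rwa [nhdsWithin_Ico_eq_nhdsLT hT] at hlim, ?_, fun hlt => hc2 fun hc => ?_⟩
  -- If `b` is exactly the hitting time, the execution may end in the exit point or be reset; both
  -- satisfy the definition.
  · by_cases hc : ContinuousWithinAt u (Icc 0 b) (H.time x)
    · exact Or.inl (hc1 hc)
    · exact Or.inr (hc2 hc)
  -- If the execution goes on without a jump, it has the velocity of the outward-pointing field at a
  -- point of the guard, which is impossible.
  · have h1 := (hu.flow _ hmem hc).mono (T' := Icc (H.time x) b)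
      fun s hs => ⟨hT.le.trans hs.1, hs.2⟩
    obtain ⟨j, c, hjc, -⟩ := id h1
    have h2 := h1.hasMFDerivWithinAt (left_mem_Icc.2 hb) hjc
    have h3 := hjc.self_of_nhdsWithin (left_mem_Icc.2 hb)
    refine not_hasMFDerivWithinAt_of_mem_guard (H.guard_open j) (H.outward j) hlt ?_ h2
    have : (⟨j, c (H.time x)⟩ : Σ j, D j) ∈ H.exits := by
      rw [← h3, hc1 hc]
      exact hit_mem_exits hx
    exact this

/-- Since the trajectory lasts longer than the hitting time, the reset does take place. The same
formula covers a point of the guard, where the hitting time is `0` and the trajectory starts with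
the reset. -/
theorem IsTrajectory.of_next {u : ℝ → Σ j, D j} {b : ℝ} {x : Σ j, D j} (hx : x ∈ H.bas)
    (hn : H.next x ∈ H.fwd) (hu : H.IsTrajectory x b u) (hb : H.time x < b) :
    H.IsTrajectory (H.next x) (b - H.time x) fun t => u (t + H.time x) := by
  have hval : u (H.time x) = H.next x := by
    by_cases hx' : x ∈ H.exits
    · rw [(exits_regular hx').2.1, (exits_regular hx').2.2.2]
      exact hu.start_reset hx'
    · exact (hu.isExecution.at_time (hu.start_flow hx') hx hx' hb.le).2.2 hb
  refine ⟨?_, fun _ => by simpa using hval, fun h => absurd h (not_mem_exits hn)⟩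
  have h1 := (hu.isExecution.restrict hb.le (fun s hs => ⟨(time_nonneg hx).trans hs.1, hs.2⟩)
    (by rw [hval]; exact hn)).shift (H.time x)
  have h2 : {t | t + H.time x ∈ Icc (H.time x) b} = Icc 0 (b - H.time x) := by
    ext t
    change (_ ≤ _ ∧ _ ≤ _) ↔ (_ ≤ _ ∧ _ ≤ _)
    constructor <;> rintro ⟨h1, h2⟩ <;> constructor <;> linarith
  rwa [h2] at h1

omit [∀ j, T2Space (D j)] in
theorem isTrajectory_flow {x : Σ j, D j} (hx : x ∈ H.bas) (hx' : x ∉ H.exits) {b : ℝ}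
    (hb : b ≤ H.time x) : H.IsTrajectory x b (H.flow x) := by
  have hsub : Icc 0 b ⊆ Icc 0 (H.time x) := Icc_subset_Icc_right hb
  refine ⟨⟨ordConnected_Icc, fun t ht => ((continuousOn_flow hx).mono hsub t ht).mono fun s hs =>
    hs.1, fun t ht _ => ?_, fun t ht hc => absurd ((continuousOn_flow hx).mono hsub t ht) hc⟩,
    fun _ => flow_zero hx, fun h => absurd h hx'⟩
  exact hasFieldVelocity_of_isMIntegralCurveOn (IsMIntegralCurveOn.mono (hitBy_flow hx).2.2.1 hsub)
    (fun s _ => rfl) ht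

/-- A trajectory from the next point extends to a trajectory. -/
theorem IsTrajectory.exists_of_next {w : ℝ → Σ j, D j} {b : ℝ} {x : Σ j, D j} (hx : x ∈ H.bas)
    (hn : H.next x ∈ H.fwd) (hb : 0 ≤ b) (hw : H.IsTrajectory (H.next x) b w) :
    ∃ u, H.IsTrajectory x (H.time x + b) u ∧ u (H.time x + b) = w b := by
  have hw0 : w 0 = H.next x := hw.start_flow (not_mem_exits hn)
  by_cases hx' : x ∈ H.exits
  -- From a point of the guard the trajectory starts with the reset, so `w` itself serves.
  · obtain ⟨-, h1, h2, h3⟩ := exits_regular hx'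
    refine ⟨w, ?_, by rw [h1, zero_add]⟩
    rw [h1, zero_add]
    exact ⟨hw.isExecution, fun h => absurd hx' h, fun _ => hw0.trans h3⟩
  set T := H.time x with hTdef
  have hT : 0 < T := time_pos hx hx'
  let u : ℝ → Σ j, D j := fun t => if t < T then H.flow x t else w (t - T)
  have hu1 : ∀ t, t < T → u t = H.flow x t := fun t ht => if_pos ht
  have hu2 : ∀ t, T ≤ t → u t = w (t - T) := fun t ht => if_neg (not_lt.2 ht)
  have hex : H.IsExecution (Icc T (T + b)) fun t => w (t - T) := by
    have := hw.isExecution.shift (-T)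
    have h2 : {t | t + -T ∈ Icc 0 b} = Icc T (T + b) := by
      ext t
      change (_ ≤ _ ∧ _ ≤ _) ↔ (_ ≤ _ ∧ _ ≤ _)
      constructor <;> rintro ⟨h1, h2⟩ <;> constructor <;> linarith
    rw [h2] at this
    exact this
  have hfl := (isTrajectory_flow hx hx' le_rfl).isExecution
  have hsubL : ∀ t, t < T → Icc 0 T ∈ 𝓝[Icc 0 (T + b)] t := fun t ht =>
    mem_nhdsWithin.2 ⟨Iio T, isOpen_Iio, ht, fun s hs => ⟨hs.2.1, le_of_lt hs.1⟩⟩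
  have hsubR : ∀ t, T < t → Icc T (T + b) ∈ 𝓝[Icc 0 (T + b)] t := fun t ht =>
    mem_nhdsWithin.2 ⟨Ioi T, isOpen_Ioi, ht, fun s hs => ⟨le_of_lt hs.1, hs.2.2⟩⟩
  have hevL : ∀ t, t < T → u =ᶠ[𝓝 t] H.flow x := fun t ht =>
    (isOpen_Iio.mem_nhds (show t ∈ Iio T from ht) : Iio T ∈ 𝓝 t) |> fun h =>
      mem_of_superset h hu1
  have hevR : ∀ t, T < t → u =ᶠ[𝓝 t] fun t => w (t - T) := fun t ht =>
    (isOpen_Ioi.mem_nhds (show t ∈ Ioi T from ht) : Ioi T ∈ 𝓝 t) |> fun h =>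
      mem_of_superset h fun s hs => hu2 s (le_of_lt hs)
  have hfc : ∀ t, 0 ≤ t → t < T → ContinuousWithinAt u (Icc 0 (T + b)) t := fun t ht0 ht =>
    ((((continuousOn_flow hx) t ⟨ht0, ht.le⟩).mono_of_mem_nhdsWithin (hsubL t ht)).congr_of_eventuallyEq
      (mem_nhdsWithin_of_mem_nhds (hevL t ht)) (hu1 t ht))
  have hleft : Tendsto u (𝓝[<] T) (𝓝 (H.hit x)) := by
    have h1 := (continuousOn_flow hx T ⟨hT.le, le_rfl⟩).mono (Ico_subset_Icc_self)
    rw [ContinuousWithinAt, nhdsWithin_Ico_eq_nhdsLT hT] at h1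
    exact h1.congr' (eventually_nhdsWithin_of_forall fun s hs => (hu1 s hs).symm)
  have huT : u T = H.next x := by rw [hu2 T le_rfl, sub_self, hw0]
  -- The left limit is in the guard and the value is in `H.fwd`, so the concatenation has a real
  -- discontinuity at `T` and the jump condition is the one to verify.
  have hnot : ¬ ContinuousWithinAt u (Icc 0 (T + b)) T := by
    intro hc
    have h1 := hc.mono (s := Ico 0 T) fun s hs => ⟨hs.1, by linarith [hs.2]⟩
    rw [ContinuousWithinAt, nhdsWithin_Ico_eq_nhdsLT hT] at h1
    have := tendsto_nhds_unique h1 hleft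
    rw [huT] at this
    exact not_mem_exits hn (this ▸ hit_mem_exits hx)
  refine ⟨u, ⟨⟨ordConnected_Icc, fun t ht => ?_, fun t ht hc => ?_, fun t ht hc => ?_⟩,
    fun _ => (hu1 0 hT).trans (flow_zero hx), fun h => absurd h hx'⟩, ?_⟩
  · rcases lt_or_ge t T with h | h
    · exact (hfc t ht.1 h).mono inter_subset_left
    · have h1 := hex.right_cont t ⟨h, ht.2⟩
      have h2 : Icc 0 (T + b) ∩ Ici t ⊆ Icc T (T + b) ∩ Ici t := fun s hs =>
        ⟨⟨h.trans hs.2, hs.1.2⟩, hs.2⟩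
      exact (h1.mono h2).congr (fun s hs => hu2 s (h.trans hs.2)) (hu2 t h)
  · rcases lt_trichotomy t T with h | h | h
    · have h1 := (hfl.flow t ⟨ht.1, h.le⟩ (continuousOn_flow hx t ⟨ht.1, h.le⟩)).mono_of_mem
        (hsubL t h)
      exact h1.congr (mem_nhdsWithin_of_mem_nhds (hevL t h))
    · exact absurd (h ▸ hc) hnot
    · have h1 : ContinuousWithinAt (fun t => w (t - T)) (Icc T (T + b)) t :=
        (hc.mono fun s hs => ⟨hT.le.trans hs.1, hs.2⟩).congr
          (fun s hs => (hu2 s hs.1).symm) (hu2 t h.le).symm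
      exact ((hex.flow t ⟨h.le, ht.2⟩ h1).mono_of_mem (hsubR t h)).congr
        (mem_nhdsWithin_of_mem_nhds (hevR t h))
  · rcases lt_trichotomy t T with h | h | h
    · exact absurd (hfc t ht.1 h) hc
    · subst h
      refine ⟨x.1, _, hit_mem_exits hx, hleft.mono_left (nhdsWithin_mono _ inter_subset_right), ?_⟩
      exact huT.symm
    · have h1 : ¬ ContinuousWithinAt (fun t => w (t - T)) (Icc T (T + b)) t := fun h1 => hc
        ((h1.mono_of_mem_nhdsWithin (hsubR t h)).congr_of_eventuallyEq
          (mem_nhdsWithin_of_mem_nhds (hevR t h)) (hu2 t h.le))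
      obtain ⟨j, y, hy, h2, h3⟩ := hex.jump t ⟨h.le, ht.2⟩ h1
      refine ⟨j, y, hy, ?_, h3.trans (hu2 t h.le).symm⟩
      have h4 : Icc T (T + b) ∩ Iio t ∈ 𝓝[Icc 0 (T + b) ∩ Iio t] t :=
        mem_nhdsWithin.2 ⟨Ioi T, isOpen_Ioi, h, fun s hs => ⟨⟨le_of_lt hs.1, hs.2.1.2⟩, hs.2.2⟩⟩
      exact (h2.mono_left (nhdsWithin_le_of_mem h4)).congr'
        (mem_nhdsWithin_of_mem_nhds (hevR t h).symm)
  · rw [hu2 _ (by linarith), add_sub_cancel_left]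

/-- The trajectories from `x` exist up to the time `b` and lead into the set `M`. -/
def LandsIn (H : HybridSystem n D) (M : Set (Σ j, D j)) (b : ℝ) (x : Σ j, D j) : Prop :=
  0 < b ∧ (∃ u, H.IsTrajectory x b u) ∧ ∀ u, H.IsTrajectory x b u → u b ∈ M

/-- Strictly before the hitting time executions are determined, which avoids the ambiguity at a
transition. -/
theorem landsIn_flow {M : Set (Σ j, D j)} {b : ℝ} {x : Σ j, D j} (hx : x ∈ H.bas)
    (hx' : x ∉ H.exits) (hb : 0 < b) (hbT : b < H.time x) (hM : H.flow x b ∈ M) :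
    H.LandsIn M b x := by
  refine ⟨hb, ⟨_, isTrajectory_flow hx hx' hbT.le⟩, fun u hu => ?_⟩
  rw [hu.isExecution.eq_flow (hu.start_flow hx') hx b ⟨hb.le, le_rfl⟩ hbT]
  exact hM

theorem LandsIn.of_next {M : Set (Σ j, D j)} {b : ℝ} {x : Σ j, D j} (hx : x ∈ H.bas)
    (hn : H.next x ∈ H.fwd) (h : H.LandsIn M b (H.next x)) : H.LandsIn M (H.time x + b) x := by
  obtain ⟨hb, ⟨w, hw⟩, hall⟩ := h
  have hT := time_nonneg hx
  refine ⟨by linarith, ?_, fun u hu => ?_⟩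
  · obtain ⟨u, hu, -⟩ := hw.exists_of_next hx hn hb.le
    exact ⟨u, hu⟩
  · have := hall _ (by simpa using hu.of_next hx hn (by linarith))
    rwa [add_comm] at this

variable (H) in
/-- The time of the `l`-th transition of the trajectory from `x`. -/
noncomputable def nextTime (l : ℕ) (x : Σ j, D j) : ℝ :=
  ∑ i ∈ Finset.range l, H.time (H.next^[i] x)

omit [∀ j, T2Space (D j)] in
theorem nextTime_succ (l : ℕ) (x : Σ j, D j) :
    H.nextTime (l + 1) x = H.time x + H.nextTime l (H.next x) := by
  rw [nextTime, Finset.sum_range_succ', add_comm]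
  rfl

/-- Where a trajectory meets points before the transition of number `L + 1`. -/
theorem IsTrajectory.meetsAt {L : ℕ} : ∀ {x : Σ j, D j} {b : ℝ} {u : ℝ → Σ j, D j},
    (∀ i ≤ L, H.next^[i] x ∈ H.bas) → (∀ i ≤ L + 1, 0 < i → H.next^[i] x ∈ H.fwd) →
    H.IsTrajectory x b u → ∀ {s : ℝ} {w : Σ j, D j}, 0 < s → s ≤ b → s < H.nextTime (L + 1) x →
    MeetsAt u s w → ∃ l ≤ L, H.nextTime l x ≤ s ∧ s ≤ H.nextTime (l + 1) x ∧
      w = H.flow (H.next^[l] x) (s - H.nextTime l x) := by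
  induction L with
  | zero =>
    intro x b u hbas hfwd hu s w hs hsb hsT hm
    have hx : x ∈ H.bas := hbas 0 le_rfl
    have hsT' : s < H.time x := by simpa [nextTime] using hsT
    have hx' : x ∉ H.exits := fun h => by linarith [(exits_regular h).2.1]
    refine ⟨0, le_rfl, by simpa [nextTime] using hs.le, hsT.le, ?_⟩
    have heq := hu.isExecution.eq_flow (hu.start_flow hx') hx
    simp only [nextTime, Finset.range_zero, Finset.sum_empty, sub_zero, Function.iterate_zero, id]
    rcases hm with hm | hm
    · rw [← hm, heq s ⟨hs.le, hsb⟩ hsT']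
    · refine tendsto_nhds_unique hm ?_
      have h1 := (continuousOn_flow hx s ⟨hs.le, hsT'.le⟩).mono (s := Ico 0 s)
        fun r hr => ⟨hr.1, hr.2.le.trans hsT'.le⟩
      have h2 := h1.congr' (eventually_nhdsWithin_of_forall fun r hr =>
        (heq r ⟨hr.1, hr.2.le.trans hsb⟩ (hr.2.trans hsT')).symm)
      rwa [nhdsWithin_Ico_eq_nhdsLT hs] at h2
  | succ L ih =>
    intro x b u hbas hfwd hu s w hs hsb hsT hm
    have hx : x ∈ H.bas := hbas 0 (Nat.zero_le _)
    have hn : H.next x ∈ H.fwd := hfwd 1 (by omega) one_pos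
    -- Past the first transition, the trajectory shifted in time is one from `H.next x`, and the
    -- induction hypothesis applies to it.
    have ih' : H.time x < s → ∃ l ≤ L + 1, H.nextTime l x ≤ s ∧ s ≤ H.nextTime (l + 1) x ∧
        w = H.flow (H.next^[l] x) (s - H.nextTime l x) := by
      intro hlt
      have hu' := hu.of_next hx hn (hlt.trans_le hsb)
      have hm' : MeetsAt (fun t => u (t + H.time x)) (s - H.time x) w := by
        rcases hm with hm | hm
        · left; simpa using hm
        · right
          refine hm.comp (tendsto_nhdsWithin_iff.2 ⟨?_, ?_⟩)
          · have : Tendsto (fun t => t + H.time x) (𝓝 (s - H.time x))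
              (𝓝 (s - H.time x + H.time x)) := (continuous_add_const _).tendsto _
            rw [sub_add_cancel] at this
            exact this.mono_left nhdsWithin_le_nhds
          · exact eventually_nhdsWithin_of_forall fun r hr => by
              show r + H.time x < s
              have : r < s - H.time x := hr
              linarith
      obtain ⟨l, hl, h1, h2, h3⟩ := ih (x := H.next x) (fun i hi => hbas (i + 1) (by omega))
        (fun i hi hi0 => hfwd (i + 1) (by omega) (by omega)) hu' (by linarith) (by linarith)
        (by rw [nextTime_succ] at hsT; linarith) hm'
      refine ⟨l + 1, by omega, by rw [nextTime_succ]; linarith,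
        by rw [nextTime_succ]; linarith, ?_⟩
      rw [h3, nextTime_succ, sub_add_eq_sub_sub]
      rfl
    by_cases hx' : x ∈ H.exits
    · exact ih' (by rw [(exits_regular hx').2.1]; exact hs)
    have heq := hu.isExecution.eq_flow (hu.start_flow hx') hx
    rcases lt_trichotomy (H.time x) s with h | h | h
    · exact ih' h
    -- Exactly at the transition the exit point belongs to stretch `0`, at its full length, and the
    -- point after the reset to stretch `1`, at time `0`.
    · subst h
      obtain ⟨h1, h2, -⟩ := hu.isExecution.at_time (hu.start_flow hx') hx hx' hsb
      have hhit : w = H.hit x → ∃ l ≤ L + 1, H.nextTime l x ≤ H.time x ∧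
          H.time x ≤ H.nextTime (l + 1) x ∧
          w = H.flow (H.next^[l] x) (H.time x - H.nextTime l x) := fun hw =>
        ⟨0, Nat.zero_le _, by simpa [nextTime] using hs.le, by simp [nextTime], by
          rw [hw, nextTime, Finset.sum_range_zero, sub_zero]; rfl⟩
      rcases hm with hm | hm
      · rcases h2 with h2 | h2
        · exact hhit (hm.symm.trans h2)
        · have hnb : H.next x ∈ H.bas := hbas 1 (by omega)
          refine ⟨1, by omega, by simp [nextTime], ?_, ?_⟩
          · rw [nextTime_succ]
            have := time_nonneg hnb
            simp only [nextTime, Finset.range_one, Finset.sum_singleton, Function.iterate_zero, id]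
            linarith
          · rw [← hm, h2]
            simp [nextTime, flow_zero hnb]
      · exact hhit (tendsto_nhds_unique hm h1)
    · refine ⟨0, Nat.zero_le _, by simpa [nextTime] using hs.le, by simpa [nextTime] using h.le, ?_⟩
      simp only [nextTime, Finset.range_zero, Finset.sum_empty, sub_zero, Function.iterate_zero, id]
      rcases hm with hm | hm
      · rw [← hm, heq s ⟨hs.le, hsb⟩ h]
      · refine tendsto_nhds_unique hm ?_
        have h1 := (continuousOn_flow hx s ⟨hs.le, h.le⟩).mono (s := Ico 0 s)
          fun r hr => ⟨hr.1, hr.2.le.trans h.le⟩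
        have h2 := h1.congr' (eventually_nhdsWithin_of_forall fun r hr =>
          (heq r ⟨hr.1, hr.2.le.trans hsb⟩ (hr.2.trans h)).symm)
        rwa [nhdsWithin_Ico_eq_nhdsLT hs] at h2

/-- Points that a trajectory meets. -/
theorem IsTrajectory.meetsAt_flow {l : ℕ} : ∀ {x : Σ j, D j} {b : ℝ} {u : ℝ → Σ j, D j},
    (∀ i ≤ l, H.next^[i] x ∈ H.bas) → (∀ i ≤ l, 0 < i → H.next^[i] x ∈ H.fwd) →
    H.IsTrajectory x b u → ∀ {s : ℝ}, 0 < s → H.nextTime l x + s < b →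
    s ≤ H.time (H.next^[l] x) → MeetsAt u (H.nextTime l x + s) (H.flow (H.next^[l] x) s) := by
  induction l with
  | zero =>
    intro x b u hbas hfwd hu s hs hsb hsT
    have hx : x ∈ H.bas := hbas 0 le_rfl
    simp only [nextTime, Finset.range_zero, Finset.sum_empty, zero_add, Function.iterate_zero,
      id] at *
    have hx' : x ∉ H.exits := fun h => by linarith [(exits_regular h).2.1]
    rcases hsT.eq_or_lt with rfl | h
    · right
      exact (hu.isExecution.at_time (hu.start_flow hx') hx hx' hsb.le).1
    · left
      exact hu.isExecution.eq_flow (hu.start_flow hx') hx s ⟨hs.le, hsb.le⟩ h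
  | succ l ih =>
    intro x b u hbas hfwd hu s hs hsb hsT
    have hx : x ∈ H.bas := hbas 0 (Nat.zero_le _)
    have hn : H.next x ∈ H.fwd := hfwd 1 (by omega) one_pos
    rw [nextTime_succ] at hsb ⊢
    have hnn : 0 ≤ H.nextTime l (H.next x) := Finset.sum_nonneg fun i hi =>
      time_nonneg (hbas (i + 1) (by have := Finset.mem_range.1 hi; omega))
    have hu' := hu.of_next hx hn (by linarith)
    have := ih (x := H.next x) (fun i hi => hbas (i + 1) (by omega))
        (fun i hi hi0 => hfwd (i + 1) (by omega) (by omega)) hu' hs (by linarith) hsT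
    rcases this with h | h
    · left
      rw [← show H.nextTime l (H.next x) + s + H.time x = H.time x + H.nextTime l (H.next x) + s by
        ring]
      exact h
    · right
      have h2 := h.comp (f := fun t => t - H.time x) (x := 𝓝[<] (H.time x + H.nextTime l (H.next x) + s))
        (tendsto_nhdsWithin_iff.2 ⟨?_, ?_⟩)
      · refine h2.congr fun t => ?_
        simp
      · have : Tendsto (fun t => t - H.time x) (𝓝 (H.time x + H.nextTime l (H.next x) + s))
              (𝓝 (H.time x + H.nextTime l (H.next x) + s - H.time x)) :=
          (continuous_id.sub continuous_const).tendsto _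
        rw [show H.time x + H.nextTime l (H.next x) + s - H.time x = H.nextTime l (H.next x) + s by
          ring] at this
        exact this.mono_left nhdsWithin_le_nhds
      · exact eventually_nhdsWithin_of_forall fun r hr => by
          show r - H.time x < H.nextTime l (H.next x) + s
          have : r < H.time x + H.nextTime l (H.next x) + s := hr
          linarith

end HybridSystem

end Hybrid

end HybridDS

namespace HybridDS

/-! ### Maps of constant rank -/

section ConstantRank

variable {X Y Z : Type*} [NormedAddCommGroup X] [NormedSpace ℝ X] [FiniteDimensional ℝ X]
  [NormedAddCommGroup Y] [NormedSpace ℝ Y]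
  [NormedAddCommGroup Z] [NormedSpace ℝ Z] [FiniteDimensional ℝ Z]

/-- The inverse function theorem for maps that are smooth near a point. -/
theorem exists_smooth_local_inverse {V W : Type*} [NormedAddCommGroup V] [NormedSpace ℝ V]
    [CompleteSpace V] [NormedAddCommGroup W] [NormedSpace ℝ W] {f : V → W} {x₀ : V} {f' : V ≃L[ℝ] W}
    (hf : ∀ᶠ x in 𝓝 x₀, ContDiffAt ℝ ∞ f x) (hf' : HasFDerivAt f (f' : V →L[ℝ] W) x₀) :
    ∃ h : W → V, h (f x₀) = x₀ ∧ (∀ᶠ z in 𝓝 (f x₀), ContDiffAt ℝ ∞ h z) ∧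
      (∀ᶠ x in 𝓝 x₀, h (f x) = x) ∧ ∀ᶠ z in 𝓝 (f x₀), f (h z) = z := by
  have hf0 := hf.self_of_nhds
  let e := hf0.toOpenPartialHomeomorph f hf' (by simp)
  have hx₀ : x₀ ∈ e.source := hf0.mem_toOpenPartialHomeomorph_source hf' (by simp)
  have hec : ∀ x, e x = f x := fun x => by
    rw [← ContDiffAt.toOpenPartialHomeomorph_coe hf0 hf' (by simp)]
  have ht : f x₀ ∈ e.target := by rw [← hec]; exact e.map_source hx₀
  have hsymm0 : e.symm (f x₀) = x₀ := by rw [← hec]; exact e.left_inv hx₀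
  -- Invertibility of the derivative persists nearby. It is required at all these points, since
  -- `C^∞` at one point gives neighbourhoods that depend on the order and so says nothing about
  -- `C^∞` at the points around it.
  have hinv : ∀ᶠ x in 𝓝 x₀, ∃ A : V ≃L[ℝ] W, (A : V →L[ℝ] W) = fderiv ℝ f x := by
    have h1 : ContinuousAt (fderiv ℝ f) x₀ :=
      (hf0.fderiv_right (m := 0) (by exact_mod_cast le_top)).continuousAt
    refine h1.eventually (p := fun A => A ∈ range ((↑) : (V ≃L[ℝ] W) → V →L[ℝ] W)) ?_
    rw [hf'.fderiv]
    exact ContinuousLinearEquiv.nhds _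
  have hcont : ContinuousAt e.symm (f x₀) := e.continuousAt_symm ht
  refine ⟨e.symm, hsymm0, ?_, ?_, ?_⟩
  · filter_upwards [e.open_target.mem_nhds ht,
      hcont.eventually (by rw [hsymm0]; exact hf.and hinv)] with z hz ⟨h1, A, hA⟩
    have he : (e : V → W) = f := funext hec
    refine e.contDiffAt_symm (f₀' := A) hz ?_ ?_
    · rw [he, hA]
      exact (h1.differentiableAt (by simp)).hasFDerivAt
    · rw [he]
      exact h1
  · filter_upwards [e.open_source.mem_nhds hx₀] with x hx
    rw [← hec]
    exact e.left_inv hx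
  · filter_upwards [e.open_target.mem_nhds ht] with z hz
    rw [← hec]
    exact e.right_inv hz

/-- A map of constant rank factors locally through a linear map of the same rank. -/
theorem exists_section_of_constant_rank {G : X → Y} {x₀ : X}
    (hGs : ∀ᶠ x in 𝓝 x₀, ContDiffAt ℝ ∞ G x)
    (π : Y →L[ℝ] Z)
    (hrank : ∀ᶠ x in 𝓝 x₀, Module.finrank ℝ (fderiv ℝ G x).range = Module.finrank ℝ Z)
    (hsurj : Function.Surjective (π ∘L fderiv ℝ G x₀)) :
    ∃ s : Z → X, s (π (G x₀)) = x₀ ∧ (∀ᶠ z in 𝓝 (π (G x₀)), ContDiffAt ℝ ∞ s z) ∧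
      (∀ᶠ z in 𝓝 (π (G x₀)), π (G (s z)) = z) ∧ ∀ᶠ x in 𝓝 x₀, G x = G (s (π (G x))) := by
  have : CompleteSpace X := FiniteDimensional.complete ℝ X
  have hG := hGs.self_of_nhds
  set L₀ : X →L[ℝ] Z := π ∘L fderiv ℝ G x₀ with hL₀
  obtain ⟨B', hB'⟩ := (L₀ : X →ₗ[ℝ] Z).exists_rightInverse_of_surjective
    (LinearMap.range_eq_top.2 hsurj)
  let B : Z →L[ℝ] X := LinearMap.toContinuousLinearMap B'
  have hB : ∀ z, L₀ (B z) = z := fun z => LinearMap.congr_fun hB' z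
  -- In the coordinates `Θ` the map `π ∘ G` becomes the linear map `L₀`. The correction by the right
  -- inverse `B` has derivative zero at `x₀`, so `Θ` is a local diffeomorphism.
  let Θ : X → X := fun x => x + B (π (G x) - L₀ x)
  have hΘs : ∀ᶠ x in 𝓝 x₀, ContDiffAt ℝ ∞ Θ x := by
    filter_upwards [hGs] with x hx
    exact contDiffAt_id.add
      (B.contDiff.contDiffAt.comp x ((π.contDiff.contDiffAt.comp x hx).sub L₀.contDiff.contDiffAt))
  have hΘ := hΘs.self_of_nhds
  have hΘ' : HasFDerivAt Θ ((ContinuousLinearEquiv.refl ℝ X : X ≃L[ℝ] X) : X →L[ℝ] X) x₀ := by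
    have h1 : HasFDerivAt (fun x => π (G x) - L₀ x) (L₀ - L₀) x₀ :=
      (π.hasFDerivAt.comp x₀ (hG.differentiableAt (by simp)).hasFDerivAt).sub L₀.hasFDerivAt
    have h2 := (hasFDerivAt_id (𝕜 := ℝ) x₀).add (B.hasFDerivAt.comp x₀ h1)
    refine h2.congr_fderiv ?_
    ext x
    simp
  have hLΘ : ∀ x, L₀ (Θ x) = π (G x) := fun x => by simp [Θ, hB]
  set w₀ := Θ x₀ with hw₀
  obtain ⟨e', hsymm0, hsymms, hleft, hright⟩ := exists_smooth_local_inverse hΘs hΘ'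
  have hsymm := hsymms.self_of_nhds
  have hG1 : ∀ᶠ x in 𝓝 x₀, ContDiffAt ℝ 1 G x :=
    (hG.of_le (by exact_mod_cast le_top)).eventually (by simp)
  -- Near `x₀` the map `π` sends the range of `fderiv ℝ G x` onto `Z`. By the rank hypothesis both
  -- have the same dimension, so `π` is injective on this range.
  have hinj : ∀ᶠ x in 𝓝 x₀, ∀ y ∈ (fderiv ℝ G x).range, π y = 0 → y = 0 := by
    have hc : ContinuousAt (fun x => (π ∘L fderiv ℝ G x) ∘L B) x₀ := by
      have h1 : ContinuousAt (fderiv ℝ G) x₀ :=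
        (hG.fderiv_right (m := 0) (by exact_mod_cast le_top)).continuousAt
      exact (continuousAt_const.clm_comp h1).clm_comp continuousAt_const
    have h0 : (π ∘L fderiv ℝ G x₀) ∘L B = (ContinuousLinearEquiv.refl ℝ Z : Z →L[ℝ] Z) := by
      ext z; exact hB z
    have : CompleteSpace Z := FiniteDimensional.complete ℝ Z
    have h2 := hc.eventually (p := fun A => A ∈ range ((↑) : (Z ≃L[ℝ] Z) → Z →L[ℝ] Z))
      (by
        show _ ∈ 𝓝 ((π ∘L fderiv ℝ G x₀) ∘L B)
        rw [h0]; exact ContinuousLinearEquiv.nhds _)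
    filter_upwards [h2, hrank] with x hx hr y hy hy0
    obtain ⟨A, hA⟩ := hx
    let ρ : (fderiv ℝ G x).range →ₗ[ℝ] Z := (π : Y →ₗ[ℝ] Z).domRestrict _
    have hρ : Function.Surjective ρ := fun z => by
      refine ⟨⟨fderiv ℝ G x (B (A.symm z)), LinearMap.mem_range_self _ _⟩, ?_⟩
      have := congrArg (fun T : Z →L[ℝ] Z => T (A.symm z)) hA
      simp only [ContinuousLinearEquiv.coe_coe, ContinuousLinearEquiv.apply_symm_apply] at this
      exact this.symm
    have : Function.Injective ρ := (LinearMap.injective_iff_surjective_of_finrank_eq_finrank hr).2 hρ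
    have h3 : (⟨y, hy⟩ : (fderiv ℝ G x).range) = 0 := this (by rw [map_zero]; exact hy0)
    exact congrArg Subtype.val h3
  have hgood : ∀ᶠ w in 𝓝 w₀, Θ (e' w) = w ∧ ContDiffAt ℝ 1 e' w ∧
      ContDiffAt ℝ 1 G (e' w) ∧ ∀ y ∈ (fderiv ℝ G (e' w)).range, π y = 0 → y = 0 := by
    refine hright.and (.and ?_ ?_)
    · exact (hsymm.of_le (by exact_mod_cast le_top)).eventually (by simp)
    · exact hsymm.continuousAt.eventually (by rw [hsymm0]; exact hG1.and hinj)
  obtain ⟨ε, hε, hball⟩ := Metric.eventually_nhds_iff_ball.1 hgood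
  have hLe : ∀ w, Θ (e' w) = w → π (G (e' w)) = L₀ w := fun w hw => by
    rw [← hLΘ, hw]
  -- Along a segment in a fibre of `L₀` the value of `π ∘ G` is constant. So the velocity of `G` is
  -- killed by `π`, and as it lies in the range of the derivative, it vanishes.
  have hconst : ∀ w ∈ Metric.ball w₀ ε, ∀ w' ∈ Metric.ball w₀ ε, L₀ w = L₀ w' →
      G (e' w) = G (e' w') := by
    intro w hw w' hw' hww
    let ℓ : ℝ → X := fun t => w + t • (w' - w)
    have hℓ : ∀ t ∈ Icc (0 : ℝ) 1, ℓ t ∈ Metric.ball w₀ ε := fun t ht =>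
      (convex_ball w₀ ε).add_smul_sub_mem hw hw' ht
    have hℓ' : ∀ t, HasDerivAt ℓ (w' - w) t := fun t => by
      have := ((hasDerivAt_id t).smul_const (w' - w)).const_add w
      rwa [one_smul] at this
    have hd : ∀ t ∈ Icc (0 : ℝ) 1, HasDerivAt (fun t => G (e' (ℓ t))) 0 t := by
      intro t ht
      obtain ⟨h1, h2, h3, h4⟩ := hball _ (hℓ t ht)
      have d1 := (h2.differentiableAt (by simp)).hasFDerivAt.comp_hasDerivAt t (hℓ' t)
      have d2 := (h3.differentiableAt (by simp)).hasFDerivAt.comp_hasDerivAt t d1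
      have d3 := π.hasFDerivAt.comp_hasDerivAt t d2
      have d4 : HasDerivAt (fun t => L₀ (ℓ t)) 0 t := by
        have := L₀.hasFDerivAt.comp_hasDerivAt t (hℓ' t)
        rwa [map_sub, hww, sub_self] at this
      have d5 : (fun t => L₀ (ℓ t)) =ᶠ[𝓝 t] (π ∘ (G ∘ (e' ∘ ℓ))) := by
        have := (hℓ' t).continuousAt.eventually (Metric.isOpen_ball.mem_nhds (hℓ t ht))
        filter_upwards [this] with t' ht'
        exact (hLe _ (hball _ ht').1).symm
      have d6 := d3.unique (d4.congr_of_eventuallyEq d5.symm)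
      have d7 := h4 _ (LinearMap.mem_range_self _ _) d6
      have d2' : HasDerivAt (fun t => G (e' (ℓ t))) _ t := d2
      exact d7 ▸ d2'
    have := constant_of_has_deriv_right_zero (f := fun t => G (e' (ℓ t))) (a := 0) (b := 1)
      (fun t ht => (hd t ht).continuousAt.continuousWithinAt)
      (fun t ht => (hd t (Ico_subset_Icc_self ht)).hasDerivWithinAt) 1 (by simp)
    simp only [ℓ, zero_smul, one_smul, add_zero, add_sub_cancel] at this
    exact this.symm
  set z₀ := π (G x₀) with hz₀
  have hz₀' : L₀ w₀ = z₀ := hLΘ x₀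
  -- The affine section of `L₀` through `w₀`; pulled back by the inverse of `Θ` it gives `s`.
  let a : Z → X := fun z => w₀ + B (z - z₀)
  have ha0 : a z₀ = w₀ := by simp [a]
  have hak : ContDiff ℝ ∞ a := contDiff_const.add (B.contDiff.comp (contDiff_id.sub contDiff_const))
  have hLa : ∀ z, L₀ (a z) = z := fun z => by simp [a, hB, hz₀']
  have haball : ∀ᶠ z in 𝓝 z₀, a z ∈ Metric.ball w₀ ε :=
    hak.continuous.continuousAt.eventually (by rw [ha0]; exact Metric.ball_mem_nhds _ hε)
  refine ⟨fun z => e' (a z), ?_, ?_, ?_, ?_⟩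
  · simp only [ha0]
    exact hsymm0
  · filter_upwards [hak.continuous.continuousAt.eventually (by rw [ha0]; exact hsymms)] with z hz
    exact ContDiffAt.comp z hz hak.contDiffAt
  · filter_upwards [haball] with z hz
    rw [hLe _ (hball _ hz).1, hLa]
  · have h1 : ∀ᶠ x in 𝓝 x₀, Θ x ∈ Metric.ball w₀ ε :=
      hΘ.continuousAt.eventually (Metric.ball_mem_nhds _ hε)
    have h2 : ∀ᶠ x in 𝓝 x₀, a (π (G x)) ∈ Metric.ball w₀ ε :=
      (π.continuous.continuousAt.comp hG.continuousAt).eventually haball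
    filter_upwards [h1, h2, hleft] with x hx1 hx2 hx3
    have := hconst _ hx1 _ hx2 (by rw [hLΘ, hLa])
    rwa [hx3] at this

omit [FiniteDimensional ℝ X] in
theorem hasFDerivAt_iterate {g : X → X} {x₀ : X} {A : X →L[ℝ] X} (hg : HasFDerivAt g A x₀)
    (h0 : g x₀ = x₀) (m : ℕ) : HasFDerivAt (g^[m]) (A ^ m) x₀ := by
  induction m with
  | zero => exact hasFDerivAt_id x₀
  | succ m ih =>
    rw [Function.iterate_succ, pow_succ]
    exact HasFDerivAt.comp x₀ (by rw [h0]; exact ih) hg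

omit [FiniteDimensional ℝ X] in
theorem contDiffAt_iterate {g : X → X} {x₀ : X} {k : WithTop ℕ∞} (hg : ContDiffAt ℝ k g x₀)
    (h0 : g x₀ = x₀) (m : ℕ) : ContDiffAt ℝ k (g^[m]) x₀ := by
  induction m with
  | zero => exact contDiffAt_id
  | succ m ih =>
    rw [Function.iterate_succ]
    exact ContDiffAt.comp x₀ (by rw [h0]; exact ih) hg

/-- A nonzero `v` in the kernel and in the range of `A ^ m` lies in the ranges of all lower powers.
So the rank drops at each of the `m` multiplications by `A` that lead from `A` to `A ^ (m + 1)`,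
more often than a rank below `m` allows. -/
theorem ker_disjoint_range_pow {A : X →ₗ[ℝ] X} {m : ℕ} (h : Module.finrank ℝ A.range < m) {v : X}
    (hv : v ∈ (A ^ m).range) (hA : A v = 0) : v = 0 := by
  by_contra hne
  have key : ∀ k ≤ m, Module.finrank ℝ (A ^ (k + 1)).range + k ≤ Module.finrank ℝ A.range := by
    intro k hk
    induction k with
    | zero => rw [zero_add, pow_one, add_zero]
    | succ k ih =>
      have ih := ih (by omega)
      have hvk : v ∈ (A ^ (k + 1)).range := by
        obtain ⟨w, rfl⟩ := hv
        refine ⟨(A ^ (m - (k + 1))) w, ?_⟩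
        rw [← Module.End.mul_apply, ← pow_add, show k + 1 + (m - (k + 1)) = m by omega]
      have h1 := LinearMap.finrank_range_add_finrank_ker (A.domRestrict (A ^ (k + 1)).range)
      have h2 : (A.domRestrict (A ^ (k + 1)).range).range = (A ^ (k + 1 + 1)).range := by
        ext y
        constructor
        · rintro ⟨⟨_, w, rfl⟩, rfl⟩
          exact ⟨w, by rw [pow_succ']; rfl⟩
        · rintro ⟨w, rfl⟩
          exact ⟨⟨(A ^ (k + 1)) w, w, rfl⟩, by rw [pow_succ' A (k + 1)]; rfl⟩
      have h3 : 0 < Module.finrank ℝ (A.domRestrict (A ^ (k + 1)).range).ker := by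
        refine Module.finrank_pos_iff_exists_ne_zero.2 ⟨⟨⟨v, hvk⟩, hA⟩, fun h => hne ?_⟩
        exact congrArg (fun w => (w : (A ^ (k + 1)).range).1) (congrArg Subtype.val h)
      rw [h2] at h1
      omega
  have := key m le_rfl
  omega

omit [FiniteDimensional ℝ X] in
theorem eventually_contDiffAt_iterate {g : X → X} {x₀ : X} {k : WithTop ℕ∞}
    (hg : ∀ᶠ x in 𝓝 x₀, ContDiffAt ℝ k g x) (h0 : g x₀ = x₀) (m : ℕ) :
    ∀ᶠ x in 𝓝 x₀, ContDiffAt ℝ k (g^[m]) x := by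
  induction m with
  | zero => exact .of_forall fun x => contDiffAt_id
  | succ m ih =>
    filter_upwards [hg, hg.self_of_nhds.continuousAt.eventually (by rw [h0]; exact ih)] with x h1 h2
    rw [Function.iterate_succ]
    exact ContDiffAt.comp x h2 h1

/-- A discrete system, an iterate of which has constant rank near a fixed point, reduces near the
fixed point to a local diffeomorphism. -/
theorem exists_reduction {g : X → X} {y₀ : X} (hgs : ∀ᶠ y in 𝓝 y₀, ContDiffAt ℝ ∞ g y)
    (h0 : g y₀ = y₀)
    {m r : ℕ} (hm : Module.finrank ℝ (fderiv ℝ g y₀).range < m)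
    (hr : ∀ᶠ y in 𝓝 y₀, Module.finrank ℝ (fderiv ℝ (g^[m]) y).range = r) :
    ∃ (χ : X →L[ℝ] EuclideanSpace ℝ (Fin r)) (σ : EuclideanSpace ℝ (Fin r) → X)
      (f h : EuclideanSpace ℝ (Fin r) → EuclideanSpace ℝ (Fin r)),
      σ (χ y₀) = y₀ ∧ (∀ᶠ z in 𝓝 (χ y₀), ContDiffAt ℝ ∞ σ z) ∧ (∀ᶠ z in 𝓝 (χ y₀), χ (σ z) = z) ∧
      f (χ y₀) = χ y₀ ∧ (∀ᶠ z in 𝓝 (χ y₀), ContDiffAt ℝ ∞ f z) ∧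
      h (χ y₀) = χ y₀ ∧ (∀ᶠ z in 𝓝 (χ y₀), ContDiffAt ℝ ∞ h z) ∧
      (∀ᶠ z in 𝓝 (χ y₀), h (f z) = z) ∧ (∀ᶠ z in 𝓝 (χ y₀), f (h z) = z) ∧
      (∀ᶠ z in 𝓝 (χ y₀), g (σ z) = σ (f z)) ∧
      ∀ᶠ y in 𝓝 y₀, g^[m] y = σ (χ (g^[m] y)) := by
  have hg := hgs.self_of_nhds
  set A := fderiv ℝ g y₀ with hA
  have hgA : HasFDerivAt g A y₀ := (hg.differentiableAt (by simp)).hasFDerivAt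
  have hGA := hasFDerivAt_iterate hgA h0 m
  have hG := contDiffAt_iterate hg h0 m
  have hGs := eventually_contDiffAt_iterate hgs h0 m
  have hG0 : g^[m] y₀ = y₀ := Function.iterate_fixed h0 m
  have hcoe : ∀ k : ℕ, ((A ^ k : X →L[ℝ] X) : X →ₗ[ℝ] X) = (A : X →ₗ[ℝ] X) ^ k := fun k => by
    induction k with
    | zero => rfl
    | succ k ih => rw [pow_succ, pow_succ, ← ih]; rfl
  -- The range of the derivative of `g^[m]` is the tangent space of the submanifold looked for; `χ`
  -- is a projection to it, read in coordinates.
  let R : Submodule ℝ X := (A ^ m : X →L[ℝ] X).range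
  have hRr : Module.finrank ℝ R = r := by
    have := hr.self_of_nhds
    rwa [hGA.fderiv] at this
  let iso : R ≃ₗ[ℝ] EuclideanSpace ℝ (Fin r) :=
    LinearEquiv.ofFinrankEq _ _ (by rw [hRr]; simp)
  obtain ⟨p, hp⟩ := R.subtype.exists_leftInverse_of_injective (Submodule.ker_subtype R)
  let χ : X →L[ℝ] EuclideanSpace ℝ (Fin r) := LinearMap.toContinuousLinearMap (iso.toLinearMap ∘ₗ p)
  have hχ : ∀ w : R, χ w = iso w := fun w => congrArg iso (LinearMap.congr_fun hp w)
  have hχinj : ∀ w ∈ R, χ w = 0 → w = 0 := fun w hw h => by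
    have h1 := hχ ⟨w, hw⟩
    rw [h] at h1
    exact congrArg Subtype.val (iso.map_eq_zero_iff.1 h1.symm)
  have hsurj : Function.Surjective (χ ∘L fderiv ℝ (g^[m]) y₀) := by
    rw [hGA.fderiv]
    intro z
    obtain ⟨w, hw⟩ := (iso.symm z).2
    refine ⟨w, ?_⟩
    have : χ (iso.symm z : R) = z := by rw [hχ]; simp
    rw [← hw] at this
    exact this
  obtain ⟨s, hs0, hsks, hs1, hs2⟩ := exists_section_of_constant_rank hGs χ (by simpa using hr) hsurj
  rw [hG0] at hs0 hsks hs1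
  have hsk := hsks.self_of_nhds
  set z₀ := χ y₀ with hz₀
  -- The parametrization passes through `g^[m]`, so its values lie in the image of `g^[m]`, and `χ ∘
  -- σ` is the identity because `s` is a section.
  let σ : EuclideanSpace ℝ (Fin r) → X := fun z => g^[m] (s z)
  have hσ0 : σ z₀ = y₀ := by simp only [σ, hs0, hG0]
  have hσk : ∀ᶠ z in 𝓝 z₀, ContDiffAt ℝ ∞ σ z := by
    filter_upwards [hsks, hsk.continuousAt.eventually (by rw [hs0]; exact hGs)] with z h1 h2
    exact ContDiffAt.comp z h2 h1
  have hfk : ∀ᶠ z in 𝓝 z₀, ContDiffAt ℝ ∞ (fun z => χ (g (σ z))) z := by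
    filter_upwards [hσk, hσk.self_of_nhds.continuousAt.eventually (by rw [hσ0]; exact hgs)] with
      z h1 h2
    exact χ.contDiff.contDiffAt.comp z (ContDiffAt.comp z h2 h1)
  have hσd : HasFDerivAt σ ((A ^ m) ∘L fderiv ℝ s z₀) z₀ :=
    HasFDerivAt.comp z₀ (by rw [hs0]; exact hGA) (hsk.differentiableAt (by simp)).hasFDerivAt
  have hχσ : ∀ z, χ (((A ^ m) ∘L fderiv ℝ s z₀) z) = z := by
    have h1 : HasFDerivAt (fun z => χ (σ z)) (χ ∘L ((A ^ m) ∘L fderiv ℝ s z₀)) z₀ :=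
      χ.hasFDerivAt.comp z₀ hσd
    have h2 := (hasFDerivAt_id (𝕜 := ℝ) z₀).congr_of_eventuallyEq hs1
    exact fun z => congrArg (fun T => T z) (h1.unique h2)
  have hfd : HasFDerivAt (fun z => χ (g (σ z))) (χ ∘L (A ∘L ((A ^ m) ∘L fderiv ℝ s z₀))) z₀ :=
    χ.hasFDerivAt.comp z₀ (HasFDerivAt.comp z₀ (by rw [hσ0]; exact hgA) hσd)
  -- The derivative of `χ ∘ g ∘ σ` is `A` restricted to `R`. It maps `R` to itself, where `χ` is
  -- injective, and is injective there as the kernel of `A` meets the range of `A ^ m` trivially.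
  have hinj : Function.Injective (χ ∘L (A ∘L ((A ^ m) ∘L fderiv ℝ s z₀))) := by
    rw [injective_iff_map_eq_zero]
    intro z hz
    set w := ((A ^ m) ∘L fderiv ℝ s z₀) z with hw
    have hwR : w ∈ R := ⟨_, rfl⟩
    have hAw : A w ∈ R := by
      refine ⟨A (fderiv ℝ s z₀ z), ?_⟩
      show (A ^ m * A) (fderiv ℝ s z₀ z) = (A * A ^ m) (fderiv ℝ s z₀ z)
      rw [← pow_succ, ← pow_succ']
    have h1 : A w = 0 := hχinj _ hAw hz
    have h2 : w = 0 := ker_disjoint_range_pow (A := (A : X →ₗ[ℝ] X)) hm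
      (by rw [← hcoe]; exact hwR) h1
    rw [← hχσ z, ← hw, h2, map_zero]
  let f' : EuclideanSpace ℝ (Fin r) ≃L[ℝ] EuclideanSpace ℝ (Fin r) :=
    (LinearEquiv.ofInjectiveEndo (χ ∘L (A ∘L ((A ^ m) ∘L fderiv ℝ s z₀)) :
      EuclideanSpace ℝ (Fin r) →L[ℝ] EuclideanSpace ℝ (Fin r)).toLinearMap
      hinj).toContinuousLinearEquiv
  have hf' : (f' : EuclideanSpace ℝ (Fin r) →L[ℝ] EuclideanSpace ℝ (Fin r)) =
      χ ∘L (A ∘L ((A ^ m) ∘L fderiv ℝ s z₀)) := by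
    ext1 z
    rfl
  have hf0 : χ (g (σ z₀)) = z₀ := by rw [hσ0, h0]
  obtain ⟨h, h1, h2, h3, h4⟩ := exists_smooth_local_inverse hfk (hf' ▸ hfd)
  rw [hf0] at h1 h2 h4
  refine ⟨χ, σ, fun z => χ (g (σ z)), h, hσ0, hσk, hs1, hf0, hfk, h1, h2, h3, h4, ?_, hs2⟩
  have hgsc : ContinuousAt (fun z => g (s z)) z₀ :=
    ContinuousAt.comp (by rw [hs0]; exact hg.continuousAt) hsk.continuousAt
  have hs2' : ∀ᶠ x in 𝓝 (g (s z₀)), g^[m] x = g^[m] (s (χ (g^[m] x))) := by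
    rw [hs0, h0]; exact hs2
  filter_upwards [hgsc.eventually hs2'] with z hz
  -- As `g` commutes with `g^[m]`, the point `g (σ z)` is again a value of `g^[m]`, and so lies in
  -- the image of `σ`.
  have hcomm : g (g^[m] (s z)) = g^[m] (g (s z)) := by
    rw [← Function.iterate_succ_apply' g m, Function.iterate_succ_apply]
  show g (g^[m] (s z)) = g^[m] (s (χ (g (g^[m] (s z)))))
  rw [hcomm]
  exact hz

end ConstantRank

end HybridDS

namespace HybridDS

/-! ### Submanifolds from local parametrizations -/

section Slices

variable {d : ℕ} [NeZero d] {X : Type*} [TopologicalSpace X]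

/-- On the open set `O`, the set `M` is parametrized by an open subset `A` of a half-space, and the
parametrization `ψ` has a smooth left inverse `q`. -/
structure IsSlice (N : ℕ) [NeZero N] [ChartedSpace (EuclideanHalfSpace N) X] (M : Set X)
    (O : Set X) (A : Set (EuclideanHalfSpace d))
    (ψ : EuclideanHalfSpace d → X) (q : X → EuclideanSpace ℝ (Fin d)) : Prop where
  isOpen_nhd : IsOpen O
  isOpen_dom : IsOpen A
  smooth_param : ContMDiffOn (𝓡∂ d) (𝓡∂ N) ∞ ψ A
  smooth_coord : ContMDiffOn (𝓡∂ N) 𝓘(ℝ, EuclideanSpace ℝ (Fin d)) ∞ q O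
  left_inv : ∀ a ∈ A, q (ψ a) = a.1
  image : ψ '' A = M ∩ O

variable {N : ℕ} [NeZero N] [ChartedSpace (EuclideanHalfSpace N) X] {M : Set X}

namespace IsSlice

variable {O : Set X} {A : Set (EuclideanHalfSpace d)} {ψ : EuclideanHalfSpace d → X}
  {q : X → EuclideanSpace ℝ (Fin d)}

theorem mapsTo (h : IsSlice N M O A ψ q) {a : EuclideanHalfSpace d} (ha : a ∈ A) : ψ a ∈ M ∩ O :=
  h.image ▸ mem_image_of_mem ψ ha

theorem symm_coord (h : IsSlice N M O A ψ q) {a : EuclideanHalfSpace d} (ha : a ∈ A) :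
    (𝓡∂ d).symm (q (ψ a)) = a := by
  rw [h.left_inv a ha]
  exact (𝓡∂ d).left_inv a

theorem param_symm (h : IsSlice N M O A ψ q) {x : X} (hx : x ∈ M ∩ O) : (𝓡∂ d).symm (q x) ∈ A ∧
    ψ ((𝓡∂ d).symm (q x)) = x ∧ ((𝓡∂ d).symm (q x)).1 = q x := by
  rw [← h.image] at hx
  obtain ⟨a, ha, rfl⟩ := hx
  rw [h.symm_coord ha]
  exact ⟨ha, rfl, (h.left_inv a ha).symm⟩

open Classical in
/-- The chart of the set `M` given by a local parametrization. -/
noncomputable def chart (h : IsSlice N M O A ψ q) (p : M) :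
    OpenPartialHomeomorph M (EuclideanHalfSpace d) where
  toFun x := (𝓡∂ d).symm (q x.1)
  -- Off the target `A` the inverse takes the irrelevant value `p`.
  invFun a := if ha : a ∈ A then ⟨ψ a, (h.mapsTo ha).1⟩ else p
  source := {x | x.1 ∈ O}
  target := A
  map_source' x hx := (h.param_symm ⟨x.2, hx⟩).1
  map_target' a ha := by
    rw [mem_ofPred_eq, dif_pos ha]
    exact (h.mapsTo ha).2
  left_inv' x hx := by
    rw [dif_pos (h.param_symm ⟨x.2, hx⟩).1]
    exact Subtype.ext (h.param_symm ⟨x.2, hx⟩).2.1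
  right_inv' a ha := by
    simp only [dif_pos ha]
    exact h.symm_coord ha
  open_source := h.isOpen_nhd.preimage continuous_subtype_val
  open_target := h.isOpen_dom
  continuousOn_toFun := (𝓡∂ d).continuous_symm.comp_continuousOn
    (h.smooth_coord.continuousOn.comp continuous_subtype_val.continuousOn fun _ hx => hx)
  continuousOn_invFun := by
    rw [Topology.IsInducing.subtypeVal.continuousOn_iff]
    refine h.smooth_param.continuousOn.congr fun a ha => ?_
    simp only [Function.comp, dif_pos ha]

theorem chart_source (h : IsSlice N M O A ψ q) (p : M) : (h.chart p).source = {x | x.1 ∈ O} := rfl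

open Classical in
theorem chart_symm_apply (h : IsSlice N M O A ψ q) (p : M) {a : EuclideanHalfSpace d}
    (ha : a ∈ A) : ((h.chart p).symm a).1 = ψ a := by
  change ((if ha : a ∈ A then (⟨ψ a, (h.mapsTo ha).1⟩ : M) else p : M) : X) = ψ a
  rw [dif_pos ha]

end IsSlice

/-- A set that has local parametrizations near all of its points is an embedded submanifold. It
is tangent to a vector field with integral curves that stay in it. -/
theorem exists_submanifold_of_slices [IsManifold (𝓡∂ N) ∞ X]
    (v : ∀ x : X, TangentSpace (𝓡∂ N) x) (G : Set X)
    (hM : ∀ p ∈ M, ∃ (O : Set X) (A : Set (EuclideanHalfSpace d)) (ψ : EuclideanHalfSpace d → X)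
      (q : X → EuclideanSpace ℝ (Fin d)), p ∈ O ∧ IsSlice N M O A ψ q ∧
      (p ∈ G → q p 0 = 0 ∧ ∀ x ∈ M ∩ O, q x 0 = 0 → x ∈ G))
    (hv : ∀ p ∈ M, ∃ (a b t : ℝ) (c : ℝ → X), a < b ∧ t ∈ Icc a b ∧ c t = p ∧
      IsMIntegralCurveOn c v (Icc a b) ∧ ∀ s ∈ Icc a b, c s ∈ M) :
    ∃ (_ : ChartedSpace (EuclideanHalfSpace d) ↥M), IsManifold (𝓡∂ d) ∞ ↥M ∧
      SmoothEmb (𝓡∂ d) (𝓡∂ N) (Subtype.val : ↥M → X) ∧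
      (∀ p : ↥M, v p.1 ∈ range (mfderiv (𝓡∂ d) (𝓡∂ N) (Subtype.val : ↥M → X) p)) ∧
      (∃ O : Set ↥M, IsOpen O ∧ Subtype.val ⁻¹' G = O ∩ (𝓡∂ d).boundary ↥M) := by
  have hM' : ∀ p : M, ∃ (O : Set X) (A : Set (EuclideanHalfSpace d))
      (ψ : EuclideanHalfSpace d → X) (q : X → EuclideanSpace ℝ (Fin d)), p.1 ∈ O ∧
      IsSlice N M O A ψ q ∧ (p.1 ∈ G → q p.1 0 = 0 ∧ ∀ x ∈ M ∩ O, q x 0 = 0 → x ∈ G) :=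
    fun p => hM p.1 p.2
  choose O A ψ q hpO h hG using hM'
  -- The charts are the coordinates `q`. A change of charts is `q p' ∘ ψ p`, which is smooth because
  -- it passes through the ambient manifold.
  let cs : ChartedSpace (EuclideanHalfSpace d) ↥M :=
    { atlas := range fun p => (h p).chart p
      chartAt := fun p => (h p).chart p
      mem_chart_source := hpO
      chart_mem_atlas := fun p => mem_range_self p }
  have hman : IsManifold (𝓡∂ d) ∞ ↥M := by
    refine isManifold_of_contDiffOn (𝓡∂ d) ∞ ↥M ?_
    rintro _ _ ⟨p, rfl⟩ ⟨p', rfl⟩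
    have h1 : ContMDiffOn 𝓘(ℝ, EuclideanSpace ℝ (Fin d)) 𝓘(ℝ, EuclideanSpace ℝ (Fin d)) ∞
        (q p' ∘ ψ p ∘ (𝓡∂ d).symm)
        ((𝓡∂ d).symm ⁻¹' (((h p).chart p).symm.trans ((h p').chart p')).source ∩ range (𝓡∂ d)) := by
      refine (h p').smooth_coord.comp ((h p).smooth_param.comp
        ((𝓡∂ d).contMDiffOn_symm.mono inter_subset_right) ?_) ?_
      · rintro z ⟨hz, -⟩
        exact hz.1
      · rintro z ⟨hz, -⟩
        have h2 := hz.2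
        rw [mem_preimage, IsSlice.chart_source, mem_ofPred_eq] at h2
        change ((((h p).chart p).symm ((𝓡∂ d).symm z) : M) : X) ∈ O p' at h2
        rwa [IsSlice.chart_symm_apply (h p) p hz.1] at h2
    refine h1.contDiffOn.congr ?_
    rintro z ⟨hz, -⟩
    have h2 := hz.2
    rw [mem_preimage, IsSlice.chart_source, mem_ofPred_eq] at h2
    have h3 := (h p').param_symm ⟨Subtype.prop _, h2⟩
    change (((𝓡∂ d).symm (q p' (((h p).chart p).symm ((𝓡∂ d).symm z)).1)) :
      EuclideanHalfSpace d).1 = q p' (ψ p ((𝓡∂ d).symm z))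
    rw [← IsSlice.chart_symm_apply (h p) p hz.1]
    exact h3.2.2
  have hsrc : ∀ p x : M, x ∈ (extChartAt (𝓡∂ d) p).source ↔ x.1 ∈ O p := by
    intro p x
    rw [extChartAt_source]
    rfl
  have hext : ∀ p x : M, x.1 ∈ O p → extChartAt (𝓡∂ d) p x = q p x.1 := fun p x hx =>
    ((h p).param_symm ⟨x.2, hx⟩).2.2
  have hsmooth : ContMDiff (𝓡∂ d) (𝓡∂ N) ∞ (Subtype.val : ↥M → X) := by
    intro p
    have hcont : ContMDiffAt (𝓡∂ d) (𝓡∂ d) ∞ (chartAt (EuclideanHalfSpace d) p) p :=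
      (contMDiffOn_chart (I := 𝓡∂ d) (n := ∞) (x := p)).contMDiffAt
        ((chartAt (EuclideanHalfSpace d) p).open_source.mem_nhds (hpO p))
    have h1 : ContMDiffAt (𝓡∂ d) (𝓡∂ N) ∞ (ψ p ∘ chartAt (EuclideanHalfSpace d) p) p := by
      refine ContMDiffAt.comp p ((h p).smooth_param.contMDiffAt
        ((h p).isOpen_dom.mem_nhds ?_)) hcont
      exact ((h p).param_symm ⟨p.2, hpO p⟩).1
    refine h1.congr_of_eventuallyEq ?_
    filter_upwards [((h p).isOpen_nhd.preimage continuous_subtype_val).mem_nhds (hpO p)] with x hx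
    exact ((h p).param_symm ⟨x.2, hx⟩).2.1.symm
  have hne : (∞ : WithTop ℕ∞) ≠ 0 := by simp
  have hqd : ∀ p : M, MDifferentiableAt (𝓡∂ N) 𝓘(ℝ, EuclideanSpace ℝ (Fin d)) (q p) p.1 :=
    fun p => ((h p).smooth_coord.contMDiffAt ((h p).isOpen_nhd.mem_nhds (hpO p))).mdifferentiableAt
      hne
  refine ⟨cs, hman, ⟨hsmooth, fun p => ?_, .subtypeVal⟩, fun p => ?_, ?_⟩
  -- The chart factors through the inclusion by means of `q p`, so the derivative of the inclusion
  -- is injective.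
  · have h1 : mfderiv (𝓡∂ d) 𝓘(ℝ, EuclideanSpace ℝ (Fin d)) (extChartAt (𝓡∂ d) p) p =
        (mfderiv (𝓡∂ N) 𝓘(ℝ, EuclideanSpace ℝ (Fin d)) (q p) p.1).comp
          (mfderiv (𝓡∂ d) (𝓡∂ N) (Subtype.val : ↥M → X) p) := by
      rw [← mfderiv_comp p (hqd p) (hsmooth.mdifferentiableAt hne)]
      refine Filter.EventuallyEq.mfderiv_eq ?_
      filter_upwards [((h p).isOpen_nhd.preimage continuous_subtype_val).mem_nhds (hpO p)] with x hx
      exact hext p x hx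
    have h2 := (isInvertible_mfderiv_extChartAt (I := 𝓡∂ d) (mem_extChartAt_source p)).injective
    rw [h1] at h2
    exact Function.Injective.of_comp h2
  -- A curve in `M` is locally its own coordinate curve composed with the inverse chart and the
  -- inclusion, so its velocity `v` lies in the range of the derivative of the inclusion.
  · obtain ⟨a, b, t, c, hab, ht, hct, hc, hcM⟩ := hv p.1 p.2
    have hc1 := hc t ht
    have hU : UniqueMDiffWithinAt 𝓘(ℝ, ℝ) (Icc a b) t :=
      ((uniqueDiffOn_Icc hab) t ht).uniqueMDiffWithinAt
    have hO : c ⁻¹' (O p) ∈ 𝓝[Icc a b] t :=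
      hc1.continuousWithinAt.preimage_mem_nhdsWithin ((h p).isOpen_nhd.mem_nhds (hct ▸ hpO p))
    have hqc : HasMFDerivWithinAt 𝓘(ℝ, ℝ) 𝓘(ℝ, EuclideanSpace ℝ (Fin d)) (q p ∘ c)
        (Icc a b ∩ c ⁻¹' O p) t _ :=
      (HasMFDerivAt.comp_hasMFDerivWithinAt t (by rw [hct]; exact (hqd p).hasMFDerivAt) hc1).mono
        inter_subset_left
    have hs : MDifferentiableWithinAt 𝓘(ℝ, EuclideanSpace ℝ (Fin d)) (𝓡∂ d)
        (extChartAt (𝓡∂ d) p).symm (range (𝓡∂ d)) ((q p ∘ c) t) := by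
      refine mdifferentiableWithinAt_extChartAt_symm (I := 𝓡∂ d) (x := p) ?_
      simp only [Function.comp, hct, ← hext p p (hpO p)]
      exact mem_extChartAt_target p
    have h1 := hs.hasMFDerivWithinAt.comp t hqc (by
      rintro s ⟨hs, hs'⟩
      change q p (c s) ∈ range (𝓡∂ d)
      rw [← hext p ⟨c s, hcM s hs⟩ hs']
      exact mem_range_self _)
    have hpt : (extChartAt (𝓡∂ d) p).symm ((q p ∘ c) t) = p := by
      simp only [Function.comp, hct, ← hext p p (hpO p)]
      exact extChartAt_to_inv p
    have h2 := HasMFDerivAt.comp_hasMFDerivWithinAt t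
      (g := (Subtype.val : ↥M → X)) (g' := mfderiv (𝓡∂ d) (𝓡∂ N) (Subtype.val : ↥M → X) p)
      (by
        simp only [Function.comp] at hpt ⊢
        rw [hpt]
        exact (hsmooth.mdifferentiableAt hne).hasMFDerivAt) h1
    have h3 := HasMFDerivWithinAt.congr_of_eventuallyEq h2 (f₁ := c) (by
      filter_upwards [self_mem_nhdsWithin] with s hs
      have h4 : (⟨c s, hcM s hs.1⟩ : M) ∈ (extChartAt (𝓡∂ d) p).source := (hsrc _ _).2 hs.2
      have h5 := (extChartAt (𝓡∂ d) p).left_inv h4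
      rw [hext p ⟨c s, hcM s hs.1⟩ hs.2] at h5
      exact (congrArg Subtype.val h5).symm) (by
      simp only [Function.comp] at hpt ⊢
      rw [hpt, hct])
    have h6 := (hasMFDerivWithinAt_inter' hO).1 h3
    have h7 := hU.eq h6 hc1
    have h8 := DFunLike.congr_fun h7 (1 : ℝ)
    rw [← hct]
    refine ⟨_, h8.trans ?_⟩
    change (1 : ℝ) • v (c t) = v (c t)
    exact one_smul ℝ _
  -- In the slices around points of `G`, the boundary of `M` and `G` are described by the same
  -- equation; other boundary points of `M`, such as starting points of curves, are left out.
  · refine ⟨⋃ p : {p : M // p.1 ∈ G}, {x | x.1 ∈ O p}, isOpen_iUnion fun p =>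
      (h p).isOpen_nhd.preimage continuous_subtype_val, ?_⟩
    have hbd : ∀ p x : M, x.1 ∈ O p → (x ∈ (𝓡∂ d).boundary ↥M ↔ q p x.1 0 = 0) := by
      intro p x hx
      rw [← hext p x hx]
      exact isBoundaryPoint_iff_chart ((hsrc p x).2 hx)
    ext x
    constructor
    · intro hx
      refine ⟨mem_iUnion.2 ⟨⟨x, hx⟩, hpO x⟩, ?_⟩
      rw [hbd x x (hpO x)]
      exact (hG x hx).1
    · rintro ⟨hx, hx'⟩
      obtain ⟨⟨p, hp⟩, hxp⟩ := mem_iUnion.1 hx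
      rw [hbd p x hxp] at hx'
      exact (hG p hp).2 x.1 ⟨x.2, hxp⟩ hx'

end Slices
end HybridDS

namespace HybridDS

/-! ### Smooth maps into hybrid manifolds -/

section SmoothMaps

variable {J : Type*} {n : J → ℕ} [∀ j, NeZero (n j)] {D : J → Type*}
  [∀ j, TopologicalSpace (D j)] [∀ j, ChartedSpace (EuclideanHalfSpace (n j)) (D j)]
  {E₁ H₁ Y : Type*} [NormedAddCommGroup E₁] [NormedSpace ℝ E₁] [TopologicalSpace H₁]
  {I₁ : ModelWithCorners ℝ E₁ H₁} [TopologicalSpace Y] [ChartedSpace H₁ Y]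
  {Z : Type*} [NormedAddCommGroup Z] [NormedSpace ℝ Z]

/-- Near `y`, the map `f` takes values in a single domain, and it is smooth at `y`. -/
def SmoothAt (n : J → ℕ) [∀ j, NeZero (n j)] {D : J → Type*} [∀ j, TopologicalSpace (D j)]
    [∀ j, ChartedSpace (EuclideanHalfSpace (n j)) (D j)]
    (I₁ : ModelWithCorners ℝ E₁ H₁) (f : Y → Σ j, D j) (y : Y) : Prop :=
  ∃ (k : J) (g : Y → D k), (∀ᶠ z in 𝓝 y, f z = ⟨k, g z⟩) ∧ ContMDiffAt I₁ (𝓡∂ (n k)) ∞ g y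

theorem smoothAt_mk {k : J} {g : Y → D k} {y : Y} (hg : ContMDiffAt I₁ (𝓡∂ (n k)) ∞ g y) :
    SmoothAt n I₁ (fun z => (⟨k, g z⟩ : Σ j, D j)) y := ⟨k, g, .of_forall fun _ => rfl, hg⟩

theorem SmoothAt.continuousAt {f : Y → Σ j, D j} {y : Y} (hf : SmoothAt n I₁ f y) :
    ContinuousAt f y := by
  obtain ⟨k, g, h1, h2⟩ := hf
  exact (continuous_sigmaMk.continuousAt.comp h2.continuousAt).congr
    (by filter_upwards [h1] with z hz using hz.symm)

theorem SmoothAt.exists_eq {f : Y → Σ j, D j} {y : Y} (hf : SmoothAt n I₁ f y) {k : J} {x : D k}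
    (hx : f y = ⟨k, x⟩) : ∃ g : Y → D k, g y = x ∧ (∀ᶠ z in 𝓝 y, f z = ⟨k, g z⟩) ∧
      ContMDiffAt I₁ (𝓡∂ (n k)) ∞ g y := by
  obtain ⟨k', g, h1, h2⟩ := hf
  have h3 := h1.self_of_nhds.symm.trans hx
  obtain rfl : k' = k := congrArg Sigma.fst h3
  exact ⟨g, sigma_mk_injective h3, h1, h2⟩

theorem SmoothAt.comp_contMDiffAt {f : Y → Σ j, D j} {y : Y} (hf : SmoothAt n I₁ f y)
    {F : (Σ j, D j) → Z} {p : Σ j, D j} (hp : f y = p)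
    (hF : ContMDiffAt (𝓡∂ (n p.1)) 𝓘(ℝ, Z) ∞ (fun x => F ⟨p.1, x⟩) p.2) :
    ContMDiffAt I₁ 𝓘(ℝ, Z) ∞ (fun z => F (f z)) y := by
  obtain ⟨g, h0, h1, h2⟩ := hf.exists_eq (k := p.1) (x := p.2) hp
  have h3 : ContMDiffAt I₁ 𝓘(ℝ, Z) ∞ ((fun x => F ⟨p.1, x⟩) ∘ g) y :=
    ContMDiffAt.comp y (by rw [h0]; exact hF) h2
  refine h3.congr_of_eventuallyEq ?_
  filter_upwards [h1] with z hz
  simp only [Function.comp, hz]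

theorem SmoothAt.comp {f : Y → Σ j, D j} {y : Y} (hf : SmoothAt n I₁ f y)
    {F : (Σ j, D j) → Σ j, D j} {p : Σ j, D j} (hp : f y = p)
    (hF : SmoothAt n (𝓡∂ (n p.1)) (fun x => F ⟨p.1, x⟩) p.2) :
    SmoothAt n I₁ (fun z => F (f z)) y := by
  obtain ⟨g, h0, h1, h2⟩ := hf.exists_eq (k := p.1) (x := p.2) hp
  obtain ⟨k, G, h3, h4⟩ := hF
  refine ⟨k, G ∘ g, ?_, ContMDiffAt.comp y (by rw [h0]; exact h4) h2⟩
  filter_upwards [h1, h2.continuousAt.eventually (by rw [h0]; exact h3)] with z h5 h6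
  rw [h5]
  exact h6

theorem SmoothAt.comp_left {E₂ H₂ Y' : Type*} [NormedAddCommGroup E₂] [NormedSpace ℝ E₂]
    [TopologicalSpace H₂] {I₂ : ModelWithCorners ℝ E₂ H₂} [TopologicalSpace Y']
    [ChartedSpace H₂ Y'] {f : Y → Σ j, D j} {y : Y'} {φ : Y' → Y} (hf : SmoothAt n I₁ f (φ y))
    (hφ : ContMDiffAt I₂ I₁ ∞ φ y) : SmoothAt n I₂ (fun z => f (φ z)) y := by
  obtain ⟨k, g, h1, h2⟩ := hf
  exact ⟨k, g ∘ φ, hφ.continuousAt.eventually h1, ContMDiffAt.comp y h2 hφ⟩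

/-- The projection to a domain, extended by a constant. -/
noncomputable def toDomain {k : J} (x₀ : D k) : (Σ j, D j) → D k :=
  Function.extend (Sigma.mk k) id fun _ => x₀

omit [∀ j, TopologicalSpace (D j)] in
theorem toDomain_mk {k : J} (x₀ x : D k) : toDomain x₀ ⟨k, x⟩ = x :=
  sigma_mk_injective.extend_apply _ _ x

omit [∀ j, TopologicalSpace (D j)] in
theorem mk_toDomain {k : J} (x₀ : D k) {p : Σ j, D j} (hp : p.1 = k) :
    (⟨k, toDomain x₀ p⟩ : Σ j, D j) = p := by
  obtain ⟨j, x⟩ := p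
  obtain rfl : j = k := hp
  rw [toDomain_mk]

theorem SmoothAt.toDomain {f : Y → Σ j, D j} {y : Y} (hf : SmoothAt n I₁ f y) {k : J} (x₀ : D k)
    (hk : (f y).1 = k) : ContMDiffAt I₁ (𝓡∂ (n k)) ∞ (fun z => HybridDS.toDomain x₀ (f z)) y := by
  obtain ⟨g, -, h1, h2⟩ := hf.exists_eq (k := k) (mk_toDomain x₀ hk).symm
  refine h2.congr_of_eventuallyEq ?_
  filter_upwards [h1] with z hz
  rw [hz, toDomain_mk]

theorem continuousAt_of_smoothAt {F : (Σ j, D j) → Σ j, D j} {p : Σ j, D j}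
    (hF : SmoothAt n (𝓡∂ (n p.1)) (fun x => F ⟨p.1, x⟩) p.2) : ContinuousAt F p :=
  (Topology.IsOpenEmbedding.sigmaMk.continuousAt_iff).1 hF.continuousAt

theorem continuousAt_of_contMDiffAt {F : (Σ j, D j) → Z} {p : Σ j, D j}
    (hF : ContMDiffAt (𝓡∂ (n p.1)) 𝓘(ℝ, Z) ∞ (fun x => F ⟨p.1, x⟩) p.2) : ContinuousAt F p :=
  (Topology.IsOpenEmbedding.sigmaMk.continuousAt_iff).1 hF.continuousAt

namespace HybridSystem

variable [∀ j, IsManifold (𝓡∂ (n j)) ∞ (D j)] {H : HybridSystem n D} [∀ j, T2Space (D j)]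

theorem contMDiffAt_time {p : Σ j, D j} (hp : p ∈ H.bas) :
    ContMDiffAt (𝓡∂ (n p.1)) 𝓘(ℝ, ℝ) ∞ (fun x => H.time ⟨p.1, x⟩) p.2 :=
  (hit_regular (H.smooth_field p.1) (H.guard_open p.1) (H.outward p.1) hp).2.1

theorem smoothAt_hit {p : Σ j, D j} (hp : p ∈ H.bas) :
    SmoothAt n (𝓡∂ (n p.1)) (fun x => H.hit ⟨p.1, x⟩) p.2 :=
  smoothAt_mk (hit_regular (H.smooth_field p.1) (H.guard_open p.1) (H.outward p.1) hp).2.2.2.1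

/-- The reset is smooth only as a map on the guard, but the hitting point always lies in the guard,
so smoothness within the guard suffices. -/
theorem smoothAt_next {p : Σ j, D j} (hp : p ∈ H.bas) :
    SmoothAt n (𝓡∂ (n p.1)) (fun x => H.next ⟨p.1, x⟩) p.2 := by
  obtain ⟨h0, -, -, h1, -⟩ :=
    hit_regular (H.smooth_field p.1) (H.guard_open p.1) (H.outward p.1) hp
  obtain ⟨k, f, h2, h3⟩ := H.smooth_reset p.1 _ (hit_mem_exits hp)
  have hmem : ∀ᶠ x in 𝓝 p.2, hitPt (H.field p.1) (H.guard p.1) x ∈ H.guard p.1 := by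
    filter_upwards [h0] with x hx
    exact hit_mem_exits (H := H) (x := ⟨p.1, x⟩) hx
  refine ⟨k, f ∘ hitPt (H.field p.1) (H.guard p.1), ?_, ?_⟩
  · exact (tendsto_nhdsWithin_iff.2 ⟨h1.continuousAt, hmem⟩).eventually h2
  · rw [← contMDiffWithinAt_univ] at h1 ⊢
    exact contMDiffWithinAt_comp_of_mem p.2 h3 h1 (by rw [nhdsWithin_univ]; exact hmem)

theorem continuousAt_time {p : Σ j, D j} (hp : p ∈ H.bas) : ContinuousAt H.time p :=
  continuousAt_of_contMDiffAt (contMDiffAt_time hp)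

theorem continuousAt_hit {p : Σ j, D j} (hp : p ∈ H.bas) : ContinuousAt H.hit p :=
  continuousAt_of_smoothAt (smoothAt_hit hp)

theorem continuousAt_iterate_next {l : ℕ} {p : Σ j, D j} (hp : ∀ i < l, H.next^[i] p ∈ H.bas) :
    ContinuousAt (H.next^[l]) p := by
  induction l with
  | zero => exact continuousAt_id
  | succ l ih =>
    rw [Function.iterate_succ']
    exact (continuousAt_of_smoothAt (smoothAt_next (hp l l.lt_succ_self))).comp
      (ih fun i hi => hp i (hi.trans l.lt_succ_self))

theorem eventually_iterate_next {l : ℕ} {p : Σ j, D j} (hp : ∀ i < l, H.next^[i] p ∈ H.bas)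
    {s : Set (Σ j, D j)} (hs : IsOpen s) (h : H.next^[l] p ∈ s) :
    ∀ᶠ x in 𝓝 p, H.next^[l] x ∈ s :=
  (continuousAt_iterate_next hp).eventually (hs.mem_nhds h)

theorem continuousAt_nextTime {l : ℕ} {p : Σ j, D j} (hp : ∀ i < l, H.next^[i] p ∈ H.bas) :
    ContinuousAt (H.nextTime l) p := by
  refine tendsto_finsetSum _ fun i hi => ?_
  have hi := Finset.mem_range.1 hi
  exact ((continuousAt_time (hp i hi)).comp
    (continuousAt_iterate_next fun i' hi' => hp i' (hi'.trans hi)))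

theorem _root_.HybridDS.SmoothAt.iterate_next {f : Y → Σ j, D j} {y : Y} (hf : SmoothAt n I₁ f y) {l : ℕ}
    (hp : ∀ i < l, H.next^[i] (f y) ∈ H.bas) : SmoothAt n I₁ (fun z => H.next^[l] (f z)) y := by
  induction l with
  | zero => exact hf
  | succ l ih =>
    simp only [Function.iterate_succ']
    exact (ih fun i hi => hp i (hi.trans l.lt_succ_self)).comp rfl
      (smoothAt_next (hp l l.lt_succ_self))

theorem _root_.HybridDS.SmoothAt.hit {f : Y → Σ j, D j} {y : Y} (hf : SmoothAt n I₁ f y)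
    (hp : f y ∈ H.bas) : SmoothAt n I₁ (fun z => H.hit (f z)) y :=
  hf.comp rfl (smoothAt_hit hp)

theorem _root_.HybridDS.SmoothAt.time {f : Y → Σ j, D j} {y : Y} (hf : SmoothAt n I₁ f y)
    (hp : f y ∈ H.bas) : ContMDiffAt I₁ 𝓘(ℝ, ℝ) ∞ (fun z => H.time (f z)) y :=
  hf.comp_contMDiffAt rfl (contMDiffAt_time hp)

theorem LandsIn.of_iterate_next {l : ℕ} {M : Set (Σ j, D j)} : ∀ {x : Σ j, D j} {b : ℝ},
    (∀ i < l, H.next^[i] x ∈ H.bas) → (∀ i < l, H.next^[i + 1] x ∈ H.fwd) →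
    H.LandsIn M b (H.next^[l] x) → H.LandsIn M (H.nextTime l x + b) x := by
  induction l with
  | zero =>
    intro x b _ _ h
    simpa [nextTime] using h
  | succ l ih =>
    intro x b h1 h2 h
    rw [nextTime_succ, add_assoc]
    exact LandsIn.of_next (h1 0 l.succ_pos) (h2 0 l.succ_pos)
      (ih (fun i hi => h1 (i + 1) (by omega)) (fun i hi => h2 (i + 1) (by omega)) h)

-- The exit point determines everything that follows.
omit [∀ j, T2Space (D j)] in
theorem hit_iterate_congr {x y : Σ j, D j} (h : H.hit x = H.hit y) (l : ℕ) :
    H.hit (H.next^[l] x) = H.hit (H.next^[l] y) ∧ H.next^[l + 1] x = H.next^[l + 1] y := by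
  have key : ∀ l, H.next^[l + 1] x = H.next^[l + 1] y := fun l => by
    rw [Function.iterate_succ_apply, Function.iterate_succ_apply, next_eq_of_hit_eq h]
  refine ⟨?_, key l⟩
  cases l with
  | zero => exact h
  | succ l => rw [key]

/-- The curves into the guard depend smoothly on their starting points. -/
theorem smoothAt_flow {f : Y → Σ j, D j} {y : Y} (hf : SmoothAt n I₁ f y) {τ : Y → ℝ} {A : Set Y}
    (hτ : ContMDiffWithinAt I₁ 𝓘(ℝ, ℝ) ∞ τ A y) (hy : f y ∈ H.bas)
    (hτ' : ∀ z ∈ A, τ z ∈ Icc 0 (H.time (f z))) (hyA : y ∈ A) {k : J} (x₀ : D k)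
    (hk : (f y).1 = k) :
    ContMDiffWithinAt I₁ (𝓡∂ (n k)) ∞ (fun z => HybridDS.toDomain x₀ (H.flow (f z) (τ z))) A y := by
  obtain ⟨g, hg, h1, h2⟩ := hf.exists_eq (mk_toDomain x₀ hk).symm
  have hb : (⟨k, g y⟩ : Σ j, D j) ∈ H.bas := h1.self_of_nhds ▸ hy
  have hev : ∀ᶠ z in 𝓝[A] y, f z = ⟨k, g z⟩ := mem_nhdsWithin_of_mem_nhds h1
  have h3 := (hit_regular (H.smooth_field k) (H.guard_open k) (H.outward k) hb).2.2.1 (τ y) (by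
    have := hτ' y hyA
    rwa [h1.self_of_nhds] at this)
  have h4 : ContMDiffWithinAt I₁ (𝓘(ℝ, ℝ).prod (𝓡∂ (n k))) ∞ (fun z => (τ z, g z)) A y :=
    hτ.prodMk h2.contMDiffWithinAt
  have hbev : ∀ᶠ z in 𝓝[A] y, (⟨k, g z⟩ : Σ j, D j) ∈ H.bas :=
    mem_nhdsWithin_of_mem_nhds ((continuous_sigmaMk.continuousAt.comp h2.continuousAt).eventually
      (isOpen_bas.mem_nhds hb))
  have h5 := contMDiffWithinAt_comp_of_mem y h3 h4 (by
    filter_upwards [hev, hbev, self_mem_nhdsWithin] with z hz hz' hzA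
    have := hτ' z hzA
    rw [hz] at this
    exact ⟨hz', this⟩)
  refine h5.congr_of_eventuallyEq ?_ ?_
  · filter_upwards [hev] with z hz
    rw [hz]
    exact toDomain_mk x₀ _
  · rw [h1.self_of_nhds]
    exact toDomain_mk x₀ _

end HybridSystem

end SmoothMaps

end HybridDS

namespace HybridDS

/-! ### Submanifolds that consist of sheets of curves -/

section HalfSpace

variable {r : ℕ}

/-- The coordinates other than the first. -/
noncomputable def tailL (r : ℕ) : EuclideanSpace ℝ (Fin (r + 1)) →L[ℝ] EuclideanSpace ℝ (Fin r) :=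
  LinearMap.toContinuousLinearMap
    { toFun := fun x => WithLp.toLp 2 fun i => x i.succ
      map_add' := fun _ _ => rfl
      map_smul' := fun _ _ => rfl }

/-- The vector with a given first coordinate. -/
noncomputable def consL (r : ℕ) :
    ℝ × EuclideanSpace ℝ (Fin r) →L[ℝ] EuclideanSpace ℝ (Fin (r + 1)) :=
  LinearMap.toContinuousLinearMap
    { toFun := fun p => WithLp.toLp 2 (Fin.cons p.1 p.2.ofLp : Fin (r + 1) → ℝ)
      map_add' := fun p q => by
        ext i
        refine Fin.cases ?_ (fun i => ?_) i <;> simp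
      map_smul' := fun c p => by
        ext i
        refine Fin.cases ?_ (fun i => ?_) i <;> simp }

theorem consL_apply_zero (s : ℝ) (y : EuclideanSpace ℝ (Fin r)) : consL r (s, y) 0 = s := rfl

theorem tailL_consL (s : ℝ) (y : EuclideanSpace ℝ (Fin r)) : tailL r (consL r (s, y)) = y := rfl

theorem consL_tailL (x : EuclideanSpace ℝ (Fin (r + 1))) : consL r (x 0, tailL r x) = x := by
  ext i
  refine Fin.cases ?_ (fun i => ?_) i <;> rfl

theorem contMDiff_halfSpace_zero :
    ContMDiff (𝓡∂ (r + 1)) 𝓘(ℝ, ℝ) ∞ fun a : EuclideanHalfSpace (r + 1) => a.1 0 :=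
  (EuclideanSpace.proj (𝕜 := ℝ) (0 : Fin (r + 1))).contMDiff.comp
    (ModelWithCorners.contMDiff (𝓡∂ (r + 1)))

theorem contMDiff_halfSpace_tail :
    ContMDiff (𝓡∂ (r + 1)) 𝓘(ℝ, EuclideanSpace ℝ (Fin r)) ∞
      fun a : EuclideanHalfSpace (r + 1) => tailL r a.1 :=
  (tailL r).contMDiff.comp (ModelWithCorners.contMDiff (𝓡∂ (r + 1)))

end HalfSpace

/-- Each piece lies within one component, so the components inject into the index set of the cover.
-/
theorem finite_connectedComponents_of_cover {X ι : Type*} [TopologicalSpace X] [Finite ι]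
    {M : Set X} {C : ι → Set X} (hC : ∀ i, IsPreconnected (C i)) (hM : M = ⋃ i, C i) :
    Finite (ConnectedComponents ↥M) := by
  have h : ∀ i, ∀ x y : M, x.1 ∈ C i → y.1 ∈ C i → (x : ConnectedComponents M) = y := by
    intro i x y hx hy
    have hsub : C i ⊆ M := hM ▸ subset_iUnion C i
    have h1 : IsPreconnected (Subtype.val ⁻¹' C i : Set M) := by
      refine IsInducing.subtypeVal.isPreconnected_image.1 ?_
      rw [Subtype.image_preimage_coe, inter_eq_right.2 hsub]
      exact hC i
    exact ConnectedComponents.coe_eq_coe'.2 (h1.subset_connectedComponent hy hx)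
  have h2 : ∀ c : ConnectedComponents M, ∃ (i : ι) (x : M), x.1 ∈ C i ∧ (x : ConnectedComponents M) = c := by
    intro c
    obtain ⟨x, rfl⟩ := ConnectedComponents.surjective_coe c
    obtain ⟨i, hi⟩ := mem_iUnion.1 (hM.le x.2)
    exact ⟨i, x, hi, rfl⟩
  choose i x hx hxc using h2
  refine Finite.of_injective i fun c c' hcc => ?_
  rw [← hxc c, ← hxc c']
  exact h (i c) _ _ (hx c) (hcc ▸ hx c')

section Hybrid

variable {J : Type*} {n : J → ℕ} [∀ j, NeZero (n j)] {D : J → Type*}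
  [∀ j, TopologicalSpace (D j)] [∀ j, ChartedSpace (EuclideanHalfSpace (n j)) (D j)]
  [∀ j, IsManifold (𝓡∂ (n j)) ∞ (D j)]

omit [∀ j, IsManifold (𝓡∂ (n j)) ∞ (D j)] in
theorem isSlice_of_sigma {d : ℕ} [NeZero d] {M O : Set (Σ j, D j)} {A : Set (EuclideanHalfSpace d)}
    {Ψ : EuclideanHalfSpace d → Σ j, D j} {q : (Σ j, D j) → EuclideanSpace ℝ (Fin d)} {j : J}
    (x₀ : D j) (hO : IsOpen O) (hA : IsOpen A) (hj : ∀ a ∈ A, (Ψ a).1 = j)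
    (hΨ : ∀ a ∈ A, ContMDiffWithinAt (𝓡∂ d) (𝓡∂ (n j)) ∞ (fun a => toDomain x₀ (Ψ a)) A a)
    (hq : ∀ p ∈ O, ContMDiffAt (𝓡∂ (n p.1)) 𝓘(ℝ, EuclideanSpace ℝ (Fin d)) ∞
      (fun x => q ⟨p.1, x⟩) p.2) (hqΨ : ∀ a ∈ A, q (Ψ a) = a.1) (himg : Ψ '' A = M ∩ O) :
    IsSlice (n j) (Sigma.mk j ⁻¹' M) (Sigma.mk j ⁻¹' O) A (fun a => toDomain x₀ (Ψ a))
      (fun x => q ⟨j, x⟩) := by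
  have hmk : ∀ a ∈ A, (⟨j, toDomain x₀ (Ψ a)⟩ : Σ j, D j) = Ψ a := fun a ha =>
    mk_toDomain x₀ (hj a ha)
  refine ⟨hO.preimage continuous_sigmaMk, hA, hΨ, fun x hx =>
    (hq ⟨j, x⟩ hx).contMDiffWithinAt, fun a ha => by simp only [hmk a ha, hqΨ a ha], ?_⟩
  ext x
  constructor
  · rintro ⟨a, ha, rfl⟩
    change (⟨j, toDomain x₀ (Ψ a)⟩ : Σ j, D j) ∈ M ∩ O
    rw [hmk a ha, ← himg]
    exact mem_image_of_mem Ψ ha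
  · intro hx
    obtain ⟨a, ha, hax⟩ := himg.ge (show (⟨j, x⟩ : Σ j, D j) ∈ M ∩ O from hx)
    exact ⟨a, ha, by simp only [hax, toDomain_mk]⟩

namespace HybridSystem

/-- Families of curves into the guard, parametrized by their starting points `start i y`, which are
permuted by the resets. The families fill disjoint open sets `tube i`, in which the parameter `y`
is a smooth function of the point. The parameters of the family `0` are extended from `base` to
`ext`, which contains the parameters of the points to which the last reset leads. -/
structure SheetSystem (H : HybridSystem n D) (K r : ℕ) where
  start : ℕ → EuclideanSpace ℝ (Fin r) → Σ j, D j
  coord : ℕ → (Σ j, D j) → EuclideanSpace ℝ (Fin r)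
  tube : ℕ → Set (Σ j, D j)
  dom : ℕ → J
  base : Set (EuclideanSpace ℝ (Fin r))
  -- The last reset sends the parameters in `base` to those in `ext`, which need not be contained in
  -- `base`.
  ext : Set (EuclideanSpace ℝ (Fin r))
  total : Set (EuclideanSpace ℝ (Fin r))
  isOpen_base : IsOpen base
  isOpen_ext : IsOpen ext
  base_subset : base ⊆ total
  ext_subset : ext ⊆ total
  isPreconnected_base : IsPreconnected base
  isPreconnected_ext : IsPreconnected ext
  smooth_start : ∀ i < K, ∀ y ∈ total, SmoothAt n 𝓘(ℝ, EuclideanSpace ℝ (Fin r)) (start i) y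
  start_fst : ∀ i < K, ∀ y ∈ total, (start i y).1 = dom i
  start_bas : ∀ i < K, ∀ y ∈ total, start i y ∈ H.bas
  start_fwd : ∀ i < K, ∀ y ∈ total, start i y ∈ H.fwd
  isOpen_tube : ∀ i < K, IsOpen (tube i)
  disjoint_tube : ∀ i < K, ∀ j < K, i ≠ j → Disjoint (tube i) (tube j)
  tube_subset : ∀ i < K, tube i ⊆ H.bas
  flow_mem : ∀ i < K, ∀ y ∈ total, ∀ s ∈ Icc 0 (H.time (start i y)), H.flow (start i y) s ∈ tube i
  smooth_coord : ∀ i < K, ∀ p ∈ tube i, ContMDiffAt (𝓡∂ (n p.1))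
    𝓘(ℝ, EuclideanSpace ℝ (Fin r)) ∞ (fun x => coord i ⟨p.1, x⟩) p.2
  coord_mem : ∀ i < K, ∀ p ∈ tube i, coord i p ∈ total
  coord_flow : ∀ i < K, ∀ y ∈ total, ∀ s ∈ Icc 0 (H.time (start i y)),
    coord i (H.flow (start i y) s) = y
  next_start : ∀ i, i + 1 < K → ∀ y ∈ base, H.next (start i y) = start (i + 1) y
  next_last : ∀ i, i + 1 = K → ∀ y ∈ base, H.next (start i y) ∈ start 0 '' ext
  pos : 0 < K

namespace SheetSystem

variable {H : HybridSystem n D} {K r : ℕ} (S : H.SheetSystem K r)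

/-- The parameters of the points of the sheet `i`. -/
def Param (i : ℕ) (y : EuclideanSpace ℝ (Fin r)) (s : ℝ) : Prop :=
  (y ∈ S.base ∧ s ∈ Icc 0 (H.time (S.start i y))) ∨
    -- The extension of the sheet `0` stops halfway. It contains the starting points that are needed
    -- but no point of the guard, so it does not require further extensions; and the half-open
    -- interval creates no new boundary at its far end.
    (i = 0 ∧ y ∈ S.ext ∧ s ∈ Ico 0 (H.time (S.start i y) / 2))

/-- The union of the sheets. -/
def carrier : Set (Σ j, D j) := {x | ∃ i < K, ∃ y s, S.Param i y s ∧ H.flow (S.start i y) s = x}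

variable [∀ j, T2Space (D j)] {S}

omit [∀ j, T2Space (D j)] in
theorem time_start_pos {i : ℕ} (hi : i < K) {y : EuclideanSpace ℝ (Fin r)} (hy : y ∈ S.total) :
    0 < H.time (S.start i y) := time_pos (S.start_bas i hi y hy) (not_mem_exits (S.start_fwd i hi y hy))

omit [∀ j, T2Space (D j)] in
theorem Param.mem {i : ℕ} (hi : i < K) {y : EuclideanSpace ℝ (Fin r)} {s : ℝ}
    (h : S.Param i y s) : y ∈ S.total ∧ s ∈ Icc 0 (H.time (S.start i y)) := by
  rcases h with ⟨h1, h2⟩ | ⟨rfl, h1, h2⟩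
  · exact ⟨S.base_subset h1, h2⟩
  · have := time_start_pos hi (S.ext_subset h1)
    exact ⟨S.ext_subset h1, h2.1, by linarith [h2.2]⟩

-- The tubes are disjoint, so the tube of a point of the union fixes its sheet.
omit [∀ j, T2Space (D j)] in
theorem exists_param {x : Σ j, D j} (hx : x ∈ S.carrier) {i : ℕ} (hi : i < K) (hxi : x ∈ S.tube i) :
    ∃ y s, S.Param i y s ∧ H.flow (S.start i y) s = x := by
  obtain ⟨i', hi', y, s, h, rfl⟩ := hx
  obtain ⟨hy, hs⟩ := h.mem hi'
  obtain rfl : i = i' := by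
    by_contra hne
    exact Set.disjoint_left.1 (S.disjoint_tube i hi i' hi' hne) hxi (S.flow_mem i' hi' y hy s hs)
  exact ⟨y, s, h, rfl⟩

theorem time_flow {i : ℕ} (hi : i < K) {y : EuclideanSpace ℝ (Fin r)} (hy : y ∈ S.total) {s : ℝ}
    (hs : s ∈ Icc 0 (H.time (S.start i y))) :
    H.time (H.flow (S.start i y) s) = H.time (S.start i y) - s :=
  (flow_regular (S.start_bas i hi y hy) hs).2.1

theorem contMDiffAt_time_start {i : ℕ} (hi : i < K) {y : EuclideanSpace ℝ (Fin r)}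
    (hy : y ∈ S.total) : ContMDiffAt 𝓘(ℝ, EuclideanSpace ℝ (Fin r)) 𝓘(ℝ, ℝ) ∞
      (fun y => H.time (S.start i y)) y :=
  (S.smooth_start i hi y hy).time (S.start_bas i hi y hy)

theorem contMDiffAt_time_start_coord {i : ℕ} (hi : i < K) {p : Σ j, D j} (hp : p ∈ S.tube i) :
    ContMDiffAt (𝓡∂ (n p.1)) 𝓘(ℝ, ℝ) ∞
      (fun x => H.time (S.start i (S.coord i ⟨p.1, x⟩))) p.2 :=
  ContMDiffAt.comp p.2 (contMDiffAt_time_start hi (S.coord_mem i hi p hp)) (S.smooth_coord i hi p hp)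

/-- Sheets near points that are not in the guard. -/
theorem isSlice_start {i : ℕ} (hi : i < K) (x₀ : D (S.dom i)) :
    IsSlice (n (S.dom i)) (Sigma.mk (S.dom i) ⁻¹' S.carrier)
      (Sigma.mk (S.dom i) ⁻¹' {x | x ∈ S.tube i ∧ 0 < H.time x})
      {a : EuclideanHalfSpace (r + 1) | S.Param i (tailL r a.1) (a.1 0) ∧
        a.1 0 < H.time (S.start i (tailL r a.1))}
      (fun a => toDomain x₀ (H.flow (S.start i (tailL r a.1)) (a.1 0)))
      (fun x => consL r (H.time (S.start i (S.coord i ⟨S.dom i, x⟩)) - H.time ⟨S.dom i, x⟩,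
        S.coord i ⟨S.dom i, x⟩)) := by
  have htail := (contMDiff_halfSpace_tail (r := r)).continuous
  have hzero := (contMDiff_halfSpace_zero (r := r)).continuous
  have hT : ∀ a : EuclideanHalfSpace (r + 1), tailL r a.1 ∈ S.total →
      ContinuousAt (fun a : EuclideanHalfSpace (r + 1) => H.time (S.start i (tailL r a.1))) a :=
    fun a ha => ContinuousAt.comp (f := fun a : EuclideanHalfSpace (r + 1) => tailL r a.1)
      (g := fun y => H.time (S.start i y))
      (contMDiffAt_time_start hi ha).continuousAt htail.continuousAt
  -- The first coordinate is the time elapsed since the start. It is recovered from a point as the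
  -- hitting time of the starting point minus that of the point itself.
  refine isSlice_of_sigma (Ψ := fun a => H.flow (S.start i (tailL r a.1)) (a.1 0))
    (q := fun p => consL r (H.time (S.start i (S.coord i p)) - H.time p, S.coord i p)) x₀ ?_ ?_
    ?_ ?_ ?_ ?_ ?_
  · refine isOpen_iff_mem_nhds.2 fun x hx => ?_
    filter_upwards [(S.isOpen_tube i hi).mem_nhds hx.1,
      (continuousAt_time (S.tube_subset i hi hx.1)).eventually (lt_mem_nhds hx.2)] with z h1 h2
    exact ⟨h1, h2⟩
  · refine isOpen_iff_mem_nhds.2 fun a ha => ?_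
    obtain ⟨h1, h2⟩ := ha
    have hTa := hT a (h1.mem hi).1
    have hev := hzero.continuousAt.eventually_lt hTa h2
    rcases h1 with ⟨h1, h3⟩ | ⟨h0, h1, h3⟩
    · filter_upwards [hev, htail.continuousAt.eventually (S.isOpen_base.mem_nhds h1)] with b h4 h5
      exact ⟨Or.inl ⟨h5, b.2, h4.le⟩, h4⟩
    · filter_upwards [hev, htail.continuousAt.eventually (S.isOpen_ext.mem_nhds h1),
        hzero.continuousAt.eventually_lt (hTa.div_const 2) h3.2] with b h4 h5 h6
      exact ⟨Or.inr ⟨h0, h5, b.2, h6⟩, h4⟩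
  · rintro a ⟨ha, -⟩
    exact S.start_fst i hi _ (ha.mem hi).1
  · intro a haA
    have ha := haA.1
    refine smoothAt_flow (f := fun a : EuclideanHalfSpace (r + 1) => S.start i (tailL r a.1))
      ((S.smooth_start i hi _ (ha.mem hi).1).comp_left
        (φ := fun a : EuclideanHalfSpace (r + 1) => tailL r a.1) contMDiff_halfSpace_tail.contMDiffAt)
      contMDiff_halfSpace_zero.contMDiffAt.contMDiffWithinAt (S.start_bas i hi _ (ha.mem hi).1)
      (fun b hb => (hb.1.mem hi).2) haA x₀ (S.start_fst i hi _ (ha.mem hi).1)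
  · rintro p ⟨hp, -⟩
    exact (consL r).contMDiff.contMDiffAt.comp p.2 (((contMDiffAt_time_start_coord hi hp).sub
      (contMDiffAt_time (S.tube_subset i hi hp))).prodMk_space (S.smooth_coord i hi p hp))
  · rintro a ⟨ha, -⟩
    obtain ⟨hy, hs⟩ := ha.mem hi
    simp only [S.coord_flow i hi _ hy _ hs, time_flow hi hy hs, sub_sub_cancel]
    exact consL_tailL a.1
  · ext x
    constructor
    · rintro ⟨a, ⟨ha, ha'⟩, rfl⟩
      obtain ⟨hy, hs⟩ := ha.mem hi
      refine ⟨⟨i, hi, _, _, ha, rfl⟩, S.flow_mem i hi _ hy _ hs, ?_⟩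
      rw [time_flow hi hy hs]
      linarith
    · rintro ⟨hx, hxt, hx0⟩
      obtain ⟨y, s, h, rfl⟩ := exists_param hx hi hxt
      obtain ⟨hy, hs⟩ := h.mem hi
      rw [time_flow hi hy hs] at hx0
      refine ⟨⟨consL r (s, y), hs.1⟩, ⟨?_, ?_⟩, ?_⟩
      · simpa only [consL_apply_zero, tailL_consL] using h
      · simp only [consL_apply_zero, tailL_consL]
        linarith
      · simp only [consL_apply_zero, tailL_consL]

/-- Sheets near points of the guard. -/
theorem isSlice_exit {i : ℕ} (hi : i < K) (x₀ : D (S.dom i)) :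
    IsSlice (n (S.dom i)) (Sigma.mk (S.dom i) ⁻¹' S.carrier)
      (Sigma.mk (S.dom i) ⁻¹' {x | x ∈ S.tube i ∧ S.coord i x ∈ S.base ∧
        H.time x < H.time (S.start i (S.coord i x))})
      {a : EuclideanHalfSpace (r + 1) | tailL r a.1 ∈ S.base ∧
        a.1 0 < H.time (S.start i (tailL r a.1))}
      (fun a => toDomain x₀ (H.flow (S.start i (tailL r a.1))
        (H.time (S.start i (tailL r a.1)) - a.1 0)))
      (fun x => consL r (H.time ⟨S.dom i, x⟩, S.coord i ⟨S.dom i, x⟩)) := by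
  have htail := (contMDiff_halfSpace_tail (r := r)).continuous
  have hzero := (contMDiff_halfSpace_zero (r := r)).continuous
  have hTs : ∀ a : EuclideanHalfSpace (r + 1), tailL r a.1 ∈ S.total →
      ContMDiffAt (𝓡∂ (r + 1)) 𝓘(ℝ, ℝ) ∞
      (fun a : EuclideanHalfSpace (r + 1) => H.time (S.start i (tailL r a.1))) a :=
    fun a ha => ContMDiffAt.comp (f := fun a : EuclideanHalfSpace (r + 1) => tailL r a.1)
      (g := fun y => H.time (S.start i y)) a
      (contMDiffAt_time_start hi ha) contMDiff_halfSpace_tail.contMDiffAt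
  have hmem : ∀ a ∈ {a : EuclideanHalfSpace (r + 1) | tailL r a.1 ∈ S.base ∧
      a.1 0 < H.time (S.start i (tailL r a.1))}, H.time (S.start i (tailL r a.1)) - a.1 0 ∈
      Icc 0 (H.time (S.start i (tailL r a.1))) := fun a ha =>
    ⟨by linarith [ha.2], by linarith [a.2]⟩
  -- Here the first coordinate is the time left until the guard, so that its zero set consists of
  -- the exit points.
  refine isSlice_of_sigma (Ψ := fun a => H.flow (S.start i (tailL r a.1))
      (H.time (S.start i (tailL r a.1)) - a.1 0))
    (q := fun p => consL r (H.time p, S.coord i p)) x₀ ?_ ?_ ?_ ?_ ?_ ?_ ?_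
  · refine isOpen_iff_mem_nhds.2 fun x hx => ?_
    filter_upwards [(S.isOpen_tube i hi).mem_nhds hx.1,
      (continuousAt_of_contMDiffAt (S.smooth_coord i hi x hx.1)).eventually
        (S.isOpen_base.mem_nhds hx.2.1),
      (continuousAt_time (S.tube_subset i hi hx.1)).eventually_lt
        (continuousAt_of_contMDiffAt (F := fun p => H.time (S.start i (S.coord i p)))
          (contMDiffAt_time_start_coord hi hx.1)) hx.2.2] with z h1 h2 h3
    exact ⟨h1, h2, h3⟩
  · refine isOpen_iff_mem_nhds.2 fun a ha => ?_
    filter_upwards [htail.continuousAt.eventually (S.isOpen_base.mem_nhds ha.1),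
      hzero.continuousAt.eventually_lt (hTs a (S.base_subset ha.1)).continuousAt ha.2] with b h1 h2
    exact ⟨h1, h2⟩
  · rintro a ⟨ha, -⟩
    exact S.start_fst i hi _ (S.base_subset ha)
  · intro a ha
    have ha' := S.base_subset ha.1
    exact smoothAt_flow (f := fun a : EuclideanHalfSpace (r + 1) => S.start i (tailL r a.1))
      ((S.smooth_start i hi _ ha').comp_left
        (φ := fun a : EuclideanHalfSpace (r + 1) => tailL r a.1) contMDiff_halfSpace_tail.contMDiffAt)
      ((hTs a ha').sub contMDiff_halfSpace_zero.contMDiffAt).contMDiffWithinAt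
      (S.start_bas i hi _ ha') hmem ha x₀ (S.start_fst i hi _ ha')
  · rintro p ⟨hp, -⟩
    exact (consL r).contMDiff.contMDiffAt.comp p.2
      ((contMDiffAt_time (S.tube_subset i hi hp)).prodMk_space (S.smooth_coord i hi p hp))
  · intro a ha
    have ha' := S.base_subset ha.1
    simp only [S.coord_flow i hi _ ha' _ (hmem a ha), time_flow hi ha' (hmem a ha), sub_sub_cancel]
    exact consL_tailL a.1
  · ext x
    constructor
    · rintro ⟨a, ha, rfl⟩
      have ha' := S.base_subset ha.1
      refine ⟨⟨i, hi, _, _, Or.inl ⟨ha.1, hmem a ha⟩, rfl⟩, S.flow_mem i hi _ ha' _ (hmem a ha),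
        ?_, ?_⟩
      · rw [S.coord_flow i hi _ ha' _ (hmem a ha)]
        exact ha.1
      · rw [S.coord_flow i hi _ ha' _ (hmem a ha), time_flow hi ha' (hmem a ha), sub_sub_cancel]
        exact ha.2
    · rintro ⟨hx, hxt, hxb, hx0⟩
      obtain ⟨y, s, h, rfl⟩ := exists_param hx hi hxt
      obtain ⟨hy, hs⟩ := h.mem hi
      rw [S.coord_flow i hi _ hy _ hs] at hxb hx0
      rw [time_flow hi hy hs] at hx0
      refine ⟨⟨consL r (H.time (S.start i y) - s, y), ?_⟩, ⟨?_, ?_⟩, ?_⟩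
      · rw [consL_apply_zero]
        linarith [hs.2]
      · simpa only [tailL_consL] using hxb
      · simpa only [consL_apply_zero, tailL_consL] using hx0
      · simp only [consL_apply_zero, tailL_consL, sub_sub_cancel]

/-- A union of sheets is an embedded submanifold, to which the field is tangent. -/
theorem exists_submanifold (S : H.SheetSystem K r) (j : J) :
    ∃ (_ : ChartedSpace (EuclideanHalfSpace (r + 1)) ↥(Sigma.mk j ⁻¹' S.carrier)),
    IsManifold (𝓡∂ (r + 1)) ∞ ↥(Sigma.mk j ⁻¹' S.carrier) ∧
    SmoothEmb (𝓡∂ (r + 1)) (𝓡∂ (n j)) (Subtype.val : ↥(Sigma.mk j ⁻¹' S.carrier) → D j) ∧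
    (∀ p : ↥(Sigma.mk j ⁻¹' S.carrier), H.field j p.1 ∈
      range (mfderiv (𝓡∂ (r + 1)) (𝓡∂ (n j))
        (Subtype.val : ↥(Sigma.mk j ⁻¹' S.carrier) → D j) p)) ∧
    (∃ O : Set ↥(Sigma.mk j ⁻¹' S.carrier), IsOpen O ∧
      Subtype.val ⁻¹' H.guard j = O ∩ (𝓡∂ (r + 1)).boundary ↥(Sigma.mk j ⁻¹' S.carrier)) := by
  refine exists_submanifold_of_slices (H.field j) (H.guard j) ?_ ?_
  · rintro p ⟨i, hi, y, s, h, hp⟩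
    obtain ⟨hy, hs⟩ := h.mem hi
    obtain rfl : S.dom i = j := (S.start_fst i hi y hy).symm.trans (congrArg Sigma.fst hp)
    -- Before the end of a curve the hitting time is positive, so the condition on the guard is
    -- void. At the end the parameter is in `base`, as the extension stops halfway.
    by_cases hsT : s < H.time (S.start i y)
    · have h0 : 0 < H.time ⟨S.dom i, p⟩ := by
        rw [← hp, time_flow hi hy hs]
        linarith
      refine ⟨_, _, _, _, ?_, isSlice_start hi p, fun hpG => ?_⟩
      · refine ⟨?_, h0⟩
        rw [← hp]
        exact S.flow_mem i hi y hy s hs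
      · exact absurd (exits_regular (x := ⟨S.dom i, p⟩) hpG).2.1 h0.ne'
    · have hyb : y ∈ S.base := by
        rcases h with h | ⟨-, -, h⟩
        · exact h.1
        · linarith [h.2, time_start_pos hi hy]
      refine ⟨_, _, _, _, ?_, isSlice_exit hi p, fun hpG => ⟨?_, fun x hx h0 => ?_⟩⟩
      · change (⟨S.dom i, p⟩ : Σ j, D j) ∈ S.tube i ∧ S.coord i ⟨S.dom i, p⟩ ∈ S.base ∧ _ < _
        rw [← hp]
        refine ⟨S.flow_mem i hi y hy s hs, ?_⟩
        rw [S.coord_flow i hi y hy s hs, time_flow hi hy hs]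
        exact ⟨hyb, by linarith [time_start_pos hi hy]⟩
      · rw [consL_apply_zero]
        exact (exits_regular (x := ⟨S.dom i, p⟩) hpG).2.1
      · rw [consL_apply_zero] at h0
        exact mem_exits_of_time_eq_zero (x := ⟨S.dom i, x⟩) (S.tube_subset i hi hx.2.1) h0
  · rintro p ⟨i, hi, y, s, h, hp⟩
    obtain ⟨hy, hs⟩ := h.mem hi
    have hT := time_start_pos hi hy
    -- A piece of the curve through the point that stays in the sheet: the whole curve over `base`,
    -- and on the extension a piece that ends midway between `s` and half of the hitting time.
    obtain ⟨b, hb, hsb, hbT, hP⟩ : ∃ b, 0 < b ∧ s ≤ b ∧ b ≤ H.time (S.start i y) ∧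
        ∀ t ∈ Icc 0 b, S.Param i y t := by
      rcases h with ⟨h1, h2⟩ | ⟨h0, h1, h2⟩
      · exact ⟨_, hT, h2.2, le_rfl, fun t ht => Or.inl ⟨h1, ht⟩⟩
      · exact ⟨(s + H.time (S.start i y) / 2) / 2, by linarith [h2.1], by linarith [h2.2],
          by linarith [h2.2], fun t ht => Or.inr ⟨h0, h1, ht.1, by linarith [ht.2, h2.2]⟩⟩
    have hbas := S.start_bas i hi y hy
    have hcar : ∀ t ∈ Icc 0 b, H.flow (S.start i y) t ∈ S.carrier := fun t ht =>
      ⟨i, hi, y, t, hP t ht, rfl⟩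
    generalize S.start i y = x at hp hbas hbT hcar
    obtain ⟨k, x⟩ := x
    obtain rfl : k = j := congrArg Sigma.fst hp
    exact ⟨0, b, s, hitCurve (H.field k) (H.guard k) x, hb, ⟨hs.1, hsb⟩, sigma_mk_injective hp,
      IsMIntegralCurveOn.mono (hitBy_flow hbas).2.2.1 (Icc_subset_Icc_right hbT), hcar⟩

/-- An exit point has hitting time `0`, so it lies over `base` and not on the extension. The reset
then leads to the start of the next sheet or, from the last one, to a starting point of the sheet
`0` over `ext`. -/
theorem reset_mem (S : H.SheetSystem K r) {x : Σ j, D j} (hx : x ∈ H.exits) (hxS : x ∈ S.carrier) :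
    H.reset x.1 x.2 ∈ S.carrier := by
  obtain ⟨i, hi, y, s, h, rfl⟩ := hxS
  obtain ⟨hy, hs⟩ := h.mem hi
  have hx0 := (exits_regular hx).2.1
  rw [time_flow hi hy hs] at hx0
  have hyb : y ∈ S.base := by
    rcases h with h | ⟨-, -, h⟩
    · exact h.1
    · linarith [h.2, time_start_pos hi hy]
  rw [← (exits_regular hx).2.2.2, next_flow (S.start_bas i hi y hy) hs]
  rcases (Nat.succ_le_of_lt hi).lt_or_eq with h1 | h1
  · have hT := time_start_pos h1 hy
    rw [S.next_start i h1 y hyb]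
    exact ⟨i + 1, h1, y, 0, Or.inl ⟨hyb, le_rfl, hT.le⟩, flow_zero (S.start_bas _ h1 y hy)⟩
  · obtain ⟨y', hy', h2⟩ := S.next_last i h1 y hyb
    rw [← h2]
    have hT := time_start_pos S.pos (S.ext_subset hy')
    exact ⟨0, S.pos, y', 0, Or.inr ⟨rfl, hy', le_rfl, by linarith⟩,
      flow_zero (S.start_bas _ S.pos y' (S.ext_subset hy'))⟩

/-- With times rescaled by the hitting time, the part of a sheet is a continuous image of a product.
-/
theorem isPreconnected_sheet (S : H.SheetSystem K r) {i : ℕ} (hi : i < K)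
    {B : Set (EuclideanSpace ℝ (Fin r))} (hB : B ⊆ S.total) (hB' : IsPreconnected B) {Λ : Set ℝ}
    (hΛ : Λ ⊆ Icc 0 1) (hΛ' : IsPreconnected Λ) :
    IsPreconnected ((fun p : ℝ × EuclideanSpace ℝ (Fin r) =>
      H.flow (S.start i p.2) (p.1 * H.time (S.start i p.2))) '' (Λ ×ˢ B)) := by
  refine (hΛ'.prod hB').image _ fun p hp => ?_
  have hp' := hB hp.2
  let x₀ : D (S.dom i) := S.start_fst i hi _ hp' ▸ (S.start i p.2).2
  have hsnd : ContMDiffAt 𝓘(ℝ, ℝ × EuclideanSpace ℝ (Fin r)) 𝓘(ℝ, EuclideanSpace ℝ (Fin r)) ∞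
      (Prod.snd : ℝ × EuclideanSpace ℝ (Fin r) → _) p := contDiff_snd.contMDiff.contMDiffAt
  have hfst : ContMDiffAt 𝓘(ℝ, ℝ × EuclideanSpace ℝ (Fin r)) 𝓘(ℝ, ℝ) ∞
      (Prod.fst : ℝ × EuclideanSpace ℝ (Fin r) → _) p := contDiff_fst.contMDiff.contMDiffAt
  have hT : ContMDiffAt 𝓘(ℝ, ℝ × EuclideanSpace ℝ (Fin r)) 𝓘(ℝ, ℝ) ∞
      (fun p => H.time (S.start i p.2)) p :=
    ContMDiffAt.comp (g := fun y => H.time (S.start i y)) p (contMDiffAt_time_start hi hp') hsnd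
  have h1 := smoothAt_flow (f := fun p : ℝ × EuclideanSpace ℝ (Fin r) => S.start i p.2)
    (τ := fun p => p.1 * H.time (S.start i p.2)) (A := Λ ×ˢ B)
    ((S.smooth_start i hi _ hp').comp_left hsnd) (hfst.mul hT).contMDiffWithinAt
    (S.start_bas i hi _ hp') (fun z hz => by
      have hT := time_start_pos hi (hB hz.2)
      have hz1 := hΛ hz.1
      exact ⟨mul_nonneg hz1.1 hT.le, mul_le_of_le_one_left hT.le hz1.2⟩) hp x₀
    (S.start_fst i hi _ hp')
  exact (continuous_sigmaMk.continuousAt.comp_continuousWithinAt h1.continuousWithinAt).congr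
    (fun z hz => (mk_toDomain x₀ (p := H.flow _ _) (S.start_fst i hi _ (hB hz.2))).symm)
    (mk_toDomain x₀ (p := H.flow _ _) (S.start_fst i hi _ hp')).symm

/-- A union of sheets has finitely many components. -/
theorem finite_components (S : H.SheetSystem K r) (j : J) :
    Finite (ConnectedComponents ↥(Sigma.mk j ⁻¹' S.carrier)) := by
  have hmk : ∀ s : Set (Σ j, D j), IsPreconnected s → IsPreconnected (Sigma.mk j ⁻¹' s) := by
    intro s hs
    have : Nonempty J := ⟨j⟩
    obtain ⟨i, t, ht, rfl⟩ := Sigma.isPreconnected_iff.1 hs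
    by_cases hij : i = j
    · subst hij
      rwa [preimage_image_eq _ sigma_mk_injective]
    · convert isPreconnected_empty
      exact eq_empty_of_forall_notMem fun x ⟨y, _, hy⟩ => hij (congrArg Sigma.fst hy)
  let φ := fun (i : ℕ) (p : ℝ × EuclideanSpace ℝ (Fin r)) =>
    H.flow (S.start i p.2) (p.1 * H.time (S.start i p.2))
  refine finite_connectedComponents_of_cover (C := fun o : Option (Fin K) => Sigma.mk j ⁻¹'
    o.elim (φ 0 '' (Ico 0 (1 / 2) ×ˢ S.ext)) fun i => φ i '' (Icc 0 1 ×ˢ S.base)) ?_ ?_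
  · rintro (_ | i)
    · exact hmk _ (S.isPreconnected_sheet S.pos S.ext_subset S.isPreconnected_ext
        (fun s hs => ⟨hs.1, by linarith [hs.2]⟩) isPreconnected_Ico)
    · exact hmk _ (S.isPreconnected_sheet i.2 S.base_subset S.isPreconnected_base subset_rfl
        isPreconnected_Icc)
  · rw [← preimage_iUnion, iUnion_option]
    congr 1
    ext x
    constructor
    · rintro ⟨i, hi, y, s, h, rfl⟩
      have hT := time_start_pos hi (h.mem hi).1
      have hs : s / H.time (S.start i y) * H.time (S.start i y) = s := div_mul_cancel₀ s hT.ne'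
      rcases h with ⟨h1, h2⟩ | ⟨rfl, h1, h2⟩
      · refine Or.inr (mem_iUnion.2 ⟨⟨i, hi⟩, (s / H.time (S.start i y), y),
          ⟨⟨div_nonneg h2.1 hT.le, (div_le_one hT).2 h2.2⟩, h1⟩, ?_⟩)
        simp only [φ, hs]
      · refine Or.inl ⟨(s / H.time (S.start 0 y), y), ⟨⟨div_nonneg h2.1 hT.le, ?_⟩, h1⟩, ?_⟩
        · rw [div_lt_iff₀ hT]
          linarith [h2.2]
        · simp only [φ, hs]
    · rintro (⟨⟨t, y⟩, ⟨ht, hy⟩, rfl⟩ | h)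
      · have hT := time_start_pos S.pos (S.ext_subset hy)
        refine ⟨0, S.pos, y, _, Or.inr ⟨rfl, hy, mul_nonneg ht.1 hT.le, ?_⟩, rfl⟩
        have := mul_lt_mul_of_pos_right ht.2 hT
        simp only at this ⊢
        linarith
      · obtain ⟨i, ⟨t, y⟩, ⟨ht, hy⟩, rfl⟩ := mem_iUnion.1 h
        have hT := time_start_pos i.2 (S.base_subset hy)
        exact ⟨i, i.2, y, _, Or.inl ⟨hy, mul_nonneg ht.1 hT.le,
          mul_le_of_le_one_left hT.le ht.2⟩, rfl⟩

theorem isInvariantSubmanifold (S : H.SheetSystem K r) :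
    H.IsInvariantSubmanifold (r + 1) S.carrier where
  submanifold := S.exists_submanifold
  components := S.finite_components
  reset_mem j x hx hxS := S.reset_mem (x := ⟨j, x⟩) hx hxS

end SheetSystem

end HybridSystem

end Hybrid

end HybridDS

namespace HybridDS

/-! ### Cycles of transitions -/

section Hybrid

variable {J : Type*} {n : J → ℕ} [∀ j, NeZero (n j)] {D : J → Type*}
  [∀ j, TopologicalSpace (D j)] [∀ j, ChartedSpace (EuclideanHalfSpace (n j)) (D j)]
  [∀ j, IsManifold (𝓡∂ (n j)) ∞ (D j)]

namespace HybridSystem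

/-- After `K` transitions, the trajectory from the exit point `Q` returns to `Q`. -/
structure IsCycle (H : HybridSystem n D) (Q : Σ j, D j) (K : ℕ) : Prop where
  pos : 0 < K
  exit : Q ∈ H.exits
  bas : ∀ i, 0 < i → H.next^[i] Q ∈ H.bas
  fwd : ∀ i, 0 < i → H.next^[i] Q ∈ H.fwd
  hit : H.hit (H.next^[K] Q) = Q
  inj : ∀ i j, 0 < i → i ≤ K → 0 < j → j ≤ K →
    H.hit (H.next^[i] Q) = H.hit (H.next^[j] Q) → i = j

/-- The points of the trajectory from `Q` up to its `K`-th transition. -/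
def cycleSet (H : HybridSystem n D) (Q : Σ j, D j) (K : ℕ) : Set (Σ j, D j) :=
  {w | ∃ i < K, ∃ s ∈ Icc 0 (H.time (H.next^[i + 1] Q)), H.flow (H.next^[i + 1] Q) s = w}

/-- A parametrization `e` of the guard near `Q`, with a smooth left inverse `ρ`. -/
structure IsGuardParam (H : HybridSystem n D) (Q : Σ j, D j) {E : Type*} [NormedAddCommGroup E]
    [NormedSpace ℝ E] (e : E → Σ j, D j) (ρ : (Σ j, D j) → E) (y₀ : E) : Prop where
  apply_eq : e y₀ = Q
  smooth_param : ∀ᶠ y in 𝓝 y₀, SmoothAt n 𝓘(ℝ, E) e y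
  mem_exits : ∀ᶠ y in 𝓝 y₀, e y ∈ H.exits
  smooth_coord : ∀ᶠ p in 𝓝 Q, ContMDiffAt (𝓡∂ (n p.1)) 𝓘(ℝ, E) ∞ (fun x => ρ ⟨p.1, x⟩) p.2
  left_inv : ∀ᶠ y in 𝓝 y₀, ρ (e y) = y
  right_inv : ∀ᶠ p in 𝓝 Q, p ∈ H.exits → e (ρ p) = p

/-- The return map of the guard in coordinates. -/
noncomputable def returnMap (H : HybridSystem n D) (K : ℕ) {E : Type*} (e : E → Σ j, D j)
    (ρ : (Σ j, D j) → E) (y : E) : E := ρ (H.hit (H.next^[K] (e y)))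

variable {H : HybridSystem n D} {Q : Σ j, D j} {K : ℕ} [∀ j, T2Space (D j)]

theorem next_hit {x : Σ j, D j} (hx : x ∈ H.bas) : H.next (H.hit x) = H.next x :=
  next_eq_of_hit_eq (exits_regular (hit_mem_exits hx)).2.2.1

namespace IsCycle

theorem bas_iterate (hc : H.IsCycle Q K) (i : ℕ) : H.next^[i] Q ∈ H.bas := by
  rcases Nat.eq_zero_or_pos i with rfl | hi
  · exact (exits_regular hc.exit).1
  · exact hc.bas i hi

theorem isCompact_cycleSet (hc : H.IsCycle Q K) : IsCompact (H.cycleSet Q K) := by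
  have h : H.cycleSet Q K = ⋃ i ∈ Finset.range K,
      H.flow (H.next^[i + 1] Q) '' Icc 0 (H.time (H.next^[i + 1] Q)) := by
    ext w
    simp [cycleSet, and_assoc]
  rw [h]
  exact (Finset.range K).isCompact_biUnion fun i _ =>
    isCompact_Icc.image_of_continuousOn (continuousOn_flow (hc.bas_iterate (i + 1)))

end IsCycle

namespace IsGuardParam

variable {E : Type*} [NormedAddCommGroup E] [NormedSpace ℝ E] {e : E → Σ j, D j}
  {ρ : (Σ j, D j) → E} {y₀ : E}

omit [∀ j, T2Space (D j)] in
theorem continuousAt (he : H.IsGuardParam Q e ρ y₀) : ContinuousAt e y₀ :=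
  he.smooth_param.self_of_nhds.continuousAt

omit [∀ j, T2Space (D j)] in
theorem coord_eq (he : H.IsGuardParam Q e ρ y₀) : ρ Q = y₀ := by
  have := he.left_inv.self_of_nhds
  rwa [he.apply_eq] at this

omit [∀ j, T2Space (D j)] in
theorem continuousAt_coord (he : H.IsGuardParam Q e ρ y₀) : ContinuousAt ρ Q :=
  continuousAt_of_contMDiffAt he.smooth_coord.self_of_nhds

omit [∀ j, T2Space (D j)] in
theorem returnMap_eq (he : H.IsGuardParam Q e ρ y₀) (hc : H.IsCycle Q K) :
    H.returnMap K e ρ y₀ = y₀ := by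
  rw [returnMap, he.apply_eq, hc.hit, he.coord_eq]

theorem continuousAt_hit_iterate (he : H.IsGuardParam Q e ρ y₀) (hc : H.IsCycle Q K) (i : ℕ) :
    ContinuousAt (fun y => H.hit (H.next^[i] (e y))) y₀ := by
  have h1 : ContinuousAt (H.next^[i]) (e y₀) := by
    rw [he.apply_eq]
    exact continuousAt_iterate_next fun i _ => hc.bas_iterate i
  have h2 : ContinuousAt H.hit (H.next^[i] (e y₀)) := by
    rw [he.apply_eq]
    exact continuousAt_hit (hc.bas_iterate i)
  exact ContinuousAt.comp (f := fun y => H.next^[i] (e y)) h2 (h1.comp he.continuousAt)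

theorem eventually_iterate (he : H.IsGuardParam Q e ρ y₀) (hc : H.IsCycle Q K) {i : ℕ}
    {s : Set (Σ j, D j)} (hs : IsOpen s) (h : H.next^[i] Q ∈ s) :
    ∀ᶠ y in 𝓝 y₀, H.next^[i] (e y) ∈ s := by
  refine he.continuousAt.eventually (p := fun x => H.next^[i] x ∈ s) ?_
  rw [he.apply_eq]
  exact eventually_iterate_next (fun i _ => hc.bas_iterate i) hs h

theorem eventually_bas (he : H.IsGuardParam Q e ρ y₀) (hc : H.IsCycle Q K) (L : ℕ) :
    ∀ᶠ y in 𝓝 y₀, ∀ i ≤ L, H.next^[i] (e y) ∈ H.bas :=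
  (finite_le_nat L).eventually_all.2 fun i _ =>
    he.eventually_iterate hc isOpen_bas (hc.bas_iterate i)

theorem eventually_fwd (he : H.IsGuardParam Q e ρ y₀) (hc : H.IsCycle Q K) (L : ℕ) :
    ∀ᶠ y in 𝓝 y₀, ∀ i ≤ L, 0 < i → H.next^[i] (e y) ∈ H.fwd :=
  (finite_le_nat L).eventually_all.2 fun i _ => by
    by_cases hi : 0 < i
    · filter_upwards [he.eventually_iterate hc isOpen_fwd (hc.fwd i hi)] with y hy _ using hy
    · exact .of_forall fun y h => absurd h hi

theorem eventually_hit (he : H.IsGuardParam Q e ρ y₀) (hc : H.IsCycle Q K)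
    {p : (Σ j, D j) → Prop} (hp : ∀ᶠ x in 𝓝 Q, p x) :
    ∀ᶠ y in 𝓝 y₀, p (H.hit (H.next^[K] (e y))) := by
  refine (he.continuousAt_hit_iterate hc K).eventually (p := p) ?_
  dsimp only
  rw [he.apply_eq, hc.hit]
  exact hp

theorem param_returnMap (he : H.IsGuardParam Q e ρ y₀) (hc : H.IsCycle Q K) :
    ∀ᶠ y in 𝓝 y₀, e (H.returnMap K e ρ y) = H.hit (H.next^[K] (e y)) := by
  filter_upwards [he.eventually_hit hc he.right_inv, he.eventually_bas hc K] with y h1 h2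
  exact h1 (hit_mem_exits (h2 K le_rfl))

theorem contDiffAt_returnMap (he : H.IsGuardParam Q e ρ y₀) (hc : H.IsCycle Q K) :
    ∀ᶠ y in 𝓝 y₀, ContDiffAt ℝ ∞ (H.returnMap K e ρ) y := by
  filter_upwards [he.eventually_hit hc he.smooth_coord, he.eventually_bas hc K, he.smooth_param]
    with y h1 h2 h3
  refine ContMDiffAt.contDiffAt ?_
  exact (((h3.iterate_next fun i hi => h2 i hi.le).hit (h2 K le_rfl))).comp_contMDiffAt rfl h1

/-- One application of the return map is one turn of `K` transitions; only the exit point matters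
for what follows, so turns compose. -/
theorem hit_iterate_mul (he : H.IsGuardParam Q e ρ y₀) (hc : H.IsCycle Q K) (m : ℕ) :
    ∀ᶠ y in 𝓝 y₀, H.hit (H.next^[m * K] (e y)) = e ((H.returnMap K e ρ)^[m] y) := by
  have hexit : ∀ {y}, e y ∈ H.exits → H.hit (e y) = e y := fun h => (exits_regular h).2.2.1
  induction m with
  | zero =>
    filter_upwards [he.mem_exits] with y hy
    rw [zero_mul]
    exact hexit hy
  | succ m ih =>
    have hg : ContinuousAt (H.returnMap K e ρ) y₀ :=
      (he.contDiffAt_returnMap hc).self_of_nhds.continuousAt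
    filter_upwards [hg.eventually (by rw [he.returnMap_eq hc]; exact ih),
      hg.eventually (by rw [he.returnMap_eq hc]; exact he.mem_exits), he.param_returnMap hc]
      with y h1 h2 h3
    rw [Nat.add_mul, one_mul, Function.iterate_add_apply, Function.iterate_succ_apply, ← h1]
    refine (hit_iterate_congr ?_ _).1
    rw [hexit h2, h3]

/-- The sheets of curves that lead through the points of an invariant submanifold of the guard. -/
theorem exists_sheetSystem (he : H.IsGuardParam Q e ρ y₀) (hc : H.IsCycle Q K) {r : ℕ}
    {χ : E →L[ℝ] EuclideanSpace ℝ (Fin r)} {σ : EuclideanSpace ℝ (Fin r) → E}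
    {f h : EuclideanSpace ℝ (Fin r) → EuclideanSpace ℝ (Fin r)} {z₀ : EuclideanSpace ℝ (Fin r)}
    (hσ0 : σ z₀ = y₀) (hσ : ∀ᶠ z in 𝓝 z₀, ContDiffAt ℝ ∞ σ z) (hχσ : ∀ᶠ z in 𝓝 z₀, χ (σ z) = z)
    (hf0 : f z₀ = z₀) (hf : ∀ᶠ z in 𝓝 z₀, ContDiffAt ℝ ∞ f z)
    (hh : ∀ᶠ z in 𝓝 z₀, ContDiffAt ℝ ∞ h z)
    (hhf : ∀ᶠ z in 𝓝 z₀, h (f z) = z) (hfh : ∀ᶠ z in 𝓝 z₀, f (h z) = z)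
    (hg : ∀ᶠ z in 𝓝 z₀, H.returnMap K e ρ (σ z) = σ (f z)) :
    ∃ S : H.SheetSystem K r, (∀ i z, S.start i z = H.next^[i + 1] (e (σ z))) ∧ z₀ ∈ S.base := by
  have hz₀ : χ y₀ = z₀ := by rw [← hσ0]; exact hχσ.self_of_nhds
  -- The exit points of a cycle are distinct. Disjoint neighbourhoods of them separate the tubes by
  -- means of the hitting point.
  obtain ⟨V, hV, hVd⟩ := ((finite_lt_nat K).image fun i => H.hit (H.next^[i + 1] Q)).t2_separation
  obtain ⟨A, hA, hAo, hQA⟩ := _root_.mem_nhds_iff.1 he.smooth_coord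
  obtain ⟨B, hB, hBo, hzB⟩ := _root_.mem_nhds_iff.1 hh
  have hσc : ContinuousAt σ z₀ := hσ.self_of_nhds.continuousAt
  have hfc : ContinuousAt f z₀ := hf.self_of_nhds.continuousAt
  have pull : ∀ {p : E → Prop}, (∀ᶠ y in 𝓝 y₀, p y) → ∀ᶠ z in 𝓝 z₀, p (σ z) := fun {p} hp =>
    hσc.eventually (p := p) (by rw [hσ0]; exact hp)
  have hhitV : ∀ᶠ y in 𝓝 y₀, ∀ i < K, H.hit (H.next^[i + 1] (e y)) ∈
      V (H.hit (H.next^[i + 1] Q)) := by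
    refine (finite_lt_nat K).eventually_all.2 fun i _ => ?_
    refine (he.continuousAt_hit_iterate hc (i + 1)).eventually
      (p := fun x => x ∈ V (H.hit (H.next^[i + 1] Q))) ?_
    dsimp only
    rw [he.apply_eq]
    exact (hV _).2.mem_nhds (hV _).1
  have hfst : ∀ᶠ y in 𝓝 y₀, ∀ i < K, (H.next^[i + 1] (e y)).1 = (H.next^[i + 1] Q).1 := by
    refine (finite_lt_nat K).eventually_all.2 fun i _ => ?_
    have ho : IsOpen {p : Σ j, D j | p.1 = (H.next^[i + 1] Q).1} := by
      have := isOpen_range_sigmaMk (σ := D) (i := (H.next^[i + 1] Q).1)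
      rwa [Set.range_sigmaMk] at this
    exact he.eventually_iterate hc ho rfl
  -- All local conditions hold together near `z₀`. They define the open set `C`; the ball is then
  -- chosen such that `f` maps it into `C`.
  have key := (((pull he.smooth_param).and hσ).and ((pull (he.eventually_bas hc K)).and
    (pull (he.eventually_fwd hc K)))).and (((pull hhitV).and (pull hfst)).and
    (((pull (he.eventually_hit hc (hAo.mem_nhds hQA))).and (pull (he.param_returnMap hc))).and
    ((hg.and (hfc.eventually (by rw [hf0]; exact hχσ))).and
    ((hfc.eventually (by rw [hf0]; exact hBo.mem_nhds hzB)).and (hhf.and (hfh.and (hf.and hh)))))))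
  obtain ⟨C, hC, hCo, hzC⟩ := _root_.mem_nhds_iff.1 key
  obtain ⟨ε, hε, hball⟩ := Metric.eventually_nhds_iff_ball.1
    ((hCo.eventually_mem hzC).and (hfc.eventually (by rw [hf0]; exact hCo.mem_nhds hzC)))
  -- From the start of the sheet `i` there are `K - 1 - i` resets before the exit near `Q`, where
  -- one whole turn is complete and the parameter reads `f z`.
  have hcoord : ∀ i < K, ∀ z ∈ C, χ (ρ (H.hit (H.next^[K - 1 - i] (H.next^[i + 1] (e (σ z)))))) =
      f z := by
    intro i hi z hz
    obtain ⟨-, -, -, ⟨h1, h2⟩, -⟩ := hC hz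
    rw [← Function.iterate_add_apply, show K - 1 - i + (i + 1) = K by omega]
    change χ (H.returnMap K e ρ (σ z)) = f z
    rw [h1, h2]
  have hiter : ∀ i < K, ∀ l ≤ K - 1 - i, ∀ z ∈ C, ∀ s ∈ Icc 0 (H.time (H.next^[i + 1] (e (σ z)))),
      H.next^[l] (H.flow (H.next^[i + 1] (e (σ z))) s) ∈ H.bas ∧
      H.hit (H.next^[l] (H.flow (H.next^[i + 1] (e (σ z))) s)) =
        H.hit (H.next^[l] (H.next^[i + 1] (e (σ z)))) := by
    intro i hi l hl z hz s hs
    obtain ⟨⟨-, hb, -⟩, -⟩ := hC hz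
    obtain ⟨f1, -, f3⟩ := flow_regular (hb (i + 1) hi) hs
    refine ⟨?_, (hit_iterate_congr f3 l).1⟩
    cases l with
    | zero => exact f1
    | succ l =>
      rw [(hit_iterate_congr f3 l).2, ← Function.iterate_add_apply]
      exact hb _ (by omega)
  have hflowcoord : ∀ i < K, ∀ z ∈ C, ∀ s ∈ Icc 0 (H.time (H.next^[i + 1] (e (σ z)))),
      χ (ρ (H.hit (H.next^[K - 1 - i] (H.flow (H.next^[i + 1] (e (σ z))) s)))) = f z := by
    intro i hi z hz s hs
    rw [(hiter i hi _ le_rfl z hz s hs).2, hcoord i hi z hz]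
  have hChf : ∀ z ∈ C, h (f z) = z := fun z hz => (hC hz).2.2.2.2.2.1
  have hsmooth : ∀ i < K, ∀ p : Σ j, D j, (∀ l ≤ K - 1 - i, H.next^[l] p ∈ H.bas) →
      H.hit (H.next^[K - 1 - i] p) ∈ A → χ (ρ (H.hit (H.next^[K - 1 - i] p))) ∈ B →
      ContMDiffAt (𝓡∂ (n p.1)) 𝓘(ℝ, EuclideanSpace ℝ (Fin r)) ∞
        (fun x => h (χ (ρ (H.hit (H.next^[K - 1 - i] ⟨p.1, x⟩))))) p.2 := by
    intro i hi p h1 h2 h3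
    have s1 : SmoothAt n (𝓡∂ (n p.1)) (fun x => (⟨p.1, x⟩ : Σ j, D j)) p.2 :=
      smoothAt_mk contMDiffAt_id
    have s2 := ((s1.iterate_next (l := K - 1 - i) fun l hl => h1 l hl.le).hit
      (h1 _ le_rfl)).comp_contMDiffAt rfl (hA h2)
    have s3 : ContMDiffAt (𝓡∂ (n p.1)) 𝓘(ℝ, EuclideanSpace ℝ (Fin r)) ∞
      (fun x => χ (ρ (H.hit (H.next^[K - 1 - i] ⟨p.1, x⟩)))) p.2 :=
      χ.contMDiff.contMDiffAt.comp p.2 s2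
    have s4 : ContMDiffAt 𝓘(ℝ, EuclideanSpace ℝ (Fin r)) 𝓘(ℝ, EuclideanSpace ℝ (Fin r)) ∞ h
      (χ (ρ (H.hit (H.next^[K - 1 - i] p)))) := ContDiffAt.contMDiffAt (hB h3)
    exact ContMDiffAt.comp p.2 s4 s3
  let S : H.SheetSystem K r :=
    { start := fun i z => H.next^[i + 1] (e (σ z))
      -- The parameter of a point is read at the end of the turn, where it is `f z`, and brought
      -- back by `h`. This is where `f` has to be a local diffeomorphism.
      coord := fun i p => h (χ (ρ (H.hit (H.next^[K - 1 - i] p))))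
      tube := fun i => {p | (∀ l ≤ K - 1 - i, H.next^[l] p ∈ H.bas) ∧
        H.hit p ∈ V (H.hit (H.next^[i + 1] Q)) ∧ H.hit (H.next^[K - 1 - i] p) ∈ A ∧
        χ (ρ (H.hit (H.next^[K - 1 - i] p))) ∈ B ∧ h (χ (ρ (H.hit (H.next^[K - 1 - i] p)))) ∈ C}
      dom := fun i => (H.next^[i + 1] Q).1
      base := Metric.ball z₀ ε
      ext := f '' Metric.ball z₀ ε
      total := C
      isOpen_base := Metric.isOpen_ball
      isOpen_ext := by
        have : f '' Metric.ball z₀ ε = {z | z ∈ C ∧ h z ∈ Metric.ball z₀ ε} := by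
          ext z
          constructor
          · rintro ⟨b, hb, rfl⟩
            refine ⟨(hball b hb).2, ?_⟩
            rwa [hChf b (hball b hb).1]
          · rintro ⟨hz, hb⟩
            exact ⟨h z, hb, (hC hz).2.2.2.2.2.2.1⟩
        rw [this, isOpen_iff_mem_nhds]
        rintro z ⟨hz, hb⟩
        filter_upwards [hCo.mem_nhds hz, (hC hz).2.2.2.2.2.2.2.2.continuousAt.eventually
          (Metric.isOpen_ball.mem_nhds hb)] with z' h1 h2
        exact ⟨h1, h2⟩
      base_subset := fun z hz => (hball z hz).1
      ext_subset := by
        rintro _ ⟨z, hz, rfl⟩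
        exact (hball z hz).2
      isPreconnected_base := (convex_ball z₀ ε).isPreconnected
      isPreconnected_ext := (convex_ball z₀ ε).isPreconnected.image f fun z hz =>
        (hC (hball z hz).1).2.2.2.2.2.2.2.1.continuousAt.continuousWithinAt
      smooth_start := fun i hi z hz => by
        obtain ⟨⟨⟨h1, h2⟩, h3, -⟩, -⟩ := hC hz
        exact (h1.comp_left h2.contMDiffAt).iterate_next fun l hl => h3 l (by omega)
      start_fst := fun i hi z hz => (hC hz).2.1.2 i hi
      start_bas := fun i hi z hz => (hC hz).1.2.1 (i + 1) hi
      start_fwd := fun i hi z hz => (hC hz).1.2.2 (i + 1) hi i.succ_pos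
      isOpen_tube := fun i hi => by
        refine isOpen_iff_mem_nhds.2 fun p ⟨h1, h2, h3, h4, h5⟩ => ?_
        have c1 : ContinuousAt (fun p => H.hit (H.next^[K - 1 - i] p)) p :=
          ContinuousAt.comp (continuousAt_hit (h1 _ le_rfl))
            (continuousAt_iterate_next fun l hl => h1 l hl.le)
        have c2 : ContinuousAt (fun p => χ (ρ (H.hit (H.next^[K - 1 - i] p)))) p :=
          χ.continuous.continuousAt.comp (ContinuousAt.comp
            (f := fun p => H.hit (H.next^[K - 1 - i] p)) (continuousAt_of_contMDiffAt (hA h3)) c1)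
        have c3 : ContinuousAt (fun p => h (χ (ρ (H.hit (H.next^[K - 1 - i] p))))) p :=
          ContinuousAt.comp (f := fun p => χ (ρ (H.hit (H.next^[K - 1 - i] p))))
            (show ContDiffAt ℝ ∞ h _ from hB h4).continuousAt c2
        filter_upwards [(finite_le_nat (K - 1 - i)).eventually_all.2 fun l hl =>
            eventually_iterate_next (fun l' hl' => h1 l' (hl'.le.trans hl)) isOpen_bas (h1 l hl),
          (continuousAt_hit (h1 0 (Nat.zero_le _))).eventually ((hV _).2.mem_nhds h2),
          c1.eventually (hAo.mem_nhds h3), c2.eventually (hBo.mem_nhds h4),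
          c3.eventually (hCo.mem_nhds h5)] with p' g1 g2 g3 g4 g5
        exact ⟨g1, g2, g3, g4, g5⟩
      disjoint_tube := fun i hi j hj hij => by
        refine Set.disjoint_left.2 fun p hp hp' => ?_
        have := hVd (mem_image_of_mem _ hi) (mem_image_of_mem _ hj) fun heq =>
          hij (by simpa using hc.inj (i + 1) (j + 1) i.succ_pos hi j.succ_pos hj heq)
        exact Set.disjoint_left.1 this hp.2.1 hp'.2.1
      tube_subset := fun i hi p hp => hp.1 0 (Nat.zero_le _)
      flow_mem := fun i hi z hz s hs => by
        obtain ⟨⟨-, hb, -⟩, ⟨h1, -⟩, ⟨h2, -⟩, -, h3, h4, -⟩ := hC hz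
        refine ⟨fun l hl => (hiter i hi l hl z hz s hs).1, ?_, ?_, ?_, ?_⟩
        · rw [(flow_regular (hb (i + 1) hi) hs).2.2]
          exact h1 i hi
        · rw [(hiter i hi _ le_rfl z hz s hs).2, ← Function.iterate_add_apply,
            show K - 1 - i + (i + 1) = K by omega]
          exact h2
        · rw [hflowcoord i hi z hz s hs]
          exact h3
        · rw [hflowcoord i hi z hz s hs, h4]
          exact hz
      smooth_coord := fun i hi p hp => hsmooth i hi p hp.1 hp.2.2.1 hp.2.2.2.1
      coord_mem := fun i hi p hp => hp.2.2.2.2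
      coord_flow := fun i hi z hz s hs => by
        rw [hflowcoord i hi z hz s hs, hChf z hz]
      next_start := fun i hi z hz => (Function.iterate_succ_apply' H.next (i + 1) _).symm
      next_last := fun i hi z hz => by
        obtain ⟨⟨-, hb, -⟩, -, ⟨-, h1⟩, ⟨h2, -⟩, -⟩ := hC (hball z hz).1
        refine ⟨f z, mem_image_of_mem f hz, ?_⟩
        change H.next (e (σ (f z))) = _
        -- The exit point of the last sheet is `e (σ (f z))`, so its reset is the starting point of
        -- the sheet `0` with parameter `f z`.
        rw [← h2, h1, next_hit (hb K le_rfl), hi]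
      pos := hc.pos }
  exact ⟨S, fun _ _ => rfl, Metric.mem_ball_self hε⟩

end IsGuardParam

/-- The return map reduces to a local diffeomorphism `f` of a submanifold of the guard, and `M`
consists of the sheets over it. Nearby trajectories arrive in the submanifold after a bounded number
of turns, because the values of `g^[m]` lie in it. -/
theorem exists_reduction_of_isCycle {d : ℕ} {e : EuclideanSpace ℝ (Fin d) → Σ j, D j}
    {ρ : (Σ j, D j) → EuclideanSpace ℝ (Fin d)} {y₀ : EuclideanSpace ℝ (Fin d)}
    (he : H.IsGuardParam Q e ρ y₀) (hc : H.IsCycle Q K) {m r : ℕ}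
    (hm : Module.finrank ℝ (fderiv ℝ (H.returnMap K e ρ) y₀).range < m)
    (hr : ∀ᶠ y in 𝓝 y₀, Module.finrank ℝ (fderiv ℝ ((H.returnMap K e ρ)^[m]) y).range = r) :
    ∃ M W : Set (Σ j, D j), H.IsInvariantSubmanifold (r + 1) M ∧ IsOpen W ∧
      H.cycleSet Q K ⊆ M ∩ W ∧ ∃ b₀ : ℝ, ∀ x ∈ W, ∃ b ∈ Icc 0 b₀,
        (∃ u, H.IsTrajectory x b u) ∧ ∀ u, H.IsTrajectory x b u → u b ∈ M := by
  set g := H.returnMap K e ρ with hgdef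
  obtain ⟨χ, σ, f, h, hσ0, hσ, hχσ, hf0, hf, -, hh, hhf, hfh, hg, hred⟩ :=
    exists_reduction (he.contDiffAt_returnMap hc) (he.returnMap_eq hc) hm hr
  obtain ⟨S, hS, hzS⟩ := he.exists_sheetSystem hc hσ0 hσ hχσ hf0 hf hh hhf hfh hg
  have hstart : ∀ i, S.start i (χ y₀) = H.next^[i + 1] Q := fun i => by
    rw [hS, hσ0, he.apply_eq]
  have hgs : ContinuousAt (g^[m]) y₀ :=
    (contDiffAt_iterate (he.contDiffAt_returnMap hc).self_of_nhds (he.returnMap_eq hc)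
      m).continuousAt
  have hland : ∀ w ∈ H.cycleSet Q K, ∃ b₀ : ℝ, ∀ᶠ x in 𝓝 w, ∃ b ≤ b₀, H.LandsIn S.carrier b x := by
    rintro w ⟨i, hi, s, hs, rfl⟩
    set w := H.flow (H.next^[i + 1] Q) s with hw
    obtain ⟨hwb, -, hwh⟩ := flow_regular (hc.bas_iterate (i + 1)) hs
    have hwn : ∀ l, H.next^[l + 1] w = H.next^[l + 1 + (i + 1)] Q := fun l => by
      rw [(hit_iterate_congr hwh l).2, ← Function.iterate_add_apply]
    have hwbas : ∀ l, H.next^[l] w ∈ H.bas := fun l => by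
      cases l with
      | zero => exact hwb
      | succ l => rw [hwn]; exact hc.bas_iterate _
    have hwfwd : ∀ l, H.next^[l + 1] w ∈ H.fwd := fun l => by
      rw [hwn]; exact hc.fwd _ (by omega)
    set a := K - 1 - i with ha
    have hwQ : H.hit (H.next^[a] w) = Q := by
      rw [(hit_iterate_congr hwh a).1, ← Function.iterate_add_apply,
        show a + (i + 1) = K by omega, hc.hit]
    -- There are `a` resets before the exit near `Q`, then `m` turns of `K` transitions to reach the
    -- submanifold, and one more reset to enter the sheet `0`.
    set N := m * K + 1 + a with hN
    have hca : ContinuousAt (fun x => H.hit (H.next^[a] x)) w :=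
      ContinuousAt.comp (continuousAt_hit (hwbas a)) (continuousAt_iterate_next fun l _ => hwbas l)
    have hcρ : ContinuousAt (fun x => ρ (H.hit (H.next^[a] x))) w :=
      ContinuousAt.comp (f := fun x => H.hit (H.next^[a] x))
        (by rw [hwQ]; exact he.continuousAt_coord) hca
    have hy0 : ρ (H.hit (H.next^[a] w)) = y₀ := by rw [hwQ, he.coord_eq]
    have pull : ∀ {p : EuclideanSpace ℝ (Fin d) → Prop}, (∀ᶠ y in 𝓝 y₀, p y) →
        ∀ᶠ x in 𝓝 w, p (ρ (H.hit (H.next^[a] x))) := fun {p} hp =>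
      hcρ.eventually (p := p) (by dsimp only; rw [hy0]; exact hp)
    have hbase : ∀ᶠ y in 𝓝 y₀, χ (g^[m] y) ∈ S.base := by
      refine (χ.continuous.continuousAt.comp hgs).eventually (S.isOpen_base.mem_nhds ?_)
      change χ (g^[m] y₀) ∈ _
      rw [Function.iterate_fixed (he.returnMap_eq hc)]
      exact hzS
    have htime : ContinuousAt (fun x => H.nextTime N x + H.time (H.next^[N] x) / 2) w :=
      (continuousAt_nextTime fun l _ => hwbas l).add
        ((ContinuousAt.comp (continuousAt_time (hwbas N))
          (continuousAt_iterate_next fun l _ => hwbas l)).div_const 2)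
    -- The landing time depends continuously on the starting point, so near `w` it stays below its
    -- value at `w` plus `1`.
    refine ⟨H.nextTime N w + H.time (H.next^[N] w) / 2 + 1, ?_⟩
    filter_upwards [(finite_le_nat N).eventually_all.2 fun l _ =>
        eventually_iterate_next (fun l _ => hwbas l) isOpen_bas (hwbas l),
      (finite_le_nat N).eventually_all.2 fun l _ =>
        eventually_iterate_next (fun l _ => hwbas l) isOpen_fwd (hwfwd l),
      hca.eventually (p := fun p => p ∈ H.exits → e (ρ p) = p)
        (by dsimp only; rw [hwQ]; exact he.right_inv), pull he.mem_exits,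
      pull (he.hit_iterate_mul hc m), pull hred, pull hbase, pull (he.eventually_bas hc (m * K)),
      htime.eventually (gt_mem_nhds (lt_add_one _))] with x h1 h2 h3 h4 h5 h6 h7 h8 h9
    have h3' := h3 (hit_mem_exits (h1 a (by omega)))
    set y := ρ (H.hit (H.next^[a] x)) with hy
    -- The first exit point near `Q` is `e y`; `m` turns later it is `e (g^[m] y)`, which equals `e
    -- (σ (χ (g^[m] y)))`, and its reset starts a curve of the sheet `0`.
    have hNx : H.next^[N] x = S.start 0 (χ (g^[m] y)) := by
      rw [hN, Function.iterate_add_apply, hS, ← h6, zero_add, Function.iterate_one]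
      have e1 : H.hit (H.next^[a] x) = H.hit (e y) := by rw [(exits_regular h4).2.2.1, h3']
      rw [(hit_iterate_congr e1 (m * K)).2, Function.iterate_succ_apply', ← next_hit (h8 _ le_rfl),
        h5]
    have hT := SheetSystem.time_start_pos S.pos (S.base_subset h7)
    -- Halfway between two transitions every trajectory is determined, so all of them are in the
    -- sheet at this time.
    have hl : H.LandsIn S.carrier (H.time (H.next^[N] x) / 2) (H.next^[N] x) := by
      rw [hNx]
      refine landsIn_flow (S.start_bas 0 S.pos _ (S.base_subset h7))
        (not_mem_exits (S.start_fwd 0 S.pos _ (S.base_subset h7))) (by linarith) (by linarith) ?_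
      exact ⟨0, S.pos, _, _, Or.inl ⟨h7, by linarith, by linarith⟩, rfl⟩
    exact ⟨_, h9.le, LandsIn.of_iterate_next (fun l hl => h1 l hl.le) (fun l hl => h2 l hl.le) hl⟩
  -- The orbit is compact, so finitely many of the local time bounds suffice.
  obtain ⟨b₀, hb₀⟩ : ∃ b₀ : ℝ,
      H.cycleSet Q K ⊆ interior {x | ∃ b ≤ b₀, H.LandsIn S.carrier b x} := by
    refine IsCompact.induction_on (p := fun s => ∃ b₀ : ℝ,
      s ⊆ interior {x | ∃ b ≤ b₀, H.LandsIn S.carrier b x}) hc.isCompact_cycleSet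
      ⟨0, empty_subset _⟩ (fun s t hst ⟨b, hb⟩ => ⟨b, hst.trans hb⟩) ?_ fun w hw => ?_
    · rintro s t ⟨b, hb⟩ ⟨b', hb'⟩
      refine ⟨max b b', union_subset (hb.trans (interior_mono ?_))
        (hb'.trans (interior_mono ?_))⟩
      · rintro x ⟨c, hc, hx⟩
        exact ⟨c, hc.trans (le_max_left _ _), hx⟩
      · rintro x ⟨c, hc, hx⟩
        exact ⟨c, hc.trans (le_max_right _ _), hx⟩
    · obtain ⟨b, hb⟩ := hland w hw
      exact ⟨_, mem_nhdsWithin_of_mem_nhds (interior_mem_nhds.2 hb), b, subset_rfl⟩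
  refine ⟨S.carrier, _, S.isInvariantSubmanifold, isOpen_interior, subset_inter ?_ hb₀, b₀,
    fun x hx => ?_⟩
  · rintro w ⟨i, hi, s, hs, rfl⟩
    rw [← hstart] at hs ⊢
    exact ⟨i, hi, _, s, Or.inl ⟨hzS, hs⟩, rfl⟩
  · obtain ⟨b, hb, h0, hx⟩ := interior_subset hx
    exact ⟨b, ⟨h0.le, hb⟩, hx⟩

end HybridSystem

end Hybrid

end HybridDS

namespace HybridDS

/-! ### Periodic orbits with transitions -/

section Hybrid

variable {J : Type*} {n : J → ℕ} [∀ j, NeZero (n j)] {D : J → Type*}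
  [∀ j, TopologicalSpace (D j)] [∀ j, ChartedSpace (EuclideanHalfSpace (n j)) (D j)]
  [∀ j, IsManifold (𝓡∂ (n j)) ∞ (D j)]

namespace HybridSystem

variable {H : HybridSystem n D} [∀ j, T2Space (D j)] {γ : ℝ → Σ j, D j} {τ : ℝ}

/-- An execution between two subsequent transitions. -/
theorem IsExecution.leads_to_transition (hu : H.IsExecution univ γ) (hfwd : ∀ t, γ t ∈ H.fwd)
    {a b : ℝ} (hab : a < b) (hcont : ∀ s ∈ Ioo a b, ContinuousAt γ s) (hb : ¬ ContinuousAt γ b) :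
    γ a ∈ H.bas ∧ H.time (γ a) = b - a ∧ (∀ s ∈ Ico 0 (b - a), H.flow (γ a) s = γ (a + s)) ∧
      H.next (γ a) = γ b ∧ Tendsto γ (𝓝[<] b) (𝓝 (H.hit (γ a))) := by
  obtain ⟨j, y, hy, hlim, hres⟩ := hu.jump b (mem_univ b) (by rwa [continuousWithinAt_univ])
  rw [univ_inter] at hlim
  classical
  -- With the value at `b` replaced by the left limit, the piece is continuous up to `b` and becomes
  -- a curve into the guard.
  have hc' : ContinuousOn (Function.update γ b ⟨j, y⟩) (Icc a b) := by
    intro r hr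
    rcases hr.2.eq_or_lt with rfl | hrb
    · rw [continuousWithinAt_update_same]
      refine hlim.mono_left (nhdsWithin_mono _ ?_)
      rintro s ⟨hs, hs'⟩
      exact lt_of_le_of_ne hs.2 hs'
    · rw [continuousWithinAt_update_of_ne hrb.ne]
      rcases hr.1.eq_or_lt with rfl | har
      · refine (hu.right_cont a (mem_univ a)).mono ?_
        exact fun s hs => ⟨mem_univ s, hs.1⟩
      · exact (hcont r ⟨har, hrb⟩).continuousWithinAt
  obtain ⟨k, c, hc, hint⟩ := hu.exists_isMIntegralCurveOn hab (subset_univ _)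
    (fun r hr => (hcont r hr).continuousWithinAt) hc' fun r hr => Function.update_of_ne hr.2.ne _ _
  have hcγ : ∀ r ∈ Ico a b, γ r = ⟨k, c r⟩ := fun r hr => by
    rw [← hc r (Ico_subset_Icc_self hr), Function.update_of_ne hr.2.ne]
  have hcb : (⟨j, y⟩ : Σ j, D j) = ⟨k, c b⟩ := by
    rw [← hc b (right_mem_Icc.2 hab.le), Function.update_self]
  have hh : HitBy (H.field k) (H.guard k) (c a) (b - a) fun s => c (s + a) := by
    refine ⟨by linarith, by simp, ?_, ?_, fun s hs => ?_⟩
    · refine IsMIntegralCurveOn.mono (IsMIntegralCurveOn.comp_add hint a) fun s hs => ?_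
      exact ⟨by linarith [hs.1], by linarith [hs.2]⟩
    · change (⟨k, c (b - a + a)⟩ : Σ j, D j) ∈ H.exits
      rw [sub_add_cancel]
      rw [← hcb]
      exact hy
    · change (⟨k, c (s + a)⟩ : Σ j, D j) ∈ H.fwd
      rw [← hcγ _ ⟨by linarith [hs.1], by linarith [hs.2]⟩]
      exact hfwd _
  obtain ⟨e1, e2, e3⟩ := hh.eq (H.smooth_field k) (H.guard_open k) (H.outward k)
  have hhit : H.hit ⟨k, c a⟩ = ⟨j, y⟩ := by
    rw [hcb]
    refine Sigma.ext rfl (heq_of_eq (e2.trans ?_))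
    simp only [sub_add_cancel]
  rw [hcγ a ⟨le_rfl, hab⟩]
  refine ⟨hh.mem_basin, e1, fun s hs => ?_, ?_, ?_⟩
  · rw [hcγ _ ⟨by linarith [hs.1], by linarith [hs.2]⟩, add_comm a s]
    exact Sigma.ext rfl (heq_of_eq (e3 (Ico_subset_Icc_self hs)))
  · rw [← next_hit hh.mem_basin, hhit, ← hres]
    exact (exits_regular (x := ⟨j, y⟩) hy).2.2.2
  · rw [hhit]
    exact hlim

omit [∀ j, T2Space (D j)] in
theorem IsPeriodicOrbit.continuousAt_add_zsmul (hγ : H.IsPeriodicOrbit γ τ) (t : ℝ) (z : ℤ)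
    (h : ContinuousAt γ (t + z • τ)) : ContinuousAt γ t := by
  have h1 : γ = γ ∘ fun s => s + z • τ := funext fun s => (hγ.periodic.zsmul z s).symm
  rw [h1]
  exact ContinuousAt.comp h (by fun_prop)

-- Reduction modulo the period is injective on a half-open interval of length `τ` and preserves
-- transitions.
omit [∀ j, T2Space (D j)] in
theorem IsPeriodicOrbit.finite_transitions (hγ : H.IsPeriodicOrbit γ τ)
    (hfin : {t ∈ Ico 0 τ | ¬ ContinuousAt γ t}.Finite) (a : ℝ) :
    {t ∈ Ioc a (a + τ) | ¬ ContinuousAt γ t}.Finite := by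
  refine Set.Finite.of_finite_image (f := toIcoMod hγ.pos 0) (hfin.subset ?_) ?_
  · rintro _ ⟨t, ⟨-, ht⟩, rfl⟩
    refine ⟨toIcoMod_mem_Ico' hγ.pos t, fun h => ht ?_⟩
    refine hγ.continuousAt_add_zsmul t (-toIcoDiv hγ.pos 0 t) ?_
    rwa [neg_smul, ← sub_eq_add_neg, self_sub_toIcoDiv_zsmul]
  · rintro s ⟨hs, -⟩ t ⟨ht, -⟩ hst
    have h1 := self_sub_toIcoMod hγ.pos 0 s
    have h2 := self_sub_toIcoMod hγ.pos 0 t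
    set z := toIcoDiv hγ.pos 0 s - toIcoDiv hγ.pos 0 t with hz
    have h3 : s - t = z * τ := by
      rw [hz, Int.cast_sub, sub_mul, ← zsmul_eq_mul, ← zsmul_eq_mul, ← h1, ← h2]
      rw [hst]
      ring
    have h4 : |(z : ℝ)| * τ < 1 * τ := by
      rw [← abs_of_pos hγ.pos, ← abs_mul, ← h3, abs_of_pos hγ.pos, one_mul, abs_lt]
      constructor <;> linarith [hs.1, hs.2, ht.1, ht.2]
    have h5 : |(z : ℝ)| < 1 := lt_of_mul_lt_mul_right h4 hγ.pos.le
    have h6 : z = 0 := Int.abs_lt_one_iff.1 (by exact_mod_cast h5)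
    rw [h6] at h3
    simp only [Int.cast_zero, zero_mul] at h3
    linarith

omit [∀ j, T2Space (D j)] in
theorem IsPeriodicOrbit.exists_next_transition (hγ : H.IsPeriodicOrbit γ τ)
    (hfin : {t ∈ Ico 0 τ | ¬ ContinuousAt γ t}.Finite) (hjump : ∃ t, ¬ ContinuousAt γ t) (a : ℝ) :
    ∃ b, a < b ∧ (∀ s ∈ Ioo a b, ContinuousAt γ s) ∧ ¬ ContinuousAt γ b := by
  have hne : {t ∈ Ioc a (a + τ) | ¬ ContinuousAt γ t}.Nonempty := by
    obtain ⟨t, ht⟩ := hjump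
    refine ⟨toIocMod hγ.pos a t, toIocMod_mem_Ioc hγ.pos a t, fun h => ht ?_⟩
    refine hγ.continuousAt_add_zsmul t (-toIocDiv hγ.pos a t) ?_
    rwa [neg_smul, ← sub_eq_add_neg, self_sub_toIocDiv_zsmul]
  obtain ⟨b, ⟨hb, hb'⟩, hmin⟩ := (hγ.finite_transitions hfin a).exists_minimalFor id _ hne
  refine ⟨b, hb.1, fun s hs => ?_, hb'⟩
  by_contra hcon
  have := hmin (j := s) ⟨⟨hs.1, hs.2.le.trans hb.2⟩, hcon⟩ hs.2.le
  exact absurd hs.2 (not_lt.2 this)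

/-- A periodic orbit with isolated transitions is a cycle. -/
theorem IsPeriodicOrbit.exists_isCycle (hγ : H.IsPeriodicOrbit γ τ)
    (hfin : {t ∈ Ico 0 τ | ¬ ContinuousAt γ t}.Finite) (hjump : ∃ t, ¬ ContinuousAt γ t)
    (hfwd : ∀ t, γ t ∈ H.fwd) (t : ℝ) :
    ∃ K, H.IsCycle (H.hit (γ t)) K ∧ orbit γ = H.cycleSet (H.hit (γ t)) K ∧
      ∀ i, ∃ s, H.next^[i + 1] (H.hit (γ t)) = γ s := by
  choose N hlt hcont hN using hγ.exists_next_transition hfin hjump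
  have hlead := fun a => hγ.isExecution.leads_to_transition hfwd (hlt a) (hcont a) (hN a)
  have hnext : ∀ k a, H.next^[k] (γ a) = γ (N^[k] a) := by
    intro k
    induction k with
    | zero => exact fun a => rfl
    | succ k ih => intro a; rw [Function.iterate_succ_apply, Function.iterate_succ_apply, ← ih,
        (hlead a).2.2.2.1]
  have hmono : ∀ a, StrictMono fun k => N^[k] a := fun a => strictMono_nat_of_lt_succ fun k => by
    rw [Function.iterate_succ_apply']
    exact hlt _
  have hunb : ∀ a, ∃ k, a + τ ≤ N^[k] a := by
    intro a
    by_contra hcon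
    push Not at hcon
    refine Set.infinite_of_injective_forall_mem (f := fun k => N^[k + 1] a) ?_ ?_
      (hγ.finite_transitions hfin a)
    · exact fun k l hkl => Nat.succ_injective ((hmono a).injective hkl)
    · intro k
      refine ⟨⟨(hmono a) k.succ_pos, (hcon _).le⟩, ?_⟩
      rw [Function.iterate_succ_apply']
      exact hN _
  -- Determinism: equal values at `x` and `y` force equal hitting times and next points, hence equal
  -- futures; the induction is on the number of transitions.
  have hdet : ∀ k x y, γ x = γ y → ∀ s, 0 ≤ s → x + s < N^[k] x → γ (x + s) = γ (y + s) := by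
    intro k
    induction k with
    | zero => intro x y _ s hs h; simp only [Function.iterate_zero, id] at h; linarith
    | succ k ih =>
      intro x y hxy s hs h
      have hx := hlead x
      have hy := hlead y
      have hTT : N x - x = N y - y := by rw [← hx.2.1, ← hy.2.1, hxy]
      rcases lt_or_ge s (N x - x) with hsT | hsT
      · rw [← hx.2.2.1 s ⟨hs, hsT⟩, ← hy.2.2.1 s ⟨hs, hTT ▸ hsT⟩, hxy]
      · have h2 := ih (N x) (N y) (by rw [← hx.2.2.2.1, ← hy.2.2.2.1, hxy]) (s - (N x - x))
          (by linarith) (by rw [Function.iterate_succ_apply] at h; linarith)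
        rwa [show N x + (s - (N x - x)) = x + s by ring,
          show N y + (s - (N x - x)) = y + s by rw [hTT]; ring] at h2
  -- The future from `x` covers a full period, so equal values at `x` and `y` make `y - x` a period.
  have hper : ∀ x y, γ x = γ y → Function.Periodic γ (y - x) := by
    intro x y hxy s
    obtain ⟨k, hk⟩ := hunb x
    have h1 := toIcoMod_mem_Ico hγ.pos x s
    have h2 := hdet k x y hxy (toIcoMod hγ.pos x s - x) (by linarith [h1.1])
      (by linarith [h1.2])
    have h3 : s = toIcoMod hγ.pos x s + toIcoDiv hγ.pos x s • τ :=
      (toIcoMod_add_toIcoDiv_zsmul hγ.pos x s).symm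
    have h4 := hγ.periodic.zsmul (toIcoDiv hγ.pos x s)
    calc γ (s + (y - x)) = γ (toIcoMod hγ.pos x s + (y - x) + toIcoDiv hγ.pos x s • τ) := by
          congr 1; nth_rewrite 1 [h3]; ring
      _ = γ (y + (toIcoMod hγ.pos x s - x)) := by rw [h4]; congr 1; ring
      _ = γ (toIcoMod hγ.pos x s) := by rw [← h2]; congr 1; ring
      _ = γ s := by rw [← h4, ← h3]
  set a := N t with ha
  have hQ : ∀ i, H.next^[i + 1] (H.hit (γ t)) = γ (N^[i] a) := fun i => by
    rw [Function.iterate_succ_apply, next_hit (hlead t).1, (hlead t).2.2.2.1, hnext]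
  classical
  -- The number of transitions in one period, counted from the transition `a`.
  let K := Nat.find (hunb a)
  have hK1 : a + τ ≤ N^[K] a := Nat.find_spec (hunb a)
  have hK2 : ∀ k < K, N^[k] a < a + τ := fun k hk => not_le.1 (Nat.find_min (hunb a) hk)
  have hK0 : 0 < K := by
    by_contra h0
    have : K = 0 := by omega
    rw [this] at hK1
    simp only [Function.iterate_zero, id] at hK1
    linarith [hγ.pos]
  have hKs : N^[K] a = N (N^[K - 1] a) := by
    rw [← Function.iterate_succ_apply' N, show (K - 1).succ = K by omega]
  -- By periodicity `a + τ` is a transition, so it cannot lie strictly between two subsequent ones.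
  have hKeq : N^[K] a = a + τ := by
    by_contra hne
    have h1 : a + τ < N^[K] a := lt_of_le_of_ne hK1 (Ne.symm hne)
    have h2 := hcont (N^[K - 1] a) (a + τ) ⟨hK2 _ (by omega), by rwa [← hKs]⟩
    exact hN t (hγ.continuousAt_add_zsmul a 1 (by rwa [one_smul]))
  have hcyc : H.IsCycle (H.hit (γ t)) K := by
    have hsucc : ∀ i, 0 < i → ∃ l, i = l + 1 := fun i hi => ⟨i - 1, by omega⟩
    refine ⟨hK0, hit_mem_exits (hlead t).1, fun i hi => ?_, fun i hi => ?_, ?_, ?_⟩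
    · obtain ⟨l, rfl⟩ := hsucc i hi
      rw [hQ]
      exact (hlead _).1
    · obtain ⟨l, rfl⟩ := hsucc i hi
      rw [hQ]
      exact hfwd _
    · have h1 := (hlead (N^[K - 1] a)).2.2.2.2
      rw [← hQ (K - 1), Nat.sub_add_cancel hK0, ← hKs, hKeq] at h1
      have h2 := (hlead t).2.2.2.2
      have h3 : Tendsto (fun s => s + τ) (𝓝[<] a) (𝓝[<] (a + τ)) := by
        refine tendsto_nhdsWithin_iff.2 ⟨((continuous_id.add continuous_const).tendsto
          a).mono_left nhdsWithin_le_nhds, ?_⟩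
        filter_upwards [self_mem_nhdsWithin] with s hs
        exact add_lt_add_left (α := ℝ) hs τ
      have h4 := h1.comp h3
      have h5 : γ ∘ (fun s => s + τ) = γ := funext hγ.periodic
      rw [h5] at h4
      exact tendsto_nhds_unique h4 h2
    -- Equal exit points have equal resets, so `γ` would take the same value at two transitions less
    -- than `τ` apart and have a smaller period.
    · have key : ∀ i j, i < j → j < K → H.hit (H.next^[i + 1] (H.hit (γ t))) ≠
          H.hit (H.next^[j + 1] (H.hit (γ t))) := by
        intro i j hij hj heq
        rw [hQ, hQ] at heq
        have h1 := next_eq_of_hit_eq heq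
        rw [(hlead _).2.2.2.1, (hlead _).2.2.2.1, ← Function.iterate_succ_apply' N,
          ← Function.iterate_succ_apply' N] at h1
        have h2 := hmono a (show i + 1 < j + 1 by omega)
        have h3 := (hmono a).monotone (show j + 1 ≤ K by omega)
        have h4 := hmono a (show 0 < i + 1 by omega)
        simp only [Function.iterate_zero, id] at h2 h3 h4
        exact hγ.least _ (by linarith) (by linarith) (hper _ _ h1)
      intro i j hi hiK hj hjK heq
      obtain ⟨i, rfl⟩ := hsucc i hi
      obtain ⟨j, rfl⟩ := hsucc j hj
      rcases lt_trichotomy i j with h | h | h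
      · exact absurd heq (key i j h (by omega))
      · rw [h]
      · exact absurd heq.symm (key j i h (by omega))
  refine ⟨K, hcyc, Subset.antisymm ?_ ?_, fun i => ⟨_, hQ i⟩⟩
  · refine closure_minimal ?_ hcyc.isCompact_cycleSet.isClosed
    rintro _ ⟨s, rfl⟩
    have h1 := toIcoMod_mem_Ico hγ.pos a s
    have h3 : γ s = γ (toIcoMod hγ.pos a s) := by
      rw [← hγ.periodic.zsmul (toIcoDiv hγ.pos a s) (toIcoMod hγ.pos a s),
      toIcoMod_add_toIcoDiv_zsmul]
    set s' := toIcoMod hγ.pos a s with hs'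
    have hex : ∃ k, s' < N^[k + 1] a := ⟨K - 1, by
      rw [Nat.sub_add_cancel hK0, hKeq]; exact h1.2⟩
    have f1 := Nat.find_spec hex
    have f2 : N^[Nat.find hex] a ≤ s' := by
      rcases Nat.eq_zero_or_pos (Nat.find hex) with h0 | h0
      · rw [h0]; exact h1.1
      · have := Nat.find_min hex (m := Nat.find hex - 1) (by omega)
        rwa [Nat.sub_add_cancel h0, not_lt] at this
    have f3 : Nat.find hex < K := by
      by_contra hcon
      have := (hmono a).monotone (show K ≤ Nat.find hex by omega)
      linarith [h1.2]
    set k := Nat.find hex with hk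
    rw [Function.iterate_succ_apply'] at f1
    have hl := hlead (N^[k] a)
    refine ⟨k, f3, s' - N^[k] a, ?_, ?_⟩
    · rw [hQ, hl.2.1]
      exact ⟨by linarith, by linarith⟩
    · rw [hQ, hl.2.2.1 _ ⟨by linarith, by linarith⟩, h3]
      congr 1
      ring
  · rintro w ⟨i, hi, s, hs, rfl⟩
    have hl := hlead (N^[i] a)
    rw [hQ, hl.2.1] at hs
    rw [hQ]
    rcases hs.2.eq_or_lt with h | h
    · rw [h, ← hl.2.1]
      exact mem_closure_of_tendsto hl.2.2.2.2 (.of_forall fun s => mem_range_self s)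
    · rw [hl.2.2.1 s ⟨hs.1, h⟩]
      exact subset_closure (mem_range_self _)

end HybridSystem

end Hybrid

end HybridDS

namespace HybridDS

/-! ### Returns of trajectories to points of a cycle -/

section Hybrid

variable {J : Type*} {n : J → ℕ} [∀ j, NeZero (n j)] {D : J → Type*}
  [∀ j, TopologicalSpace (D j)] [∀ j, ChartedSpace (EuclideanHalfSpace (n j)) (D j)]
  [∀ j, IsManifold (𝓡∂ (n j)) ∞ (D j)]

namespace HybridSystem

variable {H : HybridSystem n D} {Q : Σ j, D j} {K : ℕ} [∀ j, T2Space (D j)]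

theorem flow_flow {x : Σ j, D j} (hx : x ∈ H.bas) {s t : ℝ} (hs : s ∈ Icc 0 (H.time x))
    (ht : t ∈ Icc 0 (H.time x - s)) : H.flow (H.flow x s) t = H.flow x (s + t) := by
  have h := (hitBy_flow hx).shift hs
  obtain ⟨-, -, h3⟩ := h.eq (H.smooth_field x.1) (H.guard_open x.1) (H.outward x.1)
  rw [add_comm s t]
  exact Sigma.ext rfl (heq_of_eq (h3 ht))

namespace IsCycle

theorem next_mem_cycleSet (hc : H.IsCycle Q K) {w : Σ j, D j} (hw : w ∈ H.cycleSet Q K) :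
    H.next w ∈ H.cycleSet Q K := by
  obtain ⟨i, hi, s, hs, rfl⟩ := hw
  rw [next_flow (hc.bas _ i.succ_pos) hs, ← Function.iterate_succ_apply' H.next]
  have hmem : ∀ i, i < K → H.next^[i + 1] Q ∈ H.cycleSet Q K := fun i hi =>
    ⟨i, hi, 0, ⟨le_rfl, time_nonneg (hc.bas _ i.succ_pos)⟩, flow_zero (hc.bas _ i.succ_pos)⟩
  rcases (Nat.succ_le_of_lt hi).lt_or_eq with h | h
  · exact hmem (i + 1) h
  · have h1 : H.next^[(i + 1).succ] Q = H.next^[0 + 1] Q := by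
      rw [Function.iterate_succ_apply', ← next_hit (hc.bas _ i.succ_pos),
        show i.succ = K from h, hc.hit]
      rfl
    rw [h1]
    exact hmem 0 hc.pos

theorem flow_mem_cycleSet (hc : H.IsCycle Q K) {w : Σ j, D j} (hw : w ∈ H.cycleSet Q K) {t : ℝ}
    (ht : t ∈ Icc 0 (H.time w)) : H.flow w t ∈ H.cycleSet Q K := by
  obtain ⟨i, hi, s, hs, rfl⟩ := hw
  rw [(flow_regular (hc.bas _ i.succ_pos) hs).2.1] at ht
  rw [flow_flow (hc.bas _ i.succ_pos) hs ht]
  exact ⟨i, hi, s + t, ⟨by linarith [hs.1, ht.1], by linarith [ht.2]⟩, rfl⟩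

theorem iterate_mem_cycleSet (hc : H.IsCycle Q K) {w : Σ j, D j} (hw : w ∈ H.cycleSet Q K)
    (l : ℕ) : H.next^[l] w ∈ H.cycleSet Q K := by
  induction l with
  | zero => exact hw
  | succ l ih =>
    rw [Function.iterate_succ_apply']
    exact hc.next_mem_cycleSet ih

end IsCycle

/-- The value of a trajectory at a transition. -/
theorem IsTrajectory.apply_nextTime {l : ℕ} : ∀ {x : Σ j, D j} {b : ℝ} {u : ℝ → Σ j, D j},
    (∀ i < l, H.next^[i] x ∈ H.bas) → (∀ i ≤ l, 0 < i → H.next^[i] x ∈ H.fwd) →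
    H.IsTrajectory x b u → H.nextTime l x < b → (l = 0 → x ∉ H.exits) →
    u (H.nextTime l x) = H.next^[l] x := by
  induction l with
  | zero =>
    intro x b u _ _ hu _ h0
    simpa [nextTime] using hu.start_flow (h0 rfl)
  | succ l ih =>
    intro x b u hbas hfwd hu hb _
    rw [nextTime_succ] at hb ⊢
    have hn : H.next x ∈ H.fwd := hfwd 1 (by omega) one_pos
    have hbas' : ∀ i < l, H.next^[i] (H.next x) ∈ H.bas := fun i hi => hbas (i + 1) (by omega)
    have h0 : 0 ≤ H.nextTime l (H.next x) :=
      Finset.sum_nonneg fun i hi => time_nonneg (hbas' i (Finset.mem_range.1 hi))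
    have h1 := ih hbas' (fun i hi _ => hfwd (i + 1) (by omega) i.succ_pos)
      (hu.of_next (hbas 0 l.succ_pos) hn (by linarith)) (by linarith) fun _ => not_mem_exits hn
    rwa [add_comm (H.nextTime l _)] at h1

/-- The return of a trajectory to a point `x` of a cycle. -/
theorem IsCycle.return_time (hc : H.IsCycle Q K) {x : Σ j, D j} (hx : x ∈ H.cycleSet Q K)
    (hxQ : H.hit x = Q) {b : ℝ} (hb : 0 < b) {u : ℝ → Σ j, D j} (hu : H.IsTrajectory x b u)
    {y : Σ j, D j} (hy : MeetsAt u b y) (hy' : y ∈ H.cycleSet Q K → y = x)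
    (hfirst : ∀ t ∈ Ioo 0 b, ¬ MeetsAt u t x) :
    y = x ∧ b < H.nextTime (K + 2) x ∧ H.nextTime (K + 1) x = H.time x + b := by
  obtain ⟨i, hi, s₀, hs₀, hxs⟩ := hx
  have hbasQ := fun i => hc.bas_iterate i
  obtain ⟨hxb, hxt, hxh⟩ := flow_regular (hbasQ (i + 1)) hs₀
  rw [hxs] at hxb hxt hxh
  -- The next exit from `x` is `Q`, and exit points on the cycle are distinct, so `x` lies on the
  -- last curve of the cycle.
  have hiK : i + 1 = K := hc.inj _ _ i.succ_pos hi hc.pos le_rfl (by rw [← hxh, hxQ, hc.hit])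
  have hnx : ∀ l, H.next^[l + 1] x = H.next^[l + 1] Q := fun l =>
    (hit_iterate_congr (by rw [hxQ, (exits_regular hc.exit).2.2.1]) l).2
  have hbas : ∀ l, H.next^[l] x ∈ H.bas := fun l => by
    cases l with
    | zero => exact hxb
    | succ l => rw [hnx]; exact hbasQ _
  have hfwd : ∀ l, 0 < l → H.next^[l] x ∈ H.fwd := fun l hl => by
    obtain ⟨l, rfl⟩ : ∃ l', l = l' + 1 := ⟨l - 1, by omega⟩
    rw [hnx]; exact hc.fwd _ l.succ_pos
  have hpos : ∀ l, 0 < l → 0 < H.time (H.next^[l] x) := fun l hl =>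
    time_pos (hbas l) (not_mem_exits (hfwd l hl))
  have hsucc : ∀ l, H.nextTime (l + 1) x = H.nextTime l x + H.time (H.next^[l] x) := fun l =>
    Finset.sum_range_succ _ _
  have hK : H.next^[K] x = H.next^[i + 1] Q := by rw [← hiK, hnx]
  rw [← hK] at hs₀ hxs hxt
  have hx' : x ∈ H.cycleSet Q K := ⟨i, hi, s₀, hK ▸ hs₀, hK ▸ hxs⟩
  -- If `x` is the very start of its curve, the time of return is the `K`-th transition time, which
  -- must be positive to be an admissible time in the first return condition.
  have hnT0 : 0 < H.nextTime K x ∨ s₀ = 0 → 0 < H.nextTime K x + s₀ := by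
    intro h
    rcases h with h | h
    · linarith [hs₀.1]
    · subst h
      rw [add_zero]
      rw [← hiK, hsucc]
      have h1 : 0 ≤ H.nextTime i x := Finset.sum_nonneg fun l _ => time_nonneg (hbas l)
      rcases Nat.eq_zero_or_pos i with rfl | hi0
      · have : 0 < H.time x := by rw [hxt, sub_zero]; exact hpos K hc.pos
        simp only [Function.iterate_zero, id]
        linarith
      · linarith [hpos i hi0]
  have hKnn : 0 ≤ H.nextTime K x := Finset.sum_nonneg fun l _ => time_nonneg (hbas l)
  -- After `K` transitions and the time `s₀` the trajectory is at `x` again, so the first return to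
  -- the section cannot be later.
  have hle : b ≤ H.nextTime K x + s₀ := by
    by_contra hcon
    push Not at hcon
    rcases hs₀.1.eq_or_lt with h0 | h0
    · refine hfirst (H.nextTime K x) ⟨?_, by linarith [hs₀.1]⟩ (Or.inl ?_)
      · have := hnT0 (Or.inr h0.symm)
        linarith
      · rw [hu.apply_nextTime (fun l _ => hbas l) (fun l _ => hfwd l) (by linarith)
          fun h => absurd h hc.pos.ne']
        rw [← h0, flow_zero (hbas K)] at hxs
        exact hxs
    · refine hfirst _ ⟨by linarith, hcon⟩ ?_
      have := hu.meetsAt_flow (fun l _ => hbas l) (fun l _ => hfwd l) h0 hcon hs₀.2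
      rwa [hxs] at this
  have hlt : b < H.nextTime (K + 2) x := by
    rw [hsucc, hsucc]
    linarith [hs₀.2, hpos (K + 1) K.succ_pos]
  obtain ⟨l, hl, h1, h2, h3⟩ := hu.meetsAt (L := K + 1) (fun l _ => hbas l) (fun l _ => hfwd l)
    hb le_rfl hlt hy
  have hmem : b - H.nextTime l x ∈ Icc 0 (H.time (H.next^[l] x)) :=
    ⟨by linarith, by linarith [hsucc l]⟩
  have hyx : y = x := hy' (by
    rw [h3]
    exact hc.flow_mem_cycleSet (hc.iterate_mem_cycleSet hx' l) hmem)
  refine ⟨hyx, hlt, ?_⟩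
  obtain ⟨-, r2, r3⟩ := flow_regular (hbas l) hmem
  rw [← h3, hyx] at r2 r3
  -- For `l = 0` the hitting time of `x` would have decreased; for `0 < l < K` two exit points would
  -- agree; for `l = K + 1` the point `x` would be both an exit point and the start of a curve.
  have hlK : l = K := by
    rcases Nat.eq_zero_or_pos l with rfl | hl0
    · simp only [nextTime, Finset.range_zero, Finset.sum_empty, Function.iterate_zero, id] at r2
      linarith
    · rcases hl.lt_or_eq with h | h
      · refine hc.inj l K hl0 (by omega) hc.pos le_rfl ?_
        obtain ⟨l', rfl⟩ : ∃ l', l = l' + 1 := ⟨l - 1, by omega⟩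
        rw [← hnx, ← r3, hxQ, hc.hit]
      · subst h
        have e1 : s₀ = H.time (H.next^[K] x) := by linarith [hsucc K, hs₀.2]
        have e2 : b - H.nextTime (K + 1) x = 0 := by linarith [hsucc K]
        rw [e2, flow_zero (hbas _), hyx] at h3
        rw [e1, sub_self] at hxt
        exact absurd (mem_exits_of_time_eq_zero hxb hxt)
          (not_mem_exits (h3 ▸ hfwd (K + 1) K.succ_pos))
  rw [hlK] at r2
  rw [hsucc]
  linarith

end HybridSystem

end Hybrid

end HybridDS

namespace HybridDS

/-! ### Transversal sections -/

/-- Coordinates on the boundary hyperplane of the half-space, in which the guard lies. -/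
theorem exists_tail {N d : ℕ} [NeZero N] (h : d + 1 = N) :
    ∃ κ : EuclideanSpace ℝ (Fin N) →L[ℝ] EuclideanSpace ℝ (Fin d),
      ∀ x, x 0 = 0 → κ x = 0 → x = 0 := by
  subst h
  refine ⟨tailL d, fun x h0 h1 => ?_⟩
  ext i
  refine Fin.cases h0 (fun i => ?_) i
  exact congrArg (fun y : EuclideanSpace ℝ (Fin d) => y i) h1

section Section

variable {d : ℕ} {S : Type*} [TopologicalSpace S] [ChartedSpace (EuclideanSpace ℝ (Fin d)) S]
  [IsManifold (𝓡 d) ∞ S]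

theorem contMDiffAt_extChartAt_symm (ξ : S) {y : EuclideanSpace ℝ (Fin d)}
    (hy : y ∈ (extChartAt (𝓡 d) ξ).target) :
    ContMDiffAt 𝓘(ℝ, EuclideanSpace ℝ (Fin d)) (𝓡 d) ∞ (extChartAt (𝓡 d) ξ).symm y :=
  (contMDiffOn_extChartAt_symm (I := 𝓡 d) (n := ∞) ξ).contMDiffAt
    ((isOpen_extChartAt_target (I := 𝓡 d) ξ).mem_nhds hy)

theorem isInvertible_mfderiv_extChartAt_symm (ξ : S) {y : EuclideanSpace ℝ (Fin d)}
    (hy : y ∈ (extChartAt (𝓡 d) ξ).target) :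
    (mfderiv 𝓘(ℝ, EuclideanSpace ℝ (Fin d)) (𝓡 d) (extChartAt (𝓡 d) ξ).symm y).IsInvertible := by
  have hm1 : IsManifold (𝓡 d) 1 S := IsManifold.of_le (I := 𝓡 d) (M := S) (n := ∞)
    (by exact_mod_cast le_top)
  have := isInvertible_mfderivWithin_extChartAt_symm (I := 𝓡 d) (x := ξ) hy
  rwa [ModelWithCorners.Boundaryless.range_eq_univ, mfderivWithin_univ] at this

variable {n : ℕ} [NeZero n] {X : Type*} [TopologicalSpace X] [ChartedSpace (EuclideanHalfSpace n) X]
  [IsManifold (𝓡∂ n) ∞ X] [T2Space X] {v : ∀ x : X, TangentSpace (𝓡∂ n) x} {G : Set X}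

/-- The points in which the field leads from a transversal section into the guard form a chart of
the guard. -/
theorem exists_guard_coord
    (hv : ContMDiff (𝓡∂ n) (𝓡∂ n).tangent ∞ fun x => (⟨x, v x⟩ : TangentBundle (𝓡∂ n) X))
    (hG : ∃ O : Set X, IsOpen O ∧ G = O ∩ (𝓡∂ n).boundary X)
    (hout : ∀ x ∈ G, (show EuclideanSpace ℝ (Fin n) from v x) 0 < 0)
    {ι : S → X} (hι : SmoothEmb (𝓡 d) (𝓡∂ n) ι) (hd : d + 1 = n) (ξ : S)
    (htr : v (ι ξ) ∉ range (mfderiv (𝓡 d) (𝓡∂ n) ι ξ)) (hξ : ι ξ ∈ basin v G) :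
    ∃ ρ : X → EuclideanSpace ℝ (Fin d),
      (∀ᶠ x in 𝓝 (hitPt v G (ι ξ)), ContMDiffAt (𝓡∂ n) 𝓘(ℝ, EuclideanSpace ℝ (Fin d)) ∞ ρ x) ∧
      (∀ᶠ y in 𝓝 (extChartAt (𝓡 d) ξ ξ), ρ (hitPt v G (ι ((extChartAt (𝓡 d) ξ).symm y))) = y) ∧
      ∀ᶠ x in 𝓝 (hitPt v G (ι ξ)), x ∈ G →
        hitPt v G (ι ((extChartAt (𝓡 d) ξ).symm (ρ x))) = x := by
  have hm1 : IsManifold (𝓡∂ n) 1 X := IsManifold.of_le (I := 𝓡∂ n) (M := X) (n := ∞)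
    (by exact_mod_cast le_top)
  have hne : (∞ : WithTop ℕ∞) ≠ 0 := by simp
  obtain ⟨κ, hκ⟩ := exists_tail hd
  set φ := extChartAt (𝓡 d) ξ with hφ
  set y₀ := φ ξ with hy₀
  set q := hitPt v G (ι ξ) with hq
  set b := extChartAt (𝓡∂ n) q with hb
  have hφ0 : φ.symm y₀ = ξ := extChartAt_to_inv ξ
  have hyt : y₀ ∈ φ.target := mem_extChartAt_target ξ
  let A : EuclideanSpace ℝ (Fin d) → X := fun y => ι (φ.symm y)
  have hA0 : A y₀ = ι ξ := congrArg ι hφ0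
  have hA : ∀ y ∈ φ.target, ContMDiffAt 𝓘(ℝ, EuclideanSpace ℝ (Fin d)) (𝓡∂ n) ∞ A y :=
    fun y hy => hι.smooth.contMDiffAt.comp y (contMDiffAt_extChartAt_symm ξ hy)
  have hAt : ∀ᶠ y in 𝓝 y₀, y ∈ φ.target := (isOpen_extChartAt_target ξ).mem_nhds hyt
  obtain ⟨hbas, hTk, -, hPk, hker⟩ := hit_regular hv hG hout hξ
  obtain ⟨hTv, hPv⟩ := mfderiv_hit_field hv hG hout hξ
  have hbasA : ∀ᶠ y in 𝓝 y₀, A y ∈ basin v G :=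
    (hA y₀ hyt).continuousAt.eventually (by rw [hA0]; exact hbas)
  let C : EuclideanSpace ℝ (Fin d) → X := fun y => hitPt v G (A y)
  have hC0 : C y₀ = q := by simp only [C, hA0, hq]
  have hCk : ∀ y ∈ φ.target, A y ∈ basin v G →
      ContMDiffAt 𝓘(ℝ, EuclideanSpace ℝ (Fin d)) (𝓡∂ n) ∞ C y := fun y hy hyb =>
    ContMDiffAt.comp y (hit_regular hv hG hout hyb).2.2.2.1 (hA y hy)
  have hbo : IsOpen b.source := isOpen_extChartAt_source q
  have hqs : q ∈ b.source := mem_extChartAt_source q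
  have hCs : ∀ᶠ y in 𝓝 y₀, C y ∈ b.source :=
    (hCk y₀ hyt hbasA.self_of_nhds).continuousAt.eventually (by rw [hC0]; exact hbo.mem_nhds hqs)
  have hbk : ∀ x ∈ b.source, ContMDiffAt (𝓡∂ n) 𝓘(ℝ, EuclideanSpace ℝ (Fin n)) ∞ b x :=
    fun x hx => contMDiffAt_extChartAt' (by rwa [← extChartAt_source (𝓡∂ n)])
  let B : EuclideanSpace ℝ (Fin d) → EuclideanSpace ℝ (Fin n) := fun y => b (C y)
  have hBk : ∀ᶠ y in 𝓝 y₀, ContDiffAt ℝ ∞ B y := by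
    filter_upwards [hAt, hbasA, hCs] with y h1 h2 h3
    exact ContMDiffAt.contDiffAt (ContMDiffAt.comp y (hbk _ h3) (hCk y h1 h2))
  have hGb : ∀ x ∈ b.source, x ∈ G → b x 0 = 0 := by
    intro x hx hxG
    obtain ⟨O, -, rfl⟩ := hG
    exact (isBoundaryPoint_iff_chart hx).1 hxG.2
  have hB0 : ∀ᶠ y in 𝓝 y₀, B y 0 = 0 := by
    filter_upwards [hbasA, hCs] with y h1 h2
    exact hGb _ h2 (hitBy_hitCurve h1).2.2.2.1
  have hBd := (hBk.self_of_nhds.differentiableAt hne).hasFDerivAt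
  -- Let `V` be a vector tangent to the section that the derivative of the hitting point kills, and
  -- `c` its image under that of the hitting time. The field has the images `0` and `-1`, so `V + c
  -- • v` is killed by both, and vanishes.
  have hinj : ∀ w, κ (fderiv ℝ B y₀ w) = 0 → w = 0 := by
    intro w hw
    have h1 : (fderiv ℝ B y₀ w) 0 = 0 := by
      have e1 := (EuclideanSpace.proj (𝕜 := ℝ) (0 : Fin n)).hasFDerivAt.comp y₀ hBd
      have e2 := (hasFDerivAt_const (𝕜 := ℝ) (0 : ℝ) y₀).congr_of_eventuallyEq
        (f₁ := (EuclideanSpace.proj (𝕜 := ℝ) (0 : Fin n)) ∘ B) hB0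
      exact DFunLike.congr_fun (e1.unique e2) w
    have h2 := hκ _ h1 hw
    have dA : HasMFDerivAt 𝓘(ℝ, EuclideanSpace ℝ (Fin d)) (𝓡∂ n) A y₀
        ((mfderiv (𝓡 d) (𝓡∂ n) ι ξ).comp
          (mfderiv 𝓘(ℝ, EuclideanSpace ℝ (Fin d)) (𝓡 d) φ.symm y₀)) :=
      HasMFDerivAt.comp y₀ (by rw [hφ0]; exact (hι.smooth.mdifferentiableAt hne).hasMFDerivAt)
        ((contMDiffAt_extChartAt_symm ξ hyt).mdifferentiableAt hne).hasMFDerivAt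
    have dC := HasMFDerivAt.comp (g := hitPt v G) (f := A) y₀
      (by rw [hA0]; exact (hPk.mdifferentiableAt hne).hasMFDerivAt) dA
    have dB := HasMFDerivAt.comp (g := b) (f := C) y₀
      (by rw [hC0]; exact ((hbk q hqs).mdifferentiableAt hne).hasMFDerivAt) dC
    have h3 := congrArg (fun L : EuclideanSpace ℝ (Fin d) →L[ℝ] EuclideanSpace ℝ (Fin n) => L w)
      (hasMFDerivAt_unique dB hBd.hasMFDerivAt)
    rw [h2] at h3
    set V := (mfderiv (𝓡 d) (𝓡∂ n) ι ξ) (mfderiv 𝓘(ℝ, EuclideanSpace ℝ (Fin d)) (𝓡 d) φ.symm y₀ w)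
      with hV
    have h4 : mfderiv (𝓡∂ n) (𝓡∂ n) (hitPt v G) (ι ξ) V = 0 := by
      refine (isInvertible_mfderiv_extChartAt (I := 𝓡∂ n) hqs).injective ?_
      rw [map_zero]
      exact h3
    set c : ℝ := mfderiv (𝓡∂ n) 𝓘(ℝ, ℝ) (hitTime v G) (ι ξ) V with hc
    have h5 : V + c • v (ι ξ) = 0 := by
      refine hker _ ?_ ?_
      · rw [map_add, map_smul, hTv, ← hc]
        change c + c • (-1 : ℝ) = 0
        simp
      · rw [map_add, map_smul, hPv, h4, smul_zero, add_zero]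
    -- Otherwise the field would be a multiple of a vector tangent to the section, against
    -- transversality.
    have h6 : c = 0 := by
      by_contra hc0
      let L : EuclideanSpace ℝ (Fin d) →L[ℝ] EuclideanSpace ℝ (Fin n) := mfderiv (𝓡 d) (𝓡∂ n) ι ξ
      let z : EuclideanSpace ℝ (Fin d) := mfderiv 𝓘(ℝ, EuclideanSpace ℝ (Fin d)) (𝓡 d) φ.symm y₀ w
      have h8 : L (-(c⁻¹ • z)) = -(c⁻¹ • L z) := by rw [map_neg, map_smul]
      refine htr ⟨-(c⁻¹ • z), h8.trans ?_⟩
      have h9 : ∀ x y : EuclideanSpace ℝ (Fin n), x + c • y = 0 → -(c⁻¹ • x) = y := by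
        intro x y hxy
        rw [eq_neg_of_add_eq_zero_left hxy, smul_neg, neg_neg, smul_smul, inv_mul_cancel₀ hc0,
          one_smul]
      exact h9 _ _ h5
    rw [h6, zero_smul, add_zero] at h5
    have h7 := hι.injective_mfderiv ξ (h5.trans (map_zero _).symm)
    exact (isInvertible_mfderiv_extChartAt_symm ξ hyt).injective (h7.trans (map_zero _).symm)
  -- Points of the guard have first coordinate `0`, so `κ` loses nothing, and the inverse of `F`
  -- provides coordinates of the guard.
  let F : EuclideanSpace ℝ (Fin d) → EuclideanSpace ℝ (Fin d) := fun y => κ (B y)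
  have hFk : ∀ᶠ y in 𝓝 y₀, ContDiffAt ℝ ∞ F y := by
    filter_upwards [hBk] with y hy
    exact κ.contDiff.contDiffAt.comp y hy
  let f' : EuclideanSpace ℝ (Fin d) ≃L[ℝ] EuclideanSpace ℝ (Fin d) :=
    (LinearEquiv.ofInjectiveEndo (κ ∘L fderiv ℝ B y₀ :
      EuclideanSpace ℝ (Fin d) →L[ℝ] EuclideanSpace ℝ (Fin d)).toLinearMap
      ((injective_iff_map_eq_zero _).2 hinj)).toContinuousLinearEquiv
  have hf' : (f' : EuclideanSpace ℝ (Fin d) →L[ℝ] EuclideanSpace ℝ (Fin d)) =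
      κ ∘L fderiv ℝ B y₀ := by
    ext1 z
    rfl
  have hFd : HasFDerivAt F (f' : EuclideanSpace ℝ (Fin d) →L[ℝ] EuclideanSpace ℝ (Fin d)) y₀ := by
    rw [hf']
    exact κ.hasFDerivAt.comp y₀ hBd
  obtain ⟨h, h0, hk, hl, hr⟩ := exists_smooth_local_inverse hFk hFd
  have hκb : ContinuousAt (fun x => κ (b x)) q :=
    κ.continuous.continuousAt.comp (hbk q hqs).continuousAt
  have hF0 : F y₀ = κ (b q) := by simp only [F, B, hC0]
  rw [hF0] at h0 hk hr
  have hκbh : ContinuousAt (fun x => h (κ (b x))) q :=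
    ContinuousAt.comp (f := fun x => κ (b x)) hk.self_of_nhds.continuousAt hκb
  refine ⟨fun x => h (κ (b x)), ?_, hl, ?_⟩
  · filter_upwards [hbo.mem_nhds hqs, hκb.eventually hk] with x h1 h2
    exact ContMDiffAt.comp x h2.contMDiffAt (κ.contMDiff.contMDiffAt.comp x (hbk x h1))
  · filter_upwards [hbo.mem_nhds hqs, hκb.eventually hr,
      hκbh.eventually (by dsimp only; rw [h0]; exact hB0),
      hκbh.eventually (by dsimp only; rw [h0]; exact hCs)] with x h1 h2 h3 h4 hxG
    refine b.injOn h4 h1 ?_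
    have h5 : B (h (κ (b x))) - b x = 0 := by
      refine hκ _ ?_ ?_
      · change B (h (κ (b x))) 0 - b x 0 = 0
        rw [h3, hGb x h1 hxG, sub_zero]
      · rw [map_sub, sub_eq_zero]
        exact h2
    exact sub_eq_zero.1 h5

end Section

end HybridDS

namespace HybridDS

/-! ### The Poincaré map and the return map of the guard -/

section Hybrid

variable {J : Type*} {n : J → ℕ} [∀ j, NeZero (n j)] {D : J → Type*}
  [∀ j, TopologicalSpace (D j)] [∀ j, ChartedSpace (EuclideanHalfSpace (n j)) (D j)]
  [∀ j, IsManifold (𝓡∂ (n j)) ∞ (D j)] [∀ j, T2Space (D j)]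
  {d : ℕ} {S : Type*} [TopologicalSpace S] [ChartedSpace (EuclideanSpace ℝ (Fin d)) S]
  [IsManifold (𝓡 d) ∞ S]

namespace HybridSystem

variable {H : HybridSystem n D} {K : ℕ} {j₀ : J} {ι : S → D j₀} {ξ : S}

theorem exists_isGuardParam (hι : SmoothEmb (𝓡 d) (𝓡∂ (n j₀)) ι) (hd : d + 1 = n j₀)
    (htr : H.field j₀ (ι ξ) ∉ range (mfderiv (𝓡 d) (𝓡∂ (n j₀)) ι ξ))
    (hξ : (⟨j₀, ι ξ⟩ : Σ j, D j) ∈ H.bas) :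
    ∃ ρ, H.IsGuardParam (H.hit ⟨j₀, ι ξ⟩)
      (fun y => H.hit ⟨j₀, ι ((extChartAt (𝓡 d) ξ).symm y)⟩) ρ (extChartAt (𝓡 d) ξ ξ) := by
  obtain ⟨ρ, h1, h2, h3⟩ := exists_guard_coord (H.smooth_field j₀) (H.guard_open j₀)
    (H.outward j₀) hι hd ξ htr hξ
  set q := hitPt (H.field j₀) (H.guard j₀) (ι ξ) with hq
  have hη0 : (extChartAt (𝓡 d) ξ).symm (extChartAt (𝓡 d) ξ ξ) = ξ := extChartAt_to_inv ξ
  have hη : ∀ᶠ y in 𝓝 (extChartAt (𝓡 d) ξ ξ),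
      ContMDiffAt 𝓘(ℝ, EuclideanSpace ℝ (Fin d)) (𝓡∂ (n j₀)) ∞
        (fun y => ι ((extChartAt (𝓡 d) ξ).symm y)) y := by
    filter_upwards [(isOpen_extChartAt_target (I := 𝓡 d) ξ).mem_nhds (mem_extChartAt_target ξ)]
      with y hy
    exact hι.smooth.contMDiffAt.comp y (contMDiffAt_extChartAt_symm ξ hy)
  have hcont : ContinuousAt (fun y => (⟨j₀, ι ((extChartAt (𝓡 d) ξ).symm y)⟩ : Σ j, D j))
      (extChartAt (𝓡 d) ξ ξ) :=
    ContinuousAt.comp (g := Sigma.mk j₀) continuous_sigmaMk.continuousAt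
      hη.self_of_nhds.continuousAt
  have hbas : ∀ᶠ y in 𝓝 (extChartAt (𝓡 d) ξ ξ),
      (⟨j₀, ι ((extChartAt (𝓡 d) ξ).symm y)⟩ : Σ j, D j) ∈ H.bas :=
    hcont.eventually (p := fun p => p ∈ H.bas)
      (by dsimp only; rw [hη0]; exact isOpen_bas.mem_nhds hξ)
  have hnhds : 𝓝 (H.hit ⟨j₀, ι ξ⟩) = map (Sigma.mk j₀) (𝓝 q) := Sigma.nhds_mk j₀ q
  refine ⟨fun p => ρ (toDomain q p), by rw [hη0], ?_, ?_, ?_, ?_, ?_⟩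
  · filter_upwards [hη, hbas] with y hy hb
    exact (smoothAt_mk hy).hit hb
  · filter_upwards [hbas] with y hb using hit_mem_exits hb
  · rw [hnhds, eventually_map]
    filter_upwards [h1] with x hx
    simp only [toDomain_mk]
    exact hx
  · filter_upwards [h2] with y hy
    refine Eq.trans (congrArg ρ ?_) hy
    exact toDomain_mk q _
  · rw [hnhds, eventually_map]
    filter_upwards [h3] with x hx hxe
    rw [toDomain_mk]
    exact Sigma.ext rfl (heq_of_eq (hx hxe))

/-- Up to the flow, the Poincaré map is the return map of the guard. -/
theorem IsPoincareMap.eventually_hit_eq {γ : ℝ → Σ j, D j} {U : Set S} {P : S → S}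
    (hP : H.IsPoincareMap γ d ι U P ξ) (hc : H.IsCycle (H.hit ⟨j₀, ι ξ⟩) K)
    (hγ : orbit γ = H.cycleSet (H.hit ⟨j₀, ι ξ⟩) K) :
    P ξ = ξ ∧ ∀ᶠ x in 𝓝 ξ, H.hit ⟨j₀, ι (P x)⟩ = H.hit (H.next^[K] ⟨j₀, ι x⟩) := by
  let a : S → Σ j, D j := fun x => ⟨j₀, ι x⟩
  have ha : Continuous a := continuous_sigmaMk.comp hP.embedding.isEmbedding.continuous
  have hξ : a ξ ∈ orbit γ ∩ range a := hP.inter ▸ mem_singleton _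
  have hξc : a ξ ∈ H.cycleSet (H.hit (a ξ)) K := hγ ▸ hξ.1
  have hξb : a ξ ∈ H.bas := by
    obtain ⟨i, -, s, hs, hxs⟩ := hξc
    exact hxs ▸ (flow_regular (hc.bas_iterate (i + 1)) hs).1
  have hnx : ∀ l, H.next^[l + 1] (a ξ) = H.next^[l + 1] (H.hit (a ξ)) := fun l =>
    (hit_iterate_congr (exits_regular hc.exit).2.2.1.symm l).2
  have hbas : ∀ l, H.next^[l] (a ξ) ∈ H.bas := fun l => by
    cases l with
    | zero => exact hξb
    | succ l => rw [hnx]; exact hc.bas_iterate _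
  have hfwd : ∀ l, 0 < l → H.next^[l] (a ξ) ∈ H.fwd := fun l hl => by
    obtain ⟨l, rfl⟩ : ∃ l', l = l' + 1 := ⟨l - 1, by omega⟩
    rw [hnx]; exact hc.fwd _ l.succ_pos
  have hpos : ∀ l, 0 < l → 0 < H.time (H.next^[l] (a ξ)) := fun l hl =>
    time_pos (hbas l) (not_mem_exits (hfwd l hl))
  have hsucc : ∀ l (x : Σ j, D j), H.nextTime (l + 1) x = H.nextTime l x + H.time (H.next^[l] x) :=
    fun l _ => Finset.sum_range_succ _ _
  have hmono : StrictMono fun l => H.nextTime (l + 1) (a ξ) := strictMono_nat_of_lt_succ fun l => by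
    rw [hsucc (l + 1)]
    linarith [hpos (l + 1) l.succ_pos]
  obtain ⟨θ, hθc, hθ⟩ := hP.first_return
  obtain ⟨h0, u, hu, hm, hfirst⟩ := hθ ξ hP.mem
  -- At the fixed point, the next exit after the return is the one that ends the stretch `K`, so the
  -- return time plus the hitting time is the transition time of number `K + 1`.
  obtain ⟨hPξ, hlt, htime⟩ := hc.return_time hξc rfl h0 hu hm
    (fun hy => by
      have : a (P ξ) ∈ orbit γ ∩ range a := ⟨hγ ▸ hy, mem_range_self _⟩
      rw [hP.inter] at this
      exact this) fun t ht => hfirst t ht ξ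
  have hPξ' : P ξ = ξ := hP.embedding.isEmbedding.injective (sigma_mk_injective hPξ)
  refine ⟨hPξ', ?_⟩
  have haP : ContinuousAt (fun x => a (P x)) ξ := ha.continuousAt.comp
    (hP.smooth.contMDiffAt (hP.isOpen.mem_nhds hP.mem)).continuousAt
  have hT : ContinuousAt (fun x => H.time (a (P x)) + θ x) ξ :=
    (ContinuousAt.comp (g := H.time) (f := fun x => a (P x))
      (by rw [hPξ']; exact continuousAt_time hξb) haP).add hθc
  have hN : ∀ l, ContinuousAt (fun x => H.nextTime l (a x)) ξ := fun l =>
    ContinuousAt.comp (f := a) (continuousAt_nextTime fun i _ => hbas i) ha.continuousAt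
  have e1 : ∀ᶠ x in 𝓝 ξ, ∀ i ∈ Iic (K + 1), H.next^[i] (a x) ∈ H.bas :=
    (eventually_all_finite (finite_Iic _)).2 fun i _ => ha.continuousAt.eventually
      (eventually_iterate_next (fun i _ => hbas i) isOpen_bas (hbas i))
  have e2 : ∀ᶠ x in 𝓝 ξ, ∀ i ∈ Iic (K + 2), 0 < i → H.next^[i] (a x) ∈ H.fwd :=
    (eventually_all_finite (finite_Iic _)).2 fun i _ => by
      rcases Nat.eq_zero_or_pos i with rfl | hi
      · exact .of_forall fun x h => absurd h (lt_irrefl 0)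
      · filter_upwards [ha.continuousAt.eventually
          (eventually_iterate_next (fun i _ => hbas i) isOpen_fwd (hfwd i hi))] with x hx _ using hx
  have e3 : ∀ᶠ x in 𝓝 ξ, θ x < H.nextTime (K + 2) (a x) := hθc.eventually_lt (hN _) hlt
  -- For every nearby `x`, return time plus hitting time of the image is one of the transition
  -- times. At `ξ` only the index `K` is possible, and by continuity of the return time this remains
  -- so nearby.
  have e4 : ∀ᶠ x in 𝓝 ξ, ∀ l ∈ Iic (K + 1), l ≠ K →
      H.nextTime (l + 1) (a x) ≠ H.time (a (P x)) + θ x :=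
    (eventually_all_finite (finite_Iic _)).2 fun l _ => by
      by_cases hl : l = K
      · exact .of_forall fun x h => absurd hl h
      · have : H.nextTime (l + 1) (a ξ) ≠ H.time (a (P ξ)) + θ ξ := by
          rw [hPξ', ← htime]
          exact fun h => hl (hmono.injective h)
        filter_upwards [((hN (l + 1)).sub hT).eventually_ne (sub_ne_zero.2 this)] with x hx _ using sub_ne_zero.1 hx
  filter_upwards [hP.isOpen.mem_nhds hP.mem, e1, e2, e3, e4] with x hxU h1 h2 h3 h4
  obtain ⟨hx0, u, hu, hm, -⟩ := hθ x hxU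
  obtain ⟨l, hl, hs1, hs2, hs3⟩ := hu.meetsAt (L := K + 1) h1 h2 hx0 le_rfl h3 hm
  obtain ⟨-, r2, r3⟩ := flow_regular (h1 l hl)
    (s := θ x - H.nextTime l (a x)) ⟨by linarith, by linarith [hsucc l (a x)]⟩
  rw [← hs3] at r2 r3
  have hlK : l = K := by
    by_contra hne
    refine h4 l hl hne ?_
    rw [hsucc]
    change H.time (a (P x)) = _ at r2
    linarith
  rw [r3, hlK]

end HybridSystem

end Hybrid

end HybridDS

namespace HybridDS

/-! ### Ranks of the Poincaré map and of the return map -/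

theorem finrank_range_comp_eq {E₁ E₂ E₃ E₄ : Type*} [NormedAddCommGroup E₁] [NormedSpace ℝ E₁]
    [NormedAddCommGroup E₂] [NormedSpace ℝ E₂] [NormedAddCommGroup E₃] [NormedSpace ℝ E₃]
    [NormedAddCommGroup E₄] [NormedSpace ℝ E₄] {A : E₃ →L[ℝ] E₄} {L : E₂ →L[ℝ] E₃}
    {B : E₁ →L[ℝ] E₂} (hA : Function.Injective A) (hB : Function.Surjective B) :
    Module.finrank ℝ (A.comp (L.comp B)).range = Module.finrank ℝ L.range := by
  have h : (A.comp (L.comp B)).range = L.range.map A.toLinearMap := by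
    ext z
    constructor
    · rintro ⟨x, rfl⟩
      exact ⟨L (B x), ⟨B x, rfl⟩, rfl⟩
    · rintro ⟨_, ⟨x, rfl⟩, rfl⟩
      obtain ⟨x, rfl⟩ := hB x
      exact ⟨x, rfl⟩
  rw [h]
  exact (Submodule.equivMapOfInjective A.toLinearMap hA L.range).finrank_eq.symm

section Section

variable {d : ℕ} {S : Type*} [TopologicalSpace S] [ChartedSpace (EuclideanSpace ℝ (Fin d)) S]
  [IsManifold (𝓡 d) ∞ S]

omit [IsManifold (𝓡 d) ∞ S] in
theorem contMDiffAt_iterate_of_mem {P : S → S} {U : Set S} (hU : IsOpen U)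
    (hP : ContMDiffOn (𝓡 d) (𝓡 d) ∞ P U) {x : S} {m : ℕ} (hx : ∀ i < m, P^[i] x ∈ U) :
    ContMDiffAt (𝓡 d) (𝓡 d) ∞ (P^[m]) x := by
  induction m with
  | zero => exact contMDiffAt_id
  | succ m ih =>
    rw [Function.iterate_succ']
    exact ContMDiffAt.comp x (hP.contMDiffAt (hU.mem_nhds (hx m m.lt_succ_self)))
      (ih fun i hi => hx i (hi.trans m.lt_succ_self))

omit [IsManifold (𝓡 d) ∞ S] in
/-- The iterates of a map near a fixed point in a chart. -/
theorem eventually_iterate_eq_chart {P : S → S} {U : Set S} {ξ : S} (hU : IsOpen U) (hξ : ξ ∈ U)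
    (hP : ContMDiffOn (𝓡 d) (𝓡 d) ∞ P U) (hfix : P ξ = ξ)
    {g : EuclideanSpace ℝ (Fin d) → EuclideanSpace ℝ (Fin d)}
    (hg : ∀ᶠ y in 𝓝 (extChartAt (𝓡 d) ξ ξ),
      g y = extChartAt (𝓡 d) ξ (P ((extChartAt (𝓡 d) ξ).symm y))) (m : ℕ) :
    ∀ᶠ y in 𝓝 (extChartAt (𝓡 d) ξ ξ),
      g^[m] y = extChartAt (𝓡 d) ξ (P^[m] ((extChartAt (𝓡 d) ξ).symm y)) ∧
      P^[m] ((extChartAt (𝓡 d) ξ).symm y) ∈ (extChartAt (𝓡 d) ξ).source := by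
  set φ := extChartAt (𝓡 d) ξ with hφ
  have hη0 : φ.symm (φ ξ) = ξ := extChartAt_to_inv ξ
  have hfix' : ∀ k, P^[k] ξ = ξ := fun k => Function.iterate_fixed hfix k
  have hc : ∀ k, ContinuousAt (fun y => P^[k] (φ.symm y)) (φ ξ) := fun k =>
    ContinuousAt.comp (g := P^[k]) (by
      rw [hη0]
      exact (contMDiffAt_iterate_of_mem hU hP fun i _ => (hfix' i).symm ▸ hξ).continuousAt)
      (continuousAt_extChartAt_symm ξ)
  have hs : ∀ k, ∀ᶠ y in 𝓝 (φ ξ), P^[k] (φ.symm y) ∈ φ.source := fun k =>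
    (hc k).eventually (p := fun x => x ∈ φ.source) (by
      dsimp only
      rw [hη0, hfix']
      exact (isOpen_extChartAt_source ξ).mem_nhds (mem_extChartAt_source ξ))
  refine Filter.Eventually.and ?_ (hs m)
  induction m with
  | zero =>
    filter_upwards [(isOpen_extChartAt_target (I := 𝓡 d) ξ).mem_nhds (mem_extChartAt_target ξ)]
      with y hy
    exact (φ.right_inv hy).symm
  | succ m ih =>
    have hc' : ContinuousAt (fun y => φ (P^[m] (φ.symm y))) (φ ξ) :=
      ContinuousAt.comp (g := φ) (by rw [hη0, hfix']; exact continuousAt_extChartAt ξ) (hc m)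
    filter_upwards [ih, hs m, hc'.eventually (by dsimp only; rw [hη0, hfix']; exact hg)]
      with y h1 h2 h3
    rw [Function.iterate_succ_apply', h1, h3, φ.left_inv h2, Function.iterate_succ_apply']

/-- Charts have invertible derivatives, so a map and its coordinate representation have the same
rank. -/
theorem finrank_range_chart {P : S → S} {ξ : S}
    {g : EuclideanSpace ℝ (Fin d) → EuclideanSpace ℝ (Fin d)} {y : EuclideanSpace ℝ (Fin d)}
    (hy : y ∈ (extChartAt (𝓡 d) ξ).target)
    (hP : MDifferentiableAt (𝓡 d) (𝓡 d) P ((extChartAt (𝓡 d) ξ).symm y))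
    (hPs : P ((extChartAt (𝓡 d) ξ).symm y) ∈ (extChartAt (𝓡 d) ξ).source)
    (hg : ∀ᶠ y in 𝓝 y, g y = extChartAt (𝓡 d) ξ (P ((extChartAt (𝓡 d) ξ).symm y))) :
    Module.finrank ℝ (fderiv ℝ g y).range =
      Module.finrank ℝ (mfderiv (𝓡 d) (𝓡 d) P ((extChartAt (𝓡 d) ξ).symm y)).range := by
  have hm1 : IsManifold (𝓡 d) 1 S := IsManifold.of_le (I := 𝓡 d) (M := S) (n := ∞)
    (by exact_mod_cast le_top)
  set φ := extChartAt (𝓡 d) ξ with hφ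
  let B : EuclideanSpace ℝ (Fin d) →L[ℝ] EuclideanSpace ℝ (Fin d) :=
    mfderiv 𝓘(ℝ, EuclideanSpace ℝ (Fin d)) (𝓡 d) φ.symm y
  let L : EuclideanSpace ℝ (Fin d) →L[ℝ] EuclideanSpace ℝ (Fin d) :=
    mfderiv (𝓡 d) (𝓡 d) P (φ.symm y)
  let A : EuclideanSpace ℝ (Fin d) →L[ℝ] EuclideanSpace ℝ (Fin d) :=
    mfderiv (𝓡 d) 𝓘(ℝ, EuclideanSpace ℝ (Fin d)) φ (P (φ.symm y))
  have d1 : HasMFDerivAt 𝓘(ℝ, EuclideanSpace ℝ (Fin d)) (𝓡 d) φ.symm y B :=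
    ((contMDiffAt_extChartAt_symm ξ hy).mdifferentiableAt (by simp)).hasMFDerivAt
  have d2 : HasMFDerivAt 𝓘(ℝ, EuclideanSpace ℝ (Fin d)) (𝓡 d) (P ∘ φ.symm) y (L.comp B) :=
    HasMFDerivAt.comp y hP.hasMFDerivAt d1
  have d3 : HasMFDerivAt (𝓡 d) 𝓘(ℝ, EuclideanSpace ℝ (Fin d)) φ (P (φ.symm y)) A :=
    (mdifferentiableAt_extChartAt (by rwa [← extChartAt_source (𝓡 d)])).hasMFDerivAt
  have d4 : HasMFDerivAt 𝓘(ℝ, EuclideanSpace ℝ (Fin d)) 𝓘(ℝ, EuclideanSpace ℝ (Fin d))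
      (φ ∘ P ∘ φ.symm) y (A.comp (L.comp B)) :=
    HasMFDerivAt.comp (f := P ∘ φ.symm) y d3 d2
  have d5 : HasFDerivAt g (A.comp (L.comp B)) y := d4.hasFDerivAt.congr_of_eventuallyEq hg
  have hA : Function.Injective A := (isInvertible_mfderiv_extChartAt hPs).injective
  have hB : Function.Surjective B := (isInvertible_mfderiv_extChartAt_symm ξ hy).surjective
  rw [d5.fderiv]
  exact finrank_range_comp_eq hA hB

end Section

section Hybrid

variable {J : Type*} {n : J → ℕ} [∀ j, NeZero (n j)] {D : J → Type*}
  [∀ j, TopologicalSpace (D j)] [∀ j, ChartedSpace (EuclideanHalfSpace (n j)) (D j)]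
  [∀ j, IsManifold (𝓡∂ (n j)) ∞ (D j)] [∀ j, T2Space (D j)]

namespace HybridSystem

variable {H : HybridSystem n D} {K : ℕ} {Q : Σ j, D j} {d : ℕ}
  {e : EuclideanSpace ℝ (Fin d) → Σ j, D j} {ρ : (Σ j, D j) → EuclideanSpace ℝ (Fin d)}
  {y₀ : EuclideanSpace ℝ (Fin d)}

/-- The return map of the guard has smaller rank than the dimension of any visited domain: it
forgets the position in the direction of the field. -/
theorem finrank_range_fderiv_returnMap_lt (he : H.IsGuardParam Q e ρ y₀) (hc : H.IsCycle Q K)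
    {i : ℕ} (hi : i < K) :
    Module.finrank ℝ (fderiv ℝ (H.returnMap K e ρ) y₀).range < n (H.next^[i + 1] Q).1 := by
  set p := H.next^[i + 1] Q with hp
  obtain ⟨l, rfl⟩ : ∃ l, K = l + (i + 1) := ⟨K - (i + 1), by omega⟩
  have hpl : ∀ k, H.next^[k] p = H.next^[k + (i + 1)] Q := fun k =>
    (Function.iterate_add_apply _ _ _ _).symm
  have hpb : ∀ k, H.next^[k] p ∈ H.bas := fun k => by rw [hpl]; exact hc.bas_iterate _
  have hp0 : p ∈ H.bas := hpb 0
  -- The return map is factored as `A ∘ B` through the domain of `p`, one of the starting points on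
  -- the cycle.
  let A : D p.1 → EuclideanSpace ℝ (Fin d) := fun x => ρ (H.hit (H.next^[l] ⟨p.1, x⟩))
  let B : EuclideanSpace ℝ (Fin d) → D p.1 := fun y => toDomain p.2 (H.next^[i + 1] (e y))
  have hs : SmoothAt n 𝓘(ℝ, EuclideanSpace ℝ (Fin d)) (fun y => H.next^[i + 1] (e y)) y₀ :=
    he.smooth_param.self_of_nhds.iterate_next fun k _ => by
      rw [he.apply_eq]; exact hc.bas_iterate k
  have hep : H.next^[i + 1] (e y₀) = p := by rw [he.apply_eq]
  have hBk : ContMDiffAt 𝓘(ℝ, EuclideanSpace ℝ (Fin d)) (𝓡∂ (n p.1)) ∞ B y₀ :=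
    hs.toDomain p.2 (congrArg Sigma.fst hep)
  have hB0 : B y₀ = p.2 := by
    change toDomain p.2 (H.next^[i + 1] (e y₀)) = p.2
    rw [hep]
    exact toDomain_mk p.2 p.2
  have hAk : ContMDiffAt (𝓡∂ (n p.1)) 𝓘(ℝ, EuclideanSpace ℝ (Fin d)) ∞ A p.2 := by
    have h1 : SmoothAt n (𝓡∂ (n p.1)) (fun x : D p.1 => H.hit (H.next^[l] ⟨p.1, x⟩)) p.2 :=
      ((smoothAt_mk (k := p.1) (g := fun x : D p.1 => x) contMDiffAt_id).iterate_next
        fun k _ => hpb k).hit (hpb l)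
    refine h1.comp_contMDiffAt (p := Q) ?_ he.smooth_coord.self_of_nhds
    change H.hit (H.next^[l] p) = Q
    rw [hpl, hc.hit]
  have hgAB : ∀ᶠ y in 𝓝 y₀, H.returnMap (l + (i + 1)) e ρ y = (A ∘ B) y := by
    obtain ⟨f, -, hf, -⟩ := hs.exists_eq (k := p.1) (x := p.2) hep
    filter_upwards [hf] with y hy
    have : (⟨p.1, B y⟩ : Σ j, D j) = H.next^[i + 1] (e y) :=
      mk_toDomain p.2 ((congrArg (fun z : Σ j, D j => z.1) hy :))
    simp only [returnMap, Function.comp_apply, A, this]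
    rw [Function.iterate_add_apply]
  have dB := (hBk.mdifferentiableAt (by simp)).hasMFDerivAt
  have dA := (hAk.mdifferentiableAt (by simp)).hasMFDerivAt
  have dAB := HasMFDerivAt.comp (g := A) y₀ (by rw [hB0]; exact dA) dB
  let DA : EuclideanSpace ℝ (Fin (n p.1)) →L[ℝ] EuclideanSpace ℝ (Fin d) :=
    mfderiv (𝓡∂ (n p.1)) 𝓘(ℝ, EuclideanSpace ℝ (Fin d)) A p.2
  let DB : EuclideanSpace ℝ (Fin d) →L[ℝ] EuclideanSpace ℝ (Fin (n p.1)) :=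
    mfderiv 𝓘(ℝ, EuclideanSpace ℝ (Fin d)) (𝓡∂ (n p.1)) B y₀
  have dg : HasFDerivAt (H.returnMap (l + (i + 1)) e ρ) (DA.comp DB) y₀ :=
    (HasMFDerivAt.hasFDerivAt dAB).congr_of_eventuallyEq hgAB
  rw [dg.fderiv]
  -- The field is such a vector: `A` depends only on the hitting point, so it is constant along the
  -- curve from `p`, and the field does not vanish as the hitting time has derivative `-1` along it.
  have hfield : ∃ w : EuclideanSpace ℝ (Fin (n p.1)), w ≠ 0 ∧ DA w = 0 := by
    obtain ⟨h1, -⟩ := mfderiv_hit_field (H.smooth_field p.1) (H.guard_open p.1) (H.outward p.1) hp0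
    refine ⟨H.field p.1 p.2, fun h0 => ?_, ?_⟩
    · have h2 : (mfderiv (𝓡∂ (n p.1)) 𝓘(ℝ, ℝ) (hitTime (H.field p.1) (H.guard p.1)) p.2 :
          EuclideanSpace ℝ (Fin (n p.1)) →L[ℝ] ℝ) (H.field p.1 p.2) = -1 := h1
      have h3 := map_zero (mfderiv (𝓡∂ (n p.1)) 𝓘(ℝ, ℝ) (hitTime (H.field p.1) (H.guard p.1)) p.2 :
          EuclideanSpace ℝ (Fin (n p.1)) →L[ℝ] ℝ)
      rw [show (H.field p.1 p.2 : EuclideanSpace ℝ (Fin (n p.1))) = 0 from h0, h3] at h2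
      have h4 : (0 : ℝ) ≠ -1 := by norm_num
      exact h4 h2
    · obtain ⟨hT, hc0, hcv, -⟩ := hitBy_flow hp0
      have hT' : 0 < H.time p := time_pos hp0 (not_mem_exits (hc.fwd _ i.succ_pos))
      have h0 : (0 : ℝ) ∈ Icc 0 (H.time p) := ⟨le_rfl, hT⟩
      have d1 := hcv 0 h0
      rw [hc0] at d1
      have d2 := HasMFDerivAt.comp_hasMFDerivWithinAt (g := A) 0 (by rw [hc0]; exact dA) d1
      have d3 : HasFDerivWithinAt (fun _ : ℝ => A p.2) (DA.comp ((1 : ℝ →L[ℝ] ℝ).smulRight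
          (H.field p.1 p.2 : EuclideanSpace ℝ (Fin (n p.1))))) (Icc 0 (H.time p)) 0 := by
        refine (HasMFDerivWithinAt.hasFDerivWithinAt d2).congr (fun s hs => ?_) ?_
        · exact congrArg ρ (hit_iterate_congr (flow_regular hp0 hs).2.2 l).1.symm
        · exact congrArg A hc0.symm
      have d4 := (uniqueDiffOn_Icc hT' 0 h0).eq d3 (hasFDerivWithinAt_const _ _ _)
      have d5 : ∀ w : EuclideanSpace ℝ (Fin (n p.1)),
          DA.comp ((1 : ℝ →L[ℝ] ℝ).smulRight w) = 0 → DA w = 0 := fun w hw => by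
        simpa using DFunLike.congr_fun hw 1
      exact d5 _ d4
  obtain ⟨w, hw, hDw⟩ := hfield
  have h1 : Module.finrank ℝ (DA.comp DB).range ≤ Module.finrank ℝ DA.range :=
    Submodule.finrank_mono (LinearMap.range_comp_le_range DB.toLinearMap DA.toLinearMap)
  have h2 := LinearMap.finrank_range_add_finrank_ker DA.toLinearMap
  rw [finrank_euclideanSpace_fin] at h2
  have h3 : 0 < Module.finrank ℝ (LinearMap.ker DA.toLinearMap) :=
    Submodule.one_le_finrank_iff.2 fun h => hw ((Submodule.mem_bot ℝ).1 (h ▸ hDw))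
  change Module.finrank ℝ (DA.comp DB).range ≤ Module.finrank ℝ (LinearMap.range DA.toLinearMap)
    at h1
  omega

end HybridSystem

end Hybrid

end HybridDS

namespace HybridDS

/-! ### Conclusion for orbits with transitions -/

section Hybrid

variable {J : Type*} {n : J → ℕ} [∀ j, NeZero (n j)] {D : J → Type*}
  [∀ j, TopologicalSpace (D j)] [∀ j, ChartedSpace (EuclideanHalfSpace (n j)) (D j)]
  [∀ j, IsManifold (𝓡∂ (n j)) ∞ (D j)]
  {d : ℕ} {S : Type*} [TopologicalSpace S] [ChartedSpace (EuclideanSpace ℝ (Fin d)) S]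
  [IsManifold (𝓡 d) ∞ S]

namespace HybridSystem

variable {H : HybridSystem n D} {K : ℕ} {j₀ : J} {ι : S → D j₀} {ξ : S}

theorem mem_fwd_of_eventually_flowsForward {x : Σ j, D j} (h : ∀ᶠ y in 𝓝 x, H.FlowsForward y) :
    x ∈ H.fwd :=
  ((continuous_sigmaMk (σ := D) (i := x.1)).tendsto x.2).eventually h

/-- The reduction along an orbit with transitions. -/
theorem exists_reduction_of_transition [∀ j, T2Space (D j)] {γ : ℝ → Σ j, D j} {τ : ℝ}
    (hγ : H.IsPeriodicOrbit γ τ) (hfin : {t ∈ Ico 0 τ | ¬ ContinuousAt γ t}.Finite)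
    (hjump : ∃ t, ¬ ContinuousAt γ t) (hfwd : ∀ t, γ t ∈ H.fwd) {U : Set S} {P : S → S}
    (hP : H.IsPoincareMap γ d ι U P ξ) {m : ℕ} (hm : m ∈ range fun t => n (γ t).1) {V : Set S}
    (hV : IsOpen V) (hξV : ξ ∈ V) (hVU : ∀ x ∈ V, ∀ i < m, P^[i] x ∈ U) {r : ℕ}
    (hr : ∀ x ∈ V, Module.finrank ℝ (mfderiv (𝓡 d) (𝓡 d) (P^[m]) x).range = r) :
    ∃ M W : Set (Σ j, D j),
      H.IsInvariantSubmanifold (r + 1) M ∧ IsOpen W ∧ orbit γ ⊆ M ∩ W ∧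
      ∃ b₀ : ℝ, ∀ x ∈ W, ∃ b ∈ Icc 0 b₀,
        (∃ u, H.IsTrajectory x b u) ∧ ∀ u, H.IsTrajectory x b u → u b ∈ M := by
  let a : S → Σ j, D j := fun x => ⟨j₀, ι x⟩
  have ha : Continuous a := continuous_sigmaMk.comp hP.embedding.isEmbedding.continuous
  have hξ : a ξ ∈ orbit γ ∩ range a := hP.inter ▸ mem_singleton _
  -- The cycle has to be based at the exit that follows `ξ`. A first cycle finds an orbit time `t`
  -- at the start of the curve through `ξ`, and the cycle from there has this exit as its base.
  obtain ⟨K, hc, horb, hξb⟩ : ∃ K, H.IsCycle (H.hit (a ξ)) K ∧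
      orbit γ = H.cycleSet (H.hit (a ξ)) K ∧ a ξ ∈ H.bas := by
    obtain ⟨K₀, hc₀, horb₀, hval⟩ := hγ.exists_isCycle hfin hjump hfwd 0
    obtain ⟨i, -, s, hs, hxs⟩ : a ξ ∈ H.cycleSet _ K₀ := horb₀ ▸ hξ.1
    obtain ⟨t, ht⟩ := hval i
    obtain ⟨hb, -, hh⟩ := flow_regular (hc₀.bas_iterate (i + 1)) hs
    rw [hxs] at hb hh
    rw [ht] at hh
    obtain ⟨K, hc, horb, -⟩ := hγ.exists_isCycle hfin hjump hfwd t
    exact ⟨K, hh ▸ hc, hh ▸ horb, hb⟩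
  obtain ⟨ρ, he⟩ := H.exists_isGuardParam hP.embedding hP.codim hP.transverse hξb
  obtain ⟨hfix, hrel⟩ := hP.eventually_hit_eq hc horb
  set φ := extChartAt (𝓡 d) ξ with hφ
  set e : EuclideanSpace ℝ (Fin d) → Σ j, D j := fun y => H.hit ⟨j₀, ι (φ.symm y)⟩ with he_def
  have hη0 : φ.symm (φ ξ) = ξ := extChartAt_to_inv ξ
  have hηc : ContinuousAt φ.symm (φ ξ) := continuousAt_extChartAt_symm ξ
  have hηV : ∀ {p : S → Prop}, (∀ᶠ x in 𝓝 ξ, p x) → ∀ᶠ y in 𝓝 (φ ξ), p (φ.symm y) := fun h =>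
    hηc.eventually (by rwa [hη0])
  have hPc : ContinuousAt P ξ := (hP.smooth.contMDiffAt (hP.isOpen.mem_nhds hP.mem)).continuousAt
  have hPsrc : ∀ᶠ x in 𝓝 ξ, P x ∈ φ.source :=
    hPc.eventually (by
      rw [hfix]; exact (isOpen_extChartAt_source ξ).mem_nhds (mem_extChartAt_source ξ))
  have hφP : ContinuousAt (fun x => φ (P x)) ξ :=
    ContinuousAt.comp (g := φ) (by rw [hfix]; exact continuousAt_extChartAt ξ) hPc
  have hinv : ∀ᶠ x in 𝓝 ξ, ρ (e (φ (P x))) = φ (P x) :=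
    hφP.eventually (p := fun y => ρ (e y) = y) (by dsimp only; rw [hfix]; exact he.left_inv)
  have hbasx : ∀ᶠ x in 𝓝 ξ, a x ∈ H.bas := ha.continuousAt.eventually (isOpen_bas.mem_nhds hξb)
  -- The parametrization of the guard comes from the section, so the return map in these coordinates
  -- is the Poincaré map in the chart at `ξ`.
  have hg : ∀ᶠ y in 𝓝 (φ ξ), H.returnMap K e ρ y = φ (P (φ.symm y)) := by
    filter_upwards [hηV hrel, hηV hPsrc, hηV hinv, hηV hbasx] with y h1 h2 h3 h4
    rw [← h3]
    have h5 : e (φ (P (φ.symm y))) = H.hit ⟨j₀, ι (P (φ.symm y))⟩ := by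
      rw [he_def]
      dsimp only
      rw [φ.left_inv h2]
    rw [h5, h1, returnMap]
    refine congrArg ρ (hit_iterate_congr ?_ K).1
    exact (exits_regular (hit_mem_exits h4)).2.2.1
  have hgm := eventually_iterate_eq_chart hP.isOpen hP.mem hP.smooth hfix hg m
  have hrank : ∀ᶠ y in 𝓝 (φ ξ),
      Module.finrank ℝ (fderiv ℝ ((H.returnMap K e ρ)^[m]) y).range = r := by
    filter_upwards [hgm.eventually_nhds, hηV (hV.mem_nhds hξV),
      (isOpen_extChartAt_target (I := 𝓡 d) ξ).mem_nhds (mem_extChartAt_target ξ)] with y h1 h2 h3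
    rw [finrank_range_chart h3 ((contMDiffAt_iterate_of_mem hP.isOpen hP.smooth
      (hVU _ h2)).mdifferentiableAt (by simp)) h1.self_of_nhds.2 (h1.mono fun _ h => h.1)]
    exact hr _ h2
  -- The number `m` is the dimension of a visited domain, through which the return map factors.
  have hlow : Module.finrank ℝ (fderiv ℝ (H.returnMap K e ρ) (φ ξ)).range < m := by
    obtain ⟨t, rfl⟩ := hm
    obtain ⟨i, hi, s, -, hs⟩ : γ t ∈ H.cycleSet (H.hit (a ξ)) K :=
      horb ▸ subset_closure (mem_range_self t)
    have h1 : (γ t).1 = (H.next^[i + 1] (H.hit (a ξ))).1 := by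
      rw [← hs]
      rfl
    dsimp only
    rw [h1]
    exact finrank_range_fderiv_returnMap_lt he hc hi
  rw [horb]
  exact exists_reduction_of_isCycle he hc hlow hrank

end HybridSystem

end Hybrid

end HybridDS

namespace HybridDS

/-! ### Orbits without transitions -/

/-- An injective map of constant rank is an immersion. -/
theorem finrank_eq_of_injOn {E : Type*} [NormedAddCommGroup E] [NormedSpace ℝ E]
    [FiniteDimensional ℝ E] {g : E → E} {y₀ : E} {r : ℕ}
    (hg : ∀ᶠ y in 𝓝 y₀, ContDiffAt ℝ ∞ g y)
    (hr : ∀ᶠ y in 𝓝 y₀, Module.finrank ℝ (fderiv ℝ g y).range = r)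
    (hinj : ∃ O ∈ 𝓝 y₀, InjOn g O) : Module.finrank ℝ E = r := by
  have : CompleteSpace E := FiniteDimensional.complete ℝ E
  set R := (fderiv ℝ g y₀).range with hR
  have hRr : Module.finrank ℝ R = r := hr.self_of_nhds
  obtain ⟨π', hπ'⟩ := R.subtype.exists_leftInverse_of_injective (by simp)
  let π : E →L[ℝ] R := LinearMap.toContinuousLinearMap π'
  have hπ : ∀ z : R, π z = z := fun z => LinearMap.congr_fun hπ' z
  obtain ⟨s, hs0, hsk, -, hs⟩ := exists_section_of_constant_rank hg π
    (hr.mono fun y hy => hy.trans hRr.symm) (by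
      rintro ⟨z, w, rfl⟩
      exact ⟨w, hπ ⟨_, w, rfl⟩⟩)
  obtain ⟨O, hO, hinj⟩ := hinj
  have hgc : ContinuousAt g y₀ := hg.self_of_nhds.continuousAt
  have hsπ : ContinuousAt (fun y => s (π (g y))) y₀ :=
    ContinuousAt.comp (f := fun y => π (g y)) hsk.self_of_nhds.continuousAt
      (π.continuous.continuousAt.comp hgc)
  -- The points `y` and `s (π (g y))` have the same image under `g`, so injectivity identifies them.
  -- Thus `g` has a differentiable left inverse and its derivative is injective.
  have hid : ∀ᶠ y in 𝓝 y₀, s (π (g y)) = y := by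
    filter_upwards [hO, hsπ.eventually (p := fun y => y ∈ O) (by dsimp only; rw [hs0]; exact hO),
      hs] with y h1 h2 h3
    exact (hinj h1 h2 h3).symm
  have d1 : HasFDerivAt (fun y => π (g y)) (π ∘L fderiv ℝ g y₀) y₀ :=
    π.hasFDerivAt.comp y₀ (hg.self_of_nhds.differentiableAt (by simp)).hasFDerivAt
  have d2 : HasFDerivAt (fun y => s (π (g y))) _ y₀ :=
    HasFDerivAt.comp y₀ (hsk.self_of_nhds.differentiableAt (by simp)).hasFDerivAt d1
  have d3 := d2.unique ((hasFDerivAt_id y₀).congr_of_eventuallyEq hid)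
  have hinj' : Function.Injective (π ∘L fderiv ℝ g y₀) := fun x y hxy => by
    have h1 := DFunLike.congr_fun d3 x
    have h2 := DFunLike.congr_fun d3 y
    rw [ContinuousLinearMap.comp_apply] at h1 h2
    rw [hxy] at h1
    exact h1.symm.trans h2
  have h1 := LinearMap.finrank_le_finrank_of_injective
    (f := (π ∘L fderiv ℝ g y₀).toLinearMap) hinj'
  have h2 : Module.finrank ℝ R ≤ Module.finrank ℝ E := Submodule.finrank_le R
  omega

theorem exists_injOn_iterate {S : Type*} [TopologicalSpace S] {P : S → S} {ξ : S}
    (hP : ContinuousAt P ξ) (hfix : P ξ = ξ) (h : ∃ O ∈ 𝓝 ξ, InjOn P O) (m : ℕ) :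
    ∃ O ∈ 𝓝 ξ, InjOn (P^[m]) O := by
  obtain ⟨O, hO, hinj⟩ := h
  induction m with
  | zero => exact ⟨univ, univ_mem, fun _ _ _ _ h => h⟩
  | succ m ih =>
    obtain ⟨O', hO', hinj'⟩ := ih
    have hc : Tendsto P (𝓝 ξ) (𝓝 ξ) := by
      have := hP.tendsto
      rwa [hfix] at this
    refine ⟨O ∩ P ⁻¹' O', inter_mem hO (hc hO'), fun x hx y hy hxy => ?_⟩
    exact hinj hx.1 hy.1 (hinj' hx.2 hy.2 hxy)

/-- For an open set, the charts of the ambient manifold are slice parametrizations. -/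
theorem exists_slice_of_isOpen {X : Type*} [TopologicalSpace X] {N d : ℕ} [NeZero N] [NeZero d]
    (h : d = N) [ChartedSpace (EuclideanHalfSpace N) X] [IsManifold (𝓡∂ N) ∞ X] {M : Set X}
    (hM : IsOpen M) (p : X) :
    ∃ (O : Set X) (A : Set (EuclideanHalfSpace d)) (ψ : EuclideanHalfSpace d → X)
      (q : X → EuclideanSpace ℝ (Fin d)), p ∈ O ∧ IsSlice N M O A ψ q := by
  subst h
  let e := chartAt (EuclideanHalfSpace d) p
  refine ⟨e.source, e.target ∩ e.symm ⁻¹' M, e.symm, extChartAt (𝓡∂ d) p, mem_chart_source _ p,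
    e.open_source, e.isOpen_inter_preimage_symm hM,
    (contMDiffOn_chart_symm (I := 𝓡∂ d) (n := ∞)).mono inter_subset_left, ?_, ?_, ?_⟩
  · have := contMDiffOn_extChartAt (I := 𝓡∂ d) (n := ∞) (x := p)
    exact this
  · rintro a ⟨ha, -⟩
    rw [extChartAt_coe, Function.comp_apply, e.right_inv ha]
    rfl
  · ext x
    constructor
    · rintro ⟨a, ⟨ha, ha'⟩, rfl⟩
      exact ⟨ha', e.map_target ha⟩
    · rintro ⟨hx, hx'⟩
      refine ⟨e x, ⟨e.map_source hx', ?_⟩, e.left_inv hx'⟩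
      rw [mem_preimage, e.left_inv hx']
      exact hx

section Hybrid

variable {J : Type*} {n : J → ℕ} [∀ j, NeZero (n j)] {D : J → Type*}
  [∀ j, TopologicalSpace (D j)] [∀ j, ChartedSpace (EuclideanHalfSpace (n j)) (D j)]
  [∀ j, IsManifold (𝓡∂ (n j)) ∞ (D j)] {d : ℕ}

namespace HybridSystem

variable {H : HybridSystem n D} {j₀ : J}

/-- An open connected set of points from which the field can be followed forward is an invariant
submanifold. -/
theorem isInvariantSubmanifold_of_isOpen {r : ℕ} (hr : r + 1 = n j₀) {N : Set (D j₀)}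
    (hN : IsOpen N) (hN' : IsPreconnected N) (hNF : N ⊆ fwdSet (H.field j₀)) :
    H.IsInvariantSubmanifold (r + 1) (Sigma.mk j₀ '' N) := by
  have hpre : Sigma.mk j₀ ⁻¹' (Sigma.mk j₀ '' N) = N := preimage_image_eq N sigma_mk_injective
  have hdisj : ∀ x ∈ N, x ∉ H.guard j₀ := fun x hx =>
    Set.disjoint_left.1 (disjoint_fwdSet (H.guard_open j₀) (H.outward j₀)) (hNF hx)
  refine ⟨fun j => ?_, fun j => ?_, ?_⟩
  · refine exists_submanifold_of_slices (H.field j) (H.guard j) ?_ ?_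
    · rintro p ⟨y, hy, hyp⟩
      obtain rfl : j₀ = j := congrArg Sigma.fst hyp
      obtain rfl : y = p := sigma_mk_injective hyp
      rw [hpre]
      obtain ⟨O, A, ψ, q, hO, h⟩ := exists_slice_of_isOpen hr hN y
      exact ⟨O, A, ψ, q, hO, h, fun hG => absurd hG (hdisj y hy)⟩
    · rintro p ⟨y, hy, hyp⟩
      obtain rfl : j₀ = j := congrArg Sigma.fst hyp
      obtain rfl : y = p := sigma_mk_injective hyp
      rw [hpre]
      obtain ⟨δ, hδ, c, hc0, hc⟩ : CanFlow (H.field j₀) y := (hNF hy).self_of_nhds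
      have hcN : ∀ᶠ s in 𝓝[≥] (0 : ℝ), c s ∈ N := by
        have h1 : ContinuousWithinAt c (Ico 0 δ) 0 := (hc 0 ⟨le_rfl, hδ⟩).continuousWithinAt
        have h2 := h1.eventually (p := fun x => x ∈ N) (by rw [hc0]; exact hN.mem_nhds hy)
        rwa [nhdsWithin_Ico_eq_nhdsGE hδ] at h2
      obtain ⟨ε, hε, hεN⟩ := (mem_nhdsGE_iff_exists_Ico_subset).1 hcN
      have hε' : 0 < ε := hε
      have hb : 0 < min δ ε / 2 := half_pos (lt_min hδ hε')
      have hlt : min δ ε / 2 < min δ ε := half_lt_self (lt_min hδ hε')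
      refine ⟨0, min δ ε / 2, 0, c, hb, ⟨le_rfl, hb.le⟩, hc0, IsMIntegralCurveOn.mono hc fun s hs =>
        ⟨hs.1, hs.2.trans_lt (hlt.trans_le (min_le_left _ _))⟩, fun s hs =>
        hεN ⟨hs.1, hs.2.trans_lt (hlt.trans_le (min_le_right _ _))⟩⟩
  · refine finite_connectedComponents_of_cover (ι := Unit)
      (C := fun _ => Sigma.mk j ⁻¹' (Sigma.mk j₀ '' N)) (fun _ => ?_) (iUnion_const _).symm
    by_cases hj : j₀ = j
    · subst hj
      rwa [hpre]
    · convert isPreconnected_empty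
      ext x
      exact ⟨fun ⟨y, _, hy⟩ => hj (congrArg Sigma.fst hy), fun h => h.elim⟩
  · rintro j x hx ⟨y, hy, hyp⟩
    obtain rfl : j₀ = j := congrArg Sigma.fst hyp
    obtain rfl : y = x := sigma_mk_injective hyp
    exact absurd hx (hdisj y hy)

/-- The constant restriction to one time; the point is not in the guard, so no reset precedes it. -/
theorem exists_isTrajectory_zero {x : Σ j, D j} (hx : x ∈ H.fwd) :
    ∃ u, H.IsTrajectory x 0 u := by
  obtain ⟨δ, hδ, c, hc0, hc⟩ : CanFlow (H.field x.1) x.2 := Filter.Eventually.self_of_nhds hx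
  have hsub : Icc (0 : ℝ) 0 ⊆ Ico 0 δ := fun s hs => ⟨hs.1, hs.2.trans_lt hδ⟩
  have hcont : ∀ t ∈ Icc (0 : ℝ) 0,
      ContinuousWithinAt (fun t => (⟨x.1, c t⟩ : Σ j, D j)) (Icc 0 0) t := fun t ht =>
    (continuous_sigmaMk.comp_continuousOn (IsMIntegralCurveOn.mono hc hsub).continuousOn) t ht
  refine ⟨fun t => ⟨x.1, c t⟩, ⟨ordConnected_Icc, fun t ht => (hcont t ht).mono inter_subset_left,
    fun t ht _ => hasFieldVelocity_of_isMIntegralCurveOn (IsMIntegralCurveOn.mono hc hsub)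
      (fun s _ => rfl) ht, fun t ht h => absurd (hcont t ht) h⟩,
    fun _ => Sigma.ext rfl (heq_of_eq hc0), fun h => ?_⟩
  exact absurd h (Set.disjoint_left.1 (disjoint_fwdSet (H.guard_open x.1) (H.outward x.1)) hx)

variable [∀ j, T2Space (D j)]

/-- A continuous periodic curve has a compact and connected image, so it is closed and lies in one
domain. -/
theorem IsPeriodicOrbit.exists_integralCurve {γ : ℝ → Σ j, D j} {τ : ℝ}
    (hγ : H.IsPeriodicOrbit γ τ) (hcont : ∀ t, ContinuousAt γ t) :
    orbit γ = range γ ∧ ∃ (j : J) (c : ℝ → D j), (∀ t, γ t = ⟨j, c t⟩) ∧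
      IsMIntegralCurveOn c (H.field j) univ := by
  have hγc : Continuous γ := continuous_iff_continuousAt.2 hcont
  refine ⟨(hγ.periodic.compact_of_continuous hγ.pos.ne' hγc).isClosed.closure_eq, ?_⟩
  obtain ⟨j, T, -, hT⟩ := Sigma.isConnected_iff.1 (isConnected_range hγc)
  have h1 : ∀ t, ∃ y, γ t = ⟨j, y⟩ := fun t => by
    obtain ⟨y, -, hy⟩ : γ t ∈ Sigma.mk j '' T := hT ▸ mem_range_self t
    exact ⟨y, hy.symm⟩
  choose c hc using h1
  refine ⟨j, c, hc, fun t ht => ?_⟩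
  exact (hγ.isExecution.flow t ht (hcont t).continuousWithinAt).hasMFDerivWithinAt ht
    (.of_forall hc)

end HybridSystem

end Hybrid

end HybridDS

namespace HybridDS

/-! ### Injectivity of the Poincaré map and conclusion without transitions -/

section Hybrid

variable {J : Type*} {n : J → ℕ} [∀ j, NeZero (n j)] {D : J → Type*}
  [∀ j, TopologicalSpace (D j)] [∀ j, ChartedSpace (EuclideanHalfSpace (n j)) (D j)]
  [∀ j, IsManifold (𝓡∂ (n j)) ∞ (D j)] [∀ j, T2Space (D j)]
  {d : ℕ} {S : Type*} [TopologicalSpace S] [ChartedSpace (EuclideanSpace ℝ (Fin d)) S]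
  [IsManifold (𝓡 d) ∞ S]

namespace HybridSystem

variable {H : HybridSystem n D} {j₀ : J} {ι : S → D j₀} {ξ : S} {γ : ℝ → Σ j, D j}

/-- A Poincaré map of an orbit without transitions is injective. -/
theorem IsPoincareMap.exists_injOn {U : Set S} {P : S → S}
    (hP : H.IsPoincareMap γ d ι U P ξ) (hγ : orbit γ = range γ) {c : ℝ → D j₀}
    (hγc : ∀ t, γ t = ⟨j₀, c t⟩) (hc : IsMIntegralCurveOn c (H.field j₀) univ)
    (hfwd : ∀ t, c t ∈ fwdSet (H.field j₀)) : P ξ = ξ ∧ ∃ O ∈ 𝓝 ξ, InjOn P O := by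
  have hv := H.smooth_field j₀
  have hξ : (⟨j₀, ι ξ⟩ : Σ j, D j) ∈ orbit γ ∩ range fun s => (⟨j₀, ι s⟩ : Σ j, D j) :=
    hP.inter ▸ mem_singleton _
  obtain ⟨t₀, ht₀⟩ := hγ ▸ hξ.1
  rw [hγc] at ht₀
  replace ht₀ : c t₀ = ι ξ := sigma_mk_injective ht₀
  obtain ⟨θ, hθc, hθ⟩ := hP.first_return
  set T := θ ξ + 1 with hT
  have key : ∀ x ∈ U, θ x < T → ∀ c' : ℝ → D j₀, c' 0 = ι x →
      IsMIntegralCurveOn c' (H.field j₀) (Icc 0 T) → (∀ s ∈ Icc 0 T, c' s ∈ fwdSet (H.field j₀)) →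
      c' (θ x) = ι (P x) ∧ ∀ t ∈ Ioo 0 (θ x), c' t ∉ range ι := by
    intro x hx hxT c' hc0 hc' hcF
    obtain ⟨h0, u, hu, hm, hfirst⟩ := hθ x hx
    have hu0 : u 0 = ⟨j₀, c' 0⟩ := by
      rw [hc0]
      refine hu.start_flow ?_
      rw [← hc0]
      exact Set.disjoint_left.1 (disjoint_fwdSet (H.guard_open j₀) (H.outward j₀))
        (hcF 0 ⟨le_rfl, by linarith⟩)
    have heq : ∀ t ∈ Icc 0 (θ x), u t = ⟨j₀, c' t⟩ := fun t ht =>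
      hu.isExecution.eq_curve hu0 hc' (fun s hs => hcF s ⟨hs.1, hs.2.le⟩) t ht
        (ht.2.trans_lt hxT)
    refine ⟨?_, fun t ht ⟨y, hy⟩ => hfirst t ht y (.inl ?_)⟩
    · have hθm : θ x ∈ Icc 0 (θ x) := ⟨h0.le, le_rfl⟩
      rcases hm with hm | hm
      · rw [heq _ hθm] at hm
        exact sigma_mk_injective hm
      · refine sigma_mk_injective (tendsto_nhds_unique ?_ hm)
        have hcc : ContinuousAt c' (θ x) :=
          (hc'.continuousOn (θ x) ⟨h0.le, hxT.le⟩).continuousAt (Icc_mem_nhds h0 hxT)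
        refine ((continuous_sigmaMk (σ := D)).continuousAt.comp hcc).tendsto.mono_left
          nhdsWithin_le_nhds |>.congr' ?_
        filter_upwards [Ioo_mem_nhdsLT h0] with s hs
        exact (heq s ⟨hs.1.le, hs.2.le⟩).symm
    · rw [heq t ⟨ht.1.le, ht.2.le⟩, hy]
  have hcs : IsMIntegralCurveOn (fun s => c (s + t₀)) (H.field j₀) (Icc 0 T) :=
    IsMIntegralCurveOn.mono (IsMIntegralCurveOn.comp_add hc t₀) fun s _ => mem_univ (s + t₀)
  have hθ0 := (hθ ξ hP.mem).1
  have hfix : P ξ = ξ := by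
    have h1 := (key ξ hP.mem (by linarith) _ (by rw [zero_add, ht₀]) hcs fun s _ => hfwd _).1
    have h2 : (⟨j₀, ι (P ξ)⟩ : Σ j, D j) ∈
        orbit γ ∩ range fun s => (⟨j₀, ι s⟩ : Σ j, D j) :=
      ⟨by rw [hγ, ← h1]; exact ⟨_, hγc _⟩, mem_range_self _⟩
    rw [hP.inter] at h2
    exact hP.embedding.isEmbedding.injective (sigma_mk_injective h2)
  refine ⟨hfix, ?_⟩
  have hdom : ∀ᶠ x in 𝓝 ξ, (T, ι x) ∈ flowDomain (H.field j₀) := by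
    have h1 : (T, ι ξ) ∈ flowDomain (H.field j₀) :=
      ⟨c (T + t₀), by change 0 ≤ T; linarith, fun s => c (s + t₀), (congrArg c (zero_add t₀)).trans ht₀, rfl, hcs,
        fun s _ => hfwd _⟩
    have h2 := (fwdFlow_regular hv h1).1
    have h3 : Tendsto (fun x => (T, ι x)) (𝓝 ξ) (𝓝[Ici 0 ×ˢ univ] (T, ι ξ)) :=
      tendsto_nhdsWithin_iff.2
        ⟨(continuous_const.prodMk hP.embedding.isEmbedding.continuous).tendsto ξ,
          .of_forall fun x => ⟨by change 0 ≤ T; linarith, mem_univ _⟩⟩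
    exact h3 h2
  have hθT : ∀ᶠ x in 𝓝 ξ, θ x < T := hθc.eventually (gt_mem_nhds (by linarith))
  have hgood : ∀ᶠ x in 𝓝 ξ, x ∈ U ∧ θ x < T ∧ (T, ι x) ∈ flowDomain (H.field j₀) := by
    filter_upwards [hP.isOpen.mem_nhds hP.mem, hθT, hdom] with x h1 h2 h3 using ⟨h1, h2, h3⟩
  refine ⟨_, hgood, ?_⟩
  -- From the common image the curves are followed back for the shorter return time `θ y`. They
  -- agree by uniqueness, so the curve from `x` passes through `y` at time `θ x - θ y`. Unless this
  -- time is `0`, that is a meeting with the section before the first return.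
  have hle : ∀ x y, (x ∈ U ∧ θ x < T ∧ (T, ι x) ∈ flowDomain (H.field j₀)) →
      (y ∈ U ∧ θ y < T ∧ (T, ι y) ∈ flowDomain (H.field j₀)) → P x = P y → θ y ≤ θ x → x = y := by
    rintro x y ⟨hx, hxT, -, -, c₁, h10, -, h1, h1F⟩ ⟨hy, hyT, -, -, c₂, h20, -, h2, h2F⟩ hxy hle
    obtain ⟨k1, k2⟩ := key x hx hxT c₁ h10 h1 h1F
    obtain ⟨k3, -⟩ := key y hy hyT c₂ h20 h2 h2F
    have hy0 := (hθ y hy).1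
    have h1' : IsMIntegralCurveOn (fun s => c₁ (s + (θ x - θ y))) (H.field j₀) (Icc 0 (θ y)) :=
      IsMIntegralCurveOn.mono (IsMIntegralCurveOn.comp_add h1 (θ x - θ y)) fun s hs => by
        change 0 ≤ _ ∧ _ ≤ T
        constructor <;> linarith [hs.1, hs.2]
    have h3 := eqOn_of_isMIntegralCurveOn hv (right_mem_Icc.2 hy0.le) h1'
      (IsMIntegralCurveOn.mono h2 (Icc_subset_Icc_right hyT.le))
      (by rw [add_sub_cancel, k1, k3, hxy]) (left_mem_Icc.2 hy0.le)
    change c₁ (0 + (θ x - θ y)) = c₂ 0 at h3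
    rw [zero_add, h20] at h3
    rcases (sub_nonneg.2 hle).eq_or_lt with h | h
    · rw [← h, h10] at h3
      exact hP.embedding.isEmbedding.injective h3
    · exact absurd ⟨y, h3.symm⟩ (k2 _ ⟨h, by linarith⟩)
  intro x hx y hy hxy
  rcases le_total (θ y) (θ x) with h | h
  · exact hle x y hx hy hxy h
  · exact (hle y x hy hx hxy.symm h).symm

/-- The reduction along an orbit without transitions. -/
theorem exists_reduction_of_continuous {τ : ℝ} (hγ : H.IsPeriodicOrbit γ τ)
    (hcont : ∀ t, ContinuousAt γ t) (hfwd : ∀ t, γ t ∈ H.fwd) {U : Set S} {P : S → S}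
    (hP : H.IsPoincareMap γ d ι U P ξ) {m : ℕ} {V : Set S}
    (hV : IsOpen V) (hξV : ξ ∈ V) (hVU : ∀ x ∈ V, ∀ i < m, P^[i] x ∈ U) {r : ℕ}
    (hr : ∀ x ∈ V, Module.finrank ℝ (mfderiv (𝓡 d) (𝓡 d) (P^[m]) x).range = r) :
    ∃ M W : Set (Σ j, D j),
      H.IsInvariantSubmanifold (r + 1) M ∧ IsOpen W ∧ orbit γ ⊆ M ∩ W ∧
      ∃ b₀ : ℝ, ∀ x ∈ W, ∃ b ∈ Icc 0 b₀,
        (∃ u, H.IsTrajectory x b u) ∧ ∀ u, H.IsTrajectory x b u → u b ∈ M := by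
  obtain ⟨horb, j, c, hγc, hc⟩ := hγ.exists_integralCurve hcont
  have hξ : (⟨j₀, ι ξ⟩ : Σ j, D j) ∈ orbit γ ∩ range fun s => (⟨j₀, ι s⟩ : Σ j, D j) :=
    hP.inter ▸ mem_singleton _
  obtain ⟨t₀, ht₀⟩ := horb ▸ hξ.1
  rw [hγc] at ht₀
  obtain rfl : j = j₀ := congrArg Sigma.fst ht₀
  have hfwd' : ∀ t, c t ∈ fwdSet (H.field j) := fun t => by
    have := hfwd t
    rw [hγc] at this
    exact this
  obtain ⟨hfix, hinj⟩ := hP.exists_injOn horb hγc hc hfwd'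
  have hPc : ContinuousAt P ξ := (hP.smooth.contMDiffAt (hP.isOpen.mem_nhds hP.mem)).continuousAt
  obtain ⟨O, hO, hinj⟩ := exists_injOn_iterate hPc hfix hinj m
  -- The iterate of the Poincaré map is injective near `ξ` and has constant rank, so its rank is the
  -- dimension of the section.
  have hrd : d = r := by
    set φ := extChartAt (𝓡 d) ξ with hφ
    have hη0 : φ.symm (φ ξ) = ξ := extChartAt_to_inv ξ
    have hηc : Tendsto φ.symm (𝓝 (φ ξ)) (𝓝 ξ) := by
      have : ContinuousAt φ.symm (φ ξ) := continuousAt_extChartAt_symm ξ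
      have := this.tendsto
      rwa [hη0] at this
    have hsrc := eventually_iterate_eq_chart (g := fun y => φ (P (φ.symm y))) hP.isOpen hP.mem
      hP.smooth hfix (.of_forall fun _ => rfl) m
    have htgt : ∀ᶠ y in 𝓝 (φ ξ), y ∈ φ.target :=
      (isOpen_extChartAt_target (I := 𝓡 d) ξ).mem_nhds (mem_extChartAt_target ξ)
    have hk : ∀ x ∈ V, ContMDiffAt (𝓡 d) (𝓡 d) ∞ (P^[m]) x := fun x hx =>
      contMDiffAt_iterate_of_mem hP.isOpen hP.smooth (hVU x hx)
    have hVy : ∀ᶠ y in 𝓝 (φ ξ), φ.symm y ∈ V := hηc (hV.mem_nhds hξV)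
    have h := finrank_eq_of_injOn (g := fun y => φ (P^[m] (φ.symm y))) (y₀ := φ ξ) (r := r) ?_ ?_ ?_
    · rwa [finrank_euclideanSpace_fin] at h
    · filter_upwards [hsrc, htgt, hVy] with y h1 h2 h3
      refine ContMDiffAt.contDiffAt ?_
      exact ContMDiffAt.comp (g := φ) y (contMDiffAt_extChartAt' (by
        rw [← extChartAt_source (𝓡 d)]; exact h1.2))
        (ContMDiffAt.comp (g := P^[m]) y (hk _ h3) (contMDiffAt_extChartAt_symm ξ h2))
    · filter_upwards [hsrc, htgt, hVy] with y h1 h2 h3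
      rw [finrank_range_chart h2 ((hk _ h3).mdifferentiableAt (by simp)) h1.2
        (.of_forall fun _ => rfl)]
      exact hr _ h3
    · refine ⟨_, inter_mem (inter_mem (hsrc.mono fun _ h => h.2) htgt) (hηc hO), ?_⟩
      rintro y ⟨⟨h1, h2⟩, h3⟩ z ⟨⟨h4, h5⟩, h6⟩ hyz
      exact φ.symm.injOn h2 h5 (hinj h3 h6 (φ.injOn h1 h4 hyz))
  have hlc : LocallyConnectedSpace (D j) :=
    ChartedSpace.locallyConnectedSpace (EuclideanHalfSpace (n j)) (D j)
  -- The component keeps the number of components finite, and its openness gives the dimension `d +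
  -- 1`. It serves both as `M` and as `W`, with time `0`.
  set N := connectedComponentIn (fwdSet (H.field j)) (c t₀) with hN
  have hNo : IsOpen N := (isOpen_fwdSet (H.field j)).connectedComponentIn
  have hNF : N ⊆ fwdSet (H.field j) := connectedComponentIn_subset _ _
  have hcN : ∀ t, c t ∈ N := fun t =>
    (isPreconnected_range (continuousOn_univ.1 hc.continuousOn)).subset_connectedComponentIn
      (mem_range_self t₀) (range_subset_iff.2 hfwd') (mem_range_self t)
  have horbN : orbit γ ⊆ Sigma.mk j '' N := by
    rw [horb]
    rintro _ ⟨t, rfl⟩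
    exact ⟨c t, hcN t, (hγc t).symm⟩
  refine ⟨Sigma.mk j '' N, Sigma.mk j '' N,
    H.isInvariantSubmanifold_of_isOpen (by rw [← hrd, hP.codim]) hNo
      isPreconnected_connectedComponentIn hNF,
    Topology.IsOpenEmbedding.sigmaMk.isOpenMap _ hNo, fun x hx => ⟨horbN hx, horbN hx⟩, 0, ?_⟩
  rintro _ ⟨x, hx, rfl⟩
  refine ⟨0, ⟨le_rfl, le_rfl⟩, exists_isTrajectory_zero (hNF hx), fun u hu => ?_⟩
  rw [hu.start_flow (Set.disjoint_left.1 (disjoint_fwdSet (H.guard_open j) (H.outward j)) (hNF hx))]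
  exact mem_image_of_mem _ hx

end HybridSystem

end Hybrid

end HybridDS

theorem theorem1
    {J : Type*} [Finite J] {n : J → ℕ} [∀ j, NeZero (n j)] {D : J → Type*}
    [∀ j, TopologicalSpace (D j)] [∀ j, ChartedSpace (EuclideanHalfSpace (n j)) (D j)]
    [∀ j, IsManifold (𝓡∂ (n j)) ∞ (D j)] [∀ j, T2Space (D j)]
    [∀ j, SecondCountableTopology (D j)] [∀ j, ConnectedSpace (D j)]
    (H : HybridDS.HybridSystem n D)
    -- the periodic orbit, with isolated transitions
    (γ : ℝ → Σ j, D j) (τ : ℝ) (hγ : H.IsPeriodicOrbit γ τ)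
    (hiso : {t ∈ Ico 0 τ | ¬ ContinuousAt γ t}.Finite)
    -- the vector field can be followed forward from all points near the orbit
    (hflow : ∀ t, ∀ᶠ x in 𝓝 (γ t), H.FlowsForward x)
    -- the Poincaré map
    {d : ℕ} {S : Type*} [TopologicalSpace S] [ChartedSpace (EuclideanSpace ℝ (Fin d)) S]
    [IsManifold (𝓡 d) ∞ S] {j₀ : J} (ι : S → D j₀) (U : Set S) (P : S → S) (ξ : S)
    (hP : H.IsPoincareMap γ d ι U P ξ)
    -- the least dimension of a domain visited by the orbit
    (m : ℕ) (hm : IsLeast (range fun t => n (γ t).1) m)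
    -- the `m`-th iterate of the Poincaré map is defined on `V` and has constant rank there
    (V : Set S) (hV : IsOpen V) (hξV : ξ ∈ V) (hVU : ∀ x ∈ V, ∀ i < m, P^[i] x ∈ U)
    (r : ℕ)
    (hr : ∀ x ∈ V, Module.finrank ℝ (mfderiv (𝓡 d) (𝓡 d) (P^[m]) x).range = r) :
    ∃ M W : Set (Σ j, D j),
      H.IsInvariantSubmanifold (r + 1) M ∧ IsOpen W ∧ HybridDS.orbit γ ⊆ M ∩ W ∧
      ∃ b₀ : ℝ, ∀ x ∈ W, ∃ b ∈ Icc 0 b₀,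
        (∃ u, H.IsTrajectory x b u) ∧ ∀ u, H.IsTrajectory x b u → u b ∈ M := by
  have hfwd : ∀ t, γ t ∈ H.fwd := fun t =>
    HybridDS.HybridSystem.mem_fwd_of_eventually_flowsForward (hflow t)
  -- Without transitions the rank is full, so there is nothing to reduce; the construction of sheets
  -- needs an exit point to start from.
  by_cases hjump : ∃ t, ¬ ContinuousAt γ t
  · exact HybridDS.HybridSystem.exists_reduction_of_transition hγ hiso hjump hfwd hP hm.1 hV hξV
      hVU hr
  · push Not at hjump
    exact HybridDS.HybridSystem.exists_reduction_of_continuous hγ hjump hfwd hP hV hξV hVU hr
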